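/- Let $\mathbf{k}$ be a field of characteristic zero and let $A$ be a commutative differential graded $\mathbf{k}$-algebra with $H^i(A)=0$ for $i>0$. "$A$-module" means left (unbounded) dg $A$-module; $\mathrm{C}(A)$ is the category of $A$-modules and $\mathrm{D}(A)$ its derived category, i.e. the localization of $\mathrm{C}(A)$ at the quasi-isomorphisms. Let $\mathbb{T}_A$ be the dg $A$-module of graded $\mathbf{k}$-derivations of $A$, with differential $D\mapsto [d_A,D]$. Let $(V,\rho)$ be an anchored perfect $A$-module: $\rho\colon V\to\mathbb{T}_A$ is a morphism in $\mathrm{C}(A)$, and $V$ belongs to the smallest class of dg $A$-modules that contains $A$ and is stable under shifts (in both directions), extensions and direct summands in $\mathrm{C}(A)$. Let $\Sigma_V=A\oplus V$ be the dg $(A,A)$-bimodule with the direct sum left module structure and with the right action $$(a,v)\,a'=\bigl(aa'+\rho(v)(a'),\ (-1)^{|a'||v|}a'v\bigr).$$ For an $A$-module $M$, the HKR class $\Theta_M\colon V[-1]\otimes_A M\to M$ is the morphism of $\mathrm{D}(A)$ given by the extension class of the exact sequence $$0\to M\to \Sigma_V\otimes_A M\to V\otimes_A M\to 0,\qquad m\mapsto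 (1,0)\otimes m,\quad (a,v)\otimes m\mapsto v\otimes m .$$ Let $\mathit{free}(V,\rho)$ be the free $(\mathbf{k},A)$ dg-Lie algebroid on the anchored module $(V,\rho)$, and let $\mathrm{U}=\mathrm{U}_{\mathbf{k}/A}(\mathit{free}(V,\rho))$ be its universal enveloping algebra. For $n\ge 0$ let $\mathrm{F}^n\mathrm{U}$ be the image of $\Sigma_V^{\otimes n}$ in $\mathrm{U}$ (with $\mathrm{F}^0\mathrm{U}=A$), that is, the span of the products of at most $n$ elements of $V$ with coefficients in $A$. Let $M$ be an $A$-module, put $M_V=\mathrm{U}\otimes_A M$, and let $\mathrm{F}^nM_V$ be the image of $\mathrm{F}^n\mathrm{U}\otimes_A M$ in $M_V$. An increasing filtration $\mathrm{F}^0N\subseteq \mathrm{F}^1N\subseteq\cdots$ of an $A$-module $N$ by dg submodules is said to split in $\mathrm{D}(A)$ if for every $n\ge 0$ the projection $\mathrm{F}^nN\to \mathrm{Gr}^nN=\mathrm{F}^nN/\mathrm{F}^{n-1}N$ (with $\mathrm{F}^{-1}N=0$) has a section in $\mathrm{D}(A)$. Then the following properties are equivalent: (a) The filtration on $M_V$ splits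 in $\mathrm{D}(A)$. (b) The filtration induced on $\mathrm{F}^2M_V$ splits in $\mathrm{D}(A)$. (c) $\Theta_M$ and $\Theta_{V\otimes_A M}$ both vanish. -/

import Mathlib

open CategoryTheory

universe u

namespace DGForm

/-! ### Signs -/

/-- The sign `(-1)^n` in `k`. -/
def sgn (k : Type u) [Field k] (n : ℤ) : k := ((n.negOnePow : ℤ) : k)

section Signs

variable (k : Type u) [Field k]

lemma sgn_add (m n : ℤ) : sgn k (m + n) = sgn k m * sgn k n := by
  simp [sgn, Int.negOnePow_add]

lemma sgn_zero : sgn k 0 = 1 := by simp [sgn]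

lemma sgn_one : sgn k 1 = -1 := by simp [sgn]

lemma sgn_neg (n : ℤ) : sgn k (-n) = sgn k n := by simp [sgn]

lemma sgn_cases (n : ℤ) : sgn k n = 1 ∨ sgn k n = -1 := by
  rcases Int.even_or_odd n with h | h
  · left; simp [sgn, Int.negOnePow_even n h]
  · right; simp [sgn, Int.negOnePow_odd n h]

lemma sgn_mul_self (n : ℤ) : sgn k n * sgn k n = 1 := by
  rcases sgn_cases k n with h | h <;> simp [h]

lemma sgn_sq_mul (n : ℤ) : sgn k (n * n) = sgn k n := by
  rcases Int.even_or_odd n with h | h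
  · simp [sgn, Int.negOnePow_even n h, Int.negOnePow_even _ (h.mul_left n)]
  · simp [sgn, Int.negOnePow_odd n h, Int.negOnePow_odd _ (h.mul h)]

end Signs

/-! ### Commutative dg algebras

A graded object is a family of `k`-vector spaces indexed by `ℤ`, with cohomological differentials.
The operations of degree zero carry a proof `i + j = n` that their target has the right degree, so
that no transport between `X (i + (j + l))` and `X (i + j + l)` is ever needed. -/

/-- A commutative differential graded algebra over `k`. -/
structure CDGA (k : Type u) [Field k] where
  X : ℤ → Type u
  [grp : ∀ n, AddCommGroup (X n)]
  [mod : ∀ n, Module k (X n)]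
  one : X 0
  mul : ∀ {i j n : ℤ}, i + j = n → X i →ₗ[k] X j →ₗ[k] X n
  d : ∀ {i j : ℤ}, i + 1 = j → X i →ₗ[k] X j
  one_mul : ∀ {n : ℤ} (h : 0 + n = n) (a : X n), mul h one a = a
  mul_assoc : ∀ {i j l ij jl n : ℤ} (hij : i + j = ij) (hjl : j + l = jl) (h₁ : ij + l = n)
    (h₂ : i + jl = n) (a : X i) (b : X j) (c : X l),
    mul h₁ (mul hij a b) c = mul h₂ a (mul hjl b c)
  mul_comm : ∀ {i j n : ℤ} (h : i + j = n) (h' : j + i = n) (a : X i) (b : X j),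
    mul h a b = sgn k (i * j) • mul h' b a
  d_d : ∀ {i j l : ℤ} (h : i + 1 = j) (h' : j + 1 = l) (a : X i), d h' (d h a) = 0
  d_mul : ∀ {i j n i' j' n' : ℤ} (h : i + j = n) (hi : i + 1 = i') (hj : j + 1 = j')
    (hn : n + 1 = n') (h₁ : i' + j = n') (h₂ : i + j' = n') (a : X i) (b : X j),
    d hn (mul h a b) = mul h₁ (d hi a) b + sgn k i • mul h₂ a (d hj b)

attribute [instance] CDGA.grp CDGA.mod

variable {k : Type u} [Field k]

/-- `A` is cohomologically concentrated in nonpositive degrees: `H^i(A) = 0` for `i > 0`. -/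
def CDGA.IsNonpositive (A : CDGA k) : Prop :=
  ∀ {h i j : ℤ} (hi : h + 1 = i) (hj : i + 1 = j), 0 < i →
    ∀ a : A.X i, A.d hj a = 0 → ∃ b : A.X h, A.d hi b = a

lemma CDGA.mul_one {A : CDGA k} {n : ℤ} (h : n + 0 = n) (a : A.X n) : A.mul h a A.one = a := by
  rw [A.mul_comm h (by omega), A.one_mul]; simp [sgn_zero]

lemma CDGA.d_one (A : CDGA k) {j : ℤ} (h : 0 + 1 = j) : A.d h A.one = 0 := by
  obtain rfl : j = 1 := by omega
  have := A.d_mul (i := 0) (j := 0) (n := 0) rfl rfl rfl rfl rfl rfl A.one A.one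
  rw [CDGA.one_mul, CDGA.one_mul, CDGA.mul_one] at this
  simpa [sgn_zero] using this

/-! ### dg modules and the derived category -/

/-- A left dg module over `A`. -/
structure DGModule (A : CDGA k) where
  X : ℤ → Type u
  [grp : ∀ n, AddCommGroup (X n)]
  [mod : ∀ n, Module k (X n)]
  act : ∀ {i j n : ℤ}, i + j = n → A.X i →ₗ[k] X j →ₗ[k] X n
  d : ∀ {i j : ℤ}, i + 1 = j → X i →ₗ[k] X j
  one_act : ∀ {n : ℤ} (h : 0 + n = n) (x : X n), act h A.one x = x
  mul_act : ∀ {i j l ij jl n : ℤ} (hij : i + j = ij) (hjl : j + l = jl) (h₁ : ij + l = n)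
    (h₂ : i + jl = n) (a : A.X i) (b : A.X j) (x : X l),
    act h₁ (A.mul hij a b) x = act h₂ a (act hjl b x)
  d_d : ∀ {i j l : ℤ} (h : i + 1 = j) (h' : j + 1 = l) (x : X i), d h' (d h x) = 0
  d_act : ∀ {i j n i' j' n' : ℤ} (h : i + j = n) (hi : i + 1 = i') (hj : j + 1 = j')
    (hn : n + 1 = n') (h₁ : i' + j = n') (h₂ : i + j' = n') (a : A.X i) (x : X j),
    d hn (act h a x) = act h₁ (A.d hi a) x + sgn k i • act h₂ a (d hj x)

attribute [instance] DGModule.grp DGModule.mod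

/-- Morphisms of dg modules: `A`-linear of degree zero, commuting with the differentials. -/
@[ext]
structure DGModule.Hom {A : CDGA k} (M N : DGModule A) where
  f : ∀ n : ℤ, M.X n →ₗ[k] N.X n
  map_act : ∀ {i j n : ℤ} (h : i + j = n) (a : A.X i) (x : M.X j),
    f n (M.act h a x) = N.act h a (f j x)
  map_d : ∀ {i j : ℤ} (h : i + 1 = j) (x : M.X i), f j (M.d h x) = N.d h (f i x)

/-- The category `C(A)` of dg modules. -/
instance {A : CDGA k} : Category (DGModule A) where
  Hom M N := DGModule.Hom M N
  id M := { f := fun _ => LinearMap.id, map_act := fun _ _ _ => rfl, map_d := fun _ _ => rfl }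
  comp F G :=
    { f := fun n => (G.f n).comp (F.f n)
      map_act := fun h a x => by simp [F.map_act, G.map_act]
      map_d := fun h x => by simp [F.map_d, G.map_d] }

namespace DGModule

variable {A : CDGA k}

@[simp] lemma id_f (M : DGModule A) (n : ℤ) (x : M.X n) : Hom.f (𝟙 M) n x = x := rfl

@[simp] lemma comp_f {M N P : DGModule A} (F : M ⟶ N) (G : N ⟶ P) (n : ℤ) (x : M.X n) :
    Hom.f (F ≫ G) n x = G.f n (F.f n x) := rfl

/-- The zero morphism. -/
def zeroHom (M N : DGModule A) : M ⟶ N where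
  f _ := 0
  map_act := fun _ _ _ => by simp
  map_d := fun _ _ => by simp

/-- `F` is a quasi-isomorphism: it is bijective on cohomology. -/
def IsQuasiIso {M N : DGModule A} (F : M ⟶ N) : Prop :=
  ∀ {h i j : ℤ} (hi : h + 1 = i) (hj : i + 1 = j),
    (∀ x : M.X i, M.d hj x = 0 → (∃ y : N.X h, N.d hi y = F.f i x) → ∃ w : M.X h, M.d hi w = x) ∧
    (∀ y : N.X i, N.d hj y = 0 → ∃ x : M.X i, M.d hj x = 0 ∧ ∃ z : N.X h, N.d hi z = y - F.f i x)

variable (A) in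
/-- The class of quasi-isomorphisms. -/
def quasiIso : MorphismProperty (DGModule A) := fun _ _ F => IsQuasiIso F

end DGModule

/-- The derived category `D(A)`: the localization of `C(A)` at the quasi-isomorphisms. -/
abbrev Derived (A : CDGA k) := (DGModule.quasiIso A).Localization

/-- The localization functor `C(A) ⥤ D(A)`. -/
abbrev toDerived (A : CDGA k) : DGModule A ⥤ Derived A := (DGModule.quasiIso A).Q

/-- The zero morphism of `D(A)` between the images of two dg modules. -/
def derivedZero {A : CDGA k} (M N : DGModule A) : (toDerived A).obj M ⟶ (toDerived A).obj N :=
  (toDerived A).map (DGModule.zeroHom M N)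

namespace DGModule

variable {A : CDGA k}

/-! ### Short exact sequences, shifts, perfect modules -/

/-- `0 → X → Y → Z → 0` is an exact sequence of dg modules. -/
structure ShortExact {X Y Z : DGModule A} (i : X ⟶ Y) (p : Y ⟶ Z) : Prop where
  inj : ∀ n, Function.Injective (i.f n)
  exact : ∀ n (y : Y.X n), p.f n y = 0 ↔ ∃ x, i.f n x = y
  surj : ∀ n, Function.Surjective (p.f n)

variable (A) in
/-- `A` as a left module over itself. -/
abbrev self : DGModule A where
  X := A.X
  act := A.mul
  d := A.d
  one_act := A.one_mul
  mul_act := A.mul_assoc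
  d_d := A.d_d
  d_act := A.d_mul

/-- The shift `M[s]`: `M[s]^n = M^{n+s}`, with differential `(-1)^s d` and with `a ∈ A` acting as
`(-1)^{s|a|} a`. -/
abbrev shift (M : DGModule A) (s : ℤ) : DGModule A where
  X n := M.X (n + s)
  act {i j n} h := LinearMap.mk₂ k (fun a x => sgn k (s * i) • M.act (by omega) a x)
    (fun a b x => by simp) (fun c a x => by simp [smul_comm c])
    (fun a x y => by simp) (fun c a x => by simp [smul_comm c])
  d h := sgn k s • M.d (by omega)
  one_act h x := by simp [sgn_zero, M.one_act]
  mul_act {i j l ij jl n} hij hjl h₁ h₂ a b x := by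
    subst hij
    simp only [LinearMap.mk₂_apply, map_smul, mul_add, sgn_add, smul_smul]
    rw [M.mul_act rfl (jl := jl + s) (by omega) (by omega) (by omega), mul_comm (sgn k (s * i))]
  d_d h h' x := by simp [M.d_d]
  d_act {i j n i' j' n'} h hi hj hn h₁ h₂ a x := by
    subst hi
    simp only [LinearMap.mk₂_apply, LinearMap.smul_apply, map_smul, mul_add, sgn_add, mul_one]
    rw [M.d_act (i' := i + 1) (j' := j' + s) (by omega) rfl (by omega) (by omega) (by omega)
      (by omega)]
    rcases sgn_cases k s with h | h <;> rcases sgn_cases k (s * i) with h' | h' <;>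
      simp [h, h']

/-- (Strictly) perfect modules: the smallest class of dg modules that contains `A` and is stable
under shifts, extensions and direct summands. -/
inductive IsPerfect : DGModule A → Prop
  | self : IsPerfect (self A)
  | shift (V : DGModule A) (s : ℤ) : IsPerfect V → IsPerfect (V.shift s)
  | ext {X Y Z : DGModule A} (i : X ⟶ Y) (p : Y ⟶ Z) : ShortExact i p → IsPerfect X →
      IsPerfect Z → IsPerfect Y
  | retract {V W : DGModule A} (i : V ⟶ W) (p : W ⟶ V) : i ≫ p = 𝟙 V → IsPerfect W → IsPerfect V

/-! ### The extension class of a short exact sequence -/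

/-- Transport along an equality of degrees. -/
def castEq (M : DGModule A) {i j : ℤ} (h : i = j) : M.X i →ₗ[k] M.X j :=
  h ▸ LinearMap.id

@[simp] lemma castEq_rfl (M : DGModule A) {i : ℤ} (h : i = i) (x : M.X i) : M.castEq h x = x := rfl

lemma castEq_castEq (M : DGModule A) {i j : ℤ} (h : i = j) (h' : j = i) (x : M.X i) :
    M.castEq h' (M.castEq h x) = x := by
  subst h; rfl

lemma castEq_injective (M : DGModule A) {i j : ℤ} (h : i = j) :
    Function.Injective (M.castEq h) := by
  subst h; exact fun _ _ h => h

lemma d_castEq (M : DGModule A) {i i' j j' : ℤ} (e : i = i') (h : i' + 1 = j') (h' : i + 1 = j)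
    (e' : j = j') (x : M.X i) : M.d h (M.castEq e x) = M.castEq e' (M.d h' x) := by
  subst e e'; rfl

lemma act_castEq (M : DGModule A) {l i i' j j' : ℤ} (e : i = i') (h : l + i' = j') (h' : l + i = j)
    (e' : j = j') (a : A.X l) (x : M.X i) :
    M.act h a (M.castEq e x) = M.castEq e' (M.act h' a x) := by
  subst e e'; rfl

/-- The homotopy fibre of `p : Y ⟶ Z`: `Y ⊕ Z[-1]` with differential `(y, z) ↦ (dy, p y - dz)`. -/
abbrev fibre {Y Z : DGModule A} (p : Y ⟶ Z) : DGModule A where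
  X n := Y.X n × Z.X (n + -1)
  act {i j n} h := LinearMap.mk₂ k
    (fun a w => (Y.act h a w.1, sgn k i • Z.act (by omega : i + (j + -1) = n + -1) a w.2))
    (fun a b w => by simp) (fun c a w => by simp [smul_comm c])
    (fun a w w' => by simp) (fun c a w => by simp [smul_comm c])
  d {i j} h :=
    { toFun := fun w =>
        (Y.d h w.1, Z.castEq (by omega : i = j + -1) (p.f i w.1) - Z.d (by omega) w.2)
      map_add' := fun w w' => by ext <;> simp; abel
      map_smul' := fun c w => by ext <;> simp [smul_sub] }
  one_act h w := by simp [one_act, sgn_zero]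
  mul_act {i j l ij jl n} hij hjl h₁ h₂ a b w := by
    subst hij
    simp only [LinearMap.mk₂_apply, map_smul, smul_smul]
    rw [Y.mul_act rfl hjl h₁ h₂, Z.mul_act rfl (by omega : j + (l + -1) = jl + -1) (by omega)
      (by omega), sgn_add]
  d_d {i j l} h h' w := by
    subst h
    ext
    · simp [Y.d_d]
    · simp only [LinearMap.coe_mk, AddHom.coe_mk, p.map_d, map_sub, Z.d_d, sub_zero]
      rw [Z.d_castEq _ _ rfl (by omega), sub_self]
      rfl
  d_act {i j n i' j' n'} h hi hj hn h₁ h₂ a w := by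
    subst hi
    ext
    · simp [Y.d_act h rfl hj hn h₁ h₂]
    · simp only [LinearMap.coe_mk, AddHom.coe_mk, LinearMap.mk₂_apply, p.map_act, map_smul,
        map_sub, Prod.snd_add, Prod.smul_snd]
      rw [Z.d_act _ rfl (by omega : j + -1 + 1 = j' + -1) _ (by omega) (by omega),
        Z.act_castEq _ _ h (by omega), sgn_add, sgn_one]
      rcases sgn_cases k i with h | h <;> simp [h] <;> abel

/-- The inclusion `X ⟶ fibre p`, for `i : X ⟶ Y` with `i ≫ p = 0`. -/
def toFibre {X Y Z : DGModule A} (i : X ⟶ Y) (p : Y ⟶ Z) (h : ∀ n x, p.f n (i.f n x) = 0) :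
    X ⟶ fibre p where
  f n := (LinearMap.inl k (Y.X n) (Z.X (n + -1))).comp (i.f n)
  map_act {l m n} hd a x := by
    change (i.f n (X.act hd a x), (0 : Z.X (n + -1))) =
      (Y.act hd a (i.f m x), sgn k l • Z.act _ a 0)
    rw [i.map_act, map_zero, smul_zero]
  map_d {l m} hd x := by
    change (i.f m (X.d hd x), (0 : Z.X (m + -1))) =
      (Y.d hd (i.f l x), Z.castEq _ (p.f l (i.f l x)) - Z.d _ 0)
    rw [i.map_d, h, map_zero, map_zero, sub_zero]

/-- The inclusion `Z[-1] ⟶ fibre p`. -/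
def shiftToFibre {Y Z : DGModule A} (p : Y ⟶ Z) : Z.shift (-1) ⟶ fibre p where
  f n := LinearMap.inr k (Y.X n) (Z.X (n + -1))
  map_act {l m n} hd a x := by
    change ((0 : Y.X n), sgn k (-1 * l) • Z.act _ a x) = (Y.act hd a 0, sgn k l • Z.act _ a x)
    rw [map_zero, neg_one_mul, sgn_neg]
  map_d {l m} hd x := by
    change ((0 : Y.X m), sgn k (-1) • Z.d _ x) =
      (Y.d hd 0, Z.castEq _ (p.f l 0) - Z.d (by omega) x)
    rw [map_zero, map_zero, map_zero, zero_sub, sgn_neg, sgn_one, neg_one_smul]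

lemma ShortExact.comp_zero {X Y Z : DGModule A} {i : X ⟶ Y} {p : Y ⟶ Z} (h : ShortExact i p)
    (n : ℤ) (x : X.X n) : p.f n (i.f n x) = 0 := (h.exact n _).2 ⟨x, rfl⟩

lemma ShortExact.isQuasiIso {X Y Z : DGModule A} {i : X ⟶ Y} {p : Y ⟶ Z} (h : ShortExact i p) :
    IsQuasiIso (toFibre i p h.comp_zero) := by
  intro a b c hb hc
  have key : ∀ {e n n' : ℤ} (he : e = n + -1) (hn : n + 1 = n') (y : Y.X n) (z : Z.X (n + -1)),
      Z.castEq (by omega : n = n' + -1) (p.f n y) - Z.d (by omega) z = 0 →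
      ∃ y' : Y.X e, Z.castEq he (p.f e y') = z ∧
        ∃ x : X.X n, i.f n x = y - Y.d (by omega) y' := by
    intro e n n' he hn y z hz
    obtain ⟨y', hy'⟩ := h.surj e (Z.castEq he.symm z)
    have hz' : Z.castEq he (p.f e y') = z := by rw [hy', castEq_castEq]
    refine ⟨y', hz', (h.exact n _).1 ?_⟩
    rw [← hz', Z.d_castEq he _ (by omega : e + 1 = n) (by omega), ← p.map_d, sub_eq_zero] at hz
    rw [map_sub, Z.castEq_injective _ hz, sub_self]
  obtain ⟨e, rfl⟩ : ∃ e, e + 1 = a := ⟨a - 1, by omega⟩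
  constructor
  · rintro x - ⟨⟨y, z⟩, hyz⟩
    have h1 : Y.d hb y = i.f b x := congrArg Prod.fst hyz
    obtain ⟨y', -, w, hw⟩ := key (by omega : e = e + 1 + -1) hb y z (congrArg Prod.snd hyz)
    refine ⟨w, h.inj _ ?_⟩
    rw [i.map_d, hw, map_sub, Y.d_d, sub_zero, h1]
  · rintro ⟨y, z⟩ hyz
    have h1 : Y.d hc y = 0 := congrArg Prod.fst hyz
    obtain ⟨y', hy', x, hx⟩ := key (by omega : e + 1 = b + -1) hc y z (congrArg Prod.snd hyz)
    refine ⟨x, h.inj _ ?_, (y', 0), ?_⟩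
    · rw [i.map_d, hx, map_sub, Y.d_d, sub_zero, h1, map_zero]
    · refine Prod.ext ?_ ?_
      · change Y.d hb y' = y - i.f b x
        rw [hx]; abel
      · change Z.castEq _ (p.f (e + 1) y') - Z.d _ 0 = z - 0
        rw [hy', map_zero]

/-- The class `Z[-1] ⟶ X` in `D(A)` of the extension `0 → X → Y → Z → 0`. -/
noncomputable def extClass {X Y Z : DGModule A} (i : X ⟶ Y) (p : Y ⟶ Z) (h : ShortExact i p) :
    (toDerived A).obj (Z.shift (-1)) ⟶ (toDerived A).obj X :=
  haveI := (quasiIso A).Q_inverts (toFibre i p h.comp_zero) h.isQuasiIso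
  (toDerived A).map (shiftToFibre p) ≫ inv ((toDerived A).map (toFibre i p h.comp_zero))

end DGModule


/-! ### Graded derivations -/

section Tangent

variable (A : CDGA k)

/-- Graded `k`-linear maps `A ⟶ A` of degree `n`. -/
abbrev GMap (n : ℤ) := ∀ p : {p : ℤ × ℤ // n + p.1 = p.2}, A.X p.1.1 →ₗ[k] A.X p.1.2

/-- Graded `k`-derivations of `A` of degree `n`:
`D (a b) = D(a) b + (-1)^{n |a|} a D(b)`. -/
def derivations (n : ℤ) : Submodule k (GMap A n) where
  carrier := {D | ∀ (i j l i' j' l' : ℤ) (h : i + j = l) (hi : n + i = i') (hj : n + j = j')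
    (hl : n + l = l') (h₁ : i' + j = l') (h₂ : i + j' = l') (a : A.X i) (b : A.X j),
    D ⟨(l, l'), hl⟩ (A.mul h a b) =
      A.mul h₁ (D ⟨(i, i'), hi⟩ a) b + sgn k (n * i) • A.mul h₂ a (D ⟨(j, j'), hj⟩ b)}
  add_mem' {D E} hD hE i j l i' j' l' h hi hj hl h₁ h₂ a b := by
    simp only [Pi.add_apply, LinearMap.add_apply, map_add, smul_add]
    rw [hD i j l i' j' l' h hi hj hl h₁ h₂ a b, hE i j l i' j' l' h hi hj hl h₁ h₂ a b]
    abel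
  zero_mem' i j l i' j' l' h hi hj hl h₁ h₂ a b := by simp
  smul_mem' c D hD i j l i' j' l' h hi hj hl h₁ h₂ a b := by
    simp only [Pi.smul_apply, LinearMap.smul_apply, map_smul]
    rw [hD i j l i' j' l' h hi hj hl h₁ h₂ a b, smul_add, smul_comm c]

variable {A}

/-- The value `D(a)` of a derivation. -/
def derApply {n i j : ℤ} (h : n + i = j) : derivations A n →ₗ[k] A.X i →ₗ[k] A.X j :=
  LinearMap.mk₂ k (fun D a => D.1 ⟨(i, j), h⟩ a) (fun _ _ _ => rfl) (fun _ _ _ => rfl)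
    (fun _ _ _ => by simp) (fun _ _ _ => by simp)

lemma derApply_mul {n i j l i' j' l' : ℤ} (D : derivations A n) (h : i + j = l) (hi : n + i = i')
    (hj : n + j = j') (hl : n + l = l') (h₁ : i' + j = l') (h₂ : i + j' = l') (a : A.X i)
    (b : A.X j) : derApply hl D (A.mul h a b) =
      A.mul h₁ (derApply hi D a) b + sgn k (n * i) • A.mul h₂ a (derApply hj D b) :=
  D.2 i j l i' j' l' h hi hj hl h₁ h₂ a b

lemma derApply_one {n : ℤ} (D : derivations A n) (h : n + 0 = n) : derApply h D A.one = 0 := by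
  have := derApply_mul D (zero_add 0) h h h h (zero_add n) A.one A.one
  rw [A.one_mul, A.one_mul, A.mul_one, mul_zero, sgn_zero, one_smul] at this
  simpa using this

lemma der_ext {n : ℤ} {D E : derivations A n}
    (h : ∀ (i j : ℤ) (hij : n + i = j) (a : A.X i), derApply hij D a = derApply hij E a) :
    D = E := by
  apply Subtype.ext
  funext ⟨⟨i, j⟩, hij⟩
  ext a
  exact h i j hij a

/-- The graded commutator `[D, E] = D E - (-1)^{|D||E|} E D` of derivations. -/
def derBracket {p q n : ℤ} (h : p + q = n) :
    derivations A p →ₗ[k] derivations A q →ₗ[k] derivations A n :=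
  LinearMap.mk₂ k
    (fun D E =>
      ⟨fun r => (derApply (by have := r.2; omega : p + (q + r.1.1) = r.1.2) D).comp (derApply rfl E) -
        sgn k (p * q) • 
          (derApply (by have := r.2; omega : q + (p + r.1.1) = r.1.2) E).comp (derApply rfl D), by
        intro i j l i' j' l' hl hi hj hl' h₁ h₂ a b
        simp only [LinearMap.sub_apply, LinearMap.smul_apply, LinearMap.comp_apply]
        rw [derApply_mul E hl rfl rfl rfl (by omega : q + i + j = q + l) (by omega),
          derApply_mul D hl rfl rfl rfl (by omega : p + i + j = p + l) (by omega)]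
        simp only [map_add, map_smul]
        rw [derApply_mul D (by omega : q + i + j = q + l) (by omega : p + (q + i) = i') rfl _
            (by omega) (by omega : q + i + (p + j) = l'),
          derApply_mul D (by omega : i + (q + j) = q + l) rfl (by omega : p + (q + j) = j') _
            (by omega : p + i + (q + j) = l') (by omega),
          derApply_mul E (by omega : p + i + j = p + l) (by omega : q + (p + i) = i') rfl _
            (by omega) (by omega : p + i + (q + j) = l'),
          derApply_mul E (by omega : i + (p + j) = p + l) rfl (by omega : q + (p + j) = j') _
            (by omega : q + i + (p + j) = l') (by omega)]
        subst h
        have e : sgn k (q * p) = sgn k (p * q) := by rw [mul_comm]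
        simp only [map_sub, map_smul, LinearMap.sub_apply, LinearMap.smul_apply, mul_add, add_mul,
          sgn_add, e]
        rcases sgn_cases k (p * q) with h | h <;> rcases sgn_cases k (p * i) with h' | h' <;>
          rcases sgn_cases k (q * i) with h'' | h'' <;> simp [h, h', h''] <;> abel⟩)
    (fun D D' E => by
      apply Subtype.ext; funext r; ext a
      simp only [map_add, LinearMap.sub_apply, LinearMap.smul_apply, LinearMap.comp_apply,
        LinearMap.add_apply, Submodule.coe_add, Pi.add_apply, smul_add]
      abel)
    (fun c D E => by
      apply Subtype.ext; funext r; ext a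
      simp only [map_smul, LinearMap.sub_apply, LinearMap.smul_apply, LinearMap.comp_apply,
        Submodule.coe_smul, Pi.smul_apply, smul_sub, smul_comm c])
    (fun D E E' => by
      apply Subtype.ext; funext r; ext a
      simp only [map_add, LinearMap.sub_apply, LinearMap.smul_apply, LinearMap.comp_apply,
        LinearMap.add_apply, Submodule.coe_add, Pi.add_apply, smul_add]
      abel)
    (fun c D E => by
      apply Subtype.ext; funext r; ext a
      simp only [map_smul, LinearMap.sub_apply, LinearMap.smul_apply, LinearMap.comp_apply,
        Submodule.coe_smul, Pi.smul_apply, smul_sub, smul_comm c])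

lemma derBracket_apply {p q n i j l m : ℤ} (h : p + q = n) (hn : n + i = j) (hl : q + i = l)
    (hm : p + i = m) (h₁ : p + l = j) (h₂ : q + m = j) (D : derivations A p)
    (E : derivations A q) (a : A.X i) : derApply hn (derBracket h D E) a =
      derApply h₁ D (derApply hl E a) - sgn k (p * q) • derApply h₂ E (derApply hm D a) := by
  subst hl hm; rfl

/-- Left multiplication of derivations by elements of `A`: `(a D)(b) = a D(b)`. -/
def derAct {p q n : ℤ} (h : p + q = n) :
    A.X p →ₗ[k] derivations A q →ₗ[k] derivations A n :=
  LinearMap.mk₂ k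
    (fun a D =>
      ⟨fun r => (A.mul (by have := r.2; omega : p + (q + r.1.1) = r.1.2) a).comp (derApply rfl D), by
        intro i j l i' j' l' hl hi hj hl' h₁ h₂ b c
        simp only [LinearMap.comp_apply]
        rw [derApply_mul D hl rfl rfl rfl (by omega : q + i + j = q + l) (by omega), map_add,
          map_smul, ← A.mul_assoc (by omega : p + (q + i) = i') _ h₁,
          ← A.mul_assoc (rfl : p + i = p + i) _ (by omega : p + i + (q + j) = l'),
          A.mul_comm _ (by omega : i + p = p + i) a b,
          ← A.mul_assoc (by omega : i + p = p + i) _ (by omega : p + i + (q + j) = l')]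
        subst h
        simp only [map_smul, LinearMap.smul_apply, smul_smul, add_mul, sgn_add]
        rw [mul_comm (sgn k (p * i))]⟩)
    (fun a b D => by apply Subtype.ext; funext r; ext c; simp)
    (fun c a D => by apply Subtype.ext; funext r; ext c; simp)
    (fun a D E => by apply Subtype.ext; funext r; ext c; simp)
    (fun c a D => by apply Subtype.ext; funext r; ext c; simp)

lemma derAct_apply {p q n i j l : ℤ} (h : p + q = n) (hn : n + i = j) (hl : q + i = l)
    (h₁ : p + l = j) (a : A.X p) (D : derivations A q) (b : A.X i) :
    derApply hn (derAct h a D) b = A.mul h₁ a (derApply hl D b) := by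
  subst hl; rfl

variable (A) in
/-- The differential of `A`, as a derivation of degree `1`. -/
def derD : derivations A 1 :=
  ⟨fun r => A.d (by have := r.2; omega : r.1.1 + 1 = r.1.2), by
    intro i j l i' j' l' h hi hj hl h₁ h₂ a b
    rw [one_mul, A.d_mul h (by omega : i + 1 = i') (by omega : j + 1 = j') _ h₁ h₂]⟩

lemma derD_apply {i j : ℤ} (h : 1 + i = j) (a : A.X i) :
    derApply h (derD A) a = A.d (by omega) a := rfl

lemma derBracket_skew {p q n : ℤ} (h : p + q = n) (h' : q + p = n) (D : derivations A p)
    (E : derivations A q) : derBracket h D E = -(sgn k (p * q) • derBracket h' E D) := by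
  apply der_ext
  intro i j hij a
  simp only [map_neg, map_smul, LinearMap.neg_apply, LinearMap.smul_apply]
  rw [derBracket_apply h hij rfl rfl (by omega) (by omega),
    derBracket_apply h' hij rfl rfl (by omega) (by omega), mul_comm q p]
  rcases sgn_cases k (p * q) with h | h <;> simp [h]

lemma derBracket_jacobi {p q r pq qr pr n : ℤ} (hqr : q + r = qr) (h₁ : p + qr = n)
    (hpq : p + q = pq) (h₂ : pq + r = n) (hpr : p + r = pr) (h₃ : q + pr = n)
    (D : derivations A p) (E : derivations A q) (G : derivations A r) :
    derBracket h₁ D (derBracket hqr E G) = derBracket h₂ (derBracket hpq D E) G +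
      sgn k (p * q) • derBracket h₃ E (derBracket hpr D G) := by
  apply der_ext
  intro i j hij a
  simp only [map_add, map_smul, LinearMap.add_apply, LinearMap.smul_apply]
  rw [derBracket_apply h₁ hij (l := qr + i) (m := p + i) rfl rfl (by omega) (by omega),
    derBracket_apply hqr _ (l := r + i) (m := q + i) rfl rfl (by omega) (by omega),
    derBracket_apply hqr _ (l := pr + i) (m := pq + i) (by omega) (by omega) (by omega) (by omega),
    derBracket_apply h₂ hij (l := r + i) (m := pq + i) rfl rfl (by omega) (by omega),
    derBracket_apply hpq _ (l := q + i) (m := p + i) rfl rfl (by omega) (by omega),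
    derBracket_apply hpq _ (l := qr + i) (m := pr + i) (by omega) (by omega) (by omega) (by omega),
    derBracket_apply h₃ hij (l := pr + i) (m := q + i) rfl rfl (by omega) (by omega),
    derBracket_apply hpr _ (l := r + i) (m := p + i) rfl rfl (by omega) (by omega),
    derBracket_apply hpr _ (l := qr + i) (m := pq + i) (by omega) (by omega) (by omega) (by omega)]
  subst hqr hpq hpr
  have e : sgn k (q * p) = sgn k (p * q) := by rw [mul_comm]
  simp only [map_sub, map_smul, mul_add, add_mul, sgn_add, e]
  rcases sgn_cases k (p * q) with h | h <;> rcases sgn_cases k (p * r) with h' | h' <;>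
    rcases sgn_cases k (q * r) with h'' | h'' <;> simp [h, h', h''] <;> abel

lemma derBracket_derAct {p q r pq pr qr n : ℤ} (hqr : q + r = qr) (h₁ : p + qr = n)
    (hpr : p + r = pr) (h₂ : q + pr = n) (hpq : p + q = pq) (h₃ : pq + r = n)
    (D : derivations A p) (a : A.X q) (E : derivations A r) :
    derBracket h₁ D (derAct hqr a E) =
      sgn k (q * p) • derAct h₂ a (derBracket hpr D E) + derAct h₃ (derApply hpq D a) E := by
  apply der_ext
  intro i j hij b
  simp only [map_add, map_smul, LinearMap.add_apply, LinearMap.smul_apply]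
  rw [derBracket_apply h₁ hij (l := qr + i) (m := p + i) rfl rfl (by omega) (by omega),
    derAct_apply hqr _ (l := r + i) rfl (by omega),
    derAct_apply hqr _ (l := pr + i) (by omega) (by omega),
    derAct_apply h₂ _ (l := pr + i) rfl (by omega),
    derBracket_apply hpr _ (l := r + i) (m := p + i) rfl rfl (by omega) (by omega),
    derAct_apply h₃ _ (l := r + i) rfl (by omega),
    derApply_mul D _ hpq (j' := pr + i) (by omega) _ (by omega) (by omega)]
  subst hqr
  have e : sgn k (q * p) = sgn k (p * q) := by rw [mul_comm]
  simp only [map_sub, map_smul, mul_add, sgn_add, e]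
  rcases sgn_cases k (p * q) with h | h <;> rcases sgn_cases k (p * r) with h' | h' <;>
    simp [h, h'] <;> abel

lemma derBracket_derD_derD {n : ℤ} (h : 1 + 1 = n) : derBracket h (derD A) (derD A) = 0 := by
  apply der_ext
  intro i j hij a
  rw [derBracket_apply h hij rfl rfl (by omega) (by omega)]
  simp [derD_apply, A.d_d]

lemma derBracket_derD_derBracket {p q n p' q' n' : ℤ} (h : p + q = n) (hp : 1 + p = p')
    (hq : 1 + q = q') (hn : 1 + n = n') (h₁ : p' + q = n') (h₂ : p + q' = n')
    (D : derivations A p) (E : derivations A q) :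
    derBracket hn (derD A) (derBracket h D E) = derBracket h₁ (derBracket hp (derD A) D) E +
      sgn k p • derBracket h₂ D (derBracket hq (derD A) E) := by
  rw [derBracket_jacobi h hn hp h₁ hq h₂, one_mul]

variable (A) in
/-- The dg module `𝕋_A` of graded derivations of `A`, with differential `D ↦ [d_A, D]`. -/
abbrev tangent : DGModule A where
  X n := derivations A n
  act := derAct
  d {i j} h := derBracket (by omega : 1 + i = j) (derD A)
  one_act h D := by
    apply der_ext
    intro i j hij a
    rw [derAct_apply _ _ hij (by omega), A.one_mul]
  mul_act {p q r pq qr n} hpq hqr h₁ h₂ a b D := by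
    apply der_ext
    intro i j hij c
    rw [derAct_apply _ _ (l := r + i) rfl (by omega), derAct_apply _ _ (l := qr + i) rfl (by omega),
      derAct_apply _ _ (l := r + i) rfl (by omega), A.mul_assoc]
  d_d {i j l} h h' D := by
    apply der_ext
    intro p q hpq a
    rw [derBracket_apply _ hpq (l := j + p) (m := 1 + p) rfl rfl (by omega) (by omega),
      derBracket_apply _ _ (l := i + p) (m := 1 + p) rfl rfl (by omega) (by omega),
      derBracket_apply _ _ (l := j + p) (m := 1 + (1 + p)) (by omega) rfl (by omega) (by omega)]
    subst h
    simp only [derD_apply, map_sub, map_smul, A.d_d, one_mul, sgn_add, sgn_one]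
    simp
  d_act {i j n i' j' n'} h hi hj hn h₁ h₂ a D := by
    rw [derBracket_derAct h (by omega) (by omega : 1 + j = j') h₂ (by omega : 1 + i = i') h₁,
      mul_one, add_comm]
    rfl

end Tangent

/-! ### Bimodules and tensor products over `A` -/

/-- A dg `(A, A)`-bimodule. -/
structure DGBimodule (A : CDGA k) extends DGModule A where
  ract : ∀ {i j n : ℤ}, i + j = n → X i →ₗ[k] A.X j →ₗ[k] X n
  ract_one : ∀ {n : ℤ} (h : n + 0 = n) (x : X n), ract h x A.one = x
  ract_mul : ∀ {i j l ij jl n : ℤ} (hij : i + j = ij) (hjl : j + l = jl) (h₁ : ij + l = n)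
    (h₂ : i + jl = n) (x : X i) (a : A.X j) (b : A.X l),
    ract h₁ (ract hij x a) b = ract h₂ x (A.mul hjl a b)
  act_ract : ∀ {i j l ij jl n : ℤ} (hij : i + j = ij) (hjl : j + l = jl) (h₁ : ij + l = n)
    (h₂ : i + jl = n) (a : A.X i) (x : X j) (b : A.X l),
    ract h₁ (act hij a x) b = act h₂ a (ract hjl x b)
  d_ract : ∀ {i j n i' j' n' : ℤ} (h : i + j = n) (hi : i + 1 = i') (hj : j + 1 = j')
    (hn : n + 1 = n') (h₁ : i' + j = n') (h₂ : i + j' = n') (x : X i) (a : A.X j),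
    d hn (ract h x a) = ract h₁ (d hi x) a + sgn k i • ract h₂ x (A.d hj a)

/-- The right action `m a = (-1)^{|m||a|} a m` on a left dg module. -/
def DGModule.symAct {A : CDGA k} (V : DGModule A) {i j n : ℤ} (h : i + j = n) :
    V.X i →ₗ[k] A.X j →ₗ[k] V.X n :=
  sgn k (i * j) • (V.act (by omega : j + i = n)).flip

/-- A left dg module, viewed as a bimodule with right action `m a = (-1)^{|m||a|} a m`. -/
abbrev DGModule.sym {A : CDGA k} (V : DGModule A) : DGBimodule A where
  toDGModule := V
  ract := V.symAct
  ract_one h x := by simp [DGModule.symAct, sgn_zero, V.one_act]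
  ract_mul {i j l ij jl n} hij hjl h₁ h₂ x a b := by
    simp only [DGModule.symAct, LinearMap.smul_apply, LinearMap.flip_apply, map_smul]
    rw [← V.mul_act (by omega : l + j = jl) _ (by omega : jl + i = n), A.mul_comm _ hjl,
      map_smul, LinearMap.smul_apply, smul_smul, smul_smul]
    congr 1
    subst hij hjl
    simp only [add_mul, mul_add, sgn_add]
    rw [mul_comm l j, mul_comm (sgn k (i * l)), mul_assoc, mul_assoc, mul_comm (sgn k (i * l)),
      ← mul_assoc (sgn k (j * l)), sgn_mul_self, one_mul, mul_comm]
  act_ract {i j l ij jl n} hij hjl h₁ h₂ a x b := by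
    simp only [DGModule.symAct, LinearMap.smul_apply, LinearMap.flip_apply, map_smul]
    rw [← V.mul_act (by omega : l + i = l + i) hij (by omega) _,
      ← V.mul_act (by omega : i + l = l + i) (by omega) (by omega) _, A.mul_comm _ (add_comm i l),
      map_smul, LinearMap.smul_apply, smul_smul]
    congr 1
    subst hij
    rw [add_mul, sgn_add, mul_comm l i, mul_comm (sgn k (i * l)), mul_assoc, sgn_mul_self, mul_one]
  d_ract {i j n i' j' n'} h hi hj hn h₁ h₂ x a := by
    simp only [DGModule.symAct, LinearMap.smul_apply, LinearMap.flip_apply, map_smul]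
    rw [V.d_act _ hj hi hn (by omega) (by omega)]
    subst hi hj
    simp only [add_mul, mul_add, sgn_add, one_mul, mul_one]
    rcases sgn_cases k i with h | h <;> rcases sgn_cases k j with h' | h' <;> simp [h, h'] <;> abel

namespace DGBimodule

variable {A : CDGA k} (K : DGBimodule A) (M : DGModule A)

/-- Degree `n` of `K ⊗_k M`. -/
abbrev PreTensor (n : ℤ) : Type u :=
  DirectSum {p : ℤ × ℤ // p.1 + p.2 = n} fun p => TensorProduct k (K.X p.1.1) (M.X p.1.2)

/-- The pure tensors of `K ⊗_k M`. -/
noncomputable def preTmul {i j n : ℤ} (h : i + j = n) : K.X i →ₗ[k] M.X j →ₗ[k] PreTensor K M n :=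
  (TensorProduct.mk k (K.X i) (M.X j)).compr₂
    (DirectSum.lof k {p : ℤ × ℤ // p.1 + p.2 = n}
      (fun p => TensorProduct k (K.X p.1.1) (M.X p.1.2)) ⟨(i, j), h⟩)

/-- The relations `x a ⊗ m = x ⊗ a m`. -/
def tensorRel (n : ℤ) : Submodule k (PreTensor K M n) :=
  Submodule.span k {z | ∃ (i l j il lj : ℤ) (hil : i + l = il) (hlj : l + j = lj)
    (h₁ : il + j = n) (h₂ : i + lj = n) (x : K.X i) (a : A.X l) (m : M.X j),
    z = preTmul K M h₁ (K.ract hil x a) m - preTmul K M h₂ x (M.act hlj a m)}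

/-- Degree `n` of `K ⊗_A M`. -/
abbrev TensorX (n : ℤ) : Type u := PreTensor K M n ⧸ tensorRel K M n

/-- The pure tensors of `K ⊗_A M`. -/
noncomputable def tmul {i j n : ℤ} (h : i + j = n) : K.X i →ₗ[k] M.X j →ₗ[k] TensorX K M n :=
  (preTmul K M h).compr₂ (tensorRel K M n).mkQ

variable {K M}

lemma tmul_balanced {i l j il lj n : ℤ} (hil : i + l = il) (hlj : l + j = lj)
    (h₁ : il + j = n) (h₂ : i + lj = n) (x : K.X i) (a : A.X l) (m : M.X j) :
    tmul K M h₁ (K.ract hil x a) m = tmul K M h₂ x (M.act hlj a m) :=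
  (Submodule.Quotient.eq _).2
    (Submodule.subset_span ⟨i, l, j, il, lj, hil, hlj, h₁, h₂, x, a, m, rfl⟩)

/-- The map out of `K ⊗_A M` defined by balanced bilinear maps. -/
noncomputable def tensorLift {n : ℤ} {Y : Type*} [AddCommGroup Y] [Module k Y]
    (f : ∀ i j : ℤ, i + j = n → K.X i →ₗ[k] M.X j →ₗ[k] Y)
    (hf : ∀ {i l j il lj : ℤ} (hil : i + l = il) (hlj : l + j = lj) (h₁ : il + j = n)
      (h₂ : i + lj = n) (x : K.X i) (a : A.X l) (m : M.X j),
      f il j h₁ (K.ract hil x a) m = f i lj h₂ x (M.act hlj a m)) : TensorX K M n →ₗ[k] Y :=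
  (tensorRel K M n).liftQ
    (DirectSum.toModule k _ Y fun p => TensorProduct.lift (f _ _ p.2)) <| by
    rw [tensorRel, Submodule.span_le]
    rintro _ ⟨i, l, j, il, lj, hil, hlj, h₁, h₂, x, a, m, rfl⟩
    simp only [SetLike.mem_coe, LinearMap.mem_ker, map_sub, preTmul, LinearMap.compr₂_apply,
      TensorProduct.mk_apply, DirectSum.toModule_lof, TensorProduct.lift.tmul]
    rw [hf hil hlj h₁ h₂, sub_self]

@[simp] lemma tensorLift_tmul {n : ℤ} {Y : Type*} [AddCommGroup Y] [Module k Y]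
    (f : ∀ i j : ℤ, i + j = n → K.X i →ₗ[k] M.X j →ₗ[k] Y)
    (hf : ∀ {i l j il lj : ℤ} (hil : i + l = il) (hlj : l + j = lj) (h₁ : il + j = n)
      (h₂ : i + lj = n) (x : K.X i) (a : A.X l) (m : M.X j),
      f il j h₁ (K.ract hil x a) m = f i lj h₂ x (M.act hlj a m))
    {i j : ℤ} (h : i + j = n) (x : K.X i) (m : M.X j) :
    tensorLift f hf (tmul K M h x m) = f i j h x m := by
  simp [tensorLift, tmul, preTmul, DirectSum.toModule_lof]

lemma tensor_hom_ext {n : ℤ} {Y : Type*} [AddCommGroup Y] [Module k Y]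
    {f g : TensorX K M n →ₗ[k] Y}
    (h : ∀ {i j : ℤ} (hij : i + j = n) (x : K.X i) (m : M.X j),
      f (tmul K M hij x m) = g (tmul K M hij x m)) : f = g := by
  apply Submodule.linearMap_qext
  apply DirectSum.linearMap_ext
  rintro ⟨⟨i, j⟩, hij⟩
  apply TensorProduct.ext'
  intro x m
  exact h hij x m

variable (K M)

lemma tensorAct_balanced {i j n : ℤ} (h : i + j = n) (a : A.X i) {p l q pl lq : ℤ}
    (hpl : p + l = pl) (hlq : l + q = lq) (h₁ : pl + q = j) (_ : p + lq = j) (x : K.X p)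
    (b : A.X l) (m : M.X q) :
    (tmul K M (by omega : i + pl + q = n)).comp (K.act rfl a) (K.ract hpl x b) m =
      (tmul K M (by omega : i + p + lq = n)).comp (K.act rfl a) x (M.act hlq b m) := by
  simp only [LinearMap.comp_apply]
  rw [← K.act_ract rfl hpl (by omega) rfl]
  exact tmul_balanced _ _ _ _ _ _ _

/-- The left action on `K ⊗_A M`: `a (x ⊗ m) = a x ⊗ m`. -/
noncomputable def tensorAct {i j n : ℤ} (h : i + j = n) :
    A.X i →ₗ[k] TensorX K M j →ₗ[k] TensorX K M n where
  toFun a := tensorLift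
    (fun p q hpq => (tmul K M (by omega : i + p + q = n)).comp (K.act rfl a))
    (tensorAct_balanced K M h a)
  map_add' a b := tensor_hom_ext fun hpq x m => by
    rw [LinearMap.add_apply, tensorLift_tmul, tensorLift_tmul, tensorLift_tmul]
    simp
  map_smul' c a := tensor_hom_ext fun hpq x m => by
    rw [LinearMap.smul_apply, tensorLift_tmul, tensorLift_tmul]
    simp

lemma tensorD_balanced {i j : ℤ} (h : i + 1 = j) {p l q pl lq : ℤ}
    (hpl : p + l = pl) (hlq : l + q = lq) (h₁ : pl + q = i) (h₂ : p + lq = i) (x : K.X p)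
    (b : A.X l) (m : M.X q) :
    ((tmul K M (by omega : pl + 1 + q = j)).comp (K.d rfl) +
      sgn k pl • (tmul K M (by omega : pl + (q + 1) = j)).compl₂ (M.d rfl)) (K.ract hpl x b) m =
    ((tmul K M (by omega : p + 1 + lq = j)).comp (K.d rfl) +
      sgn k p • (tmul K M (by omega : p + (lq + 1) = j)).compl₂ (M.d rfl)) x (M.act hlq b m) := by
  simp only [LinearMap.add_apply, LinearMap.smul_apply, LinearMap.comp_apply,
    LinearMap.compl₂_apply]
  subst hpl hlq
  rw [K.d_ract rfl rfl rfl rfl (by omega : p + 1 + l = p + l + 1) (by omega),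
    M.d_act rfl rfl rfl rfl (by omega : l + 1 + q = l + q + 1) (by omega)]
  simp only [map_add, map_smul, LinearMap.add_apply, LinearMap.smul_apply, smul_add, smul_smul,
    ← sgn_add]
  rw [tmul_balanced _ rfl _ (by omega : p + 1 + (l + q) = j),
    tmul_balanced _ (by omega : l + 1 + q = l + q + 1) _ (by omega),
    tmul_balanced _ (by omega : l + (q + 1) = l + q + 1) _ (by omega), add_assoc]

/-- The differential of `K ⊗_A M`: `d (x ⊗ m) = dx ⊗ m + (-1)^{|x|} x ⊗ dm`. -/
noncomputable def tensorD {i j : ℤ} (h : i + 1 = j) : TensorX K M i →ₗ[k] TensorX K M j :=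
  tensorLift
    (fun p q hpq => (tmul K M (by omega : p + 1 + q = j)).comp (K.d rfl) +
      sgn k p • (tmul K M (by omega : p + (q + 1) = j)).compl₂ (M.d rfl))
    (tensorD_balanced K M h)

variable {K M}

lemma tensorAct_tmul {i j n p q ip : ℤ} (h : i + j = n) (hpq : p + q = j) (hip : i + p = ip)
    (h' : ip + q = n) (a : A.X i) (x : K.X p) (m : M.X q) :
    tensorAct K M h a (tmul K M hpq x m) = tmul K M h' (K.act hip a x) m := by
  subst hip
  change tensorLift (fun p q hpq => (DGBimodule.tmul K M (by omega : i + p + q = n)).comp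
    (K.act rfl a)) (tensorAct_balanced K M h a) _ = _
  rw [tensorLift_tmul]
  rfl

lemma tensorD_tmul {i j p q p' q' : ℤ} (h : i + 1 = j) (hpq : p + q = i) (hp : p + 1 = p')
    (hq : q + 1 = q') (h₁ : p' + q = j) (h₂ : p + q' = j) (x : K.X p) (m : M.X q) :
    tensorD K M h (tmul K M hpq x m) =
      tmul K M h₁ (K.d hp x) m + sgn k p • tmul K M h₂ x (M.d hq m) := by
  subst hp hq
  exact tensorLift_tmul _ (tensorD_balanced K M h) hpq x m

/-- A property that holds for pure tensors and is closed under addition holds for all tensors. -/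
lemma tensor_induction {n : ℤ} {P : TensorX K M n → Prop} (zero : P 0)
    (add : ∀ x y, P x → P y → P (x + y))
    (tmul : ∀ {i j : ℤ} (hij : i + j = n) (x : K.X i) (m : M.X j), P (DGBimodule.tmul K M hij x m))
    (z : TensorX K M n) : P z := by
  obtain ⟨z, rfl⟩ := Submodule.Quotient.mk_surjective _ z
  induction z using DirectSum.induction_on with
  | zero => exact zero
  | add x y hx hy => exact add _ _ hx hy
  | of p t =>
    induction t using TensorProduct.induction_on with
    | zero => rw [map_zero]; exact zero
    | add x y hx hy => rw [map_add]; exact add _ _ hx hy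
    | tmul x m => exact tmul p.2 x m

variable (K M)

/-- The tensor product `K ⊗_A M`, a left dg module. -/
noncomputable abbrev tensor : DGModule A where
  X := TensorX K M
  act := tensorAct K M
  d := tensorD K M
  one_act h z := by
    induction z using tensor_induction with
    | zero => simp
    | add x y hx hy => rw [map_add, hx, hy]
    | tmul hpq x m =>
    rename_i p q
    rw [tensorAct_tmul h hpq (zero_add p) hpq, K.one_act]
  mul_act {i j l ij jl n} hij hjl h₁ h₂ a b z := by
    induction z using tensor_induction with
    | zero => simp
    | add x y hx hy => simp only [map_add, hx, hy]
    | tmul hpq x m =>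
    rename_i p q
    rw [tensorAct_tmul h₁ hpq rfl (by omega), tensorAct_tmul hjl hpq rfl (by omega),
      tensorAct_tmul h₂ _ (by omega : i + (j + p) = ij + p) (by omega),
      K.mul_act hij rfl rfl (by omega)]
  d_d {i j l} h h' z := by
    induction z using tensor_induction with
    | zero => simp
    | add x y hx hy => simp only [map_add, hx, hy, add_zero]
    | tmul hpq x m =>
    rename_i p q
    rw [tensorD_tmul h hpq rfl rfl (by omega) (by omega), map_add, map_smul,
      tensorD_tmul h' _ rfl rfl (by omega) (by omega),
      tensorD_tmul h' _ rfl rfl (by omega) (by omega), K.d_d, M.d_d, sgn_add, sgn_one]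
    simp
  d_act {i j n i' j' n'} h hi hj hn h₁ h₂ a z := by
    induction z using tensor_induction with
    | zero => simp
    | add x y hx hy => simp only [map_add, hx, hy, smul_add]; abel
    | tmul hpq x m =>
    rename_i p q
    subst hi
    rw [tensorAct_tmul h hpq rfl (by omega), tensorD_tmul hn _ rfl rfl (by omega) (by omega),
      tensorAct_tmul h₁ hpq (by omega : i + 1 + p = i + p + 1) (by omega),
      tensorD_tmul hj hpq rfl rfl (by omega) (by omega), map_add, map_smul,
      tensorAct_tmul h₂ _ (by omega : i + (p + 1) = i + p + 1) (by omega),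
      tensorAct_tmul h₂ _ rfl (by omega),
      K.d_act rfl rfl rfl rfl (by omega : i + 1 + p = i + p + 1) (by omega)]
    simp only [map_add, map_smul, LinearMap.add_apply, LinearMap.smul_apply, smul_add, smul_smul,
      sgn_add, add_assoc]

end DGBimodule

/-! ### The Atiyah bimodule of an anchored module -/

namespace DGModule

variable {A : CDGA k} (V : DGModule A) (ρ : V ⟶ tangent A)

/-- The derivation `ρ(v)` evaluated at `a`. -/
def anchorApply {i j n : ℤ} (h : i + j = n) : V.X i →ₗ[k] A.X j →ₗ[k] A.X n :=
  (derApply h).comp (ρ.f i : V.X i →ₗ[k] derivations A i)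

lemma anchorApply_def {i j n : ℤ} (h : i + j = n) (v : V.X i) (a : A.X j) :
    V.anchorApply ρ h v a = derApply h (ρ.f i v : derivations A i) a := rfl

lemma anchorApply_one {n : ℤ} (v : V.X n) (h : n + 0 = n) :
    V.anchorApply ρ h v A.one = 0 := derApply_one _ h

lemma anchorApply_mul {n i j l i' j' l' : ℤ} (v : V.X n) (h : i + j = l) (hi : n + i = i')
    (hj : n + j = j') (hl : n + l = l') (h₁ : i' + j = l') (h₂ : i + j' = l') (a : A.X i)
    (b : A.X j) : V.anchorApply ρ hl v (A.mul h a b) =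
      A.mul h₁ (V.anchorApply ρ hi v a) b + sgn k (n * i) • A.mul h₂ a (V.anchorApply ρ hj v b) :=
  derApply_mul _ h hi hj hl h₁ h₂ a b

lemma anchorApply_act {p q pq i qi n : ℤ} (hpq : p + q = pq) (h₁ : pq + i = n) (hqi : q + i = qi)
    (h₂ : p + qi = n) (a : A.X p) (v : V.X q) (b : A.X i) :
    V.anchorApply ρ h₁ (V.act hpq a v) b = A.mul h₂ a (V.anchorApply ρ hqi v b) := by
  rw [anchorApply_def, ρ.map_act]
  exact derAct_apply hpq h₁ hqi h₂ a _ b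

lemma anchorApply_d {p q p' i i' n : ℤ} (hp : p + 1 = p') (h₁ : p' + i = n) (hq : p + i = q)
    (hqn : q + 1 = n) (hi : i + 1 = i') (h₂ : p + i' = n) (v : V.X p) (a : A.X i) :
    V.anchorApply ρ h₁ (V.d hp v) a =
      A.d hqn (V.anchorApply ρ hq v a) - sgn k p • V.anchorApply ρ h₂ v (A.d hi a) := by
  rw [anchorApply_def, ρ.map_d]
  refine (derBracket_apply _ h₁ hq (by omega : 1 + i = i') (by omega) h₂ _ _ a).trans ?_
  rw [one_mul]
  rfl

/-- The Atiyah bimodule `Σ_V = A ⊕ V`, with right action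
`(a, v) a' = (a a' + ρ(v)(a'), (-1)^{|a'||v|} a' v)`. -/
abbrev atiyah : DGBimodule A where
  X n := A.X n × V.X n
  act h := LinearMap.mk₂ k (fun a s => (A.mul h a s.1, V.act h a s.2))
    (fun a b s => by simp) (fun c a s => by simp) (fun a s t => by simp) (fun c a s => by simp)
  d h := (A.d h).prodMap (V.d h)
  one_act h s := by simp [A.one_mul, V.one_act]
  mul_act hij hjl h₁ h₂ a b s := by
    simp only [LinearMap.mk₂_apply]
    rw [A.mul_assoc hij hjl h₁ h₂, V.mul_act hij hjl h₁ h₂]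
  d_d h h' s := by simp [A.d_d, V.d_d]
  d_act h hi hj hn h₁ h₂ a s := by
    refine Prod.ext ?_ ?_
    · simpa using A.d_mul h hi hj hn h₁ h₂ a s.1
    · simpa using V.d_act h hi hj hn h₁ h₂ a s.2
  ract {i j n} h := LinearMap.mk₂ k
    (fun s a => (A.mul h s.1 a + V.anchorApply ρ h s.2 a, V.symAct h s.2 a))
    (fun s t a => by
      refine Prod.ext ?_ ?_
      · simp only [Prod.fst_add, Prod.snd_add, map_add, LinearMap.add_apply]; abel
      · simp only [Prod.snd_add, map_add, LinearMap.add_apply])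
    (fun c s a => by
      refine Prod.ext ?_ ?_ <;>
        simp only [Prod.smul_fst, Prod.smul_snd, map_smul, LinearMap.smul_apply, smul_add])
    (fun s a b => by
      refine Prod.ext ?_ ?_
      · simp only [Prod.fst_add, map_add]; abel
      · simp only [Prod.snd_add, map_add])
    (fun c s a => by
      refine Prod.ext ?_ ?_ <;> simp only [Prod.smul_fst, Prod.smul_snd, map_smul, smul_add])
  ract_one {n} h s := by
    refine Prod.ext ?_ (V.sym.ract_one h s.2)
    change A.mul h s.1 A.one + V.anchorApply ρ h s.2 A.one = s.1
    rw [A.mul_one, anchorApply_one, add_zero]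
  ract_mul {i j l ij jl n} hij hjl h₁ h₂ s a b := by
    refine Prod.ext ?_ (V.sym.ract_mul hij hjl h₁ h₂ s.2 a b)
    change A.mul h₁ (A.mul hij s.1 a + V.anchorApply ρ hij s.2 a) b +
        V.anchorApply ρ h₁ (sgn k (i * j) • V.act (by omega : j + i = ij) a s.2) b =
      A.mul h₂ s.1 (A.mul hjl a b) + V.anchorApply ρ h₂ s.2 (A.mul hjl a b)
    rw [anchorApply_mul V ρ s.2 hjl hij (rfl : i + l = i + l) h₂ h₁ (by omega), map_smul,
      LinearMap.smul_apply, anchorApply_act V ρ _ h₁ (rfl : i + l = i + l) (by omega),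
      ← A.mul_assoc hij hjl h₁ h₂]
    simp only [map_add, LinearMap.add_apply, add_assoc]
  act_ract {i j l ij jl n} hij hjl h₁ h₂ a s b := by
    refine Prod.ext ?_ (V.sym.act_ract hij hjl h₁ h₂ a s.2 b)
    change A.mul h₁ (A.mul hij a s.1) b + V.anchorApply ρ h₁ (V.act hij a s.2) b =
      A.mul h₂ a (A.mul hjl s.1 b + V.anchorApply ρ hjl s.2 b)
    rw [anchorApply_act V ρ hij h₁ hjl h₂, A.mul_assoc hij hjl h₁ h₂, map_add]
  d_ract {i j n i' j' n'} h hi hj hn h₁ h₂ s a := by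
    refine Prod.ext ?_ (V.sym.d_ract h hi hj hn h₁ h₂ s.2 a)
    change A.d hn (A.mul h s.1 a + V.anchorApply ρ h s.2 a) =
      A.mul h₁ (A.d hi s.1) a + V.anchorApply ρ h₁ (V.d hi s.2) a +
        sgn k i • (A.mul h₂ s.1 (A.d hj a) + V.anchorApply ρ h₂ s.2 (A.d hj a))
    rw [anchorApply_d V ρ hi h₁ h hn hj h₂, map_add, A.d_mul h hi hj hn h₁ h₂, smul_add]
    abel

end DGModule

/-! ### The HKR sequence and the HKR class -/

namespace DGModule

variable {A : CDGA k} (V : DGModule A) (ρ : V ⟶ tangent A) (M : DGModule A)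

/-- The map `M ⟶ Σ_V ⊗_A M`, `m ↦ 1 ⊗ m`. -/
noncomputable def hkrIncl : M ⟶ (V.atiyah ρ).tensor M where
  f n := (V.atiyah ρ).tmul M (zero_add n) (A.one, 0)
  map_act {i j n} h a x := by
    refine Eq.trans ?_ (DGBimodule.tensorAct_tmul (K := V.atiyah ρ) h (zero_add j) (add_zero i) h
      a (A.one, 0) x).symm
    have e : (V.atiyah ρ).act (add_zero i) a (A.one, 0) =
        (V.atiyah ρ).ract (zero_add i) (A.one, 0) a := by
      refine Prod.ext ?_ ?_
      · change A.mul _ a A.one = A.mul _ A.one a + V.anchorApply ρ _ 0 a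
        rw [A.mul_one, A.one_mul, map_zero, LinearMap.zero_apply, add_zero]
      · change V.act _ a 0 = V.symAct _ 0 a
        rw [map_zero, map_zero, LinearMap.zero_apply]
    rw [e]
    exact (DGBimodule.tmul_balanced (K := V.atiyah ρ) (zero_add i) h h (zero_add n)
      (A.one, 0) a x).symm
  map_d {i j} h x := by
    refine Eq.trans ?_ (DGBimodule.tensorD_tmul (K := V.atiyah ρ) h (zero_add i) rfl h (by omega)
      (zero_add j) (A.one, 0) x).symm
    have e : (V.atiyah ρ).d (rfl : (0 : ℤ) + 1 = 0 + 1) (A.one, 0) = 0 := by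
      refine Prod.ext ?_ ?_
      · exact A.d_one rfl
      · exact map_zero (V.d rfl)
    rw [e, map_zero, LinearMap.zero_apply, zero_add, sgn_zero, one_smul]

lemma hkrProj_balanced {n i l j il lj : ℤ} (hil : i + l = il) (hlj : l + j = lj)
    (h₁ : il + j = n) (h₂ : i + lj = n) (x : (V.atiyah ρ).X i) (a : A.X l) (m : M.X j) :
    (V.sym.tmul M h₁).comp (LinearMap.snd k (A.X il) (V.X il)) ((V.atiyah ρ).ract hil x a) m =
      (V.sym.tmul M h₂).comp (LinearMap.snd k (A.X i) (V.X i)) x (M.act hlj a m) :=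
  DGBimodule.tmul_balanced (K := V.sym) hil hlj h₁ h₂ x.2 a m

/-- The map `Σ_V ⊗_A M ⟶ V ⊗_A M`, `(a, v) ⊗ m ↦ v ⊗ m`, in degree `n`. -/
noncomputable def hkrProjFun (n : ℤ) : (V.atiyah ρ).TensorX M n →ₗ[k] V.sym.TensorX M n :=
  DGBimodule.tensorLift (K := V.atiyah ρ)
    (fun p _ h => (V.sym.tmul M h).comp (LinearMap.snd k (A.X p) (V.X p)))
    (V.hkrProj_balanced ρ M)

lemma hkrProjFun_tmul {n p q : ℤ} (h : p + q = n) (x : (V.atiyah ρ).X p) (m : M.X q) :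
    V.hkrProjFun ρ M n ((V.atiyah ρ).tmul M h x m) = V.sym.tmul M h x.2 m :=
  DGBimodule.tensorLift_tmul (K := V.atiyah ρ) _ (V.hkrProj_balanced ρ M) h x m

/-- The map `Σ_V ⊗_A M ⟶ V ⊗_A M`, `(a, v) ⊗ m ↦ v ⊗ m`. -/
noncomputable def hkrProj : (V.atiyah ρ).tensor M ⟶ V.sym.tensor M where
  f n := V.hkrProjFun ρ M n
  map_act {i j n} h a z := by
    induction z using DGBimodule.tensor_induction with
    | zero => simp only [map_zero]
    | add x y hx hy => simp only [map_add, hx, hy]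
    | tmul hpq x m =>
    rename_i p q
    rw [DGBimodule.tensorAct_tmul (K := V.atiyah ρ) h hpq rfl (by omega), hkrProjFun_tmul,
      hkrProjFun_tmul, DGBimodule.tensorAct_tmul (K := V.sym) h hpq rfl (by omega)]
    rfl
  map_d {i j} h z := by
    induction z using DGBimodule.tensor_induction with
    | zero => simp only [map_zero]
    | add x y hx hy => simp only [map_add, hx, hy]
    | tmul hpq x m =>
    rename_i p q
    rw [DGBimodule.tensorD_tmul (K := V.atiyah ρ) h hpq rfl rfl (by omega) (by omega), map_add,
      map_smul, hkrProjFun_tmul, hkrProjFun_tmul, hkrProjFun_tmul,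
      DGBimodule.tensorD_tmul (K := V.sym) h hpq rfl rfl (by omega) (by omega)]
    rfl

/-- `A`-linear maps of degree `s` (not necessarily compatible with the differentials). -/
def IsLinearOfDegree {V N : DGModule A} (s : ℤ)
    (f : ∀ i j : ℤ, s + i = j → V.X i →ₗ[k] N.X j) : Prop :=
  ∀ {l i j n m : ℤ} (h : l + i = n) (hi : s + i = j) (hn : s + n = m) (h' : l + j = m)
    (a : A.X l) (v : V.X i), f n m hn (V.act h a v) = sgn k (s * l) • N.act h' a (f i j hi v)

/-- Linear maps out of `V` lift along surjections: `V` is projective as a graded module. -/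
def IsGradedProjective (V : DGModule A) : Prop :=
  ∀ (N N' : DGModule A) (p : ∀ n, N.X n →ₗ[k] N'.X n),
    (∀ {l i n : ℤ} (h : l + i = n) (a : A.X l) (x : N.X i),
      p n (N.act h a x) = N'.act h a (p i x)) →
    (∀ n, Function.Surjective (p n)) →
    ∀ (s : ℤ) (f : ∀ i j : ℤ, s + i = j → V.X i →ₗ[k] N'.X j), IsLinearOfDegree s f →
      ∃ g : ∀ i j : ℤ, s + i = j → V.X i →ₗ[k] N.X j, IsLinearOfDegree s g ∧
        ∀ i j h v, p j (g i j h v) = f i j h v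

lemma isGradedProjective_self : IsGradedProjective (self A) := by
  intro N N' p hp hsurj s f hf
  obtain ⟨x, hx⟩ := hsurj s (f 0 s (add_zero s) A.one)
  refine ⟨fun i j h => sgn k (s * i) • (N.act (by omega : i + s = j)).flip x, ?_, ?_⟩
  · intro l i j n m h hi hn h' a v
    subst h
    change sgn k (s * (l + i)) • N.act _ (A.mul rfl a v) x =
      sgn k (s * l) • N.act h' a (sgn k (s * i) • N.act _ v x)
    rw [N.mul_act rfl (by omega : i + s = j) _ h', mul_add, sgn_add, map_smul, smul_smul]
  · intro i j h v
    change p j (sgn k (s * i) • N.act _ v x) = _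
    have := hf (add_zero i) (add_zero s) h (by omega) v A.one
    rw [show (self A).act (add_zero i) v A.one = v from A.mul_one _ v] at this
    rw [this, map_smul, hp, hx]

lemma IsGradedProjective.shift {V : DGModule A} (hV : IsGradedProjective V) (t : ℤ) :
    IsGradedProjective (V.shift t) := by
  intro N N' p hp hsurj s f hf
  have hcast : ∀ {i i' j : ℤ} (e : i = i') (h : s + i = j) (h' : s + i' = j) (x : V.X (i + t)),
      f i' j h' (V.castEq (by omega : i + t = i' + t) x) = f i j h x := by
    intro i i' j e h h' x
    subst e; rfl
  obtain ⟨g, hg, hgf⟩ := hV N N' p hp hsurj (s - t)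
    (fun i j h => (f (i - t) j (by omega)).comp (V.castEq (by omega : i = i - t + t)))
    (by
      intro l i j n m h hi hn h' a v
      rw [LinearMap.comp_apply, LinearMap.comp_apply,
        ← V.act_castEq (by omega : i = i - t + t) (by omega : l + (i - t + t) = n - t + t) h]
      have := hf (by omega : l + (i - t) = n - t) (by omega : s + (i - t) = j) (by omega) h' a
        (V.castEq (by omega : i = i - t + t) v)
      change f (n - t) m _ (sgn k (t * l) • V.act _ a _) = _ at this
      rw [map_smul] at this
      rw [show sgn k ((s - t) * l) = sgn k (t * l) * sgn k (s * l) by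
        rw [sub_mul, sub_eq_add_neg, sgn_add, sgn_neg, mul_comm], mul_smul, ← this, smul_smul,
        sgn_mul_self, one_smul])
  refine ⟨fun i j h => g (i + t) j (by omega), ?_, ?_⟩
  · intro l i j n m h hi hn h' a v
    change g (n + t) m _ (sgn k (t * l) • V.act _ a v) = _
    rw [map_smul, hg (by omega : l + (i + t) = n + t) (by omega : s - t + (i + t) = j) _ h',
      smul_smul, sub_mul, sub_eq_add_neg, sgn_add, sgn_neg, mul_comm, mul_assoc, sgn_mul_self,
      mul_one]
  · intro i j h v
    rw [hgf (i + t) j _ v, LinearMap.comp_apply]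
    exact hcast (by omega : i = i + t - t) h (by omega) v

lemma IsGradedProjective.retract {V W : DGModule A} (hW : IsGradedProjective W) (i : V ⟶ W)
    (p : W ⟶ V) (hip : i ≫ p = 𝟙 V) : IsGradedProjective V := by
  intro N N' q hq hsurj s f hf
  obtain ⟨g, hg, hgf⟩ := hW N N' q hq hsurj s (fun a b h => (f a b h).comp (p.f a))
    (by
      intro l i j n m h hi hn h' a v
      rw [LinearMap.comp_apply, p.map_act, hf h hi hn h']; rfl)
  refine ⟨fun a b h => (g a b h).comp (i.f a), ?_, ?_⟩
  · intro l i j n m h hi hn h' a v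
    rw [LinearMap.comp_apply, Hom.map_act, hg h hi hn h']; rfl
  · intro a b h v
    rw [LinearMap.comp_apply, hgf, LinearMap.comp_apply]
    have : p.f a (i.f a v) = v := by rw [← comp_f, hip, id_f]
    rw [this]

lemma IsGradedProjective.ext {X Y Z : DGModule A} {i : X ⟶ Y} {p : Y ⟶ Z} (h : ShortExact i p)
    (hX : IsGradedProjective X) (hZ : IsGradedProjective Z) : IsGradedProjective Y := by
  obtain ⟨σ, hσ, hσp⟩ := hZ Y Z p.f p.map_act h.surj 0
    (fun a b e => Z.castEq (by omega))
    (by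
      intro l i j n m h hi hn h' a v
      obtain rfl : i = j := by omega
      obtain rfl : n = m := by omega
      rw [zero_mul, sgn_zero, one_smul]; rfl)
  have hσ1 : ∀ {n : ℤ} (z : Z.X n), p.f n (σ n n (zero_add n) z) = z := fun z => hσp _ _ _ z
  have hσ2 : ∀ {l i n : ℤ} (h : l + i = n) (a : A.X l) (z : Z.X i),
      σ n n (zero_add n) (Z.act h a z) = Y.act h a (σ i i (zero_add i) z) := by
    intro l i n h a z
    rw [hσ h (zero_add i) (zero_add n) h, zero_mul, sgn_zero, one_smul]
  have hr : ∀ n, ∃ r : Y.X n →ₗ[k] X.X n, ∀ y,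
      i.f n (r y) = y - σ n n (zero_add n) (p.f n y) := by
    intro n
    refine ⟨(LinearEquiv.ofInjective (i.f n) (h.inj n)).symm.toLinearMap.comp
      (LinearMap.codRestrict (LinearMap.range (i.f n))
        (LinearMap.id - (σ n n (zero_add n)).comp (p.f n)) fun y => ?_), fun y => ?_⟩
    · refine (h.exact n _).1 ?_
      simp [hσ1]
    · have := LinearEquiv.ofInjective_symm_apply (f := i.f n) (h := h.inj n)
        ⟨y - σ n n (zero_add n) (p.f n y), (h.exact n _).1 (by simp [hσ1])⟩
      exact this
  choose r hr using hr
  have hr2 : ∀ {l j n : ℤ} (e : l + j = n) (a : A.X l) (y : Y.X j),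
      r n (Y.act e a y) = X.act e a (r j y) := by
    intro l j n e a y
    apply h.inj
    rw [hr, i.map_act, hr, p.map_act, hσ2, map_sub]
  intro N N' q hq hsurj s f hf
  obtain ⟨gX, hgX, hgX'⟩ := hX N N' q hq hsurj s (fun a b e => (f a b e).comp (i.f a))
    (by
      intro l j b n m h hi hn h' a v
      rw [LinearMap.comp_apply, i.map_act, hf h hi hn h']; rfl)
  obtain ⟨gZ, hgZ, hgZ'⟩ := hZ N N' q hq hsurj s
    (fun a b e => (f a b e).comp (σ a a (zero_add a)))
    (by
      intro l j b n m h hi hn h' a v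
      rw [LinearMap.comp_apply, hσ2, hf h hi hn h']; rfl)
  refine ⟨fun a b e => (gX a b e).comp (r a) + (gZ a b e).comp (p.f a), ?_, ?_⟩
  · intro l j b n m h hi hn h' a v
    simp only [LinearMap.add_apply, LinearMap.comp_apply, map_add, smul_add]
    rw [hr2, hgX h hi hn h', p.map_act, hgZ h hi hn h']
  · intro a b e v
    simp only [LinearMap.add_apply, LinearMap.comp_apply, map_add]
    rw [hgX', hgZ', LinearMap.comp_apply, LinearMap.comp_apply, ← map_add, hr, sub_add_cancel]

lemma IsPerfect.isGradedProjective {V : DGModule A} (hV : IsPerfect V) : IsGradedProjective V := by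
  induction hV with
  | self => exact isGradedProjective_self
  | shift V s _ ih => exact ih.shift s
  | ext i p h _ _ ihX ihZ => exact IsGradedProjective.ext h ihX ihZ
  | retract i p h _ ih => exact ih.retract i p h

end DGModule

/-- The left module underlying the right module structure of a bimodule:
`a ∗ x = (-1)^{|a||x|} x a`. -/
abbrev DGBimodule.opModule {A : CDGA k} (K : DGBimodule A) : DGModule A where
  X := K.X
  act {i j n} h := sgn k (i * j) • (K.ract (by omega : j + i = n)).flip
  d := K.d
  one_act h x := by simp [sgn_zero, K.ract_one]
  mul_act {i j l ij jl n} hij hjl h₁ h₂ a b x := by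
    simp only [LinearMap.smul_apply, LinearMap.flip_apply, map_smul]
    rw [K.ract_mul (by omega : l + j = jl) (by omega : j + i = ij) _ (by omega),
      A.mul_comm _ hij, map_smul, smul_smul, smul_smul]
    congr 1
    subst hij hjl
    simp only [add_mul, mul_add, sgn_add]
    rw [mul_comm j i]
    rcases sgn_cases k (i * j) with h | h <;> rcases sgn_cases k (i * l) with h' | h' <;>
      rcases sgn_cases k (j * l) with h'' | h'' <;> simp [h, h', h'']
  d_d := K.d_d
  d_act {i j n i' j' n'} h hi hj hn h₁ h₂ a x := by
    simp only [LinearMap.smul_apply, LinearMap.flip_apply, map_smul]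
    rw [K.d_ract _ hj hi hn (by omega) (by omega)]
    subst hi hj
    simp only [add_mul, mul_add, sgn_add, one_mul, mul_one]
    rcases sgn_cases k i with h | h <;> rcases sgn_cases k j with h' | h' <;> simp [h, h'] <;> abel

namespace DGModule

variable {A : CDGA k} {V : DGModule A} (ρ : V ⟶ tangent A) (M : DGModule A)

lemma hkr_shortExact (hV : V.IsPerfect) : ShortExact (V.hkrIncl ρ M) (V.hkrProj ρ M) := by
  obtain ⟨g, hg, hg'⟩ := hV.isGradedProjective (V.atiyah ρ).opModule V
    (fun n => LinearMap.snd k (A.X n) (V.X n))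
    (by
      intro l i n h a x
      change sgn k (l * i) • V.symAct (by omega : i + l = n) x.2 a = V.act h a x.2
      rw [symAct, LinearMap.smul_apply, LinearMap.smul_apply, LinearMap.flip_apply, smul_smul,
        mul_comm i l, sgn_mul_self, one_smul])
    (fun n => LinearMap.snd_surjective) 0 (fun a b e => V.castEq (by omega))
    (by
      intro l i j n m h hi hn h' a v
      obtain rfl : i = j := by omega
      obtain rfl : n = m := by omega
      rw [zero_mul, sgn_zero, one_smul]; rfl)
  have incl_tmul : ∀ {n p q : ℤ} (h : p + q = n) (a : A.X p) (m : M.X q),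
      (V.atiyah ρ).tmul M h (a, 0) m = (V.hkrIncl ρ M).f n (M.act h a m) := by
    intro n p q h a m
    rw [Hom.map_act]
    refine Eq.trans ?_ (DGBimodule.tensorAct_tmul (K := V.atiyah ρ) h (zero_add q) (add_zero p) h
      a (A.one, 0) m).symm
    congr 2
    refine Prod.ext ?_ ?_
    · exact (A.mul_one _ a).symm
    · exact (map_zero (V.act (add_zero p) a)).symm
  refine ⟨fun n => ?_, fun n z => ⟨fun hz => ?_, ?_⟩, fun n z => ?_⟩
  · -- a retraction of `Σ_V ⊗_A M` onto `M`
    let r : ∀ p, (V.atiyah ρ).X p →ₗ[k] A.X p := fun p =>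
      LinearMap.fst k (A.X p) (V.X p) -
        ((LinearMap.fst k (A.X p) (V.X p)).comp (g p p (zero_add p))).comp
          (LinearMap.snd k (A.X p) (V.X p))
    have hr : ∀ {p l pl : ℤ} (h : p + l = pl) (x : (V.atiyah ρ).X p) (a : A.X l),
        r pl ((V.atiyah ρ).ract h x a) = A.mul h (r p x) a := by
      intro p l pl h x a
      have h1 := congrArg Prod.fst (hg (by omega : l + p = pl) (zero_add p) (zero_add pl)
        (by omega) a x.2)
      have h2 : (g p p (zero_add p) x.2).2 = x.2 := hg' _ _ _ _
      have h3 : (g pl pl (zero_add pl) (V.act (by omega : l + p = pl) a x.2)).1 =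
          sgn k (0 * l) • sgn k (l * p) • (A.mul h (g p p (zero_add p) x.2).1 a +
            V.anchorApply ρ h (g p p (zero_add p) x.2).2 a) := h1
      change A.mul h x.1 a + V.anchorApply ρ h x.2 a -
          (g pl pl (zero_add pl) (sgn k (p * l) • V.act (by omega : l + p = pl) a x.2)).1 =
        A.mul h (x.1 - (g p p (zero_add p) x.2).1) a
      rw [map_smul, Prod.smul_fst, h3, h2, zero_mul, sgn_zero, one_smul, smul_smul, mul_comm p l,
        sgn_mul_self, one_smul, map_sub, LinearMap.sub_apply]
      abel
    have hR : ∀ {i l j il lj : ℤ} (hil : i + l = il) (hlj : l + j = lj) (h₁ : il + j = n)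
        (h₂ : i + lj = n) (x : (V.atiyah ρ).X i) (a : A.X l) (m : M.X j),
        (M.act h₁).comp (r il) ((V.atiyah ρ).ract hil x a) m =
          (M.act h₂).comp (r i) x (M.act hlj a m) := by
      intro i l j il lj hil hlj h₁ h₂ x a m
      rw [LinearMap.comp_apply, LinearMap.comp_apply, hr]
      exact M.mul_act _ _ _ _ _ _ _
    let R : (V.atiyah ρ).TensorX M n →ₗ[k] M.X n :=
      DGBimodule.tensorLift (K := V.atiyah ρ) (fun p q h => (M.act h).comp (r p))
        hR
    refine Function.LeftInverse.injective (g := R) fun m => ?_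
    refine (DGBimodule.tensorLift_tmul (K := V.atiyah ρ) (fun p q h => (M.act h).comp (r p))
      hR (zero_add n) (A.one, 0) m).trans ?_
    have : r 0 (A.one, 0) = A.one := by
      change A.one - (g 0 0 _ 0).1 = A.one
      rw [map_zero, Prod.fst_zero, sub_zero]
    rw [LinearMap.comp_apply, this, M.one_act]
  · -- a map `V ⊗_A M ⟶ (Σ_V ⊗_A M) / M` through which the quotient map factors
    let Q := (LinearMap.range ((V.hkrIncl ρ M).f n)).mkQ
    have hQ : ∀ {p q : ℤ} (h : p + q = n) (a : A.X p) (m : M.X q),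
        Q ((V.atiyah ρ).tmul M h (a, 0) m) = 0 := by
      intro p q h a m
      rw [incl_tmul h a m]
      exact (Submodule.Quotient.mk_eq_zero _).2 ⟨_, rfl⟩
    let F : ∀ p q : ℤ, p + q = n → V.X p →ₗ[k] M.X q →ₗ[k]
        (V.atiyah ρ).TensorX M n ⧸ LinearMap.range ((V.hkrIncl ρ M).f n) := fun p q h =>
      (((V.atiyah ρ).tmul M h).compr₂ Q).comp (LinearMap.inr k (A.X p) (V.X p))
    have hF : ∀ {i l j il lj : ℤ} (hil : i + l = il) (hlj : l + j = lj) (h₁ : il + j = n)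
        (h₂ : i + lj = n) (x : V.X i) (a : A.X l) (m : M.X j),
        F il j h₁ (V.symAct hil x a) m = F i lj h₂ x (M.act hlj a m) := by
      intro i l j il lj hil hlj h₁ h₂ x a m
      change Q ((V.atiyah ρ).tmul M h₁ (0, V.symAct hil x a) m) =
        Q ((V.atiyah ρ).tmul M h₂ (0, x) (M.act hlj a m))
      rw [← DGBimodule.tmul_balanced (K := V.atiyah ρ) hil hlj h₁ h₂]
      have e : (V.atiyah ρ).ract hil ((0, x) : A.X i × V.X i) a =
          ((V.anchorApply ρ hil x a, 0) : A.X il × V.X il) + (0, V.symAct hil x a) := by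
        change (A.mul hil 0 a + V.anchorApply ρ hil x a, V.symAct hil x a) = _
        rw [map_zero, LinearMap.zero_apply, zero_add, Prod.mk_add_mk, add_zero, zero_add]
      rw [e, map_add, LinearMap.add_apply, map_add, hQ, zero_add]
    let S : V.sym.TensorX M n →ₗ[k]
        (V.atiyah ρ).TensorX M n ⧸ LinearMap.range ((V.hkrIncl ρ M).f n) :=
      DGBimodule.tensorLift (K := V.sym) F hF
    have hS : S.comp (V.hkrProjFun ρ M n) = Q := by
      refine DGBimodule.tensor_hom_ext fun {p q} hpq x m => ?_
      rw [LinearMap.comp_apply, hkrProjFun_tmul]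
      refine (DGBimodule.tensorLift_tmul (K := V.sym) F hF hpq x.2 m).trans ?_
      change Q ((V.atiyah ρ).tmul M hpq (0, x.2) m) = _
      have e : x = (x.1, 0) + (0, x.2) := by
        rw [Prod.mk_add_mk, add_zero, zero_add]
      conv_rhs => rw [e, map_add, LinearMap.add_apply, map_add, hQ, zero_add]
    have hz' : Q z = 0 := by
      rw [← hS, LinearMap.comp_apply]
      exact (congrArg S hz).trans (map_zero S)
    exact (Submodule.Quotient.mk_eq_zero _).1 hz'
  · rintro ⟨m, rfl⟩
    refine (V.hkrProjFun_tmul ρ M _ _ _).trans ?_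
    rw [map_zero, LinearMap.zero_apply]
  · induction z using DGBimodule.tensor_induction with
    | zero => exact ⟨0, map_zero _⟩
    | add x y hx hy =>
      obtain ⟨x', rfl⟩ := hx
      obtain ⟨y', rfl⟩ := hy
      exact ⟨x' + y', map_add _ _ _⟩
    | tmul hpq x m => exact ⟨(V.atiyah ρ).tmul M hpq (0, x) m, V.hkrProjFun_tmul ρ M _ _ _⟩

/-- The HKR class `Θ_M : V[-1] ⊗_A M ⟶ M` in `D(A)`: the class of the extension
`0 → M → Σ_V ⊗_A M → V ⊗_A M → 0`. (`V[-1] ⊗_A M` is identified with `(V ⊗_A M)[-1]`.) -/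
noncomputable def hkrClass (hV : V.IsPerfect) :
    (toDerived A).obj ((V.sym.tensor M).shift (-1)) ⟶ (toDerived A).obj M :=
  extClass (V.hkrIncl ρ M) (V.hkrProj ρ M) (hkr_shortExact ρ M hV)

end DGModule

/-! ### dg-Lie algebroids -/

/-- A `(k, A)` dg-Lie algebroid. -/
structure DGLieAlgebroid (A : CDGA k) extends DGModule A where
  bracket : ∀ {i j n : ℤ}, i + j = n → X i →ₗ[k] X j →ₗ[k] X n
  skew : ∀ {i j n : ℤ} (h : i + j = n) (h' : j + i = n) (x : X i) (y : X j),
    bracket h x y = -(sgn k (i * j) • bracket h' y x)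
  jacobi : ∀ {p q r pq qr pr n : ℤ} (hqr : q + r = qr) (h₁ : p + qr = n) (hpq : p + q = pq)
    (h₂ : pq + r = n) (hpr : p + r = pr) (h₃ : q + pr = n) (x : X p) (y : X q) (z : X r),
    bracket h₁ x (bracket hqr y z) =
      bracket h₂ (bracket hpq x y) z + sgn k (p * q) • bracket h₃ y (bracket hpr x z)
  d_bracket : ∀ {i j n i' j' n' : ℤ} (h : i + j = n) (hi : i + 1 = i') (hj : j + 1 = j')
    (hn : n + 1 = n') (h₁ : i' + j = n') (h₂ : i + j' = n') (x : X i) (y : X j),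
    d hn (bracket h x y) = bracket h₁ (d hi x) y + sgn k i • bracket h₂ x (d hj y)
  /-- the anchor map -/
  anchor : toDGModule ⟶ tangent A
  anchor_bracket : ∀ {i j n : ℤ} (h : i + j = n) (x : X i) (y : X j),
    anchor.f n (bracket h x y) = derBracket h (anchor.f i x) (anchor.f j y)
  bracket_act : ∀ {p q r pq pr qr n : ℤ} (hqr : q + r = qr) (h₁ : p + qr = n) (hpr : p + r = pr)
    (h₂ : q + pr = n) (hpq : p + q = pq) (h₃ : pq + r = n) (x : X p) (a : A.X q) (y : X r),
    bracket h₁ x (act hqr a y) = sgn k (q * p) • act h₂ a (bracket hpr x y) +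
      act h₃ (derApply hpq (anchor.f p x) a) y

/-! ### The free dg-Lie algebroid on an anchored module

It is presented by generators (the elements of `V`) and relations (the axioms of dg-Lie algebroids,
and the requirement that `V ⟶ free(V, ρ)` is a morphism of dg modules compatible with anchors). -/

section Free

variable {A : CDGA k} (V : DGModule A)

/-- Formal expressions of degree `n` in elements of `V`. -/
inductive FreePre : ℤ → Type u
  | of {n : ℤ} (v : V.X n) : FreePre n
  | zero {n : ℤ} : FreePre n
  | add {n : ℤ} (x y : FreePre n) : FreePre n
  | smul {n : ℤ} (c : k) (x : FreePre n) : FreePre n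
  | act {i j n : ℤ} (h : i + j = n) (a : A.X i) (x : FreePre j) : FreePre n
  | d {i j : ℤ} (h : i + 1 = j) (x : FreePre i) : FreePre j
  | bracket {i j n : ℤ} (h : i + j = n) (x : FreePre i) (y : FreePre j) : FreePre n

variable {V} (ρ : V ⟶ tangent A)

/-- The anchor of a formal expression. -/
def FreePre.anchor : ∀ {n : ℤ}, FreePre V n → derivations A n
  | n, .of v => ρ.f n v
  | _, .zero => 0
  | _, .add x y => FreePre.anchor x + FreePre.anchor y
  | _, .smul c x => c • FreePre.anchor x
  | _, .act h a x => derAct h a (FreePre.anchor x)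
  | _, .d h x => (tangent A).d h (FreePre.anchor x)
  | _, .bracket h x y => derBracket h (FreePre.anchor x) (FreePre.anchor y)

/-- The relations defining the free dg-Lie algebroid. -/
inductive FreeRel : ∀ {n : ℤ}, FreePre V n → FreePre V n → Prop
  | refl {n : ℤ} (x : FreePre V n) : FreeRel x x
  | symm {n : ℤ} {x y : FreePre V n} : FreeRel x y → FreeRel y x
  | trans {n : ℤ} {x y z : FreePre V n} : FreeRel x y → FreeRel y z → FreeRel x z
  -- compatibility with the operations
  | add_congr {n : ℤ} {x x' y y' : FreePre V n} :
      FreeRel x x' → FreeRel y y' → FreeRel (.add x y) (.add x' y')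
  | smul_congr {n : ℤ} (c : k) {x x' : FreePre V n} :
      FreeRel x x' → FreeRel (.smul c x) (.smul c x')
  | act_congr {i j n : ℤ} (h : i + j = n) (a : A.X i) {x x' : FreePre V j} :
      FreeRel x x' → FreeRel (.act h a x) (.act h a x')
  | d_congr {i j : ℤ} (h : i + 1 = j) {x x' : FreePre V i} :
      FreeRel x x' → FreeRel (.d h x) (.d h x')
  | bracket_congr {i j n : ℤ} (h : i + j = n) {x x' : FreePre V i} {y y' : FreePre V j} :
      FreeRel x x' → FreeRel y y' → FreeRel (.bracket h x y) (.bracket h x' y')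
  -- `k`-vector spaces
  | add_assoc {n : ℤ} (x y z : FreePre V n) :
      FreeRel (.add (.add x y) z) (.add x (.add y z))
  | add_comm {n : ℤ} (x y : FreePre V n) : FreeRel (.add x y) (.add y x)
  | zero_add {n : ℤ} (x : FreePre V n) : FreeRel (.add .zero x) x
  | neg_add {n : ℤ} (x : FreePre V n) : FreeRel (.add (.smul (-1) x) x) .zero
  | smul_add {n : ℤ} (c : k) (x y : FreePre V n) :
      FreeRel (.smul c (.add x y)) (.add (.smul c x) (.smul c y))
  | add_smul {n : ℤ} (c c' : k) (x : FreePre V n) :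
      FreeRel (.smul (c + c') x) (.add (.smul c x) (.smul c' x))
  | mul_smul {n : ℤ} (c c' : k) (x : FreePre V n) :
      FreeRel (.smul (c * c') x) (.smul c (.smul c' x))
  | one_smul {n : ℤ} (x : FreePre V n) : FreeRel (.smul 1 x) x
  -- dg modules
  | act_add {i j n : ℤ} (h : i + j = n) (a : A.X i) (x y : FreePre V j) :
      FreeRel (.act h a (.add x y)) (.add (.act h a x) (.act h a y))
  | act_smul {i j n : ℤ} (h : i + j = n) (c : k) (a : A.X i) (x : FreePre V j) :
      FreeRel (.act h a (.smul c x)) (.smul c (.act h a x))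
  | add_act {i j n : ℤ} (h : i + j = n) (a b : A.X i) (x : FreePre V j) :
      FreeRel (.act h (a + b) x) (.add (.act h a x) (.act h b x))
  | smul_act {i j n : ℤ} (h : i + j = n) (c : k) (a : A.X i) (x : FreePre V j) :
      FreeRel (.act h (c • a) x) (.smul c (.act h a x))
  | one_act {n : ℤ} (h : 0 + n = n) (x : FreePre V n) : FreeRel (.act h A.one x) x
  | mul_act {i j l ij jl n : ℤ} (hij : i + j = ij) (hjl : j + l = jl) (h₁ : ij + l = n)
      (h₂ : i + jl = n) (a : A.X i) (b : A.X j) (x : FreePre V l) :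
      FreeRel (.act h₁ (A.mul hij a b) x) (.act h₂ a (.act hjl b x))
  | d_add {i j : ℤ} (h : i + 1 = j) (x y : FreePre V i) :
      FreeRel (.d h (.add x y)) (.add (.d h x) (.d h y))
  | d_smul {i j : ℤ} (h : i + 1 = j) (c : k) (x : FreePre V i) :
      FreeRel (.d h (.smul c x)) (.smul c (.d h x))
  | d_d {i j l : ℤ} (h : i + 1 = j) (h' : j + 1 = l) (x : FreePre V i) :
      FreeRel (.d h' (.d h x)) .zero
  | d_act {i j n i' j' n' : ℤ} (h : i + j = n) (hi : i + 1 = i') (hj : j + 1 = j')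
      (hn : n + 1 = n') (h₁ : i' + j = n') (h₂ : i + j' = n') (a : A.X i) (x : FreePre V j) :
      FreeRel (.d hn (.act h a x))
        (.add (.act h₁ (A.d hi a) x) (.smul (sgn k i) (.act h₂ a (.d hj x))))
  -- Lie bracket
  | bracket_add {i j n : ℤ} (h : i + j = n) (x : FreePre V i) (y z : FreePre V j) :
      FreeRel (.bracket h x (.add y z)) (.add (.bracket h x y) (.bracket h x z))
  | bracket_smul {i j n : ℤ} (h : i + j = n) (c : k) (x : FreePre V i) (y : FreePre V j) :
      FreeRel (.bracket h x (.smul c y)) (.smul c (.bracket h x y))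
  | add_bracket {i j n : ℤ} (h : i + j = n) (x y : FreePre V i) (z : FreePre V j) :
      FreeRel (.bracket h (.add x y) z) (.add (.bracket h x z) (.bracket h y z))
  | smul_bracket {i j n : ℤ} (h : i + j = n) (c : k) (x : FreePre V i) (y : FreePre V j) :
      FreeRel (.bracket h (.smul c x) y) (.smul c (.bracket h x y))
  | skew {i j n : ℤ} (h : i + j = n) (h' : j + i = n) (x : FreePre V i) (y : FreePre V j) :
      FreeRel (.bracket h x y) (.smul (-1) (.smul (sgn k (i * j)) (.bracket h' y x)))
  | jacobi {p q r pq qr pr n : ℤ} (hqr : q + r = qr) (h₁ : p + qr = n) (hpq : p + q = pq)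
      (h₂ : pq + r = n) (hpr : p + r = pr) (h₃ : q + pr = n)
      (x : FreePre V p) (y : FreePre V q) (z : FreePre V r) :
      FreeRel (.bracket h₁ x (.bracket hqr y z))
        (.add (.bracket h₂ (.bracket hpq x y) z)
          (.smul (sgn k (p * q)) (.bracket h₃ y (.bracket hpr x z))))
  | d_bracket {i j n i' j' n' : ℤ} (h : i + j = n) (hi : i + 1 = i') (hj : j + 1 = j')
      (hn : n + 1 = n') (h₁ : i' + j = n') (h₂ : i + j' = n')
      (x : FreePre V i) (y : FreePre V j) :
      FreeRel (.d hn (.bracket h x y))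
        (.add (.bracket h₁ (.d hi x) y) (.smul (sgn k i) (.bracket h₂ x (.d hj y))))
  | bracket_act {p q r pq pr qr n : ℤ} (hqr : q + r = qr) (h₁ : p + qr = n) (hpr : p + r = pr)
      (h₂ : q + pr = n) (hpq : p + q = pq) (h₃ : pq + r = n)
      (x : FreePre V p) (a : A.X q) (y : FreePre V r) :
      FreeRel (.bracket h₁ x (.act hqr a y))
        (.add (.smul (sgn k (q * p)) (.act h₂ a (.bracket hpr x y)))
          (.act h₃ (derApply hpq (x.anchor ρ) a) y))
  -- `V` maps to the free algebroid by a morphism of dg modules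
  | of_add {n : ℤ} (v w : V.X n) : FreeRel (.of (v + w)) (.add (.of v) (.of w))
  | of_smul {n : ℤ} (c : k) (v : V.X n) : FreeRel (.of (c • v)) (.smul c (.of v))
  | of_act {i j n : ℤ} (h : i + j = n) (a : A.X i) (v : V.X j) :
      FreeRel (.of (V.act h a v)) (.act h a (.of v))
  | of_d {i j : ℤ} (h : i + 1 = j) (v : V.X i) : FreeRel (.of (V.d h v)) (.d h (.of v))

lemma FreeRel.anchor_eq {n : ℤ} {x y : FreePre V n} (h : FreeRel ρ x y) :
    x.anchor ρ = y.anchor ρ := by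
  induction h with
  | refl => rfl
  | symm _ ih => exact ih.symm
  | trans _ _ ih ih' => exact ih.trans ih'
  | add_congr _ _ ih ih' => simp only [FreePre.anchor, ih, ih']
  | smul_congr _ _ ih => simp only [FreePre.anchor, ih]
  | act_congr _ _ _ ih => simp only [FreePre.anchor, ih]
  | d_congr _ _ ih => simp only [FreePre.anchor, ih]
  | bracket_congr _ _ _ ih ih' => simp only [FreePre.anchor, ih, ih']
  | add_assoc => exact _root_.add_assoc _ _ _
  | add_comm => exact _root_.add_comm _ _
  | zero_add => exact _root_.zero_add _
  | neg_add x =>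
    exact (congrArg (· + FreePre.anchor ρ x) (_root_.neg_one_smul k (FreePre.anchor ρ x))).trans
      (neg_add_cancel _)
  | smul_add => exact _root_.smul_add _ _ _
  | add_smul => exact _root_.add_smul _ _ _
  | mul_smul => exact (smul_smul _ _ _).symm
  | one_smul => exact _root_.one_smul _ _
  | act_add => exact map_add _ _ _
  | act_smul => exact map_smul _ _ _
  | add_act => exact LinearMap.map_add₂ _ _ _ _
  | smul_act => exact LinearMap.map_smul₂ _ _ _ _
  | one_act h x => exact (tangent A).one_act h _
  | mul_act hij hjl h₁ h₂ a b x => exact (tangent A).mul_act hij hjl h₁ h₂ a b _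
  | d_add => exact map_add _ _ _
  | d_smul => exact map_smul _ _ _
  | d_d h h' x => exact (tangent A).d_d h h' _
  | d_act h hi hj hn h₁ h₂ a x => exact (tangent A).d_act h hi hj hn h₁ h₂ a _
  | bracket_add => exact map_add _ _ _
  | bracket_smul => exact map_smul _ _ _
  | add_bracket => exact LinearMap.map_add₂ _ _ _ _
  | smul_bracket => exact LinearMap.map_smul₂ _ _ _ _
  | skew h h' x y =>
    exact (derBracket_skew h h' _ _).trans (_root_.neg_one_smul k (_ : derivations A _)).symm
  | jacobi hqr h₁ hpq h₂ hpr h₃ x y z => exact derBracket_jacobi hqr h₁ hpq h₂ hpr h₃ _ _ _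
  | d_bracket h hi hj hn h₁ h₂ x y =>
    exact derBracket_derD_derBracket h (by omega) (by omega) (by omega) h₁ h₂ _ _
  | bracket_act hqr h₁ hpr h₂ hpq h₃ x a y =>
    exact derBracket_derAct hqr h₁ hpr h₂ hpq h₃ _ a _
  | of_add v w => exact map_add _ _ _
  | of_smul c v => exact map_smul _ _ _
  | of_act h a v => exact ρ.map_act h a v
  | of_d h v => exact ρ.map_d h v

/-- The equivalence relation defining `free(V, ρ)` in degree `n`. -/
def freeSetoid (n : ℤ) : Setoid (FreePre V n) where
  r := FreeRel ρ
  iseqv := ⟨.refl, .symm, .trans⟩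

/-- Degree `n` of `free(V, ρ)`. -/
def FreeX (n : ℤ) : Type u := Quotient (freeSetoid ρ n)

/-- The class of a formal expression. -/
def FreeX.mk {n : ℤ} (x : FreePre V n) : FreeX ρ n := Quotient.mk (freeSetoid ρ n) x

variable {ρ}

lemma FreeX.sound {n : ℤ} {x y : FreePre V n} (h : FreeRel ρ x y) :
    FreeX.mk ρ x = FreeX.mk ρ y := Quotient.sound (s := freeSetoid ρ n) h

lemma FreeX.ind {n : ℤ} {P : FreeX ρ n → Prop} (h : ∀ x, P (FreeX.mk ρ x)) (x : FreeX ρ n) : P x :=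
  Quotient.ind (s := freeSetoid ρ n) h x

variable (ρ)

instance (n : ℤ) : Add (FreeX ρ n) where
  add := Quotient.map₂ (sa := freeSetoid ρ n) (sb := freeSetoid ρ n) (sc := freeSetoid ρ n)
    .add fun _ _ h _ _ h' => .add_congr h h'

instance (n : ℤ) : Zero (FreeX ρ n) where
  zero := FreeX.mk ρ .zero

instance (n : ℤ) : Neg (FreeX ρ n) where
  neg := Quotient.map (sa := freeSetoid ρ n) (sb := freeSetoid ρ n) (.smul (-1))
    fun _ _ h => .smul_congr _ h

instance (n : ℤ) : AddCommGroup (FreeX ρ n) where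
  add_assoc x y z := by
    induction x using FreeX.ind; induction y using FreeX.ind; induction z using FreeX.ind
    exact FreeX.sound (.add_assoc _ _ _)
  add_comm x y := by
    induction x using FreeX.ind; induction y using FreeX.ind
    exact FreeX.sound (.add_comm _ _)
  zero_add x := by
    induction x using FreeX.ind
    exact FreeX.sound (.zero_add _)
  add_zero x := by
    induction x using FreeX.ind
    exact FreeX.sound (.trans (.add_comm _ _) (.zero_add _))
  neg_add_cancel x := by
    induction x using FreeX.ind
    exact FreeX.sound (.neg_add _)
  nsmul := nsmulRec
  zsmul := zsmulRec

instance (n : ℤ) : SMul k (FreeX ρ n) where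
  smul c := Quotient.map (sa := freeSetoid ρ n) (sb := freeSetoid ρ n) (.smul c)
    fun _ _ h => .smul_congr c h

instance (n : ℤ) : Module k (FreeX ρ n) :=
  Module.ofMinimalAxioms
    (fun c x y => by
      induction x using FreeX.ind; induction y using FreeX.ind
      exact FreeX.sound (.smul_add _ _ _))
    (fun c c' x => by
      induction x using FreeX.ind
      exact FreeX.sound (.add_smul _ _ _))
    (fun c c' x => by
      induction x using FreeX.ind
      exact FreeX.sound (.mul_smul _ _ _))
    (fun x => by
      induction x using FreeX.ind
      exact FreeX.sound (.one_smul _))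

/-- The underlying dg module of `free(V, ρ)`. -/
def freeModule : DGModule A where
  X := FreeX ρ
  act h := LinearMap.mk₂ k
    (fun a => Quotient.map (sa := freeSetoid ρ _) (sb := freeSetoid ρ _) (.act h a)
      fun _ _ e => .act_congr h a e)
    (fun a b x => by induction x using FreeX.ind; exact FreeX.sound (.add_act h a b _))
    (fun c a x => by induction x using FreeX.ind; exact FreeX.sound (.smul_act h c a _))
    (fun a x y => by
      induction x using FreeX.ind; induction y using FreeX.ind
      exact FreeX.sound (.act_add h a _ _))
    (fun c a x => by induction x using FreeX.ind; exact FreeX.sound (.act_smul h c a _))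
  d h :=
    { toFun := Quotient.map (sa := freeSetoid ρ _) (sb := freeSetoid ρ _) (.d h)
        fun _ _ e => .d_congr h e
      map_add' := fun x y => by
        induction x using FreeX.ind; induction y using FreeX.ind
        exact FreeX.sound (.d_add h _ _)
      map_smul' := fun c x => by
        induction x using FreeX.ind
        exact FreeX.sound (.d_smul h c _) }
  one_act h x := by induction x using FreeX.ind; exact FreeX.sound (.one_act h _)
  mul_act hij hjl h₁ h₂ a b x := by
    induction x using FreeX.ind; exact FreeX.sound (.mul_act hij hjl h₁ h₂ a b _)
  d_d h h' x := by induction x using FreeX.ind; exact FreeX.sound (.d_d h h' _)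
  d_act h hi hj hn h₁ h₂ a x := by
    induction x using FreeX.ind; exact FreeX.sound (.d_act h hi hj hn h₁ h₂ a _)

/-- The anchor of `free(V, ρ)`. -/
def freeAnchor : freeModule ρ ⟶ tangent A where
  f n :=
    { toFun := Quotient.lift (s := freeSetoid ρ n) (FreePre.anchor ρ) fun _ _ h => h.anchor_eq ρ
      map_add' := fun x y => by
        induction x using FreeX.ind; induction y using FreeX.ind; rfl
      map_smul' := fun c x => by induction x using FreeX.ind; rfl }
  map_act h a x := by induction x using FreeX.ind; rfl
  map_d h x := by induction x using FreeX.ind; rfl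

/-- The free dg-Lie algebroid `free(V, ρ)`. -/
def free : DGLieAlgebroid A where
  toDGModule := freeModule ρ
  bracket h := LinearMap.mk₂ k
    (Quotient.map₂ (sa := freeSetoid ρ _) (sb := freeSetoid ρ _) (sc := freeSetoid ρ _)
      (.bracket h) fun _ _ e _ _ e' => .bracket_congr h e e')
    (fun x y z => by
      induction x using FreeX.ind; induction y using FreeX.ind; induction z using FreeX.ind
      exact FreeX.sound (.add_bracket h _ _ _))
    (fun c x y => by
      induction x using FreeX.ind; induction y using FreeX.ind
      exact FreeX.sound (.smul_bracket h c _ _))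
    (fun x y z => by
      induction x using FreeX.ind; induction y using FreeX.ind; induction z using FreeX.ind
      exact FreeX.sound (.bracket_add h _ _ _))
    (fun c x y => by
      induction x using FreeX.ind; induction y using FreeX.ind
      exact FreeX.sound (.bracket_smul h c _ _))
  skew h h' x y := by
    induction x using FreeX.ind; induction y using FreeX.ind
    exact FreeX.sound (.skew h h' _ _)
  jacobi hqr h₁ hpq h₂ hpr h₃ x y z := by
    induction x using FreeX.ind; induction y using FreeX.ind; induction z using FreeX.ind
    exact FreeX.sound (.jacobi hqr h₁ hpq h₂ hpr h₃ _ _ _)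
  d_bracket h hi hj hn h₁ h₂ x y := by
    induction x using FreeX.ind; induction y using FreeX.ind
    exact FreeX.sound (.d_bracket h hi hj hn h₁ h₂ _ _)
  anchor := freeAnchor ρ
  anchor_bracket h x y := by
    induction x using FreeX.ind; induction y using FreeX.ind; rfl
  bracket_act hqr h₁ hpr h₂ hpq h₃ x a y := by
    induction x using FreeX.ind; induction y using FreeX.ind
    exact FreeX.sound (.bracket_act hqr h₁ hpr h₂ hpq h₃ _ a _)

/-- The canonical map `V ⟶ free(V, ρ)`. -/
def freeOf : V ⟶ (free ρ).toDGModule where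
  f _ :=
    { toFun := fun v => FreeX.mk ρ (.of v)
      map_add' := fun v w => FreeX.sound (.of_add v w)
      map_smul' := fun c v => FreeX.sound (.of_smul c v) }
  map_act h a v := FreeX.sound (.of_act h a v)
  map_d h v := FreeX.sound (.of_d h v)

end Free

/-! ### The universal enveloping algebra of a dg-Lie algebroid

`U_{k/A}(L) = U⁺(A ⊕ L)/P` is the dg algebra generated by `A` and `L`, with the relations
`[a, b] = 0`, `[ℓ, a] = ρ(ℓ)(a)`, `ℓ ℓ' - (-1)^{|ℓ||ℓ'|} ℓ' ℓ = [ℓ, ℓ']` of `A ⊕ L`, and with the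
relations of `P`: the product of `a` and an element of `A ⊕ L` is their product in `A ⊕ L`
(so that `1 ∈ A` is a unit). -/

section Envelope

variable {A : CDGA k} (L : DGLieAlgebroid A)

/-- Formal expressions of degree `n` in elements of `A` and `L`. -/
inductive EnvPre : ℤ → Type u
  | ofA {n : ℤ} (a : A.X n) : EnvPre n
  | ofL {n : ℤ} (x : L.X n) : EnvPre n
  | zero {n : ℤ} : EnvPre n
  | add {n : ℤ} (x y : EnvPre n) : EnvPre n
  | smul {n : ℤ} (c : k) (x : EnvPre n) : EnvPre n
  | mul {i j n : ℤ} (h : i + j = n) (x : EnvPre i) (y : EnvPre j) : EnvPre n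
  | d {i j : ℤ} (h : i + 1 = j) (x : EnvPre i) : EnvPre j

/-- The relations defining the universal enveloping algebra. -/
inductive EnvRel : ∀ {n : ℤ}, EnvPre L n → EnvPre L n → Prop
  | refl {n : ℤ} (x : EnvPre L n) : EnvRel x x
  | symm {n : ℤ} {x y : EnvPre L n} : EnvRel x y → EnvRel y x
  | trans {n : ℤ} {x y z : EnvPre L n} : EnvRel x y → EnvRel y z → EnvRel x z
  -- compatibility with the operations
  | add_congr {n : ℤ} {x x' y y' : EnvPre L n} :
      EnvRel x x' → EnvRel y y' → EnvRel (.add x y) (.add x' y')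
  | smul_congr {n : ℤ} (c : k) {x x' : EnvPre L n} :
      EnvRel x x' → EnvRel (.smul c x) (.smul c x')
  | mul_congr {i j n : ℤ} (h : i + j = n) {x x' : EnvPre L i} {y y' : EnvPre L j} :
      EnvRel x x' → EnvRel y y' → EnvRel (.mul h x y) (.mul h x' y')
  | d_congr {i j : ℤ} (h : i + 1 = j) {x x' : EnvPre L i} :
      EnvRel x x' → EnvRel (.d h x) (.d h x')
  -- `k`-vector spaces
  | add_assoc {n : ℤ} (x y z : EnvPre L n) :
      EnvRel (.add (.add x y) z) (.add x (.add y z))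
  | add_comm {n : ℤ} (x y : EnvPre L n) : EnvRel (.add x y) (.add y x)
  | zero_add {n : ℤ} (x : EnvPre L n) : EnvRel (.add .zero x) x
  | neg_add {n : ℤ} (x : EnvPre L n) : EnvRel (.add (.smul (-1) x) x) .zero
  | smul_add {n : ℤ} (c : k) (x y : EnvPre L n) :
      EnvRel (.smul c (.add x y)) (.add (.smul c x) (.smul c y))
  | add_smul {n : ℤ} (c c' : k) (x : EnvPre L n) :
      EnvRel (.smul (c + c') x) (.add (.smul c x) (.smul c' x))
  | mul_smul {n : ℤ} (c c' : k) (x : EnvPre L n) :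
      EnvRel (.smul (c * c') x) (.smul c (.smul c' x))
  | one_smul {n : ℤ} (x : EnvPre L n) : EnvRel (.smul 1 x) x
  -- dg algebras
  | add_mul {i j n : ℤ} (h : i + j = n) (x y : EnvPre L i) (z : EnvPre L j) :
      EnvRel (.mul h (.add x y) z) (.add (.mul h x z) (.mul h y z))
  | smul_mul {i j n : ℤ} (h : i + j = n) (c : k) (x : EnvPre L i) (y : EnvPre L j) :
      EnvRel (.mul h (.smul c x) y) (.smul c (.mul h x y))
  | mul_add {i j n : ℤ} (h : i + j = n) (x : EnvPre L i) (y z : EnvPre L j) :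
      EnvRel (.mul h x (.add y z)) (.add (.mul h x y) (.mul h x z))
  | mul_smul' {i j n : ℤ} (h : i + j = n) (c : k) (x : EnvPre L i) (y : EnvPre L j) :
      EnvRel (.mul h x (.smul c y)) (.smul c (.mul h x y))
  | mul_assoc {i j l ij jl n : ℤ} (hij : i + j = ij) (hjl : j + l = jl) (h₁ : ij + l = n)
      (h₂ : i + jl = n) (x : EnvPre L i) (y : EnvPre L j) (z : EnvPre L l) :
      EnvRel (.mul h₁ (.mul hij x y) z) (.mul h₂ x (.mul hjl y z))
  | one_mul {n : ℤ} (h : 0 + n = n) (x : EnvPre L n) : EnvRel (.mul h (.ofA A.one) x) x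
  | mul_one {n : ℤ} (h : n + 0 = n) (x : EnvPre L n) : EnvRel (.mul h x (.ofA A.one)) x
  | d_add {i j : ℤ} (h : i + 1 = j) (x y : EnvPre L i) :
      EnvRel (.d h (.add x y)) (.add (.d h x) (.d h y))
  | d_smul {i j : ℤ} (h : i + 1 = j) (c : k) (x : EnvPre L i) :
      EnvRel (.d h (.smul c x)) (.smul c (.d h x))
  | d_d {i j l : ℤ} (h : i + 1 = j) (h' : j + 1 = l) (x : EnvPre L i) :
      EnvRel (.d h' (.d h x)) .zero
  | d_mul {i j n i' j' n' : ℤ} (h : i + j = n) (hi : i + 1 = i') (hj : j + 1 = j')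
      (hn : n + 1 = n') (h₁ : i' + j = n') (h₂ : i + j' = n') (x : EnvPre L i) (y : EnvPre L j) :
      EnvRel (.d hn (.mul h x y))
        (.add (.mul h₁ (.d hi x) y) (.smul (sgn k i) (.mul h₂ x (.d hj y))))
  -- `A` maps to the enveloping algebra by a morphism of dg algebras
  | ofA_add {n : ℤ} (a b : A.X n) : EnvRel (.ofA (a + b)) (.add (.ofA a) (.ofA b))
  | ofA_smul {n : ℤ} (c : k) (a : A.X n) : EnvRel (.ofA (c • a)) (.smul c (.ofA a))
  | ofA_mul {i j n : ℤ} (h : i + j = n) (a : A.X i) (b : A.X j) :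
      EnvRel (.ofA (A.mul h a b)) (.mul h (.ofA a) (.ofA b))
  | ofA_d {i j : ℤ} (h : i + 1 = j) (a : A.X i) : EnvRel (.ofA (A.d h a)) (.d h (.ofA a))
  -- `L` maps to the enveloping algebra by a morphism of dg modules
  | ofL_add {n : ℤ} (x y : L.X n) : EnvRel (.ofL (x + y)) (.add (.ofL x) (.ofL y))
  | ofL_smul {n : ℤ} (c : k) (x : L.X n) : EnvRel (.ofL (c • x)) (.smul c (.ofL x))
  | ofL_act {i j n : ℤ} (h : i + j = n) (a : A.X i) (x : L.X j) :
      EnvRel (.ofL (L.act h a x)) (.mul h (.ofA a) (.ofL x))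
  | ofL_d {i j : ℤ} (h : i + 1 = j) (x : L.X i) : EnvRel (.ofL (L.d h x)) (.d h (.ofL x))
  -- commutation relations
  | ofL_ofL {i j n : ℤ} (h : i + j = n) (h' : j + i = n) (x : L.X i) (y : L.X j) :
      EnvRel (.mul h (.ofL x) (.ofL y))
        (.add (.smul (sgn k (i * j)) (.mul h' (.ofL y) (.ofL x))) (.ofL (L.bracket h x y)))
  | ofL_ofA {i j n : ℤ} (h : i + j = n) (h' : j + i = n) (x : L.X i) (a : A.X j) :
      EnvRel (.mul h (.ofL x) (.ofA a))
        (.add (.smul (sgn k (i * j)) (.mul h' (.ofA a) (.ofL x)))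
          (.ofA (derApply h (L.anchor.f i x) a)))

/-- The equivalence relation defining `U_{k/A}(L)` in degree `n`. -/
def envSetoid (n : ℤ) : Setoid (EnvPre L n) where
  r := EnvRel L
  iseqv := ⟨.refl, .symm, .trans⟩

/-- Degree `n` of `U_{k/A}(L)`. -/
def EnvX (n : ℤ) : Type u := Quotient (envSetoid L n)

/-- The class of a formal expression. -/
def EnvX.mk {n : ℤ} (x : EnvPre L n) : EnvX L n := Quotient.mk (envSetoid L n) x

variable {L}

lemma EnvX.sound {n : ℤ} {x y : EnvPre L n} (h : EnvRel L x y) :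
    EnvX.mk L x = EnvX.mk L y := Quotient.sound (s := envSetoid L n) h

lemma EnvX.ind {n : ℤ} {P : EnvX L n → Prop} (h : ∀ x, P (EnvX.mk L x)) (x : EnvX L n) : P x :=
  Quotient.ind (s := envSetoid L n) h x

variable (L)

instance (n : ℤ) : Add (EnvX L n) where
  add := Quotient.map₂ (sa := envSetoid L n) (sb := envSetoid L n) (sc := envSetoid L n)
    .add fun _ _ h _ _ h' => .add_congr h h'

instance (n : ℤ) : Zero (EnvX L n) where
  zero := EnvX.mk L .zero

instance (n : ℤ) : Neg (EnvX L n) where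
  neg := Quotient.map (sa := envSetoid L n) (sb := envSetoid L n) (.smul (-1))
    fun _ _ h => .smul_congr _ h

instance (n : ℤ) : AddCommGroup (EnvX L n) where
  add_assoc x y z := by
    induction x using EnvX.ind; induction y using EnvX.ind; induction z using EnvX.ind
    exact EnvX.sound (.add_assoc _ _ _)
  add_comm x y := by
    induction x using EnvX.ind; induction y using EnvX.ind
    exact EnvX.sound (.add_comm _ _)
  zero_add x := by
    induction x using EnvX.ind
    exact EnvX.sound (.zero_add _)
  add_zero x := by
    induction x using EnvX.ind
    exact EnvX.sound (.trans (.add_comm _ _) (.zero_add _))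
  neg_add_cancel x := by
    induction x using EnvX.ind
    exact EnvX.sound (.neg_add _)
  nsmul := nsmulRec
  zsmul := zsmulRec

instance (n : ℤ) : SMul k (EnvX L n) where
  smul c := Quotient.map (sa := envSetoid L n) (sb := envSetoid L n) (.smul c)
    fun _ _ h => .smul_congr c h

instance (n : ℤ) : Module k (EnvX L n) :=
  Module.ofMinimalAxioms
    (fun c x y => by
      induction x using EnvX.ind; induction y using EnvX.ind
      exact EnvX.sound (.smul_add _ _ _))
    (fun c c' x => by
      induction x using EnvX.ind
      exact EnvX.sound (.add_smul _ _ _))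
    (fun c c' x => by
      induction x using EnvX.ind
      exact EnvX.sound (.mul_smul _ _ _))
    (fun x => by
      induction x using EnvX.ind
      exact EnvX.sound (.one_smul _))

/-- The map `A ⟶ U_{k/A}(L)`. -/
def envA (n : ℤ) : A.X n →ₗ[k] EnvX L n where
  toFun a := EnvX.mk L (.ofA a)
  map_add' a b := EnvX.sound (.ofA_add a b)
  map_smul' c a := EnvX.sound (.ofA_smul c a)

/-- The map `L ⟶ U_{k/A}(L)`. -/
def envL (n : ℤ) : L.X n →ₗ[k] EnvX L n where
  toFun x := EnvX.mk L (.ofL x)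
  map_add' x y := EnvX.sound (.ofL_add x y)
  map_smul' c x := EnvX.sound (.ofL_smul c x)

/-- The product of `U_{k/A}(L)`. -/
def envMul {i j n : ℤ} (h : i + j = n) : EnvX L i →ₗ[k] EnvX L j →ₗ[k] EnvX L n :=
  LinearMap.mk₂ k
    (Quotient.map₂ (sa := envSetoid L _) (sb := envSetoid L _) (sc := envSetoid L _)
      (.mul h) fun _ _ e _ _ e' => .mul_congr h e e')
    (fun x y z => by
      induction x using EnvX.ind; induction y using EnvX.ind; induction z using EnvX.ind
      exact EnvX.sound (.add_mul h _ _ _))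
    (fun c x y => by
      induction x using EnvX.ind; induction y using EnvX.ind
      exact EnvX.sound (.smul_mul h c _ _))
    (fun x y z => by
      induction x using EnvX.ind; induction y using EnvX.ind; induction z using EnvX.ind
      exact EnvX.sound (.mul_add h _ _ _))
    (fun c x y => by
      induction x using EnvX.ind; induction y using EnvX.ind
      exact EnvX.sound (.mul_smul' h c _ _))

/-- The differential of `U_{k/A}(L)`. -/
def envD {i j : ℤ} (h : i + 1 = j) : EnvX L i →ₗ[k] EnvX L j where
  toFun := Quotient.map (sa := envSetoid L _) (sb := envSetoid L _) (.d h)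
    fun _ _ e => .d_congr h e
  map_add' x y := by
    induction x using EnvX.ind; induction y using EnvX.ind
    exact EnvX.sound (.d_add h _ _)
  map_smul' c x := by
    induction x using EnvX.ind
    exact EnvX.sound (.d_smul h c _)

lemma envMul_assoc {i j l ij jl n : ℤ} (hij : i + j = ij) (hjl : j + l = jl) (h₁ : ij + l = n)
    (h₂ : i + jl = n) (x : EnvX L i) (y : EnvX L j) (z : EnvX L l) :
    envMul L h₁ (envMul L hij x y) z = envMul L h₂ x (envMul L hjl y z) := by
  induction x using EnvX.ind; induction y using EnvX.ind; induction z using EnvX.ind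
  exact EnvX.sound (.mul_assoc hij hjl h₁ h₂ _ _ _)

lemma envMul_one {n : ℤ} (h : n + 0 = n) (x : EnvX L n) :
    envMul L h x (envA L 0 A.one) = x := by
  induction x using EnvX.ind; exact EnvX.sound (.mul_one h _)

lemma one_envMul {n : ℤ} (h : 0 + n = n) (x : EnvX L n) :
    envMul L h (envA L 0 A.one) x = x := by
  induction x using EnvX.ind; exact EnvX.sound (.one_mul h _)

lemma envA_mul {i j n : ℤ} (h : i + j = n) (a : A.X i) (b : A.X j) :
    envA L n (A.mul h a b) = envMul L h (envA L i a) (envA L j b) :=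
  EnvX.sound (.ofA_mul h a b)

lemma envA_d {i j : ℤ} (h : i + 1 = j) (a : A.X i) :
    envA L j (A.d h a) = envD L h (envA L i a) := EnvX.sound (.ofA_d h a)

lemma envL_act {i j n : ℤ} (h : i + j = n) (a : A.X i) (x : L.X j) :
    envL L n (L.act h a x) = envMul L h (envA L i a) (envL L j x) :=
  EnvX.sound (.ofL_act h a x)

lemma envL_d {i j : ℤ} (h : i + 1 = j) (x : L.X i) :
    envL L j (L.d h x) = envD L h (envL L i x) := EnvX.sound (.ofL_d h x)

lemma envD_mul {i j n i' j' n' : ℤ} (h : i + j = n) (hi : i + 1 = i') (hj : j + 1 = j')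
    (hn : n + 1 = n') (h₁ : i' + j = n') (h₂ : i + j' = n') (x : EnvX L i) (y : EnvX L j) :
    envD L hn (envMul L h x y) =
      envMul L h₁ (envD L hi x) y + sgn k i • envMul L h₂ x (envD L hj y) := by
  induction x using EnvX.ind; induction y using EnvX.ind
  exact EnvX.sound (.d_mul h hi hj hn h₁ h₂ _ _)

/-- The universal enveloping algebra `U_{k/A}(L)`, as a dg bimodule over `A`. -/
abbrev envelope : DGBimodule A where
  X := EnvX L
  act {i _ _} h := (envMul L h).comp (envA L i)
  d := envD L
  one_act h x := one_envMul L h x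
  mul_act hij hjl h₁ h₂ a b x := by
    simp only [LinearMap.comp_apply]
    rw [envA_mul, envMul_assoc]
  d_d h h' x := by induction x using EnvX.ind; exact EnvX.sound (.d_d h h' _)
  d_act h hi hj hn h₁ h₂ a x := by
    simp only [LinearMap.comp_apply]
    rw [envD_mul L h hi hj hn h₁ h₂, envA_d]
  ract {_ j _} h := (envMul L h).compl₂ (envA L j)
  ract_one h x := envMul_one L h x
  ract_mul hij hjl h₁ h₂ x a b := by
    simp only [LinearMap.compl₂_apply]
    rw [envA_mul, envMul_assoc]
  act_ract hij hjl h₁ h₂ a x b := by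
    simp only [LinearMap.compl₂_apply, LinearMap.comp_apply]
    rw [envMul_assoc]
  d_ract h hi hj hn h₁ h₂ x a := by
    simp only [LinearMap.compl₂_apply]
    rw [envD_mul L h hi hj hn h₁ h₂, envA_d]

end Envelope

/-! ### Filtrations -/

/-- A dg submodule. -/
structure DGSubmodule {A : CDGA k} (M : DGModule A) where
  carrier : ∀ n, Submodule k (M.X n)
  act_mem : ∀ {i j n : ℤ} (h : i + j = n) (a : A.X i) {x : M.X j}, x ∈ carrier j →
    M.act h a x ∈ carrier n
  d_mem : ∀ {i j : ℤ} (h : i + 1 = j) {x : M.X i}, x ∈ carrier i → M.d h x ∈ carrier j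

namespace DGSubmodule

variable {A : CDGA k} {M : DGModule A}

/-- A dg submodule is a dg module. -/
abbrev toDGModule (N : DGSubmodule M) : DGModule A where
  X n := N.carrier n
  act h := LinearMap.mk₂ k (fun a x => ⟨M.act h a x, N.act_mem h a x.2⟩)
    (fun a b x => by ext; simp) (fun c a x => by ext; simp)
    (fun a x y => by ext; simp) (fun c a x => by ext; simp)
  d h := (M.d h).restrict fun _ hx => N.d_mem h hx
  one_act h x := by ext; exact M.one_act h _
  mul_act hij hjl h₁ h₂ a b x := by ext; exact M.mul_act hij hjl h₁ h₂ a b _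
  d_d h h' x := by ext; exact M.d_d h h' _
  d_act h hi hj hn h₁ h₂ a x := by ext; exact M.d_act h hi hj hn h₁ h₂ a _

/-- The zero submodule. -/
def zero (M : DGModule A) : DGSubmodule M where
  carrier _ := ⊥
  act_mem h a x hx := by
    rw [Submodule.mem_bot] at hx ⊢
    rw [hx, map_zero]
  d_mem h x hx := by
    rw [Submodule.mem_bot] at hx ⊢
    rw [hx, map_zero]

/-- The intersection `N ∩ P`, as a submodule of `P`. -/
def restrict (N P : DGSubmodule M) : DGSubmodule P.toDGModule where
  carrier n := (N.carrier n).comap (P.carrier n).subtype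
  act_mem h a _ hx := N.act_mem h a hx
  d_mem h _ hx := N.d_mem h hx

/-- The quotient `M / N`. -/
abbrev quotient (N : DGSubmodule M) : DGModule A where
  X n := M.X n ⧸ N.carrier n
  act {_ j n} h :=
    { toFun := fun a => (N.carrier j).mapQ (N.carrier n) (M.act h a) fun _ hx => N.act_mem h a hx
      map_add' := fun a b => by ext; simp
      map_smul' := fun c a => by ext; simp }
  d {i j} h := (N.carrier i).mapQ (N.carrier j) (M.d h) fun _ hx => N.d_mem h hx
  one_act h x := by
    induction x using Submodule.Quotient.induction_on with | _ x =>
    exact congrArg _ (M.one_act h x)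
  mul_act hij hjl h₁ h₂ a b x := by
    induction x using Submodule.Quotient.induction_on with | _ x =>
    exact congrArg _ (M.mul_act hij hjl h₁ h₂ a b x)
  d_d h h' x := by
    induction x using Submodule.Quotient.induction_on with | _ x =>
    exact congrArg _ (M.d_d h h' x)
  d_act h hi hj hn h₁ h₂ a x := by
    induction x using Submodule.Quotient.induction_on with | _ x =>
    exact congrArg (N.carrier _).mkQ (M.d_act h hi hj hn h₁ h₂ a x)

/-- The projection `M ⟶ M / N`. -/
def proj (N : DGSubmodule M) : M ⟶ N.quotient where
  f n := (N.carrier n).mkQ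
  map_act _ _ _ := rfl
  map_d _ _ := rfl

end DGSubmodule

/-- An increasing filtration `F⁰ ⊆ F¹ ⊆ F² ⊆ ⋯` by dg submodules. -/
structure Filtration {A : CDGA k} (M : DGModule A) where
  F : ℕ → DGSubmodule M
  mono : ∀ p n, (F p).carrier n ≤ (F (p + 1)).carrier n

namespace Filtration

variable {A : CDGA k} {M : DGModule A} (Φ : Filtration M)

/-- `F^{p-1}`, with `F^{-1} = 0`. -/
def prev : ℕ → DGSubmodule M
  | 0 => .zero M
  | p + 1 => Φ.F p

/-- The graded piece `Gr^p = F^p / F^{p-1}`. -/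
def gr (p : ℕ) : DGModule A := ((Φ.prev p).restrict (Φ.F p)).quotient

/-- The projection `F^p ⟶ Gr^p`. -/
def grProj (p : ℕ) : (Φ.F p).toDGModule ⟶ Φ.gr p := ((Φ.prev p).restrict (Φ.F p)).proj

/-- The filtration splits in `D(A)`: every projection `F^p ⟶ Gr^p` has a section in `D(A)`. -/
def Splits : Prop :=
  ∀ p, ∃ s : (toDerived A).obj (Φ.gr p) ⟶ (toDerived A).obj (Φ.F p).toDGModule,
    s ≫ (toDerived A).map (Φ.grProj p) = 𝟙 _

/-- The filtration induced on `F^q`. -/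
def restrict (q : ℕ) : Filtration (Φ.F q).toDGModule where
  F p := (Φ.F p).restrict (Φ.F q)
  mono p n _ hx := Φ.mono p n hx

end Filtration

/-! ### The filtration on `M_V = U_{k/A}(free(V, ρ)) ⊗_A M` -/

section Main

variable {A : CDGA k} {V : DGModule A} (ρ : V ⟶ tangent A)

/-- The map `V ⟶ U_{k/A}(free(V, ρ))`. -/
def envV (n : ℤ) : V.X n →ₗ[k] EnvX (free ρ) n := (envL (free ρ) n).comp ((freeOf ρ).f n)

lemma envV_act {i j n : ℤ} (h : i + j = n) (a : A.X i) (v : V.X j) :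
    envV ρ n (V.act h a v) = envMul (free ρ) h (envA (free ρ) i a) (envV ρ j v) := by
  refine Eq.trans ?_ (envL_act (free ρ) h a ((freeOf ρ).f j v))
  exact congrArg (envL (free ρ) n) ((freeOf ρ).map_act h a v)

lemma envV_d {i j : ℤ} (h : i + 1 = j) (v : V.X i) :
    envV ρ j (V.d h v) = envD (free ρ) h (envV ρ i v) := by
  refine Eq.trans ?_ (envL_d (free ρ) h ((freeOf ρ).f i v))
  exact congrArg (envL (free ρ) j) ((freeOf ρ).map_d h v)

/-- The filtration of `U_{k/A}(free(V, ρ))`: `F^p` is the image of `Σ_V ⊗ ⋯ ⊗ Σ_V` (`p` factors),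
that is, `F⁰ = A` and `F^{p+1}` is spanned by the products `(a + v) y` with `a ∈ A`, `v ∈ V`,
`y ∈ F^p`. -/
def envFil : ℕ → ∀ n : ℤ, Submodule k (EnvX (free ρ) n)
  | 0, n => LinearMap.range (envA (free ρ) n)
  | p + 1, n => Submodule.span k {z | ∃ (i j : ℤ) (h : i + j = n) (a : A.X i) (v : V.X i)
      (y : EnvX (free ρ) j), y ∈ envFil p j ∧
        z = envMul (free ρ) h (envA (free ρ) i a + envV ρ i v) y}

lemma envFil_mono (p : ℕ) (n : ℤ) : envFil ρ p n ≤ envFil ρ (p + 1) n := by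
  intro y hy
  refine Submodule.subset_span ⟨0, n, zero_add n, A.one, 0, y, hy, ?_⟩
  rw [map_zero, add_zero, one_envMul]

lemma envFil_act (p : ℕ) {i j n : ℤ} (h : i + j = n) (a : A.X i) {y : EnvX (free ρ) j}
    (hy : y ∈ envFil ρ p j) : envMul (free ρ) h (envA (free ρ) i a) y ∈ envFil ρ p n := by
  cases p with
  | zero =>
    obtain ⟨b, rfl⟩ := hy
    exact ⟨A.mul h a b, envA_mul _ _ _ _⟩
  | succ p =>
    induction hy using Submodule.span_induction with
    | zero => rw [map_zero]; exact zero_mem _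
    | add x y _ _ hx hy => rw [map_add]; exact add_mem hx hy
    | smul c x _ hx => rw [map_smul]; exact Submodule.smul_mem _ _ hx
    | mem x hx =>
      obtain ⟨q, r, hqr, b, v, y, hy, rfl⟩ := hx
      refine Submodule.subset_span ⟨i + q, r, by omega, A.mul rfl a b, V.act rfl a v, y, hy, ?_⟩
      rw [envA_mul, envV_act, ← map_add, envMul_assoc]

lemma envFil_d (p : ℕ) : ∀ {i j : ℤ} (h : i + 1 = j) {y : EnvX (free ρ) i},
    y ∈ envFil ρ p i → envD (free ρ) h y ∈ envFil ρ p j := by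
  induction p with
  | zero =>
    rintro i j h _ ⟨b, rfl⟩
    exact ⟨A.d h b, envA_d _ _ _⟩
  | succ p ih =>
    intro i j h y hy
    induction hy using Submodule.span_induction with
    | zero => rw [map_zero]; exact zero_mem _
    | add x y _ _ hx hy => rw [map_add]; exact add_mem hx hy
    | smul c x _ hx => rw [map_smul]; exact Submodule.smul_mem _ _ hx
    | mem x hx =>
      obtain ⟨q, r, hqr, b, v, y, hy, rfl⟩ := hx
      rw [envD_mul _ hqr rfl rfl h (by omega) (by omega), map_add, ← envA_d, ← envV_d]
      refine add_mem (Submodule.subset_span ⟨q + 1, r, by omega, _, _, y, hy, rfl⟩)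
        (Submodule.smul_mem _ _ (Submodule.subset_span ⟨q, r + 1, by omega, b, v, _, ih rfl hy, rfl⟩))

variable (M : DGModule A)

/-- The dg module `M_V = U_{k/A}(free(V, ρ)) ⊗_A M`. -/
noncomputable abbrev envTensor : DGModule A := (envelope (free ρ)).tensor M

/-- `F^p M_V` is the image of `F^p U ⊗ M`. -/
noncomputable def envTensorFil (p : ℕ) : DGSubmodule (envTensor ρ M) where
  carrier n := Submodule.span k {z | ∃ (i j : ℤ) (h : i + j = n) (y : EnvX (free ρ) i) (m : M.X j),
    y ∈ envFil ρ p i ∧ z = (envelope (free ρ)).tmul M h y m}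
  act_mem {i j n} h a x hx := by
    induction hx using Submodule.span_induction with
    | zero => rw [map_zero]; exact zero_mem _
    | add x y _ _ hx hy => rw [map_add]; exact add_mem hx hy
    | smul c x _ hx => rw [map_smul]; exact Submodule.smul_mem _ _ hx
    | mem x hx =>
      obtain ⟨q, r, hqr, y, m, hy, rfl⟩ := hx
      refine Submodule.subset_span ⟨i + q, r, by omega, _, m, envFil_act ρ p rfl a hy, ?_⟩
      exact DGBimodule.tensorAct_tmul (K := envelope (free ρ)) h hqr rfl (by omega) a y m
  d_mem {i j} h x hx := by
    induction hx using Submodule.span_induction with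
    | zero => rw [map_zero]; exact zero_mem _
    | add x y _ _ hx hy => rw [map_add]; exact add_mem hx hy
    | smul c x _ hx => rw [map_smul]; exact Submodule.smul_mem _ _ hx
    | mem x hx =>
      obtain ⟨q, r, hqr, y, m, hy, rfl⟩ := hx
      have := DGBimodule.tensorD_tmul (K := envelope (free ρ)) (M := M) h hqr rfl rfl (by omega)
        (by omega) y m
      refine this ▸ add_mem (Submodule.subset_span ⟨q + 1, r, by omega, _, m,
        envFil_d ρ p rfl hy, rfl⟩) (Submodule.smul_mem _ _ (Submodule.subset_span
          ⟨q, r + 1, by omega, y, _, hy, rfl⟩))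

/-- The filtration on `M_V` induced by the filtration of the enveloping algebra. -/
noncomputable def envelopeFiltration : Filtration (envTensor ρ M) where
  F := envTensorFil ρ M
  mono p n := by
    refine Submodule.span_mono ?_
    rintro _ ⟨i, j, h, y, m, hy, rfl⟩
    exact ⟨i, j, h, y, m, envFil_mono ρ p i hy, rfl⟩

end Main

end DGForm

/-! *Extensions.* Once maps that differ by a map through an acyclic module are identified, the
quasi-isomorphisms admit a calculus of left fractions, so morphisms in the derived category are
fractions of morphisms of dg modules. The class of a short exact sequence `X ⟶ Y ⟶ Z` therefore
vanishes if and only if the inclusion of `X` has a retraction up to a quasi-isomorphism out of `X`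
(`exists_retraction_of_extClass_eq_zero`, `extClass_eq_zero_of_retraction`), if and only if the
projection has a section in the derived category (`extClass_eq_zero_iff_hasDerivedSection`).

*The filtration.* A Poincaré-Birkhoff-Witt argument identifies the filtration. Write `U` for the
enveloping algebra and `M_V = U ⊗_A M`. Modules `T_p` are built recursively by `T_0 = M`,
`T_1 = Σ_V ⊗_A M`, and `T_{p+2}` is the quotient of `Σ_V ⊗_A T_{p+1}` which identifies the two
copies of `Σ_V ⊗_A T_p`. They sit in exact sequences `T_p ⟶ T_{p+1} ⟶ V^{⊗(p+1)} ⊗_A M`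
(`tower_shortExact`), where exactness uses that `V`, being perfect, has dual bases. The colimit of
the `T_p` carries an action of `V`, which extends to `U` because the Lie algebroid is free, and
comparing it with `U ⊗_A M` shows that `T_p` is the `p`-th step of the filtration of `M_V`
(`towerEquiv`). Hence splitting at step `p + 1` means that the class `towerClass p` of this sequence
vanishes (`towerClass_eq_zero_iff`). For `p = 0` this class is `Θ_M`.

*Comparison with HKR classes.* The quotient map `Σ_V ⊗_A T_{p+1} ⟶ T_{p+2}` shows that `Θ_{T_{p+1}}`
is the pullback of `towerClass (p + 1)` along `V ⊗ T_{p+1} ⟶ V ⊗ V^{⊗(p+1)} ⊗ M`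
(`hkrClass_towerX`). If `T_p ⟶ T_{p+1}` splits, the graded piece lifts to `T_{p+1}` in the derived
category. Naturality of `Θ` along the lift and along the projection then gives two things. If the
first two extensions split, `Θ_{V ⊗ M}` vanishes (`hkrClass_tensor_eq_zero`). If the classes `Θ` of
all `V^{⊗n} ⊗ M` vanish, every extension of the tower splits (`towerClass_succ_eq_zero`).

*From two classes to all of them.* The class `Θ_N` vanishes if and only if there are a
quasi-isomorphism `j : N ⟶ N'` and operators `∇_v` from `N` to `N'` satisfying the Leibniz rule
`∇_v (a x) = ρ(v)(a) j(x) ± a ∇_v x` (`Connection`). There need not be a connection on `V` itself,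
but connections on `N` and on `V ⊗ N` produce a substitute: the commutators of `∇_v` and `w ⊗ -`
form a connection on `V` with values in graded linear maps out of `N` (`Connection.comm`). Tensoring
it with the connection on `V ⊗ N` gives one on `V ⊗ V ⊗ N` (`Connection.tensor`), whose values lie
in a pushout so that the quasi-isomorphisms involved need not be inverted. By induction the
vanishing of `Θ_M` and `Θ_{V ⊗ M}` implies that of all `Θ_{V^{⊗n} ⊗ M}` (`hkrClass_towerG_eq_zero`).
-/

namespace DGForm

variable {k : Type u} [Field k] {A : CDGA k}

namespace DGModule

/-! ### Acyclic modules, quasi-isomorphisms and short exact sequences -/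

@[ext]
lemma hom_ext {M N : DGModule A} {F G : M ⟶ N} (h : ∀ n x, F.f n x = G.f n x) : F = G :=
  Hom.ext (funext fun n => LinearMap.ext (h n))

@[simp] lemma zeroHom_f (M N : DGModule A) (n : ℤ) (x : M.X n) : (zeroHom M N).f n x = 0 := rfl

/-- A dg module with zero cohomology. -/
def IsAcyclic (M : DGModule A) : Prop :=
  ∀ {h i j : ℤ} (hi : h + 1 = i) (hj : i + 1 = j) (x : M.X i), M.d hj x = 0 → ∃ y, M.d hi y = x

lemma IsAcyclic.of_retract {M N : DGModule A} (hN : N.IsAcyclic) (i : M ⟶ N) (p : N ⟶ M)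
    (h : i ≫ p = 𝟙 M) : M.IsAcyclic := by
  intro a b c hb hc x hx
  obtain ⟨y, hy⟩ := hN hb hc (i.f b x) (by rw [← i.map_d, hx, map_zero])
  refine ⟨p.f a y, ?_⟩
  rw [← p.map_d, hy, ← comp_f, h, id_f]

lemma IsQuasiIso.comp {M N P : DGModule A} {F : M ⟶ N} {G : N ⟶ P} (hF : IsQuasiIso F)
    (hG : IsQuasiIso G) : IsQuasiIso (F ≫ G) := by
  intro a b c hb hc
  constructor
  · intro x hx hz
    exact (hF hb hc).1 x hx ((hG hb hc).1 _ (by rw [← F.map_d, hx, map_zero]) hz)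
  · intro z hz
    obtain ⟨y, hy, z₁, hz₁⟩ := (hG hb hc).2 z hz
    obtain ⟨x, hx, y₁, hy₁⟩ := (hF hb hc).2 y hy
    refine ⟨x, hx, z₁ + G.f a y₁, ?_⟩
    rw [map_add, hz₁, ← G.map_d, hy₁, map_sub, comp_f]
    abel

lemma isQuasiIso_of_bijective {M N : DGModule A} (F : M ⟶ N)
    (hF : ∀ n, Function.Bijective (F.f n)) : IsQuasiIso F := by
  intro a b c hb hc
  constructor
  · rintro x - ⟨y, hy⟩
    obtain ⟨w, rfl⟩ := (hF a).2 y
    exact ⟨w, (hF b).1 (by rw [F.map_d, hy])⟩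
  · intro y hy
    obtain ⟨x, rfl⟩ := (hF b).2 y
    exact ⟨x, (hF c).1 (by rw [F.map_d, hy, map_zero]), 0, by rw [map_zero, sub_self]⟩

lemma isQuasiIso_of_isAcyclic {M N : DGModule A} (F : M ⟶ N) (hM : M.IsAcyclic)
    (hN : N.IsAcyclic) : IsQuasiIso F := by
  intro a b c hb hc
  refine ⟨fun x hx _ => hM hb hc x hx, fun y hy => ⟨0, map_zero _, ?_⟩⟩
  simpa using hN hb hc y hy

namespace ShortExact

variable {X Y Z : DGModule A} {i : X ⟶ Y} {p : Y ⟶ Z} (h : ShortExact i p)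
include h

lemma d_eq_zero_of_d_eq {n m : ℤ} (hm : n + 1 = m) {x : X.X n} (hx : Y.d hm (i.f n x) = 0) :
    X.d hm x = 0 := h.inj m (by rw [i.map_d, hx, map_zero])

lemma isQuasiIso_right (hX : X.IsAcyclic) : IsQuasiIso p := by
  intro a b c hb hc
  obtain ⟨e, he⟩ : ∃ e, e + 1 = a := ⟨a - 1, by omega⟩
  constructor
  · rintro y hy ⟨z, hz⟩
    obtain ⟨y₀, rfl⟩ := h.surj a z
    obtain ⟨x, hx⟩ := (h.exact b (y - Y.d hb y₀)).1 (by rw [map_sub, p.map_d, hz, sub_self])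
    obtain ⟨x', rfl⟩ := hX hb hc x
      (h.d_eq_zero_of_d_eq hc (by rw [hx, map_sub, hy, Y.d_d, sub_zero]))
    refine ⟨y₀ + i.f a x', ?_⟩
    rw [map_add, ← i.map_d, hx]; abel
  · intro z hz
    obtain ⟨y, rfl⟩ := h.surj b z
    obtain ⟨x, hx⟩ := (h.exact c (Y.d hc y)).1 (by rw [p.map_d, hz])
    obtain ⟨x', rfl⟩ := hX hc rfl x (h.d_eq_zero_of_d_eq rfl (by rw [hx, Y.d_d]))
    refine ⟨y - i.f b x', ?_, 0, ?_⟩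
    · rw [map_sub, ← i.map_d, hx, sub_self]
    · rw [map_zero, map_sub, h.comp_zero, sub_zero, sub_self]

lemma isQuasiIso_left (hZ : Z.IsAcyclic) : IsQuasiIso i := by
  intro a b c hb hc
  obtain ⟨e, he⟩ : ∃ e, e + 1 = a := ⟨a - 1, by omega⟩
  constructor
  · rintro x - ⟨y, hy⟩
    obtain ⟨z, hz⟩ := hZ he hb (p.f a y) (by rw [← p.map_d, hy, h.comp_zero])
    obtain ⟨y', rfl⟩ := h.surj e z
    obtain ⟨w, hw⟩ := (h.exact a (y - Y.d he y')).1 (by rw [map_sub, p.map_d, hz, sub_self])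
    refine ⟨w, h.inj b ?_⟩
    rw [i.map_d, hw, map_sub, Y.d_d, sub_zero, hy]
  · intro y hy
    obtain ⟨z, hz⟩ := hZ hb hc (p.f b y) (by rw [← p.map_d, hy, map_zero])
    obtain ⟨y', rfl⟩ := h.surj a z
    obtain ⟨x, hx⟩ := (h.exact b (y - Y.d hb y')).1 (by rw [map_sub, p.map_d, hz, sub_self])
    refine ⟨x, h.d_eq_zero_of_d_eq hc (by rw [hx, map_sub, hy, Y.d_d, sub_zero]), y', ?_⟩
    rw [hx]; abel

lemma isAcyclic_left (hp : IsQuasiIso p) : X.IsAcyclic := by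
  intro a b c hb hc x hx
  obtain ⟨e, he⟩ : ∃ e, e + 1 = a := ⟨a - 1, by omega⟩
  obtain ⟨y, hy⟩ := (hp hb hc).1 (i.f b x) (by rw [← i.map_d, hx, map_zero])
    ⟨0, by rw [map_zero, h.comp_zero]⟩
  obtain ⟨y₁, hy₁, z, hz⟩ := (hp he hb).2 (p.f a y) (by rw [← p.map_d, hy, h.comp_zero])
  obtain ⟨y₂, rfl⟩ := h.surj e z
  obtain ⟨x', hx'⟩ := (h.exact a (y - y₁ - Y.d he y₂)).1
    (by rw [map_sub, map_sub, p.map_d, hz, sub_self])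
  refine ⟨x', h.inj b ?_⟩
  rw [i.map_d, hx', map_sub, map_sub, Y.d_d, hy, hy₁, sub_zero, sub_zero]

lemma isAcyclic_right (hi : IsQuasiIso i) : Z.IsAcyclic := by
  intro a b c hb hc z hz
  obtain ⟨y, rfl⟩ := h.surj b z
  obtain ⟨x, hx⟩ := (h.exact c (Y.d hc y)).1 (by rw [p.map_d, hz])
  obtain ⟨w, rfl⟩ := (hi hc rfl).1 x (h.d_eq_zero_of_d_eq rfl (by rw [hx, Y.d_d])) ⟨y, hx.symm⟩
  obtain ⟨x₁, -, y₂, hy₂⟩ := (hi hb hc).2 (y - i.f b w)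
    (by rw [map_sub, ← i.map_d, hx, sub_self])
  refine ⟨p.f a y₂, ?_⟩
  rw [← p.map_d, hy₂, map_sub, map_sub, h.comp_zero, h.comp_zero, sub_zero, sub_zero]

lemma isAcyclic_middle (hX : X.IsAcyclic) (hZ : Z.IsAcyclic) : Y.IsAcyclic := by
  intro a b c hb hc y hy
  obtain ⟨z, hz⟩ := hZ hb hc (p.f b y) (by rw [← p.map_d, hy, map_zero])
  obtain ⟨y', rfl⟩ := h.surj a z
  obtain ⟨x, hx⟩ := (h.exact b (y - Y.d hb y')).1 (by rw [map_sub, p.map_d, hz, sub_self])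
  obtain ⟨x', rfl⟩ := hX hb hc x
    (h.d_eq_zero_of_d_eq hc (by rw [hx, map_sub, hy, Y.d_d, sub_zero]))
  refine ⟨i.f a x' + y', ?_⟩
  rw [map_add, ← i.map_d, hx, sub_add_cancel]

end ShortExact

/-! ### Direct sums, kernels, cokernels -/

/-- The direct sum of two dg modules. -/
abbrev prod (M N : DGModule A) : DGModule A where
  X n := M.X n × N.X n
  act h := LinearMap.mk₂ k (fun a w => (M.act h a w.1, N.act h a w.2))
    (fun a b w => by simp) (fun c a w => by simp) (fun a w w' => by simp) (fun c a w => by simp)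
  d h := (M.d h).prodMap (N.d h)
  one_act h w := by simp [one_act]
  mul_act hij hjl h₁ h₂ a b w := by
    simp only [LinearMap.mk₂_apply]
    rw [M.mul_act hij hjl h₁ h₂, N.mul_act hij hjl h₁ h₂]
  d_d h h' w := by simp [d_d]
  d_act h hi hj hn h₁ h₂ a w := by
    refine Prod.ext ?_ ?_
    · simpa using M.d_act h hi hj hn h₁ h₂ a w.1
    · simpa using N.d_act h hi hj hn h₁ h₂ a w.2

/-- The morphism to a direct sum with given components. -/
def prodLift {L M N : DGModule A} (F : L ⟶ M) (G : L ⟶ N) : L ⟶ M.prod N where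
  f n := (F.f n).prod (G.f n)
  map_act h a x := Prod.ext (F.map_act h a x) (G.map_act h a x)
  map_d h x := Prod.ext (F.map_d h x) (G.map_d h x)

/-- The morphism from a direct sum with given components. -/
def prodDesc {L M N : DGModule A} (F : M ⟶ L) (G : N ⟶ L) : M.prod N ⟶ L where
  f n := (F.f n).coprod (G.f n)
  map_act h a x := by
    change F.f _ (M.act h a x.1) + G.f _ (N.act h a x.2) = L.act h a (F.f _ x.1 + G.f _ x.2)
    rw [F.map_act, G.map_act, map_add]
  map_d h x := by
    change F.f _ (M.d h x.1) + G.f _ (N.d h x.2) = L.d h (F.f _ x.1 + G.f _ x.2)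
    rw [F.map_d, G.map_d, map_add]

@[simp] lemma prodLift_f {L M N : DGModule A} (F : L ⟶ M) (G : L ⟶ N) (n : ℤ) (x : L.X n) :
    (prodLift F G).f n x = (F.f n x, G.f n x) := rfl

@[simp] lemma prodDesc_f {L M N : DGModule A} (F : M ⟶ L) (G : N ⟶ L) (n : ℤ)
    (x : (M.prod N).X n) : (prodDesc F G).f n x = F.f n x.1 + G.f n x.2 := rfl

lemma IsAcyclic.prod {M N : DGModule A} (hM : M.IsAcyclic) (hN : N.IsAcyclic) :
    (M.prod N).IsAcyclic := by
  intro a b c hb hc x hx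
  obtain ⟨y, hy⟩ := hM hb hc x.1 (congrArg Prod.fst hx)
  obtain ⟨z, hz⟩ := hN hb hc x.2 (congrArg Prod.snd hx)
  exact ⟨(y, z), Prod.ext hy hz⟩

lemma isQuasiIso_prodLift {L M N : DGModule A} (F : L ⟶ M) (G : L ⟶ N) (hF : IsQuasiIso F)
    (hN : N.IsAcyclic) : IsQuasiIso (prodLift F G) := by
  intro a b c hb hc
  constructor
  · rintro x hx ⟨y, hy⟩
    exact (hF hb hc).1 x hx ⟨y.1, congrArg Prod.fst hy⟩
  · intro y hy
    obtain ⟨x, hx, z, hz⟩ := (hF hb hc).2 y.1 (congrArg Prod.fst hy)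
    have hy₂ : N.d hc y.2 = 0 := congrArg Prod.snd hy
    obtain ⟨w, hw⟩ := hN hb hc (y.2 - G.f b x)
      (by rw [map_sub, hy₂, ← G.map_d, hx, map_zero, sub_zero])
    exact ⟨x, hx, (z, w), Prod.ext hz hw⟩

/-- The difference of two morphisms. -/
def subHom {M N : DGModule A} (F G : M ⟶ N) : M ⟶ N where
  f n := F.f n - G.f n
  map_act h a x := by simp [F.map_act, G.map_act]
  map_d h x := by simp [F.map_d, G.map_d]

@[simp] lemma subHom_f {M N : DGModule A} (F G : M ⟶ N) (n : ℤ) (x : M.X n) :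
    (subHom F G).f n x = F.f n x - G.f n x := rfl

/-- The kernel of a morphism. -/
def ker {M N : DGModule A} (F : M ⟶ N) : DGSubmodule M where
  carrier n := LinearMap.ker (F.f n)
  act_mem h a x hx := by
    rw [LinearMap.mem_ker] at hx ⊢
    rw [F.map_act, hx, map_zero]
  d_mem h x hx := by
    rw [LinearMap.mem_ker] at hx ⊢
    rw [F.map_d, hx, map_zero]

/-- The image of a morphism. -/
def range {M N : DGModule A} (F : M ⟶ N) : DGSubmodule N where
  carrier n := LinearMap.range (F.f n)
  act_mem h a x hx := by
    obtain ⟨y, rfl⟩ := hx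
    exact ⟨_, F.map_act h a y⟩
  d_mem h x hx := by
    obtain ⟨y, rfl⟩ := hx
    exact ⟨_, F.map_d h y⟩

end DGModule

namespace DGSubmodule

variable {M : DGModule A}

/-- The inclusion of a submodule. -/
def incl (N : DGSubmodule M) : N.toDGModule ⟶ M where
  f n := (N.carrier n).subtype
  map_act _ _ _ := rfl
  map_d _ _ := rfl

lemma proj_eq_zero (N : DGSubmodule M) {n : ℤ} (x : M.X n) :
    N.proj.f n x = 0 ↔ x ∈ N.carrier n := Submodule.Quotient.mk_eq_zero _

lemma proj_surjective (N : DGSubmodule M) (n : ℤ) : Function.Surjective (N.proj.f n) :=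
  Submodule.mkQ_surjective _

/-- The morphism out of a quotient induced by a morphism that vanishes on the submodule. -/
def lift (N : DGSubmodule M) {P : DGModule A} (F : M ⟶ P)
    (hF : ∀ n, ∀ x ∈ N.carrier n, F.f n x = 0) : N.quotient ⟶ P where
  f n := (N.carrier n).liftQ (F.f n) (hF n)
  map_act h a x := by
    induction x using Submodule.Quotient.induction_on with | _ x =>
    exact F.map_act h a x
  map_d h x := by
    induction x using Submodule.Quotient.induction_on with | _ x =>
    exact F.map_d h x

end DGSubmodule

namespace DGModule

lemma shortExact_ker {M N : DGModule A} (F : M ⟶ N) (hF : ∀ n, Function.Surjective (F.f n)) :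
    ShortExact (ker F).incl F :=
  ⟨fun _ => Subtype.val_injective,
    fun _ y => ⟨fun hy => ⟨⟨y, hy⟩, rfl⟩, by rintro ⟨x, rfl⟩; exact x.2⟩, hF⟩

lemma shortExact_range {M N : DGModule A} (F : M ⟶ N) (hF : ∀ n, Function.Injective (F.f n)) :
    ShortExact F (range F).proj :=
  ⟨hF, fun _ y => (range F).proj_eq_zero y, (range F).proj_surjective⟩

/-! ### Mapping cones -/

/-- The mapping cone of `F : X ⟶ Y`: `Y ⊕ X[1]` with differential `(y, x) ↦ (dy + F x, -dx)`. -/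
abbrev cone {X Y : DGModule A} (F : X ⟶ Y) : DGModule A where
  X n := Y.X n × X.X (n + 1)
  act {i j n} h := LinearMap.mk₂ k
    (fun a w => (Y.act h a w.1, sgn k i • X.act (by omega : i + (j + 1) = n + 1) a w.2))
    (fun a b w => by simp) (fun c a w => by simp [smul_comm c])
    (fun a w w' => by simp) (fun c a w => by simp [smul_comm c])
  d {i j} h :=
    { toFun := fun w => (Y.d h w.1 + Y.castEq h (F.f (i + 1) w.2), -X.d (by omega) w.2)
      map_add' := fun w w' => by ext <;> simp <;> abel
      map_smul' := fun c w => by ext <;> simp [smul_add] }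
  one_act h w := by simp [one_act, sgn_zero]
  mul_act {i j l ij jl n} hij hjl h₁ h₂ a b w := by
    subst hij
    simp only [LinearMap.mk₂_apply, map_smul, smul_smul]
    rw [Y.mul_act rfl hjl h₁ h₂, X.mul_act rfl (by omega : j + (l + 1) = jl + 1) (by omega)
      (by omega), sgn_add]
  d_d {i j l} h h' w := by
    subst h h'
    ext
    · simp [Y.d_d, F.map_d]
    · simp [X.d_d]
  d_act {i j n i' j' n'} h hi hj hn h₁ h₂ a w := by
    subst hi hj hn
    ext
    · simp only [LinearMap.coe_mk, AddHom.coe_mk, LinearMap.mk₂_apply, F.map_act, map_smul,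
        map_add, Prod.fst_add, Prod.smul_fst, castEq_rfl, smul_add]
      rw [Y.d_act h rfl rfl rfl h₁ h₂]
      abel
    · simp only [LinearMap.coe_mk, AddHom.coe_mk, LinearMap.mk₂_apply, map_smul,
        map_neg, Prod.snd_add, Prod.smul_snd, smul_neg]
      rw [X.d_act _ rfl rfl _ (by omega) (by omega), sgn_add, sgn_one]
      rcases sgn_cases k i with h | h <;> simp [h] <;> abel

/-- The inclusion of the target in the mapping cone. -/
def coneInl {X Y : DGModule A} (F : X ⟶ Y) : Y ⟶ cone F where
  f n := LinearMap.inl k (Y.X n) (X.X (n + 1))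
  map_act {l m n} h a x := by
    change (Y.act h a x, (0 : X.X (n + 1))) = (Y.act h a x, sgn k l • X.act _ a 0)
    rw [map_zero, smul_zero]
  map_d {l m} h x := by
    change (Y.d h x, (0 : X.X (m + 1))) = (Y.d h x + Y.castEq h (F.f (l + 1) 0), -X.d _ 0)
    rw [map_zero, map_zero, map_zero, add_zero, neg_zero]

/-- The map of mapping cones induced by a commutative square. -/
def coneMap {X Y X' Y' : DGModule A} {F : X ⟶ Y} {G : X' ⟶ Y'} (a : X ⟶ X') (b : Y ⟶ Y')
    (h : F ≫ b = a ≫ G) : cone F ⟶ cone G where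
  f n := (b.f n).prodMap (a.f (n + 1))
  map_act {i j n} e r x := by
    refine Prod.ext (b.map_act e r x.1) ?_
    change a.f _ (sgn k i • X.act _ r x.2) = sgn k i • X'.act _ r (a.f _ x.2)
    rw [map_smul, a.map_act]
  map_d {i j} e x := by
    subst e
    refine Prod.ext ?_ ?_
    · change b.f _ (Y.d rfl x.1 + F.f _ x.2) = Y'.d rfl (b.f _ x.1) + G.f _ (a.f _ x.2)
      rw [map_add, b.map_d, ← comp_f, h, comp_f]
    · change a.f _ (-X.d _ x.2) = -X'.d _ (a.f _ x.2)
      rw [map_neg, a.map_d]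

lemma IsQuasiIso.isAcyclic_cone {X Y : DGModule A} {F : X ⟶ Y} (hF : IsQuasiIso F) :
    (cone F).IsAcyclic := by
  rintro a b c hb hc ⟨y, x⟩ hw
  subst hb hc
  have h₁ : Y.d rfl y + F.f _ x = 0 := congrArg Prod.fst hw
  have h₂ : -X.d rfl x = 0 := congrArg Prod.snd hw
  rw [neg_eq_zero] at h₂
  obtain ⟨w, rfl⟩ := (hF rfl rfl).1 x h₂ ⟨-y, by rw [map_neg, ← eq_neg_of_add_eq_zero_right h₁]⟩
  obtain ⟨x₁, hx₁, y₁, hy₁⟩ := (hF rfl rfl).2 (y + F.f _ w) (by rw [map_add, ← F.map_d, h₁])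
  refine ⟨(y₁, x₁ - w), Prod.ext ?_ ?_⟩
  · change Y.d rfl y₁ + F.f _ (x₁ - w) = y
    rw [hy₁, map_sub]; abel
  · change -X.d rfl (x₁ - w) = X.d rfl w
    rw [map_sub, hx₁, zero_sub, neg_neg]

lemma isQuasiIso_id (X : DGModule A) : IsQuasiIso (𝟙 X) :=
  isQuasiIso_of_bijective _ fun _ => Function.bijective_id

lemma isAcyclic_cone_id (X : DGModule A) : (cone (𝟙 X)).IsAcyclic :=
  IsQuasiIso.isAcyclic_cone (isQuasiIso_id X)

lemma isQuasiIso_coneInl {X Y : DGModule A} (F : X ⟶ Y) (hX : X.IsAcyclic) :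
    IsQuasiIso (coneInl F) := by
  intro a b c hb hc
  subst hb hc
  constructor
  · rintro y - ⟨⟨y', x⟩, hw⟩
    have h₁ : Y.d rfl y' + F.f _ x = y := congrArg Prod.fst hw
    have h₂ : -X.d rfl x = 0 := congrArg Prod.snd hw
    obtain ⟨w, rfl⟩ := hX (rfl : a + 1 = a + 1) rfl x (neg_eq_zero.1 h₂)
    exact ⟨y' + F.f _ w, by rw [map_add, ← F.map_d, h₁]⟩
  · rintro ⟨y, x⟩ hw
    have h₁ : Y.d rfl y + F.f _ x = 0 := congrArg Prod.fst hw
    have h₂ : -X.d rfl x = 0 := congrArg Prod.snd hw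
    obtain ⟨w, rfl⟩ := hX (rfl : a + 1 + 1 = a + 1 + 1) rfl x (neg_eq_zero.1 h₂)
    refine ⟨y + F.f _ w, by rw [map_add, ← F.map_d, h₁], (0, -w), Prod.ext ?_ ?_⟩
    · change Y.d rfl 0 + F.f _ (-w) = y - (y + F.f _ w)
      rw [map_zero, map_neg]; abel
    · change -X.d rfl (-w) = X.d rfl w - 0
      rw [map_neg, neg_neg, sub_zero]

lemma IsQuasiIso.isAcyclic_fibre {Y Z : DGModule A} {p : Y ⟶ Z} (hp : IsQuasiIso p) :
    (fibre p).IsAcyclic := by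
  rintro a b c hb hc ⟨y, z⟩ hw
  have h₁ : Y.d hc y = 0 := congrArg Prod.fst hw
  have h₂ : Z.castEq (by omega : b = c + -1) (p.f b y) - Z.d (by omega) z = 0 :=
    congrArg Prod.snd hw
  have ha : b + -1 = a := by omega
  have hd : Z.d hb (Z.castEq ha z) = p.f b y := by
    refine Z.castEq_injective (by omega : b = c + -1) ?_
    rw [sub_eq_zero.1 h₂, Z.d_castEq ha hb (by omega : b + -1 + 1 = c + -1) (by omega),
      castEq_castEq]
  obtain ⟨w, rfl⟩ := (hp hb hc).1 y h₁ ⟨_, hd⟩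
  obtain ⟨e, he⟩ : ∃ e, e + 1 = a := ⟨a - 1, by omega⟩
  obtain ⟨y₁, hy₁, z₁, hz₁⟩ := (hp he hb).2 (Z.castEq ha z - p.f a w)
    (by rw [map_sub, hd, p.map_d, sub_self])
  refine ⟨(w + y₁, Z.castEq (by omega : e = a + -1) (-z₁)), Prod.ext ?_ ?_⟩
  · change Y.d hb (w + y₁) = Y.d hb w
    rw [map_add, hy₁, add_zero]
  · change Z.castEq _ (p.f a (w + y₁)) - Z.d _ (Z.castEq _ (-z₁)) = z
    rw [Z.d_castEq _ _ he (by omega), ← map_sub, map_neg, hz₁, map_add,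
      show p.f a w + p.f a y₁ - -(Z.castEq ha z - p.f a w - p.f a y₁) = Z.castEq ha z by abel,
      castEq_castEq]

end DGModule

namespace DGModule

/-! ### Left fractions in the derived category -/

variable (A) in
/-- Two morphisms of dg modules are related if their difference factors through an acyclic
module. -/
def acyclicRel : HomRel (DGModule A) := fun X Y F G =>
  ∃ (C : DGModule A) (_ : C.IsAcyclic) (a : X ⟶ C) (b : C ⟶ Y),
    ∀ n x, F.f n x = G.f n x + b.f n (a.f n x)

instance : Congruence (acyclicRel A) where
  equivalence {X Y} :=
    { refl := fun F => ⟨cone (𝟙 X), isAcyclic_cone_id X, zeroHom _ _, zeroHom _ _,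
        fun n x => (add_zero _).symm⟩
      symm := by
        rintro F G ⟨C, hC, a, b, h⟩
        exact ⟨C, hC, a, subHom (zeroHom _ _) b, by simp [h]⟩
      trans := by
        rintro F G H ⟨C, hC, a, b, h⟩ ⟨C', hC', a', b', h'⟩
        refine ⟨C.prod C', hC.prod hC', prodLift a a', prodDesc b b', fun n x => ?_⟩
        rw [h, h', prodLift_f, prodDesc_f, add_assoc, add_comm (b.f n _)] }
  comp_left F G H h := by
    obtain ⟨C, hC, a, b, h⟩ := h
    exact ⟨C, hC, F ≫ a, b, fun n x => by simp [h]⟩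
  comp_right F h := by
    obtain ⟨C, hC, a, b, h⟩ := h
    exact ⟨C, hC, a, b ≫ F, fun n x => by simp [h]⟩

variable (A) in
/-- The category of dg modules modulo the morphisms that factor through an acyclic module. -/
abbrev AcyclicQuotient := CategoryTheory.Quotient (acyclicRel A)

variable (A) in
/-- The class of morphisms of the quotient category that are represented by a
quasi-isomorphism. -/
def quotientQuasiIso : MorphismProperty (AcyclicQuotient A) := fun X Y F =>
  ∃ f : X.as ⟶ Y.as, IsQuasiIso f ∧ (Quotient.functor (acyclicRel A)).map f = F

/-- The mapping cone of `(s, -g) : X' ⟶ X ⊕ Y` is a homotopy pushout of `s` and `g`: the leg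
opposite to a quasi-isomorphism `s` is a quasi-isomorphism. -/
lemma isQuasiIso_homotopyPushout {X' X Y : DGModule A} (s : X' ⟶ X) (g : X' ⟶ Y)
    (hs : IsQuasiIso s) : IsQuasiIso
      (prodLift (zeroHom Y X) (𝟙 Y) ≫ coneInl (prodLift s (subHom (zeroHom X' Y) g))) := by
  let p : cone (prodLift s (subHom (zeroHom X' Y) g)) ⟶ cone s :=
    coneMap (𝟙 X') (prodDesc (𝟙 X) (zeroHom Y X)) <| by
      ext n x
      exact add_zero (s.f n x)
  have h : ShortExact
      (prodLift (zeroHom Y X) (𝟙 Y) ≫ coneInl (prodLift s (subHom (zeroHom X' Y) g))) p := by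
    refine ⟨fun n x y h => ?_, fun n w => ⟨fun hw => ⟨w.1.2, ?_⟩, ?_⟩, fun n w => ?_⟩
    · exact congrArg (fun w => w.1.2) h
    · have h₁ : w.1.1 + 0 = 0 := congrArg Prod.fst hw
      have h₂ : w.2 = 0 := congrArg Prod.snd hw
      rw [add_zero] at h₁
      exact Prod.ext (Prod.ext h₁.symm rfl) h₂.symm
    · rintro ⟨y, rfl⟩
      exact Prod.ext (add_zero 0) rfl
    · exact ⟨((w.1, 0), w.2), Prod.ext (add_zero w.1) rfl⟩
  exact fun {_ _ _} hb hc => h.isQuasiIso_left hs.isAcyclic_cone hb hc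

instance : (quotientQuasiIso A).HasLeftCalculusOfFractions where
  id_mem X := ⟨𝟙 _, isQuasiIso_id _, (Quotient.functor _).map_id _⟩
  comp_mem F G hF hG := by
    obtain ⟨f, hf, rfl⟩ := hF
    obtain ⟨g, hg, rfl⟩ := hG
    exact ⟨f ≫ g, hf.comp hg, (Quotient.functor _).map_comp _ _⟩
  exists_leftFraction X Y φ := by
    obtain ⟨s, ⟨s, hs, rfl⟩, g⟩ := φ
    rename_i X'
    obtain ⟨g, rfl⟩ := (Quotient.functor (acyclicRel A)).map_surjective g
    let t := prodLift s (subHom (zeroHom X'.as Y.as) g)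
    refine ⟨⟨(Quotient.functor (acyclicRel A)).map
        (prodLift (𝟙 X.as) (zeroHom X.as Y.as) ≫ coneInl t),
      (Quotient.functor (acyclicRel A)).map (prodLift (zeroHom Y.as X.as) (𝟙 Y.as) ≫ coneInl t),
      ⟨_, isQuasiIso_homotopyPushout s g hs, rfl⟩⟩, ?_⟩
    refine Eq.symm (CategoryTheory.Quotient.sound (acyclicRel A) ?_)
    -- the difference `(s, -g)` extends to the cone of the identity
    refine ⟨cone (𝟙 X'.as), isAcyclic_cone_id _, coneInl _, coneMap (𝟙 _) t rfl, fun n x => ?_⟩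
    refine Prod.ext (Prod.ext ?_ ?_) ?_
    · change s.f n x = 0 + s.f n x
      rw [zero_add]
    · change 0 = g.f n x + (0 - g.f n x)
      abel
    · change 0 = 0 + 0
      rw [add_zero]
  ext X' X Y F₁ F₂ s hs h := by
    obtain ⟨s, hs, rfl⟩ := hs
    obtain ⟨f₁, rfl⟩ := (Quotient.functor (acyclicRel A)).map_surjective F₁
    obtain ⟨f₂, rfl⟩ := (Quotient.functor (acyclicRel A)).map_surjective F₂
    obtain ⟨C, hC, a, b, h⟩ := (Quotient.functor_map_eq_iff (acyclicRel A) (s ≫ f₁) (s ≫ f₂)).1 h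
    refine ⟨⟨cone b⟩, (Quotient.functor (acyclicRel A)).map (coneInl b),
      ⟨_, isQuasiIso_coneInl b hC, rfl⟩, ?_⟩
    refine CategoryTheory.Quotient.sound (acyclicRel A) ?_
    -- after the inclusion in the cone of `b`, the difference `f₁ - f₂` extends to the cone of `s`
    refine ⟨cone s, hs.isAcyclic_cone, coneInl s, coneMap a (subHom f₁ f₂) ?_, fun n x => ?_⟩
    · ext n x
      have := h n x
      rw [comp_f, comp_f] at this
      rw [comp_f, comp_f, subHom_f, this, add_sub_cancel_left]
    · refine Prod.ext ?_ ?_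
      · change f₁.f n x = f₂.f n x + (f₁.f n x - f₂.f n x)
        abel
      · change 0 = 0 + a.f (n + 1) 0
        rw [map_zero, add_zero]

/-- Two morphisms of dg modules that agree in `D(A)` agree, after composition with a
quasi-isomorphism, up to a morphism that factors through an acyclic module. -/
lemma exists_of_toDerived_map_eq {X Y : DGModule A} {F G : X ⟶ Y}
    (h : (toDerived A).map F = (toDerived A).map G) :
    ∃ (Y' : DGModule A) (t : Y ⟶ Y'), IsQuasiIso t ∧ acyclicRel A (F ≫ t) (G ≫ t) := by
  have h' : (Quotient.functor (acyclicRel A) ⋙ (quotientQuasiIso A).Q).map F =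
      (Quotient.functor (acyclicRel A) ⋙ (quotientQuasiIso A).Q).map G :=
    AreEqualizedByLocalization.map_eq_of_isInvertedBy
      (W := quasiIso A) h _ fun X Y f hf => (quotientQuasiIso A).Q_inverts _ ⟨f, hf, rfl⟩
  obtain ⟨Y', t, ⟨t, ht, rfl⟩, e⟩ :=
    (MorphismProperty.map_eq_iff_postcomp (quotientQuasiIso A).Q (quotientQuasiIso A) _ _).1 h'
  exact ⟨Y'.as, t, ht, (Quotient.functor_map_eq_iff (acyclicRel A) (F ≫ t) (G ≫ t)).1 e⟩

/-! ### Zero morphisms of the derived category -/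

lemma toDerived_isIso {X Y : DGModule A} {F : X ⟶ Y} (hF : IsQuasiIso F) :
    IsIso ((toDerived A).map F) := (quasiIso A).Q_inverts F hF

lemma map_comp_derivedZero {X Y Z : DGModule A} (F : X ⟶ Y) :
    (toDerived A).map F ≫ derivedZero Y Z = derivedZero X Z := by
  rw [derivedZero, ← Functor.map_comp]
  congr 1

lemma derivedZero_comp_map {X Y Z : DGModule A} (F : Y ⟶ Z) :
    derivedZero X Y ≫ (toDerived A).map F = derivedZero X Z := by
  rw [derivedZero, ← Functor.map_comp]
  congr 1
  ext n x
  simp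

/-- Zero morphisms absorb arbitrary morphisms of `D(A)`. -/
lemma comp_derivedZero {X Y Z : DGModule A}
    (s : (toDerived A).obj X ⟶ (toDerived A).obj Y) : s ≫ derivedZero Y Z = derivedZero X Z := by
  let τ : (quasiIso A).Q ⋙ 𝟭 (Derived A) ⟶
      (quasiIso A).Q ⋙ (Functor.const (Derived A)).obj ((toDerived A).obj Z) :=
    { app := fun X => derivedZero X Z
      naturality := fun X Y F => (map_comp_derivedZero F).trans (Category.comp_id _).symm }
  have h := (Localization.Construction.natTransExtension τ).naturality s
  have e : ∀ X, (Localization.Construction.natTransExtension τ).app ((toDerived A).obj X) =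
      derivedZero X Z := fun X => Localization.Construction.NatTransExtension.app_eq τ X
  rw [e X, e Y] at h
  exact h.trans (Category.comp_id _)

/-- A morphism that factors through an acyclic module vanishes in `D(A)`. -/
lemma toDerived_map_comp_of_isAcyclic {X C Y : DGModule A} (hC : C.IsAcyclic) (a : X ⟶ C)
    (b : C ⟶ Y) : (toDerived A).map (a ≫ b) = derivedZero X Y := by
  have := toDerived_isIso (isQuasiIso_of_isAcyclic (zeroHom C C) hC hC)
  have e : (toDerived A).map (zeroHom C C) = 𝟙 _ := by
    rw [← cancel_epi ((toDerived A).map (zeroHom C C)), Category.comp_id]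
    exact map_comp_derivedZero _
  rw [Functor.map_comp, ← Category.comp_id ((toDerived A).map a), ← e]
  exact (congrArg (· ≫ _) (map_comp_derivedZero a)).trans (derivedZero_comp_map b)

lemma eq_derivedZero_of_comp_map {X Y Z : DGModule A}
    {t : (toDerived A).obj X ⟶ (toDerived A).obj Y} {F : Y ⟶ Z} (hF : IsQuasiIso F)
    (h : t ≫ (toDerived A).map F = derivedZero X Z) : t = derivedZero X Y := by
  have := toDerived_isIso hF
  rw [← cancel_mono ((toDerived A).map F), h, derivedZero_comp_map]

lemma eq_derivedZero_of_map_comp {X Y Z : DGModule A}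
    {t : (toDerived A).obj Y ⟶ (toDerived A).obj Z} {F : X ⟶ Y} (hF : IsQuasiIso F)
    (h : (toDerived A).map F ≫ t = derivedZero X Z) : t = derivedZero Y Z := by
  have := toDerived_isIso hF
  rw [← cancel_epi ((toDerived A).map F), h, map_comp_derivedZero]

/-! ### Extension classes -/

/-- The shift of a morphism. -/
def shiftMap {M N : DGModule A} (F : M ⟶ N) (s : ℤ) : M.shift s ⟶ N.shift s where
  f n := F.f (n + s)
  map_act {i _ _} h a x := by
    change F.f _ (sgn k (s * i) • _) = sgn k (s * i) • _
    rw [map_smul, F.map_act]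
  map_d {i _} h x := by
    change F.f _ (sgn k s • _) = sgn k s • _
    rw [map_smul, F.map_d]

variable (A) in
/-- The shift functor of `C(A)`. -/
def shiftFunctor (s : ℤ) : DGModule A ⥤ DGModule A where
  obj M := M.shift s
  map F := shiftMap F s

lemma IsAcyclic.shift {M : DGModule A} (hM : M.IsAcyclic) (s : ℤ) : (M.shift s).IsAcyclic := by
  intro a b c hb hc x hx
  have hx' : sgn k s • M.d (by omega : b + s + 1 = c + s) x = 0 := hx
  obtain ⟨y, hy⟩ := hM (by omega : a + s + 1 = b + s) (by omega : b + s + 1 = c + s) x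
    (by rw [← one_smul k (M.d _ x), ← sgn_mul_self k s, mul_smul, hx', smul_zero])
  refine ⟨sgn k s • y, ?_⟩
  change sgn k s • M.d _ (sgn k s • y) = x
  rw [map_smul, hy, smul_smul, sgn_mul_self, one_smul]

lemma IsQuasiIso.shift {M N : DGModule A} {F : M ⟶ N} (hF : IsQuasiIso F) (s : ℤ) :
    IsQuasiIso (shiftMap F s) := by
  intro a b c hb hc
  have key : ∀ (P : DGModule A) {i j : ℤ} (h : i + 1 = j) (h' : i + s + 1 = j + s)
      (x : P.X (i + s)) (y : P.X (j + s)), (P.shift s).d h x = y ↔ P.d h' x = sgn k s • y := by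
    intro P i j h h' x y
    change sgn k s • P.d _ x = y ↔ _
    constructor
    · rintro rfl
      rw [smul_smul, sgn_mul_self, one_smul]
    · intro e
      rw [e, smul_smul, sgn_mul_self, one_smul]
  have hb' : a + s + 1 = b + s := by omega
  have hc' : b + s + 1 = c + s := by omega
  constructor
  · rintro x hx ⟨y, hy⟩
    rw [key M hc hc', smul_zero] at hx
    rw [key N hb hb'] at hy
    obtain ⟨w, hw⟩ := (hF hb' hc').1 x hx ⟨sgn k s • y, by
      rw [map_smul, hy, smul_smul, sgn_mul_self, one_smul]; rfl⟩
    refine ⟨sgn k s • w, ?_⟩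
    rw [key M hb hb', map_smul, hw]
  · intro y hy
    rw [key N hc hc', smul_zero] at hy
    obtain ⟨x, hx, z, hz⟩ := (hF hb' hc').2 y hy
    refine ⟨x, by rw [key M hc hc', hx, smul_zero], sgn k s • z, ?_⟩
    rw [key N hb hb', map_smul, hz]
    rfl

/-- The map of homotopy fibres induced by a commutative square. -/
def fibreMap {Y Z Y' Z' : DGModule A} {p : Y ⟶ Z} {p' : Y' ⟶ Z'} (b : Y ⟶ Y') (c : Z ⟶ Z')
    (h : p ≫ c = b ≫ p') : fibre p ⟶ fibre p' where
  f n := (b.f n).prodMap (c.f (n + -1))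
  map_act {i j n} e r x := by
    refine Prod.ext (b.map_act e r x.1) ?_
    change c.f _ (sgn k i • Z.act _ r x.2) = sgn k i • Z'.act _ r (c.f _ x.2)
    rw [map_smul, c.map_act]
  map_d {i j} e x := by
    refine Prod.ext (b.map_d e x.1) ?_
    have hcast : ∀ {i j : ℤ} (e : i = j) (z : Z.X i),
        c.f j (Z.castEq e z) = Z'.castEq e (c.f i z) := by
      intro i j e z; subst e; rfl
    change c.f _ (Z.castEq _ (p.f i x.1) - Z.d _ x.2) =
      Z'.castEq _ (p'.f i (b.f i x.1)) - Z'.d _ (c.f _ x.2)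
    rw [map_sub, hcast, c.map_d, ← comp_f p c, h, comp_f]

/-- The projection of the homotopy fibre to the source. -/
def fibreFst {Y Z : DGModule A} (p : Y ⟶ Z) : fibre p ⟶ Y where
  f n := LinearMap.fst k (Y.X n) (Z.X (n + -1))
  map_act _ _ _ := rfl
  map_d _ _ := rfl

lemma shiftToFibre_naturality {Y Z Y' Z' : DGModule A} {p : Y ⟶ Z} {p' : Y' ⟶ Z'} (b : Y ⟶ Y')
    (c : Z ⟶ Z') (h : p ≫ c = b ≫ p') :
    shiftToFibre p ≫ fibreMap b c h = shiftMap c (-1) ≫ shiftToFibre p' := by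
  refine hom_ext fun n x => ?_
  change (b.f n 0, c.f _ x) = (0, c.f _ x)
  rw [map_zero]

/-- A morphism of short exact sequences intertwines the extension classes. -/
lemma extClass_naturality {X Y Z X' Y' Z' : DGModule A} {i : X ⟶ Y} {p : Y ⟶ Z} {i' : X' ⟶ Y'}
    {p' : Y' ⟶ Z'} (hS : ShortExact i p) (hS' : ShortExact i' p') (a : X ⟶ X') (b : Y ⟶ Y')
    (c : Z ⟶ Z') (hab : i ≫ b = a ≫ i') (hbc : p ≫ c = b ≫ p') :
    extClass i p hS ≫ (toDerived A).map a =
      (toDerived A).map (shiftMap c (-1)) ≫ extClass i' p' hS' := by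
  have := toDerived_isIso hS.isQuasiIso
  have := toDerived_isIso hS'.isQuasiIso
  have h : toFibre i p hS.comp_zero ≫ fibreMap b c hbc = a ≫ toFibre i' p' hS'.comp_zero := by
    refine hom_ext fun n x => ?_
    change (b.f n (i.f n x), c.f _ 0) = (i'.f n (a.f n x), 0)
    rw [← comp_f, hab, comp_f, map_zero]
  have h₁ : (toDerived A).map (shiftMap c (-1)) ≫ (toDerived A).map (shiftToFibre p') =
      (toDerived A).map (shiftToFibre p) ≫ (toDerived A).map (fibreMap b c hbc) := by
    rw [← CategoryTheory.Functor.map_comp, ← CategoryTheory.Functor.map_comp,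
      shiftToFibre_naturality b c hbc]
  have h₂ : inv ((toDerived A).map (toFibre i p hS.comp_zero)) ≫ (toDerived A).map a =
      (toDerived A).map (fibreMap b c hbc) ≫
        inv ((toDerived A).map (toFibre i' p' hS'.comp_zero)) := by
    rw [IsIso.inv_comp_eq, ← Category.assoc, IsIso.eq_comp_inv, ← CategoryTheory.Functor.map_comp,
      ← CategoryTheory.Functor.map_comp, h]
  rw [extClass, extClass, Category.assoc, h₂, ← Category.assoc, ← Category.assoc, h₁]

lemma extClass_eq_zero_iff {X Y Z : DGModule A} {i : X ⟶ Y} {p : Y ⟶ Z} (hS : ShortExact i p) :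
    extClass i p hS = derivedZero _ _ ↔
      (toDerived A).map (shiftToFibre p) = derivedZero _ _ := by
  have := toDerived_isIso hS.isQuasiIso
  rw [extClass, IsIso.comp_inv_eq, derivedZero_comp_map]

/-- The extension class vanishes if the projection has a section in `D(A)`. -/
lemma extClass_eq_zero_of_section {X Y Z : DGModule A} {i : X ⟶ Y} {p : Y ⟶ Z}
    (hS : ShortExact i p) (s : (toDerived A).obj Z ⟶ (toDerived A).obj Y)
    (hs : s ≫ (toDerived A).map p = 𝟙 _) : extClass i p hS = derivedZero _ _ := by
  rw [extClass_eq_zero_iff]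
  let G : DGModule A ⥤ Derived A := shiftFunctor A (-1) ⋙ toDerived A
  have hG : (quasiIso A).IsInvertedBy G := fun X Y F hF => toDerived_isIso (IsQuasiIso.shift hF _)
  let L : Derived A ⥤ Derived A := Localization.lift G hG (toDerived A)
  let e : toDerived A ⋙ L ≅ G := Localization.fac G hG (toDerived A)
  have hs' : (e.inv.app Z ≫ L.map s ≫ e.hom.app Y) ≫ G.map p = 𝟙 _ := by
    have h₁ : e.hom.app Y ≫ G.map p = L.map ((toDerived A).map p) ≫ e.hom.app Z :=
      (e.hom.naturality p).symm
    rw [Category.assoc, Category.assoc, h₁, ← Category.assoc (L.map s), ← Functor.map_comp, hs,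
      CategoryTheory.Functor.map_id, Category.id_comp, Iso.inv_hom_id_app]
  have h₂ : G.map p ≫ (toDerived A).map (shiftToFibre p) = derivedZero (Y.shift (-1)) _ := by
    refine ((toDerived A).map_comp (shiftMap p (-1)) _).symm.trans ?_
    rw [← shiftToFibre_naturality (p := 𝟙 Y) (𝟙 Y) p rfl]
    exact toDerived_map_comp_of_isAcyclic (IsQuasiIso.isAcyclic_fibre (isQuasiIso_id Y)) _ _
  have h₃ : (toDerived A).map (shiftToFibre p) =
      (e.inv.app Z ≫ L.map s ≫ e.hom.app Y) ≫ G.map p ≫ (toDerived A).map (shiftToFibre p) := by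
    rw [← Category.assoc _ (G.map p), hs']
    exact (Category.id_comp _).symm
  rw [h₃, h₂]
  exact comp_derivedZero _

/-- If the extension class vanishes, then the inclusion has a retraction up to a
quasi-isomorphism. -/
lemma exists_retraction_of_extClass_eq_zero {X Y Z : DGModule A} {i : X ⟶ Y} {p : Y ⟶ Z}
    (hS : ShortExact i p) (h : extClass i p hS = derivedZero _ _) :
    ∃ (N : DGModule A) (F : Y ⟶ N), IsQuasiIso (i ≫ F) := by
  obtain ⟨N, t, ht, C, hC, c, e, hce⟩ :=
    exists_of_toDerived_map_eq ((extClass_eq_zero_iff hS).1 h)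
  -- `t` kills `Z[-1]` up to the acyclic module `C`, hence induces a map from `Y` to the cone of
  -- `C ⟶ N`
  have key : ∀ (n : ℤ) (z : Z.X (n + -1)), t.f n (0, z) = e.f n (c.f n z) := by
    intro n z
    refine (hce n z).trans ?_
    rw [comp_f, zeroHom_f, map_zero, zero_add]
  let F : Y ⟶ cone e :=
    { f := fun n => ((t.f n).comp (LinearMap.inl k (Y.X n) (Z.X (n + -1)))).prod
        (-(c.f (n + 1)).comp ((Z.castEq (by omega : n = n + 1 + -1)).comp (p.f n)))
      map_act := fun {l m n} h a x => by
        refine Prod.ext ?_ ?_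
        · refine Eq.trans ?_ (t.map_act h a (x, 0))
          change t.f n (Y.act h a x, 0) = t.f n (Y.act h a x, sgn k l • Z.act _ a 0)
          rw [map_zero, smul_zero]
        · change -c.f _ (Z.castEq _ (p.f n (Y.act h a x))) =
            sgn k l • C.act _ a (-c.f _ (Z.castEq _ (p.f m x)))
          rw [map_neg, ← c.map_act (by omega : l + (m + 1) = n + 1)]
          change _ = sgn k l • -c.f _ (sgn k (-1 * l) • Z.act _ a _)
          rw [map_smul, smul_neg, smul_smul, neg_one_mul, sgn_neg, sgn_mul_self, one_smul, p.map_act,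
            Z.act_castEq _ _ h (by omega)]
      map_d := fun {l m} h x => by
        subst h
        refine Prod.ext ?_ ?_
        · change t.f _ (Y.d rfl x, 0) = N.d rfl (t.f l (x, 0)) +
            e.f _ (-c.f _ (Z.castEq _ (p.f l x)))
          rw [← t.map_d, map_neg, ← key]
          refine Eq.trans (congrArg (t.f (l + 1)) (Prod.ext (sub_zero _).symm ?_))
            ((map_sub (t.f (l + 1)) _ _).trans (sub_eq_add_neg _ _))
          change 0 = Z.castEq _ (p.f l x) - Z.d _ 0 - Z.castEq _ (p.f l x)
          rw [map_zero, sub_zero, sub_self]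
        · change -c.f _ (Z.castEq _ (p.f (l + 1) (Y.d rfl x))) =
            -C.d _ (-c.f _ (Z.castEq _ (p.f l x)))
          rw [map_neg, ← c.map_d rfl]
          change _ = - -c.f _ (sgn k (-1) • Z.d _ (Z.castEq _ (p.f l x)))
          rw [Z.d_castEq _ _ rfl (by omega), p.map_d, sgn_neg, sgn_one, neg_one_smul, map_neg,
            neg_neg] }
  refine ⟨cone e, F, ?_⟩
  have hF : i ≫ F = toFibre i p hS.comp_zero ≫ t ≫ coneInl e := by
    refine hom_ext fun n x => Prod.ext rfl ?_
    change -c.f _ (Z.castEq _ (p.f n (i.f n x))) = 0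
    rw [hS.comp_zero, map_zero, map_zero, neg_zero]
  rw [hF]
  exact fun {_ _ _} hb hc => IsQuasiIso.comp hS.isQuasiIso (ht.comp (isQuasiIso_coneInl e hC)) hb hc

/-- If the inclusion has a retraction up to a quasi-isomorphism, then the extension class
vanishes. -/
lemma extClass_eq_zero_of_retraction {X Y Z N : DGModule A} {i : X ⟶ Y} {p : Y ⟶ Z}
    (hS : ShortExact i p) (F : Y ⟶ N) (hF : IsQuasiIso (i ≫ F)) :
    extClass i p hS = derivedZero _ _ := by
  -- the map `(y, z) ↦ F y` on the homotopy fibre kills `Z[-1]`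
  refine (extClass_eq_zero_iff hS).2 ?_
  have := toDerived_isIso hS.isQuasiIso
  have := toDerived_isIso hF
  have e : (toDerived A).map (fibreFst p ≫ F) =
      inv ((toDerived A).map (toFibre i p hS.comp_zero)) ≫ (toDerived A).map (i ≫ F) := by
    rw [IsIso.eq_inv_comp, ← CategoryTheory.Functor.map_comp]
    rfl
  have : IsIso ((toDerived A).map (fibreFst p ≫ F)) := by rw [e]; infer_instance
  rw [← cancel_mono ((toDerived A).map (fibreFst p ≫ F)), derivedZero_comp_map,
    ← CategoryTheory.Functor.map_comp, derivedZero]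
  refine congrArg _ (hom_ext fun n x => ?_)
  exact map_zero (F.f n)

/-- If the inclusion has a retraction up to a quasi-isomorphism, then the projection has a section
up to a quasi-isomorphism. -/
lemma exists_section_of_retraction {X Y Z N : DGModule A} {i : X ⟶ Y} {p : Y ⟶ Z}
    (hS : ShortExact i p) (F : Y ⟶ N) (hF : IsQuasiIso (i ≫ F)) :
    ∃ (W : DGModule A) (u : W ⟶ Y),
      (∀ n, Function.Surjective ((u ≫ p).f n)) ∧ IsQuasiIso (u ≫ p) := by
  refine ⟨fibre F, fibreFst F, fun n z => ?_, ?_⟩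
  · obtain ⟨y, rfl⟩ := hS.surj n z
    exact ⟨(y, 0), rfl⟩
  · -- the kernel is the homotopy fibre of the quasi-isomorphism `i ≫ F`
    have h : ShortExact (fibreMap (p := i ≫ F) (p' := F) i (𝟙 N) rfl) (fibreFst F ≫ p) := by
      refine ⟨fun n x y h => ?_, fun n w => ⟨fun hw => ?_, ?_⟩, fun n z => ?_⟩
      · exact Prod.ext (hS.inj n (congrArg Prod.fst h)) (congrArg (fun w => w.2) h)
      · obtain ⟨x, hx⟩ := (hS.exact n w.1).1 hw
        exact ⟨(x, w.2), Prod.ext hx rfl⟩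
      · rintro ⟨x, rfl⟩
        exact hS.comp_zero n x.1
      · obtain ⟨y, rfl⟩ := hS.surj n z
        exact ⟨(y, 0), rfl⟩
    exact fun {_ _ _} hb hc => h.isQuasiIso_right hF.isAcyclic_fibre hb hc

/-! ### Sections in the derived category -/

/-- The morphism `p` has a section in `D(A)`. -/
def HasDerivedSection {Y Z : DGModule A} (p : Y ⟶ Z) : Prop :=
  ∃ s : (toDerived A).obj Z ⟶ (toDerived A).obj Y, s ≫ (toDerived A).map p = 𝟙 _

lemma hasDerivedSection_of_isQuasiIso {W Y Z : DGModule A} (u : W ⟶ Y) (p : Y ⟶ Z)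
    (h : IsQuasiIso (u ≫ p)) : HasDerivedSection p := by
  have := toDerived_isIso h
  refine ⟨inv ((toDerived A).map (u ≫ p)) ≫ (toDerived A).map u, ?_⟩
  rw [Category.assoc, ← CategoryTheory.Functor.map_comp, IsIso.inv_hom_id]

/-- The extension class vanishes if and only if the projection has a section in `D(A)`. -/
lemma extClass_eq_zero_iff_hasDerivedSection {X Y Z : DGModule A} {i : X ⟶ Y} {p : Y ⟶ Z}
    (hS : ShortExact i p) : extClass i p hS = derivedZero _ _ ↔ HasDerivedSection p := by
  refine ⟨fun h => ?_, fun ⟨s, hs⟩ => extClass_eq_zero_of_section hS s hs⟩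
  obtain ⟨N, F, hF⟩ := exists_retraction_of_extClass_eq_zero hS h
  obtain ⟨W, u, -, hu⟩ := exists_section_of_retraction hS F hF
  exact hasDerivedSection_of_isQuasiIso u p hu

/-- A surjection with the same kernel as `p`, up to an isomorphism of the sources, has a section
in `D(A)` if and only if `p` does. -/
lemma hasDerivedSection_congr {Y Z Y' Z' : DGModule A} {p : Y ⟶ Z} {p' : Y' ⟶ Z'} (e : Y ⟶ Y')
    (he : ∀ n, Function.Bijective (e.f n)) (hp : ∀ n, Function.Surjective (p.f n))
    (hp' : ∀ n, Function.Surjective (p'.f n))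
    (h : ∀ n y, p.f n y = 0 ↔ p'.f n (e.f n y) = 0) :
    HasDerivedSection p ↔ HasDerivedSection p' := by
  have hw : ∀ n y y', p.f n y = p.f n y' → p'.f n (e.f n y) = p'.f n (e.f n y') := by
    intro n y y' hy
    rw [← sub_eq_zero, ← map_sub, ← map_sub, ← h, map_sub, hy, sub_self]
  have hs : ∀ n z, p.f n (Function.surjInv (hp n) z) = z := fun n =>
    Function.surjInv_eq (hp n)
  let c : Z ⟶ Z' :=
    { f := fun n =>
        { toFun := fun z => p'.f n (e.f n (Function.surjInv (hp n) z))
          map_add' := fun z z' => by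
            rw [← map_add, ← map_add]
            exact hw n _ _ (by rw [hs, map_add, hs, hs])
          map_smul' := fun c z => by
            rw [RingHom.id_apply, ← map_smul, ← map_smul]
            exact hw n _ _ (by rw [hs, map_smul, hs]) }
      map_act := fun {_ _ _} e' a z => by
        refine Eq.trans ?_ (p'.map_act e' a _)
        rw [← e.map_act]
        exact hw _ _ _ (by rw [hs, p.map_act, hs])
      map_d := fun {_ _} e' z => by
        refine Eq.trans ?_ (p'.map_d e' _)
        rw [← e.map_d]
        exact hw _ _ _ (by rw [hs, p.map_d, hs]) }
  have hc : p ≫ c = e ≫ p' := hom_ext fun n y => hw n _ _ (hs n _)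
  have hcb : ∀ n, Function.Bijective (c.f n) := by
    intro n
    constructor
    · refine (injective_iff_map_eq_zero (c.f n)).2 fun z hz => ?_
      rw [← hs n z]
      exact (h n _).2 hz
    · intro z
      obtain ⟨y', rfl⟩ := hp' n z
      obtain ⟨y, rfl⟩ := (he n).2 y'
      exact ⟨p.f n y, hw n _ _ (hs n _)⟩
  have := toDerived_isIso (isQuasiIso_of_bijective e he)
  have := toDerived_isIso (isQuasiIso_of_bijective c hcb)
  have hQ : (toDerived A).map p ≫ (toDerived A).map c =
      (toDerived A).map e ≫ (toDerived A).map p' := by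
    rw [← CategoryTheory.Functor.map_comp, hc, CategoryTheory.Functor.map_comp]
  constructor
  · rintro ⟨s, hs⟩
    refine ⟨inv ((toDerived A).map c) ≫ s ≫ (toDerived A).map e, ?_⟩
    rw [Category.assoc, Category.assoc, ← hQ, ← Category.assoc s, hs, Category.id_comp,
      IsIso.inv_hom_id]
  · rintro ⟨s, hs⟩
    refine ⟨(toDerived A).map c ≫ s ≫ inv ((toDerived A).map e), ?_⟩
    rw [← cancel_mono ((toDerived A).map c), Category.assoc, Category.assoc, Category.assoc, hQ,
      IsIso.inv_hom_id_assoc, hs, Category.comp_id, Category.id_comp]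

end DGModule

/-! ### Functoriality of tensor products -/

namespace DGBimodule

variable {K : DGBimodule A} {M N P : DGModule A}

variable (K M P) in
/-- Balanced bilinear maps `K × M ⟶ P` that are left `A`-linear and satisfy the Leibniz rule. -/
structure TensorData where
  f : ∀ {i j n : ℤ}, i + j = n → K.X i →ₗ[k] M.X j →ₗ[k] P.X n
  balanced : ∀ {i l j il lj n : ℤ} (hil : i + l = il) (hlj : l + j = lj) (h₁ : il + j = n)
    (h₂ : i + lj = n) (x : K.X i) (a : A.X l) (m : M.X j),
    f h₁ (K.ract hil x a) m = f h₂ x (M.act hlj a m)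
  act : ∀ {l i j li ij n : ℤ} (hli : l + i = li) (hij : i + j = ij) (h₁ : li + j = n)
    (h₂ : l + ij = n) (a : A.X l) (x : K.X i) (m : M.X j),
    f h₁ (K.act hli a x) m = P.act h₂ a (f hij x m)
  d : ∀ {i j n i' j' n' : ℤ} (h : i + j = n) (hi : i + 1 = i') (hj : j + 1 = j')
    (hn : n + 1 = n') (h₁ : i' + j = n') (h₂ : i + j' = n') (x : K.X i) (m : M.X j),
    P.d hn (f h x m) = f h₁ (K.d hi x) m + sgn k i • f h₂ x (M.d hj m)

/-- The linear map underlying `tensorHom`. -/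
noncomputable def TensorData.lift (T : TensorData K M P) (n : ℤ) : TensorX K M n →ₗ[k] P.X n :=
  tensorLift (fun _ _ h => T.f h) T.balanced

lemma TensorData.lift_tmul (T : TensorData K M P) {i j n : ℤ} (h : i + j = n) (x : K.X i)
    (m : M.X j) : T.lift n (tmul K M h x m) = T.f h x m :=
  tensorLift_tmul _ T.balanced h x m

/-- The morphism `K ⊗_A M ⟶ P`, `x ⊗ m ↦ T(x, m)`. -/
noncomputable def tensorHom (T : TensorData K M P) : K.tensor M ⟶ P where
  f := T.lift
  map_act {l j n} h a z := by
    induction z using tensor_induction with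
    | zero => simp only [map_zero]
    | add x y hx hy => simp only [map_add, hx, hy]
    | tmul hpq x m =>
    rename_i p q
    rw [tensorAct_tmul h hpq rfl (by omega), T.lift_tmul, T.lift_tmul]
    exact T.act rfl hpq _ h a x m
  map_d {i j} h z := by
    induction z using tensor_induction with
    | zero => simp only [map_zero]
    | add x y hx hy => simp only [map_add, hx, hy]
    | tmul hpq x m =>
    rename_i p q
    rw [tensorD_tmul h hpq rfl rfl (by omega) (by omega), map_add, map_smul, T.lift_tmul,
      T.lift_tmul, T.lift_tmul]
    exact (T.d hpq rfl rfl h _ _ x m).symm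

lemma tensorHom_tmul (T : TensorData K M P) {i j n : ℤ} (h : i + j = n) (x : K.X i) (m : M.X j) :
    (tensorHom T).f n (tmul K M h x m) = T.f h x m :=
  T.lift_tmul h x m

lemma tensor_hom_ext' {F G : K.tensor M ⟶ P}
    (h : ∀ {i j n : ℤ} (hij : i + j = n) (x : K.X i) (m : M.X j),
      F.f n (tmul K M hij x m) = G.f n (tmul K M hij x m)) : F = G :=
  DGModule.hom_ext fun _ z => LinearMap.congr_fun (tensor_hom_ext fun hij x m => h hij x m) z

variable (K) in
/-- The morphism `K ⊗_A F`. -/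
noncomputable def tensorMap (F : M ⟶ N) : K.tensor M ⟶ K.tensor N :=
  tensorHom
    { f := fun h => (tmul K N h).compl₂ (F.f _)
      balanced := fun hil hlj h₁ h₂ x a m => by
        rw [LinearMap.compl₂_apply, LinearMap.compl₂_apply, F.map_act, tmul_balanced hil hlj h₁ h₂]
      act := fun hli hij h₁ h₂ a x m => by
        rw [LinearMap.compl₂_apply, LinearMap.compl₂_apply, tensorAct_tmul h₂ hij hli h₁]
      d := fun h hi hj hn h₁ h₂ x m => by
        rw [LinearMap.compl₂_apply, LinearMap.compl₂_apply, LinearMap.compl₂_apply,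
          tensorD_tmul hn h hi hj h₁ h₂, F.map_d] }

lemma tensorMap_tmul (F : M ⟶ N) {i j n : ℤ} (h : i + j = n) (x : K.X i) (m : M.X j) :
    (tensorMap K F).f n (tmul K M h x m) = tmul K N h x (F.f j m) :=
  tensorHom_tmul _ h x m

lemma tensorMap_comp (F : M ⟶ N) (G : N ⟶ P) :
    tensorMap K (F ≫ G) = tensorMap K F ≫ tensorMap K G :=
  tensor_hom_ext' fun hij x m => by
    rw [DGModule.comp_f, tensorMap_tmul, tensorMap_tmul, tensorMap_tmul]; rfl

lemma tensorMap_surjective (F : M ⟶ N) (hF : ∀ n, Function.Surjective (F.f n)) (n : ℤ) :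
    Function.Surjective ((tensorMap K F).f n) := by
  intro z
  induction z using tensor_induction with
  | zero => exact ⟨0, map_zero _⟩
  | add x y hx hy =>
    obtain ⟨x, rfl⟩ := hx
    obtain ⟨y, rfl⟩ := hy
    exact ⟨x + y, map_add _ _ _⟩
  | tmul h x m =>
    obtain ⟨m, rfl⟩ := hF _ m
    exact ⟨tmul K M h x m, tensorMap_tmul F h x m⟩

/-! ### Exactness of tensoring with a module that has a dual basis -/

variable (K) in
/-- A finite homogeneous dual basis of the right module underlying a bimodule: homogeneous elements
`e s` and right linear forms `φ s` with `x = ∑ s, e s (φ s x)` for all `x`. Its existence means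
that the underlying graded right module is finitely generated and projective. -/
structure DualBasis where
  ι : Type
  [fintype : Fintype ι]
  deg : ι → ℤ
  e : ∀ s, K.X (deg s)
  φ : ∀ (s : ι) {i j : ℤ}, deg s + j = i → K.X i →ₗ[k] A.X j
  φ_ract : ∀ (s : ι) {i j l il jl : ℤ} (hi : deg s + j = i) (hil : i + l = il)
    (hil' : deg s + jl = il) (hjl : j + l = jl) (x : K.X i) (a : A.X l),
    φ s hil' (K.ract hil x a) = A.mul hjl (φ s hi x) a
  sum_eq : ∀ {i : ℤ} (x : K.X i),
    ∑ s, K.ract (by omega : deg s + (i - deg s) = i) (e s) (φ s (by omega) x) = x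

attribute [instance] DualBasis.fintype

namespace DualBasis

variable (B : DualBasis K)

lemma contract_balanced (M : DGModule A) (s : B.ι) {n m : ℤ} (h : B.deg s + m = n)
    {i l j il lj : ℤ} (hil : i + l = il) (hlj : l + j = lj) (h₁ : il + j = n) (_ : i + lj = n)
    (x : K.X i) (a : A.X l) (y : M.X j) :
    (M.act (by omega : il - B.deg s + j = m)).comp
      (B.φ s (by omega : B.deg s + (il - B.deg s) = il)) (K.ract hil x a) y =
    (M.act (by omega : i - B.deg s + lj = m)).comp
      (B.φ s (by omega : B.deg s + (i - B.deg s) = i)) x (M.act hlj a y) := by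
  rw [LinearMap.comp_apply, LinearMap.comp_apply,
    B.φ_ract s (by omega : B.deg s + (i - B.deg s) = i) hil (by omega) (by omega)]
  exact M.mul_act _ _ _ _ _ _ _

/-- The map `K ⊗_A M ⟶ M` induced by a linear form of a dual basis. -/
noncomputable def contract (M : DGModule A) (s : B.ι) {n m : ℤ} (h : B.deg s + m = n) :
    TensorX K M n →ₗ[k] M.X m :=
  tensorLift (fun i j hij => (M.act (by omega : i - B.deg s + j = m)).comp
      (B.φ s (by omega : B.deg s + (i - B.deg s) = i)))
    (B.contract_balanced M s h)

lemma contract_tmul (s : B.ι) {i j n m : ℤ} (h : B.deg s + m = n) (hij : i + j = n) (x : K.X i)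
    (y : M.X j) : B.contract M s h (tmul K M hij x y) =
      M.act (by omega) (B.φ s (by omega : B.deg s + (i - B.deg s) = i) x) y :=
  tensorLift_tmul _ (B.contract_balanced M s h) hij x y

lemma sum_contract {n : ℤ} (z : TensorX K M n) :
    ∑ s, tmul K M (by omega : B.deg s + (n - B.deg s) = n) (B.e s)
      (B.contract M s (by omega) z) = z := by
  induction z using tensor_induction with
  | zero => simp
  | add x y hx hy => simp only [map_add, Finset.sum_add_distrib, hx, hy]
  | tmul hpq x m =>
    rename_i i j
    conv_rhs => rw [← B.sum_eq x]
    rw [map_sum, LinearMap.sum_apply]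
    refine Finset.sum_congr rfl fun s _ => ?_
    rw [contract_tmul]
    exact (tmul_balanced (by omega : B.deg s + (i - B.deg s) = i)
      (by omega : i - B.deg s + j = n - B.deg s) hpq (by omega) (B.e s) _ m).symm

lemma contract_tensorMap (F : M ⟶ N) (s : B.ι) {n m : ℤ} (h : B.deg s + m = n)
    (z : TensorX K M n) :
    B.contract N s h ((tensorMap K F).f n z) = F.f m (B.contract M s h z) := by
  induction z using tensor_induction with
  | zero => simp only [map_zero]
  | add x y hx hy => simp only [map_add, hx, hy]
  | tmul hpq x m =>
    rw [tensorMap_tmul, contract_tmul, contract_tmul, F.map_act]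

lemma tensorMap_injective (B : DualBasis K) (F : M ⟶ N) (hF : ∀ n, Function.Injective (F.f n)) (n : ℤ) :
    Function.Injective ((tensorMap K F).f n) := by
  refine (injective_iff_map_eq_zero _).2 fun z hz => ?_
  rw [← B.sum_contract z]
  refine Finset.sum_eq_zero fun s _ => ?_
  rw [show B.contract M s _ z = 0 from hF _ ?_, map_zero]
  rw [← contract_tensorMap, hz, map_zero, map_zero]

lemma shortExact_tensorMap (B : DualBasis K) {X Y Z : DGModule A} {i : X ⟶ Y} {p : Y ⟶ Z}
    (h : DGModule.ShortExact i p) :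
    DGModule.ShortExact (tensorMap K i) (tensorMap K p) := by
  refine ⟨B.tensorMap_injective i h.inj, fun n z => ⟨fun hz => ?_, ?_⟩,
    tensorMap_surjective p h.surj⟩
  · have : ∀ s, ∃ x, i.f _ x = B.contract Y s (by omega : B.deg s + (n - B.deg s) = n) z :=
      fun s => (h.exact _ _).1 (by rw [← contract_tensorMap, hz, map_zero])
    choose x hx using this
    refine ⟨∑ s, tmul K X (by omega) (B.e s) (x s), ?_⟩
    rw [map_sum]
    conv_rhs => rw [← B.sum_contract z]
    refine Finset.sum_congr rfl fun s _ => ?_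
    rw [tensorMap_tmul, hx]
  · rintro ⟨x, rfl⟩
    induction x using tensor_induction with
    | zero => simp only [map_zero]
    | add x y hx hy => simp only [map_add, hx, hy, add_zero]
    | tmul hpq x m => rw [tensorMap_tmul, tensorMap_tmul, h.comp_zero, map_zero]

end DualBasis

end DGBimodule

namespace DGModule

/-! ### Perfect modules have dual bases -/

lemma symAct_apply {V : DGModule A} {i j n : ℤ} (h : i + j = n) (x : V.X i) (a : A.X j) :
    V.symAct h x a = sgn k (i * j) • V.act (by omega : j + i = n) a x := rfl

lemma map_symAct {V W : DGModule A} (f : ∀ n, V.X n →ₗ[k] W.X n)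
    (hf : ∀ {l i n : ℤ} (h : l + i = n) (a : A.X l) (x : V.X i),
      f n (V.act h a x) = W.act h a (f i x)) {i j n : ℤ} (h : i + j = n) (x : V.X i) (a : A.X j) :
    f n (V.symAct h x a) = W.symAct h (f i x) a := by
  rw [symAct_apply, symAct_apply, map_smul, hf]

lemma shift_symAct (V : DGModule A) (s : ℤ) {i j n : ℤ} (h : i + j = n) (x : V.X (i + s))
    (a : A.X j) :
    (V.shift s).symAct h x a = V.symAct (by omega : i + s + j = n + s) x a := by
  change sgn k (i * j) • sgn k (s * j) • V.act _ a x = sgn k ((i + s) * j) • V.act _ a x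
  rw [smul_smul, add_mul, sgn_add]

lemma symAct_castEq (V : DGModule A) {i i' j n : ℤ} (e : i = i') (h : i' + j = n) (x : V.X i)
    (a : A.X j) : V.symAct h (V.castEq e x) a = V.symAct (by omega) x a := by
  subst e; rfl

/-- An extension of graded modules whose last term is projective splits. -/
lemma ShortExact.exists_graded_splitting {X Y Z : DGModule A} {i : X ⟶ Y} {p : Y ⟶ Z}
    (h : ShortExact i p) (hZ : IsGradedProjective Z) :
    ∃ (σ : ∀ n, Z.X n →ₗ[k] Y.X n) (r : ∀ n, Y.X n →ₗ[k] X.X n),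
      (∀ {l j n : ℤ} (e : l + j = n) (a : A.X l) (z : Z.X j),
        σ n (Z.act e a z) = Y.act e a (σ j z)) ∧
      (∀ {l j n : ℤ} (e : l + j = n) (a : A.X l) (y : Y.X j),
        r n (Y.act e a y) = X.act e a (r j y)) ∧
      (∀ n y, i.f n (r n y) + σ n (p.f n y) = y) ∧ (∀ n x, r n (i.f n x) = x) := by
  obtain ⟨σ, hσ, hσp⟩ := hZ Y Z p.f p.map_act h.surj 0 (fun a b e => Z.castEq (by omega))
    (by
      intro l i j n m h hi hn h' a v
      obtain rfl : i = j := by omega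
      obtain rfl : n = m := by omega
      rw [zero_mul, sgn_zero, one_smul]; rfl)
  have hσ1 : ∀ {n : ℤ} (z : Z.X n), p.f n (σ n n (zero_add n) z) = z := fun z => hσp _ _ _ z
  have hσ2 : ∀ {l i n : ℤ} (h : l + i = n) (a : A.X l) (z : Z.X i),
      σ n n (zero_add n) (Z.act h a z) = Y.act h a (σ i i (zero_add i) z) := by
    intro l i n h a z
    rw [hσ h (zero_add i) (zero_add n) h, zero_mul, sgn_zero, one_smul]
  have hr : ∀ n, ∃ r : Y.X n →ₗ[k] X.X n, ∀ y,
      i.f n (r y) = y - σ n n (zero_add n) (p.f n y) := by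
    intro n
    have hm : ∀ y, y - σ n n (zero_add n) (p.f n y) ∈ LinearMap.range (i.f n) := fun y =>
      (h.exact n _).1 (by rw [map_sub, hσ1, sub_self])
    refine ⟨(LinearEquiv.ofInjective (i.f n) (h.inj n)).symm.toLinearMap.comp
      (LinearMap.codRestrict (LinearMap.range (i.f n))
        (LinearMap.id - (σ n n (zero_add n)).comp (p.f n)) hm), fun y => ?_⟩
    exact LinearEquiv.ofInjective_symm_apply (f := i.f n) (h := h.inj n) ⟨_, hm y⟩
  choose r hr using hr
  refine ⟨fun n => σ n n (zero_add n), r, hσ2, fun e a y => h.inj _ ?_, fun n y => ?_,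
    fun n x => h.inj _ ?_⟩
  · rw [hr, i.map_act, hr, p.map_act, hσ2, map_sub]
  · rw [hr, sub_add_cancel]
  · rw [hr, h.comp_zero, map_zero, sub_zero]

/-- The dual basis `{1}` of `A`. -/
def dualBasisSelf : (self A).sym.DualBasis where
  ι := Unit
  deg _ := 0
  e _ := A.one
  φ _ _ _ h := (self A).castEq (by omega)
  φ_ract _ {i j l il jl} hi hil hil' hjl x a := by
    obtain rfl : i = j := by omega
    obtain rfl : il = jl := by omega
    exact (A.mul_comm hjl (by omega) x a).symm
  sum_eq {i} x := by
    rw [Fintype.sum_unique]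
    change sgn k (0 * (i - 0)) • A.mul _ ((self A).castEq _ x) A.one = x
    rw [zero_mul, sgn_zero, one_smul]
    have : ∀ {j : ℤ} (e : i = j) (h : j + 0 = i), A.mul h ((self A).castEq e x) A.one = x := by
      rintro j rfl h
      exact CDGA.mul_one h x
    exact this _ _

lemma symAct_φ_congr {V : DGModule A} (B : V.sym.DualBasis) (s : B.ι) {i j j' n : ℤ} (e : j = j')
    (h : B.deg s + j = i) (h' : B.deg s + j = n) (x : V.X i) :
    V.symAct h' (B.e s) (B.φ s h x) =
      V.symAct (by omega : B.deg s + j' = n) (B.e s) (B.φ s (by omega) x) := by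
  subst e; rfl

/-- The dual basis of a shift. -/
def dualBasisShift {V : DGModule A} (B : V.sym.DualBasis) (t : ℤ) :
    (V.shift t).sym.DualBasis where
  ι := B.ι
  deg s := B.deg s - t
  e s := V.castEq (by omega : B.deg s = B.deg s - t + t) (B.e s)
  φ s i j h := B.φ s (by omega : B.deg s + j = i + t)
  φ_ract s {i j l il jl} hi hil hil' hjl x a := by
    change B.φ s _ ((V.shift t).symAct hil x a) = _
    rw [shift_symAct]
    exact B.φ_ract s (by omega : B.deg s + j = i + t) (by omega) (by omega) hjl x a
  sum_eq {i} x := by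
    conv_rhs => rw [← B.sum_eq x]
    refine Finset.sum_congr rfl fun s _ => ?_
    change (V.shift t).symAct (by omega) (V.castEq (by omega) (B.e s)) (B.φ s (by omega) x) = _
    rw [shift_symAct, symAct_castEq]
    exact symAct_φ_congr B s (by omega : i - (B.deg s - t) = i + t - B.deg s) (by omega) (by omega) x

/-- The dual basis of a direct summand. -/
def dualBasisRetract {V W : DGModule A} (B : W.sym.DualBasis) (i : V ⟶ W) (p : W ⟶ V)
    (h : i ≫ p = 𝟙 V) : V.sym.DualBasis where
  ι := B.ι
  deg := B.deg
  e s := p.f _ (B.e s)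
  φ s m _ h := (B.φ s h).comp (i.f m)
  φ_ract s {_ _ _ _ _} hi hil hil' hjl x a := by
    rw [LinearMap.comp_apply, map_symAct i.f i.map_act]
    exact B.φ_ract s hi hil hil' hjl _ a
  sum_eq {m} x := by
    have hx : p.f m (i.f m x) = x := by rw [← comp_f, h, id_f]
    conv_rhs => rw [← hx, ← B.sum_eq (i.f m x), map_sum]
    exact Finset.sum_congr rfl fun s _ => (map_symAct p.f p.map_act (by omega) _ _).symm

/-- The dual basis of a split extension. -/
lemma nonempty_dualBasis_ext {X Y Z : DGModule A} {i : X ⟶ Y} {p : Y ⟶ Z} (h : ShortExact i p)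
    (hZ : IsGradedProjective Z) (B : X.sym.DualBasis) (C : Z.sym.DualBasis) :
    Nonempty Y.sym.DualBasis := by
  obtain ⟨σ, r, hσ, hr, hσr, -⟩ := h.exists_graded_splitting hZ
  refine ⟨{
    ι := B.ι ⊕ C.ι
    deg := Sum.elim B.deg C.deg
    e := Sum.rec (fun s => i.f _ (B.e s)) (fun s => σ _ (C.e s))
    φ := fun s {m _} => Sum.rec (motive := fun s => ∀ {m j : ℤ},
      Sum.elim B.deg C.deg s + j = m → Y.X m →ₗ[k] A.X j)
      (fun s m _ e => (B.φ s e).comp (r m)) (fun s m _ e => (C.φ s e).comp (p.f m)) s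
    φ_ract := ?_
    sum_eq := ?_ }⟩
  · rintro (s | s) _ _ _ _ _ hi hil hil' hjl x a
    · change B.φ s _ (r _ (Y.symAct hil x a)) = A.mul hjl (B.φ s _ (r _ x)) a
      rw [map_symAct r hr]
      exact B.φ_ract s hi hil hil' hjl _ a
    · change C.φ s _ (p.f _ (Y.symAct hil x a)) = A.mul hjl (C.φ s _ (p.f _ x)) a
      rw [map_symAct p.f p.map_act]
      exact C.φ_ract s hi hil hil' hjl _ a
  · intro m y
    rw [Fintype.sum_sum_type]
    conv_rhs => rw [← hσr m y, ← B.sum_eq (r m y), ← C.sum_eq (p.f m y), map_sum, map_sum]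
    congr 1
    · exact Finset.sum_congr rfl fun s _ => (map_symAct i.f i.map_act (by omega) _ _).symm
    · exact Finset.sum_congr rfl fun s _ => (map_symAct σ hσ (by omega) _ _).symm

lemma IsPerfect.nonempty_dualBasis {V : DGModule A} (hV : V.IsPerfect) :
    Nonempty V.sym.DualBasis := by
  induction hV with
  | self => exact ⟨dualBasisSelf⟩
  | shift V s _ ih => exact ih.map fun B => dualBasisShift B s
  | ext i p h _ hZ ihX ihZ =>
    obtain ⟨B⟩ := ihX
    obtain ⟨C⟩ := ihZ
    exact nonempty_dualBasis_ext h hZ.isGradedProjective B C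
  | retract i p h _ ih => exact ih.map fun B => dualBasisRetract B i p h

/-! ### Tensoring with a perfect module preserves quasi-isomorphisms -/

lemma tensorLeftFun_balanced {V W : DGModule A} (N : DGModule A) (f : ∀ n, V.X n →ₗ[k] W.X n)
    (hf : ∀ {l i n : ℤ} (h : l + i = n) (a : A.X l) (x : V.X i),
      f n (V.act h a x) = W.act h a (f i x)) {n i l j il lj : ℤ} (hil : i + l = il)
    (hlj : l + j = lj) (h₁ : il + j = n) (h₂ : i + lj = n) (x : V.X i) (a : A.X l) (m : N.X j) :
    (W.sym.tmul N h₁).comp (f il) (V.symAct hil x a) m =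
      (W.sym.tmul N h₂).comp (f i) x (N.act hlj a m) := by
  rw [LinearMap.comp_apply, LinearMap.comp_apply, map_symAct f hf]
  exact DGBimodule.tmul_balanced (K := W.sym) hil hlj h₁ h₂ (f _ x) a m

/-- The map `V ⊗_A N ⟶ W ⊗_A N` induced by a graded linear map `V ⟶ W`, not necessarily compatible
with the differentials. -/
noncomputable def tensorLeftFun {V W : DGModule A} (N : DGModule A) (f : ∀ n, V.X n →ₗ[k] W.X n)
    (hf : ∀ {l i n : ℤ} (h : l + i = n) (a : A.X l) (x : V.X i),
      f n (V.act h a x) = W.act h a (f i x)) (n : ℤ) :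
    V.sym.TensorX N n →ₗ[k] W.sym.TensorX N n :=
  DGBimodule.tensorLift (K := V.sym) (fun i _ h => (W.sym.tmul N h).comp (f i))
    (tensorLeftFun_balanced N f hf)

lemma tensorLeftFun_tmul {V W : DGModule A} (N : DGModule A) (f : ∀ n, V.X n →ₗ[k] W.X n)
    (hf : ∀ {l i n : ℤ} (h : l + i = n) (a : A.X l) (x : V.X i),
      f n (V.act h a x) = W.act h a (f i x)) {i j n : ℤ} (h : i + j = n) (x : V.X i) (m : N.X j) :
    tensorLeftFun N f hf n (V.sym.tmul N h x m) = W.sym.tmul N h (f i x) m :=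
  DGBimodule.tensorLift_tmul (K := V.sym) _ (tensorLeftFun_balanced N f hf) h x m

/-- The morphism `V ⊗_A N ⟶ W ⊗_A N` induced by a morphism `V ⟶ W`. -/
noncomputable def tensorLeft {V W : DGModule A} (F : V ⟶ W) (N : DGModule A) :
    V.sym.tensor N ⟶ W.sym.tensor N where
  f := tensorLeftFun N F.f F.map_act
  map_act {i j n} h a z := by
    induction z using DGBimodule.tensor_induction with
    | zero => simp only [map_zero]
    | add x y hx hy => simp only [map_add, hx, hy]
    | tmul hpq x m =>
    rename_i p q
    rw [DGBimodule.tensorAct_tmul (K := V.sym) h hpq rfl (by omega), tensorLeftFun_tmul,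
      tensorLeftFun_tmul, DGBimodule.tensorAct_tmul (K := W.sym) h hpq rfl (by omega)]
    exact congrArg (fun y => W.sym.tmul N _ y m) (F.map_act rfl a x)
  map_d {i j} h z := by
    induction z using DGBimodule.tensor_induction with
    | zero => simp only [map_zero]
    | add x y hx hy => simp only [map_add, hx, hy]
    | tmul hpq x m =>
    rename_i p q
    rw [DGBimodule.tensorD_tmul (K := V.sym) h hpq rfl rfl (by omega) (by omega), map_add,
      map_smul, tensorLeftFun_tmul, tensorLeftFun_tmul, tensorLeftFun_tmul,
      DGBimodule.tensorD_tmul (K := W.sym) h hpq rfl rfl (by omega) (by omega), F.map_d]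

lemma tensorLeft_tmul {V W : DGModule A} (F : V ⟶ W) (N : DGModule A) {i j n : ℤ} (h : i + j = n)
    (x : V.X i) (m : N.X j) :
    (tensorLeft F N).f n (V.sym.tmul N h x m) = W.sym.tmul N h (F.f i x) m :=
  tensorLeftFun_tmul N F.f F.map_act h x m

lemma IsAcyclic.of_bijective {M N : DGModule A} (hN : N.IsAcyclic) (F : M ⟶ N)
    (hF : ∀ n, Function.Bijective (F.f n)) : M.IsAcyclic := by
  intro a b c hb hc x hx
  obtain ⟨y, hy⟩ := hN hb hc (F.f b x) (by rw [← F.map_d, hx, map_zero])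
  obtain ⟨y, rfl⟩ := (hF a).2 y
  exact ⟨y, (hF b).1 (by rw [F.map_d, hy])⟩

lemma shortExact_tensorLeft {X Y Z : DGModule A} {i : X ⟶ Y} {p : Y ⟶ Z} (h : ShortExact i p)
    (hZ : IsGradedProjective Z) (N : DGModule A) :
    ShortExact (tensorLeft i N) (tensorLeft p N) := by
  obtain ⟨σ, r, hσ, hr, hσr, hri⟩ := h.exists_graded_splitting hZ
  refine ⟨fun n => ?_, fun n z => ⟨fun hz => ?_, ?_⟩, fun n z => ?_⟩
  · refine Function.LeftInverse.injective (g := tensorLeftFun N r hr n) fun z => ?_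
    induction z using DGBimodule.tensor_induction with
    | zero => simp only [map_zero]
    | add x y hx hy => simp only [map_add, hx, hy]
    | tmul hpq x m => rw [tensorLeft_tmul, tensorLeftFun_tmul, hri]
  · have key : ∀ z, (tensorLeft i N).f n (tensorLeftFun N r hr n z) +
        tensorLeftFun N σ hσ n ((tensorLeft p N).f n z) = z := by
      intro z
      induction z using DGBimodule.tensor_induction with
      | zero => simp only [map_zero, add_zero]
      | add x y hx hy =>
        conv_rhs => rw [← hx, ← hy]
        simp only [map_add]
        abel
      | tmul hpq x m =>
        rw [tensorLeft_tmul, tensorLeftFun_tmul, tensorLeft_tmul, tensorLeftFun_tmul,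
          ← LinearMap.add_apply, ← map_add, hσr]
    refine ⟨tensorLeftFun N r hr n z, ?_⟩
    conv_rhs => rw [← key z, hz, map_zero, add_zero]
  · rintro ⟨x, rfl⟩
    induction x using DGBimodule.tensor_induction with
    | zero => simp only [map_zero]
    | add x y hx hy => simp only [map_add, hx, hy, add_zero]
    | tmul hpq x m =>
      rw [tensorLeft_tmul, tensorLeft_tmul, h.comp_zero, map_zero, LinearMap.zero_apply]
  · induction z using DGBimodule.tensor_induction with
    | zero => exact ⟨0, map_zero _⟩
    | add x y hx hy =>
      obtain ⟨x, rfl⟩ := hx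
      obtain ⟨y, rfl⟩ := hy
      exact ⟨x + y, map_add _ _ _⟩
    | tmul hpq x m =>
      obtain ⟨y, rfl⟩ := h.surj _ x
      exact ⟨Y.sym.tmul N hpq y m, tensorLeft_tmul p N hpq y m⟩

/-- The morphism `V[s] ⊗_A N ⟶ (V ⊗_A N)[s]`, `x ⊗ m ↦ x ⊗ m`. -/
noncomputable def shiftTensor (V N : DGModule A) (s : ℤ) :
    (V.shift s).sym.tensor N ⟶ (V.sym.tensor N).shift s :=
  DGBimodule.tensorHom (K := (V.shift s).sym) (P := (V.sym.tensor N).shift s)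
    { f := fun {i j n} h => V.sym.tmul N (by omega : i + s + j = n + s)
      balanced := fun {i l j il lj n} hil hlj h₁ h₂ x a m => by
        change V.sym.tmul N _ ((V.shift s).symAct hil x a) m = _
        rw [shift_symAct]
        exact DGBimodule.tmul_balanced (K := V.sym) (by omega : i + s + l = il + s) hlj
          (by omega) (by omega) x a m
      act := fun {l i j li ij n} hli hij h₁ h₂ a x m => by
        change V.sym.tmul N _ (sgn k (s * l) • V.act (by omega : l + (i + s) = li + s) a x) m =
          sgn k (s * l) • DGBimodule.tensorAct V.sym N (by omega : l + (ij + s) = n + s) a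
            (V.sym.tmul N (by omega : i + s + j = ij + s) x m)
        rw [DGBimodule.tensorAct_tmul (K := V.sym) (by omega) (by omega)
          (by omega : l + (i + s) = li + s) (by omega), map_smul, LinearMap.smul_apply]
      d := fun {i j n i' j' n'} h hi hj hn h₁ h₂ x m => by
        change sgn k s • DGBimodule.tensorD V.sym N (by omega : n + s + 1 = n' + s)
            (V.sym.tmul N (by omega : i + s + j = n + s) x m) =
          V.sym.tmul N (by omega : i' + s + j = n' + s) (sgn k s • V.d (by omega) x) m +
            sgn k i • V.sym.tmul N (by omega : i + s + j' = n' + s) x (N.d hj m)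
        rw [DGBimodule.tensorD_tmul (K := V.sym) (by omega) (by omega)
          (by omega : i + s + 1 = i' + s) hj (by omega) (by omega), smul_add, smul_smul, sgn_add,
          mul_comm (sgn k i), ← mul_assoc, sgn_mul_self, one_mul, map_smul,
          LinearMap.smul_apply] }

lemma shiftTensor_tmul (V N : DGModule A) (s : ℤ) {i j n : ℤ} (h : i + j = n) (x : V.X (i + s))
    (m : N.X j) : (shiftTensor V N s).f n ((V.shift s).sym.tmul N h x m) =
      V.sym.tmul N (by omega : i + s + j = n + s) x m :=
  DGBimodule.tensorHom_tmul (K := (V.shift s).sym) (P := (V.sym.tensor N).shift s) _ h x m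

lemma castEq_symAct (V : DGModule A) {i j n n' : ℤ} (e : n = n') (h : i + j = n) (x : V.X i)
    (a : A.X j) : V.castEq e (V.symAct h x a) = V.symAct (by omega) x a := by
  subst e; rfl

lemma unshiftTensor_balanced (V N : DGModule A) (s : ℤ) {n i l j il lj : ℤ} (hil : i + l = il)
    (hlj : l + j = lj) (h₁ : il + j = n + s) (_ : i + lj = n + s) (x : V.X i) (a : A.X l)
    (m : N.X j) :
    ((V.shift s).sym.tmul N (by omega : il - s + j = n)).comp
      (V.castEq (by omega : il = il - s + s)) (V.symAct hil x a) m =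
    ((V.shift s).sym.tmul N (by omega : i - s + lj = n)).comp
      (V.castEq (by omega : i = i - s + s)) x (N.act hlj a m) := by
  rw [LinearMap.comp_apply, LinearMap.comp_apply]
  have e : V.castEq (by omega : il = il - s + s) (V.symAct hil x a) =
      (V.shift s).symAct (by omega : i - s + l = il - s)
        (V.castEq (by omega : i = i - s + s) x) a := by
    rw [shift_symAct, symAct_castEq, castEq_symAct]
  rw [e]
  exact DGBimodule.tmul_balanced (K := (V.shift s).sym) (by omega : i - s + l = il - s) hlj
    (by omega) (by omega) _ a m

/-- The inverse of `shiftTensor`. -/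
noncomputable def unshiftTensor (V N : DGModule A) (s n : ℤ) :
    V.sym.TensorX N (n + s) →ₗ[k] (V.shift s).sym.TensorX N n :=
  DGBimodule.tensorLift (K := V.sym)
    (fun i j h => ((V.shift s).sym.tmul N (by omega : i - s + j = n)).comp
      (V.castEq (by omega : i = i - s + s)))
    (unshiftTensor_balanced V N s)

lemma unshiftTensor_tmul (V N : DGModule A) (s : ℤ) {i j n : ℤ} (h : i + j = n + s) (x : V.X i)
    (m : N.X j) : unshiftTensor V N s n (V.sym.tmul N h x m) =
      (V.shift s).sym.tmul N (by omega : i - s + j = n)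
        (V.castEq (by omega : i = i - s + s) x) m :=
  DGBimodule.tensorLift_tmul (K := V.sym) _ (unshiftTensor_balanced V N s) h x m

lemma shift_tmul_castEq (V N : DGModule A) (s : ℤ) {i i' j n : ℤ} (e : i = i') (h : i + j = n)
    (x : V.X (i + s)) (m : N.X j) : (V.shift s).sym.tmul N (by omega : i' + j = n)
      (V.castEq (by omega : i + s = i' + s) x) m = (V.shift s).sym.tmul N h x m := by
  subst e; rfl

lemma shiftTensor_bijective (V N : DGModule A) (s n : ℤ) :
    Function.Bijective ((shiftTensor V N s).f n) := by
  constructor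
  · refine Function.LeftInverse.injective (g := unshiftTensor V N s n) fun z => ?_
    induction z using DGBimodule.tensor_induction with
    | zero => rw [map_zero]; exact map_zero _
    | add x y hx hy =>
      rw [map_add]
      exact (map_add (unshiftTensor V N s n) _ _).trans (congrArg₂ _ hx hy)
    | tmul hpq x m =>
      rw [shiftTensor_tmul]
      refine (unshiftTensor_tmul V N s _ x m).trans ?_
      exact shift_tmul_castEq V N s (by omega) hpq x m
  · intro z
    change V.sym.TensorX N (n + s) at z
    induction z using DGBimodule.tensor_induction with
    | zero => exact ⟨0, map_zero _⟩
    | add x y hx hy =>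
      obtain ⟨x, rfl⟩ := hx
      obtain ⟨y, rfl⟩ := hy
      exact ⟨x + y, map_add _ _ _⟩
    | tmul hpq x m =>
      rename_i i j
      obtain ⟨i, rfl⟩ : ∃ i', i = i' + s := ⟨i - s, by omega⟩
      exact ⟨(V.shift s).sym.tmul N (by omega) x m, shiftTensor_tmul V N s (by omega) x m⟩

/-- The morphism `A ⊗_A N ⟶ N`, `a ⊗ m ↦ a m`. -/
noncomputable def selfTensor (N : DGModule A) : (self A).sym.tensor N ⟶ N :=
  DGBimodule.tensorHom (K := (self A).sym)
    { f := N.act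
      balanced := fun {i l j il lj n} hil hlj h₁ h₂ x a m => by
        have e : (self A).sym.ract hil x a = A.mul hil x a :=
          (A.mul_comm hil (by omega) x a).symm
        rw [e]
        exact N.mul_act hil hlj h₁ h₂ x a m
      act := fun hli hij h₁ h₂ a x m => N.mul_act hli hij h₁ h₂ a x m
      d := fun h hi hj hn h₁ h₂ x m => N.d_act h hi hj hn h₁ h₂ x m }

lemma selfTensor_tmul (N : DGModule A) {i j n : ℤ} (h : i + j = n) (a : A.X i) (m : N.X j) :
    (selfTensor N).f n ((self A).sym.tmul N h a m) = N.act h a m :=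
  DGBimodule.tensorHom_tmul (K := (self A).sym) _ h a m

lemma selfTensor_bijective (N : DGModule A) (n : ℤ) :
    Function.Bijective ((selfTensor N).f n) := by
  refine ⟨?_, fun m => ⟨(self A).sym.tmul N (zero_add n) A.one m, ?_⟩⟩
  · refine Function.LeftInverse.injective (g := (self A).sym.tmul N (zero_add n) A.one)
      fun z => ?_
    induction z using DGBimodule.tensor_induction with
    | zero => simp only [map_zero]
    | add x y hx hy => simp only [map_add, hx, hy]
    | tmul hpq x m =>
      rename_i i j
      rw [selfTensor_tmul]
      refine (DGBimodule.tmul_balanced (K := (self A).sym) (zero_add i) hpq hpq (zero_add n)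
        A.one x m).symm.trans ?_
      have : (self A).sym.ract (zero_add i) A.one x = x := by
        change sgn k (0 * i) • A.mul _ x A.one = x
        rw [CDGA.mul_one, zero_mul, sgn_zero, one_smul]
      rw [this]
  · rw [selfTensor_tmul, N.one_act]

lemma IsPerfect.isAcyclic_tensor {V : DGModule A} (hV : V.IsPerfect) {N : DGModule A}
    (hN : N.IsAcyclic) : (V.sym.tensor N).IsAcyclic := by
  induction hV with
  | self => exact IsAcyclic.of_bijective hN (selfTensor N) (selfTensor_bijective N)
  | shift V s _ ih =>
    exact IsAcyclic.of_bijective (IsAcyclic.shift ih s) (shiftTensor V N s)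
      (shiftTensor_bijective V N s)
  | ext i p h _ hZ ihX ihZ =>
    exact (shortExact_tensorLeft h hZ.isGradedProjective N).isAcyclic_middle ihX ihZ
  | retract i p h _ ih =>
    refine ih.of_retract (tensorLeft i N) (tensorLeft p N) ?_
    refine DGBimodule.tensor_hom_ext' fun hij x m => ?_
    rw [comp_f, tensorLeft_tmul, tensorLeft_tmul, ← comp_f, h, id_f, id_f]

lemma IsPerfect.isQuasiIso_tensorMap_of_surjective {V : DGModule A} (hV : V.IsPerfect)
    {M N : DGModule A} (F : M ⟶ N) (hs : ∀ n, Function.Surjective (F.f n)) (hF : IsQuasiIso F) :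
    IsQuasiIso (V.sym.tensorMap F) := by
  obtain ⟨B⟩ := hV.nonempty_dualBasis
  have h := shortExact_ker F hs
  exact fun {_ _ _} hb hc => (B.shortExact_tensorMap h).isQuasiIso_right
    (hV.isAcyclic_tensor (h.isAcyclic_left hF)) hb hc

lemma IsPerfect.isQuasiIso_tensorMap_of_injective {V : DGModule A} (hV : V.IsPerfect)
    {M N : DGModule A} (F : M ⟶ N) (hi : ∀ n, Function.Injective (F.f n)) (hF : IsQuasiIso F) :
    IsQuasiIso (V.sym.tensorMap F) := by
  obtain ⟨B⟩ := hV.nonempty_dualBasis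
  have h := shortExact_range F hi
  exact fun {_ _ _} hb hc => (B.shortExact_tensorMap h).isQuasiIso_left
    (hV.isAcyclic_tensor (h.isAcyclic_right hF)) hb hc

end DGModule

/-! ### Sequential colimits of dg modules -/

section SeqColim

variable {E : ℕ → Type u} [∀ p, AddCommGroup (E p)] [∀ p, Module k (E p)]
  (ι : ∀ p, E p →ₗ[k] E (p + 1))

/-- The relations identifying `x` with `ι x` in the direct sum of a sequence of vector spaces. -/
def seqColimRel : Submodule k (DirectSum ℕ E) :=
  Submodule.span k {z | ∃ (p : ℕ) (x : E p),
    z = DirectSum.lof k ℕ E (p + 1) (ι p x) - DirectSum.lof k ℕ E p x}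

/-- The colimit of a sequence of vector spaces. -/
abbrev SeqColim : Type u := DirectSum ℕ E ⧸ seqColimRel ι

namespace SeqColim

/-- The canonical map `E p ⟶ colim E`. -/
def of (p : ℕ) : E p →ₗ[k] SeqColim ι := (seqColimRel ι).mkQ.comp (DirectSum.lof k ℕ E p)

lemma of_succ (p : ℕ) (x : E p) : of ι (p + 1) (ι p x) = of ι p x :=
  (Submodule.Quotient.eq _).2 (Submodule.subset_span ⟨p, x, rfl⟩)

variable {ι} {Y : Type*} [AddCommGroup Y] [Module k Y]

/-- The map out of a sequential colimit defined by a cocone. -/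
def lift (f : ∀ p, E p →ₗ[k] Y) (hf : ∀ p x, f (p + 1) (ι p x) = f p x) : SeqColim ι →ₗ[k] Y :=
  (seqColimRel ι).liftQ (DirectSum.toModule k ℕ Y f) <| by
    rw [seqColimRel, Submodule.span_le]
    rintro _ ⟨p, x, rfl⟩
    rw [SetLike.mem_coe, LinearMap.mem_ker, map_sub, DirectSum.toModule_lof,
      DirectSum.toModule_lof, hf, sub_self]

lemma lift_of (f : ∀ p, E p →ₗ[k] Y) (hf : ∀ p x, f (p + 1) (ι p x) = f p x) (p : ℕ) (x : E p) :
    lift f hf (of ι p x) = f p x :=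
  DirectSum.toModule_lof k p x

lemma hom_ext {f g : SeqColim ι →ₗ[k] Y} (h : ∀ p x, f (of ι p x) = g (of ι p x)) : f = g := by
  apply Submodule.linearMap_qext
  apply DirectSum.linearMap_ext
  intro p
  ext x
  exact h p x

lemma induction {P : SeqColim ι → Prop} (zero : P 0) (add : ∀ x y, P x → P y → P (x + y))
    (of : ∀ p x, P (SeqColim.of ι p x)) (z : SeqColim ι) : P z := by
  obtain ⟨z, rfl⟩ := Submodule.Quotient.mk_surjective _ z
  induction z using DirectSum.induction_on with
  | zero => exact zero
  | add x y hx hy => exact add _ _ hx hy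
  | of p x => exact of p x

end SeqColim

/-- If the transition maps are injective, then over a field each term `E N` is a retract of the
sequence. -/
lemma exists_cocone_retraction (N : ℕ) : ∀ (E : ℕ → Type u) [∀ p, AddCommGroup (E p)]
    [∀ p, Module k (E p)] (ι : ∀ p, E p →ₗ[k] E (p + 1)),
    (∀ p, Function.Injective (ι p)) →
    ∃ g : ∀ p, E p →ₗ[k] E N, (∀ p x, g (p + 1) (ι p x) = g p x) ∧ ∀ x, g N x = x := by
  induction N with
  | zero =>
    intro E _ _ ι hι
    have hr : ∀ p, ∃ r : E (p + 1) →ₗ[k] E p, r ∘ₗ ι p = LinearMap.id := fun p =>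
      (ι p).exists_leftInverse_of_injective (LinearMap.ker_eq_bot.2 (hι p))
    choose r hr using hr
    refine ⟨fun p => Nat.rec LinearMap.id (fun q g => g.comp (r q)) p, fun p x => ?_, fun x => rfl⟩
    exact congrArg _ (LinearMap.congr_fun (hr p) x)
  | succ N ih =>
    intro E _ _ ι hι
    obtain ⟨g, hg, hN⟩ := ih (fun p => E (p + 1)) (fun p => ι (p + 1)) fun p => hι (p + 1)
    refine ⟨fun p => Nat.casesOn p ((g 0).comp (ι 0)) g, fun p x => ?_, hN⟩
    cases p with
    | zero => rfl
    | succ p => exact hg p x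

lemma SeqColim.of_injective (hι : ∀ p, Function.Injective (ι p)) (N : ℕ) :
    Function.Injective (SeqColim.of ι N) := by
  obtain ⟨g, hg, hN⟩ := exists_cocone_retraction N E ι hι
  exact Function.LeftInverse.injective (g := SeqColim.lift g hg) fun x => by
    rw [SeqColim.lift_of, hN]

end SeqColim

namespace DGModule

variable (T : ℕ → DGModule A) (ι : ∀ p, T p ⟶ T (p + 1))

/-- Degree `n` of the colimit of a sequence of dg modules. -/
abbrev SeqX (n : ℤ) : Type u := SeqColim (k := k) (E := fun p => (T p).X n) fun p => (ι p).f n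

/-- The map `T_p ⟶ colim T` in degree `n`. -/
def seqOf (p : ℕ) (n : ℤ) : (T p).X n →ₗ[k] SeqX T ι n :=
  SeqColim.of (k := k) (E := fun p => (T p).X n) (fun p => (ι p).f n) p

variable {T ι}

lemma seqOf_succ (p : ℕ) {n : ℤ} (x : (T p).X n) :
    seqOf T ι (p + 1) n ((ι p).f n x) = seqOf T ι p n x :=
  SeqColim.of_succ (k := k) (E := fun p => (T p).X n) (fun p => (ι p).f n) p x

lemma seqOf_injective (hι : ∀ p n, Function.Injective ((ι p).f n)) (p : ℕ) (n : ℤ) :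
    Function.Injective (seqOf T ι p n) :=
  SeqColim.of_injective (k := k) (E := fun p => (T p).X n) (fun p => (ι p).f n)
    (fun p => hι p n) p

lemma seq_induction {n : ℤ} {P : SeqX T ι n → Prop} (zero : P 0)
    (add : ∀ x y, P x → P y → P (x + y)) (of : ∀ p x, P (seqOf T ι p n x)) (z : SeqX T ι n) :
    P z := SeqColim.induction (k := k) zero add of z

lemma seq_hom_ext {n : ℤ} {Y : Type*} [AddCommGroup Y] [Module k Y] {f g : SeqX T ι n →ₗ[k] Y}
    (h : ∀ p x, f (seqOf T ι p n x) = g (seqOf T ι p n x)) : f = g :=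
  SeqColim.hom_ext (k := k) h

/-- The map out of the colimit of a sequence of dg modules defined by a cocone. -/
def seqLift {n : ℤ} {Y : Type*} [AddCommGroup Y] [Module k Y] (f : ∀ p, (T p).X n →ₗ[k] Y)
    (hf : ∀ p x, f (p + 1) ((ι p).f n x) = f p x) : SeqX T ι n →ₗ[k] Y :=
  SeqColim.lift (k := k) f hf

lemma seqLift_of {n : ℤ} {Y : Type*} [AddCommGroup Y] [Module k Y] (f : ∀ p, (T p).X n →ₗ[k] Y)
    (hf : ∀ p x, f (p + 1) ((ι p).f n x) = f p x) (p : ℕ) (x : (T p).X n) :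
    seqLift f hf (seqOf T ι p n x) = f p x :=
  SeqColim.lift_of (k := k) f hf p x

/-- A family of bilinear maps `B × T_p ⟶ Y` compatible with the transition maps defines a bilinear
map on the colimit. -/
def seqLift₂ {n : ℤ} {B Y : Type*} [AddCommGroup B] [Module k B] [AddCommGroup Y] [Module k Y]
    (f : ∀ p, B →ₗ[k] (T p).X n →ₗ[k] Y)
    (hf : ∀ b p x, f (p + 1) b ((ι p).f n x) = f p b x) : B →ₗ[k] SeqX T ι n →ₗ[k] Y where
  toFun b := seqLift (fun p => f p b) (hf b)
  map_add' b c := seq_hom_ext fun p x => by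
    rw [LinearMap.add_apply, seqLift_of, seqLift_of, seqLift_of, map_add, LinearMap.add_apply]
  map_smul' r b := seq_hom_ext fun p x => by
    rw [LinearMap.smul_apply, seqLift_of, seqLift_of, map_smul, LinearMap.smul_apply,
      RingHom.id_apply]

lemma seqLift₂_of {n : ℤ} {B Y : Type*} [AddCommGroup B] [Module k B] [AddCommGroup Y]
    [Module k Y] (f : ∀ p, B →ₗ[k] (T p).X n →ₗ[k] Y)
    (hf : ∀ b p x, f (p + 1) b ((ι p).f n x) = f p b x) (b : B) (p : ℕ) (x : (T p).X n) :
    seqLift₂ f hf b (seqOf T ι p n x) = f p b x :=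
  seqLift_of (fun p => f p b) (hf b) p x

variable (T ι)

/-- The left action on the colimit of a sequence of dg modules. -/
def seqAct {i j n : ℤ} (h : i + j = n) : A.X i →ₗ[k] SeqX T ι j →ₗ[k] SeqX T ι n :=
  seqLift₂ (fun p => ((T p).act h).compr₂ (seqOf T ι p n)) fun a p x => by
    rw [LinearMap.compr₂_apply, LinearMap.compr₂_apply, ← (ι p).map_act, seqOf_succ]

/-- The differential of the colimit of a sequence of dg modules. -/
def seqD {i j : ℤ} (h : i + 1 = j) : SeqX T ι i →ₗ[k] SeqX T ι j :=
  seqLift (fun p => (seqOf T ι p j).comp ((T p).d h)) fun p x => by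
    rw [LinearMap.comp_apply, LinearMap.comp_apply, ← (ι p).map_d, seqOf_succ]

variable {T ι}

lemma seqAct_of {i j n : ℤ} (h : i + j = n) (a : A.X i) (p : ℕ) (x : (T p).X j) :
    seqAct T ι h a (seqOf T ι p j x) = seqOf T ι p n ((T p).act h a x) :=
  seqLift₂_of _ _ a p x

lemma seqD_of {i j : ℤ} (h : i + 1 = j) (p : ℕ) (x : (T p).X i) :
    seqD T ι h (seqOf T ι p i x) = seqOf T ι p j ((T p).d h x) :=
  seqLift_of _ _ p x

variable (T ι)

/-- The colimit of a sequence of dg modules. -/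
abbrev seqColim : DGModule A where
  X := SeqX T ι
  act := seqAct T ι
  d := seqD T ι
  one_act h z := by
    induction z using seq_induction with
    | zero => simp only [map_zero]
    | add x y hx hy => simp only [map_add, hx, hy]
    | of p x => rw [seqAct_of, (T p).one_act]
  mul_act hij hjl h₁ h₂ a b z := by
    induction z using seq_induction with
    | zero => simp only [map_zero]
    | add x y hx hy => simp only [map_add, hx, hy]
    | of p x => rw [seqAct_of, seqAct_of, seqAct_of, (T p).mul_act hij hjl h₁ h₂]
  d_d h h' z := by
    induction z using seq_induction with
    | zero => simp only [map_zero]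
    | add x y hx hy => simp only [map_add, hx, hy, add_zero]
    | of p x => rw [seqD_of, seqD_of, (T p).d_d, map_zero]
  d_act h hi hj hn h₁ h₂ a z := by
    induction z using seq_induction with
    | zero => simp only [map_zero, smul_zero, add_zero]
    | add x y hx hy => simp only [map_add, hx, hy, smul_add]; abel
    | of p x =>
      rw [seqAct_of, seqD_of, seqAct_of, seqD_of, seqAct_of, (T p).d_act h hi hj hn h₁ h₂,
        map_add, map_smul]

/-- The morphism `T_p ⟶ colim T`. -/
def seqIncl (p : ℕ) : T p ⟶ seqColim T ι where
  f := seqOf T ι p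
  map_act h a x := (seqAct_of h a p x).symm
  map_d h x := (seqD_of h p x).symm

end DGModule

/-! ### The tower of extensions `M ⊆ Σ_V ⊗ M ⊆ ⋯` -/

namespace DGModule

variable {V : DGModule A} (ρ : V ⟶ tangent A)

/-- One stage `X ⊆ Y` of the tower, with its multiplication `μ : Σ_V ⊗_A X ⟶ Y` and its graded
piece `G = Y / X`. The inclusion of `X` is `x ↦ μ (1 ⊗ x)`. -/
structure Stage where
  X : DGModule A
  Y : DGModule A
  G : DGModule A
  μ : (V.atiyah ρ).tensor X ⟶ Y
  π : Y ⟶ G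
  μ_surjective : ∀ n, Function.Surjective (μ.f n)
  shortExact : ShortExact (V.hkrIncl ρ X ≫ μ) π

variable {ρ}

/-- The naturality of `m ↦ 1 ⊗ m`. -/
lemma hkrIncl_naturality {M N : DGModule A} (F : M ⟶ N) :
    V.hkrIncl ρ M ≫ (V.atiyah ρ).tensorMap F = F ≫ V.hkrIncl ρ N :=
  hom_ext fun n x => DGBimodule.tensorMap_tmul (K := V.atiyah ρ) F (zero_add n) _ x

lemma hkrProj_naturality {M N : DGModule A} (F : M ⟶ N) :
    V.hkrProj ρ M ≫ V.sym.tensorMap F = (V.atiyah ρ).tensorMap F ≫ V.hkrProj ρ N :=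
  DGBimodule.tensor_hom_ext' fun hij x m => by
    rw [comp_f, comp_f]
    refine (congrArg _ (V.hkrProjFun_tmul ρ M hij x m)).trans ?_
    refine (DGBimodule.tensorMap_tmul (K := V.sym) F hij x.2 m).trans ?_
    rw [DGBimodule.tensorMap_tmul (K := V.atiyah ρ) F hij x m]
    exact (V.hkrProjFun_tmul ρ N hij x _).symm

namespace Stage

variable (S : Stage ρ)

/-- The inclusion `X ⟶ Y` of a stage. -/
noncomputable abbrev ι : S.X ⟶ S.Y := V.hkrIncl ρ S.X ≫ S.μ

/-- The relation `s ⊗ ι x - 1 ⊗ μ (s ⊗ x)`. -/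
noncomputable def rel : (V.atiyah ρ).tensor S.X ⟶ (V.atiyah ρ).tensor S.Y :=
  subHom ((V.atiyah ρ).tensorMap S.ι) (S.μ ≫ V.hkrIncl ρ S.Y)

/-- The next stage: the quotient of `Σ_V ⊗_A Y` by the relations `s ⊗ ι x = 1 ⊗ μ (s ⊗ x)`. -/
noncomputable abbrev nextY : DGModule A := (range S.rel).quotient

/-- The multiplication of the next stage. -/
noncomputable def nextμ : (V.atiyah ρ).tensor S.Y ⟶ S.nextY := (range S.rel).proj

lemma rel_apply {n : ℤ} (z : (V.atiyah ρ).TensorX S.X n) :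
    S.rel.f n z = ((V.atiyah ρ).tensorMap S.ι).f n z - (V.hkrIncl ρ S.Y).f n (S.μ.f n z) := rfl

lemma nextμ_tensorMap {n : ℤ} (z : (V.atiyah ρ).TensorX S.X n) :
    S.nextμ.f n (((V.atiyah ρ).tensorMap S.ι).f n z) =
      S.nextμ.f n ((V.hkrIncl ρ S.Y).f n (S.μ.f n z)) := by
  rw [← sub_eq_zero, ← map_sub, ← rel_apply]
  exact (DGSubmodule.proj_eq_zero _ _).2 ⟨z, rfl⟩

lemma hkrProj_hkrIncl (M : DGModule A) {n : ℤ} (m : M.X n) :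
    (V.hkrProj ρ M).f n ((V.hkrIncl ρ M).f n m) = 0 := by
  refine (V.hkrProjFun_tmul ρ M (zero_add n) _ m).trans ?_
  rw [map_zero, LinearMap.zero_apply]

lemma hkrProj_tensorMap_rel {n : ℤ} (z : (V.atiyah ρ).TensorX S.X n) :
    (V.hkrProj ρ S.Y).f n (S.rel.f n z) =
      (V.sym.tensorMap S.ι).f n ((V.hkrProj ρ S.X).f n z) := by
  rw [rel_apply, map_sub, hkrProj_hkrIncl, sub_zero, ← comp_f, ← hkrProj_naturality, comp_f]

lemma tensorMap_ι_π {n : ℤ} (z : V.sym.TensorX S.X n) :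
    (V.sym.tensorMap S.π).f n ((V.sym.tensorMap S.ι).f n z) = 0 := by
  induction z using DGBimodule.tensor_induction with
  | zero => simp only [map_zero]
  | add x y hx hy => simp only [map_add, hx, hy, add_zero]
  | tmul hij x m =>
    rw [DGBimodule.tensorMap_tmul (K := V.sym), DGBimodule.tensorMap_tmul (K := V.sym),
      S.shortExact.comp_zero, map_zero]

/-- The projection of the next stage to its graded piece `V ⊗_A G`. -/
noncomputable def nextπ : S.nextY ⟶ V.sym.tensor S.G :=
  (range S.rel).lift (V.hkrProj ρ S.Y ≫ V.sym.tensorMap S.π) (by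
    rintro n _ ⟨z, rfl⟩
    rw [comp_f, hkrProj_tensorMap_rel, tensorMap_ι_π])

lemma nextμ_nextπ : S.nextμ ≫ S.nextπ = V.hkrProj ρ S.Y ≫ V.sym.tensorMap S.π :=
  rfl

/-- The next stage is an extension of `V ⊗_A G` by `Y`. Injectivity of `Y ⟶ Y'`: if
`1 ⊗ y = s ⊗ ι x - 1 ⊗ μ (s ⊗ x)`, projection to `V ⊗_A Y` shows that `s ⊗ x` is `1 ⊗ x'`, for which
the right-hand side vanishes. -/
lemma nextShortExact (hV : V.IsPerfect) : ShortExact (V.hkrIncl ρ S.Y ≫ S.nextμ) S.nextπ := by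
  obtain ⟨B⟩ := hV.nonempty_dualBasis
  have hB := B.shortExact_tensorMap S.shortExact
  have hX := hkr_shortExact ρ S.X hV
  have hY := hkr_shortExact ρ S.Y hV
  have hμπ : ∀ {n : ℤ} z, S.nextπ.f n (S.nextμ.f n z) =
      (V.sym.tensorMap S.π).f n ((V.hkrProj ρ S.Y).f n z) := fun {n} z => by
    rw [← comp_f, nextμ_nextπ, comp_f]
  refine ⟨fun n => (injective_iff_map_eq_zero _).2 fun y hy => ?_,
    fun n y => ⟨fun hy => ?_, ?_⟩, fun n z => ?_⟩
  · obtain ⟨z, hz⟩ := (DGSubmodule.proj_eq_zero _ _).1 hy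
    have h0 : (V.sym.tensorMap S.ι).f n ((V.hkrProj ρ S.X).f n z) = 0 := by
      rw [← hkrProj_tensorMap_rel, hz, hkrProj_hkrIncl]
    rw [← map_zero ((V.sym.tensorMap S.ι).f n)] at h0
    obtain ⟨x, rfl⟩ := (hX.exact n z).1 (hB.inj n h0)
    refine hY.inj n ?_
    rw [← hz, rel_apply, map_zero, ← comp_f, hkrIncl_naturality]
    exact sub_self _
  · obtain ⟨y, rfl⟩ := DGSubmodule.proj_surjective _ n y
    change S.nextπ.f n (S.nextμ.f n y) = 0 at hy
    rw [hμπ] at hy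
    obtain ⟨w, hw⟩ := (hB.exact n _).1 hy
    obtain ⟨z, rfl⟩ := hX.surj n w
    have h0 : (V.hkrProj ρ S.Y).f n (y - S.rel.f n z) = 0 := by
      rw [map_sub, hkrProj_tensorMap_rel, hw, sub_self]
    obtain ⟨t, ht⟩ := (hY.exact n _).1 h0
    refine ⟨t, ?_⟩
    rw [comp_f, ht, map_sub]
    refine (congrArg _ ?_).trans (sub_zero _)
    exact (DGSubmodule.proj_eq_zero _ _).2 ⟨z, rfl⟩
  · rintro ⟨x, rfl⟩
    rw [comp_f, hμπ, hkrProj_hkrIncl, map_zero]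
  · obtain ⟨y, rfl⟩ := hB.surj n z
    obtain ⟨w, rfl⟩ := hY.surj n y
    exact ⟨S.nextμ.f n w, hμπ w⟩

/-- The next stage. -/
noncomputable abbrev next (hV : V.IsPerfect) : Stage ρ where
  X := S.Y
  Y := S.nextY
  G := V.sym.tensor S.G
  μ := S.nextμ
  π := S.nextπ
  μ_surjective n := DGSubmodule.proj_surjective _ n
  shortExact := S.nextShortExact hV

end Stage

variable (ρ)

/-- The first stage `M ⊆ Σ_V ⊗_A M`. -/
noncomputable abbrev firstStage (hV : V.IsPerfect) (M : DGModule A) : Stage ρ where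
  X := M
  Y := (V.atiyah ρ).tensor M
  G := V.sym.tensor M
  μ := 𝟙 _
  π := V.hkrProj ρ M
  μ_surjective _ := Function.surjective_id
  shortExact := hkr_shortExact ρ M hV

/-- The tower of stages. -/
noncomputable def tower (hV : V.IsPerfect) (M : DGModule A) : ℕ → Stage ρ
  | 0 => firstStage ρ hV M
  | n + 1 => (tower hV M n).next hV

end DGModule

/-! ### Graded endomorphisms -/

section GEnd

variable (T : DGModule A)

/-- Graded `k`-linear endomorphisms of degree `n` of a dg module. -/
abbrev GEnd (n : ℤ) : Type u := ∀ p : {p : ℤ × ℤ // n + p.1 = p.2}, T.X p.1.1 →ₗ[k] T.X p.1.2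

variable {T}

/-- The value of a graded endomorphism. -/
def gApp {n i j : ℤ} (h : n + i = j) : GEnd T n →ₗ[k] T.X i →ₗ[k] T.X j :=
  LinearMap.proj (⟨(i, j), h⟩ : {p : ℤ × ℤ // n + p.1 = p.2})

lemma gEnd_ext {n : ℤ} {f g : GEnd T n}
    (h : ∀ (i j : ℤ) (hij : n + i = j) (x : T.X i), gApp hij f x = gApp hij g x) : f = g := by
  funext ⟨⟨i, j⟩, hij⟩
  ext x
  exact h i j hij x

/-- Composition of graded endomorphisms. -/
def gMul {p q n : ℤ} (h : p + q = n) : GEnd T p →ₗ[k] GEnd T q →ₗ[k] GEnd T n :=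
  LinearMap.mk₂ k
    (fun f g r => (gApp (by have := r.2; omega : p + (q + r.1.1) = r.1.2) f).comp (gApp rfl g))
    (fun f f' g => by funext r; ext x; simp)
    (fun c f g => by funext r; ext x; simp)
    (fun f g g' => by funext r; ext x; simp)
    (fun c f g => by funext r; ext x; simp)

lemma gApp_gMul {p q n i j l : ℤ} (h : p + q = n) (hn : n + i = j) (hl : q + i = l)
    (h₁ : p + l = j) (f : GEnd T p) (g : GEnd T q) (x : T.X i) :
    gApp hn (gMul h f g) x = gApp h₁ f (gApp hl g x) := by
  subst hl; rfl

lemma gMul_assoc {i j l ij jl n : ℤ} (hij : i + j = ij) (hjl : j + l = jl) (h₁ : ij + l = n)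
    (h₂ : i + jl = n) (f : GEnd T i) (g : GEnd T j) (e : GEnd T l) :
    gMul h₁ (gMul hij f g) e = gMul h₂ f (gMul hjl g e) := by
  apply gEnd_ext
  intro r s h x
  rw [gApp_gMul h₁ h (l := l + r) rfl (by omega),
    gApp_gMul hij _ (l := jl + r) (by omega) (by omega),
    gApp_gMul h₂ h (l := jl + r) rfl (by omega), gApp_gMul hjl _ (l := l + r) rfl (by omega)]

/-- The graded commutator of graded endomorphisms. -/
def gBr {p q n : ℤ} (h : p + q = n) : GEnd T p →ₗ[k] GEnd T q →ₗ[k] GEnd T n :=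
  gMul h - sgn k (p * q) • (gMul (by omega : q + p = n)).flip

lemma gBr_apply {p q n : ℤ} (h : p + q = n) (h' : q + p = n) (f : GEnd T p) (g : GEnd T q) :
    gBr h f g = gMul h f g - sgn k (p * q) • gMul h' g f := rfl

lemma gApp_gBr {p q n i j l m : ℤ} (h : p + q = n) (hn : n + i = j) (hl : q + i = l)
    (hm : p + i = m) (h₁ : p + l = j) (h₂ : q + m = j) (f : GEnd T p) (g : GEnd T q) (x : T.X i) :
    gApp hn (gBr h f g) x =
      gApp h₁ f (gApp hl g x) - sgn k (p * q) • gApp h₂ g (gApp hm f x) := by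
  rw [gBr_apply h (by omega), map_sub, map_smul, LinearMap.sub_apply, LinearMap.smul_apply,
    gApp_gMul h hn hl h₁, gApp_gMul _ hn hm h₂]

lemma gBr_skew {p q n : ℤ} (h : p + q = n) (h' : q + p = n) (f : GEnd T p) (g : GEnd T q) :
    gBr h f g = -(sgn k (p * q) • gBr h' g f) := by
  rw [gBr_apply h h', gBr_apply h' h, mul_comm q p]
  rcases sgn_cases k (p * q) with h | h <;> simp [h]

/-- The commutator with a graded endomorphism is a graded derivation of the composition. -/
lemma gBr_gMul {p q r pq pr qr n : ℤ} (hqr : q + r = qr) (h₁ : p + qr = n) (hpq : p + q = pq)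
    (h₂ : pq + r = n) (hpr : p + r = pr) (h₃ : q + pr = n) (f : GEnd T p) (g : GEnd T q)
    (e : GEnd T r) : gBr h₁ f (gMul hqr g e) =
      gMul h₂ (gBr hpq f g) e + sgn k (p * q) • gMul h₃ g (gBr hpr f e) := by
  rw [gBr_apply h₁ (by omega : qr + p = n), gBr_apply hpq (by omega : q + p = pq),
    gBr_apply hpr (by omega : r + p = pr), map_sub, map_sub, LinearMap.sub_apply, map_smul,
    map_smul, LinearMap.smul_apply, gMul_assoc hpq hqr h₂ h₁,
    gMul_assoc (by omega : q + p = pq) hpr h₂ h₃,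
    gMul_assoc hqr (by omega : r + p = pr) (by omega : qr + p = n) h₃]
  subst hqr
  rw [mul_add, sgn_add]
  rcases sgn_cases k (p * q) with h | h <;> rcases sgn_cases k (p * r) with h' | h' <;>
    simp [h, h'] <;> abel

lemma gBr_jacobi {p q r pq qr pr n : ℤ} (hqr : q + r = qr) (h₁ : p + qr = n)
    (hpq : p + q = pq) (h₂ : pq + r = n) (hpr : p + r = pr) (h₃ : q + pr = n)
    (f : GEnd T p) (g : GEnd T q) (e : GEnd T r) :
    gBr h₁ f (gBr hqr g e) = gBr h₂ (gBr hpq f g) e +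
      sgn k (p * q) • gBr h₃ g (gBr hpr f e) := by
  rw [gBr_apply hqr (by omega : r + q = qr), map_sub, map_smul,
    gBr_gMul hqr h₁ hpq h₂ hpr h₃, gBr_gMul (by omega : r + q = qr) h₁ hpr (by omega) hpq (by omega),
    gBr_apply h₂ (by omega : r + pq = n), gBr_apply h₃ (by omega : pr + q = n)]
  subst hpq hpr
  simp only [add_mul, mul_add, sgn_add]
  rw [mul_comm q p]
  rcases sgn_cases k (p * q) with h | h <;> rcases sgn_cases k (p * r) with h' | h' <;>
    rcases sgn_cases k (q * r) with h'' | h'' <;> simp [h, h', h''] <;> abel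

variable (T)

/-- The identity endomorphism. -/
def gOne : GEnd T 0 := fun r => T.castEq (by have := r.2; omega)

/-- The differential, as an endomorphism of degree `1`. -/
def gD : GEnd T 1 := fun r => T.d (by have := r.2; omega)

/-- The endomorphism given by the action of an element of `A`. -/
def gA (n : ℤ) : A.X n →ₗ[k] GEnd T n := LinearMap.pi fun r => T.act r.2

variable {T}

lemma gApp_gOne {n : ℤ} (h : 0 + n = n) (x : T.X n) : gApp h (gOne T) x = x := rfl

lemma gApp_gD {i j : ℤ} (h : 1 + i = j) (x : T.X i) : gApp h (gD T) x = T.d (by omega) x := rfl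

lemma gApp_gA {i j n : ℤ} (h : i + j = n) (a : A.X i) (x : T.X j) :
    gApp h (gA T i a) x = T.act h a x := rfl

lemma gA_one : gA T 0 A.one = gOne T := by
  apply gEnd_ext
  intro i j h x
  obtain rfl : i = j := by omega
  rw [gApp_gA, T.one_act, gApp_gOne]

lemma gOne_gMul {n : ℤ} (h : 0 + n = n) (f : GEnd T n) : gMul h (gOne T) f = f := by
  apply gEnd_ext
  intro i j hij x
  rw [gApp_gMul h hij hij (by omega), gApp_gOne]

lemma gMul_gOne {n : ℤ} (h : n + 0 = n) (f : GEnd T n) : gMul h f (gOne T) = f := by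
  apply gEnd_ext
  intro i j hij x
  rw [gApp_gMul h hij (zero_add i) hij, gApp_gOne]

lemma gA_mul {i j n : ℤ} (h : i + j = n) (a : A.X i) (b : A.X j) :
    gA T n (A.mul h a b) = gMul h (gA T i a) (gA T j b) := by
  apply gEnd_ext
  intro p q hpq x
  rw [gApp_gMul h hpq rfl (by omega)]
  exact T.mul_act h rfl hpq _ a b x

lemma gA_d {i j : ℤ} (h : i + 1 = j) (h' : 1 + i = j) (a : A.X i) :
    gA T j (A.d h a) = gBr h' (gD T) (gA T i a) := by
  apply gEnd_ext
  intro p q hpq x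
  rw [gApp_gBr h' hpq (l := i + p) (m := 1 + p) rfl rfl (by omega) (by omega), gApp_gA, gApp_gA,
    gApp_gA, gApp_gD, gApp_gD, one_mul,
    T.d_act rfl h (by omega : p + 1 = 1 + p) (by omega) hpq (by omega), add_sub_cancel_right]

lemma gD_gBr_gBr {i j l : ℤ} (h : 1 + i = j) (h' : 1 + j = l) (f : GEnd T i) :
    gBr h' (gD T) (gBr h (gD T) f) = 0 := by
  apply gEnd_ext
  intro p q hpq x
  rw [gApp_gBr h' hpq (l := j + p) (m := 1 + p) rfl rfl (by omega) (by omega),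
    gApp_gBr h _ (l := i + p) (m := 1 + p) rfl rfl (by omega) (by omega),
    gApp_gBr h _ (l := j + p) (m := 1 + (1 + p)) (by omega) (by omega) (by omega) (by omega)]
  simp only [gApp_gD, map_sub, map_smul, T.d_d]
  subst h
  simp [sgn_add, sgn_one]

end GEnd

/-! ### Representations of the enveloping algebra of the free algebroid -/

section Representation

variable {V : DGModule A} (ρ : V ⟶ tangent A) (T : DGModule A)

/-- An action of `V` on `T` by operators `v` that are `A`-linear in `v`, satisfy
`v (a x) = ρ(v)(a) x + (-1)^{|v||a|} a (v x)`, and are compatible with the differentials. -/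
structure AnchoredAction where
  op : ∀ {i j n : ℤ}, i + j = n → V.X i →ₗ[k] T.X j →ₗ[k] T.X n
  act_op : ∀ {p q pq i qi n : ℤ} (hpq : p + q = pq) (h₁ : pq + i = n) (hqi : q + i = qi)
    (h₂ : p + qi = n) (a : A.X p) (v : V.X q) (x : T.X i),
    op h₁ (V.act hpq a v) x = T.act h₂ a (op hqi v x)
  op_act : ∀ {p q i pq qi pi n : ℤ} (hqi : q + i = qi) (h₁ : p + qi = n) (hpq : p + q = pq)
    (h₂ : pq + i = n) (hpi : p + i = pi) (h₃ : q + pi = n) (v : V.X p) (a : A.X q) (x : T.X i),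
    op h₁ v (T.act hqi a x) =
      T.act h₂ (V.anchorApply ρ hpq v a) x + sgn k (p * q) • T.act h₃ a (op hpi v x)
  d_op : ∀ {i j n i' j' n' : ℤ} (h : i + j = n) (hi : i + 1 = i') (hj : j + 1 = j')
    (hn : n + 1 = n') (h₁ : i' + j = n') (h₂ : i + j' = n') (v : V.X i) (x : T.X j),
    T.d hn (op h v x) = op h₁ (V.d hi v) x + sgn k i • op h₂ v (T.d hj x)

/-- The graded endomorphism `f` acts on products `a x` as a derivation with symbol `D`. -/
def HasSymbol {T : DGModule A} {n : ℤ} (f : GEnd T n) (D : derivations A n) : Prop :=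
  ∀ (i j : ℤ) (h : n + i = j) (a : A.X i), gBr h f (gA T i a) = gA T j (derApply h D a)

lemma gBr_gA_gA {i j n : ℤ} (h : i + j = n) (a : A.X i) (b : A.X j) :
    gBr h (gA T i a) (gA T j b) = 0 := by
  rw [gBr_apply h (by omega), ← gA_mul, ← gA_mul, A.mul_comm h (by omega), map_smul, sub_self]

variable {T}

lemma hasSymbol_gD : HasSymbol (gD T) (derD A) := fun _ _ h a => (gA_d (by omega) h a).symm

lemma HasSymbol.gBr {p q n : ℤ} (h : p + q = n) {f : GEnd T p} {g : GEnd T q}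
    {D : derivations A p} {E : derivations A q} (hf : HasSymbol f D) (hg : HasSymbol g E) :
    HasSymbol (gBr h f g) (derBracket h D E) := by
  intro i j hij a
  have := gBr_jacobi (rfl : q + i = q + i) (by omega : p + (q + i) = j) h hij
    (rfl : p + i = p + i) (by omega) f g (gA T i a)
  rw [← sub_eq_iff_eq_add] at this
  rw [← this, hg _ _ rfl a, hf _ _ rfl a, hf, hg,
    derBracket_apply h hij rfl rfl (by omega) (by omega), map_sub, map_smul]

lemma HasSymbol.gMul {p q n : ℤ} (h : p + q = n) {f : GEnd T q} {D : derivations A q}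
    (hf : HasSymbol f D) (a : A.X p) : HasSymbol (gMul h (gA T p a) f) (derAct h a D) := by
  intro i j hij b
  have h1 := gBr_gMul h (by omega : i + n = j) (rfl : i + p = i + p) (by omega)
    (rfl : i + q = i + q) (by omega) (gA T i b) (gA T p a) f
  rw [gBr_gA_gA, map_zero, LinearMap.zero_apply, zero_add,
    gBr_skew (rfl : i + q = i + q) (by omega : q + i = i + q), hf] at h1
  rw [gBr_skew hij (by omega : i + n = j), h1, map_neg, map_smul, ← gA_mul,
    derAct_apply h hij (by omega : q + i = i + q) (by omega)]
  subst h
  rw [smul_neg, smul_neg, neg_neg, smul_smul, smul_smul, add_mul, sgn_add, mul_comm p i,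
    mul_comm q i, mul_comm (sgn k (i * p)), mul_assoc (sgn k (i * q)), mul_comm (sgn k (i * q)),
    mul_assoc, sgn_mul_self, sgn_mul_self, mul_one, one_smul]

variable (W : AnchoredAction ρ T)

namespace AnchoredAction

variable {ρ}

/-- The operator on `T` given by an element of `V`. -/
def gV (n : ℤ) : V.X n →ₗ[k] GEnd T n := LinearMap.pi fun r => W.op r.2

lemma gApp_gV {i j n : ℤ} (h : i + j = n) (v : V.X i) (x : T.X j) :
    gApp h (W.gV i v) x = W.op h v x := rfl

lemma gV_act {i j n : ℤ} (h : i + j = n) (a : A.X i) (v : V.X j) :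
    W.gV n (V.act h a v) = gMul h (gA T i a) (W.gV j v) := by
  apply gEnd_ext
  intro p q hpq x
  rw [gApp_gMul h hpq rfl (by omega)]
  exact W.act_op h hpq rfl _ a v x

lemma gV_d {i j : ℤ} (h : i + 1 = j) (h' : 1 + i = j) (v : V.X i) :
    W.gV j (V.d h v) = gBr h' (gD T) (W.gV i v) := by
  apply gEnd_ext
  intro p q hpq x
  rw [gApp_gBr h' hpq (l := i + p) (m := 1 + p) rfl rfl (by omega) (by omega), gApp_gV, gApp_gV,
    gApp_gV, gApp_gD, gApp_gD, one_mul,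
    W.d_op rfl h (by omega : p + 1 = 1 + p) (by omega) hpq (by omega), add_sub_cancel_right]

lemma hasSymbol_gV {n : ℤ} (v : V.X n) : HasSymbol (W.gV n v) (ρ.f n v : derivations A n) := by
  intro i j h a
  apply gEnd_ext
  intro p q hpq x
  rw [gApp_gBr h hpq (l := i + p) (m := n + p) rfl rfl (by omega) (by omega), gApp_gV, gApp_gV,
    gApp_gA, gApp_gA, W.op_act rfl (by omega) h hpq rfl (by omega), add_sub_cancel_right]
  rfl

/-- The operator on `T` given by a formal expression in elements of `V`. -/
def evFree : ∀ {n : ℤ}, FreePre V n → GEnd T n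
  | n, .of v => W.gV n v
  | _, .zero => 0
  | _, .add x y => evFree x + evFree y
  | _, .smul c x => c • evFree x
  | _, .act h a x => gMul h (gA T _ a) (evFree x)
  | _, .d (i := i) (j := j) h x => gBr (by omega : 1 + i = j) (gD T) (evFree x)
  | _, .bracket h x y => gBr h (evFree x) (evFree y)

lemma hasSymbol_evFree {n : ℤ} (x : FreePre V n) :
    HasSymbol (W.evFree x) (x.anchor ρ) := by
  induction x with
  | of v => exact W.hasSymbol_gV v
  | zero =>
    intro i j h a
    simp only [evFree, FreePre.anchor, map_zero, LinearMap.zero_apply]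
  | add x y hx hy =>
    intro i j h a
    simp only [evFree, FreePre.anchor, map_add, LinearMap.add_apply]
    rw [hx, hy]
  | smul c x hx =>
    intro i j h a
    simp only [evFree, FreePre.anchor, map_smul, LinearMap.smul_apply]
    rw [hx]
  | act h a x hx => exact hx.gMul h a
  | d h x hx => exact hasSymbol_gD.gBr _ hx
  | bracket h x y hx hy => exact hx.gBr h hy

lemma evFree_eq {n : ℤ} {x y : FreePre V n} (h : FreeRel ρ x y) : W.evFree x = W.evFree y := by
  induction h with
  | refl => rfl
  | symm _ ih => exact ih.symm
  | trans _ _ ih ih' => exact ih.trans ih'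
  | add_congr _ _ ih ih' => simp only [evFree, ih, ih']
  | smul_congr _ _ ih => simp only [evFree, ih]
  | act_congr _ _ _ ih => simp only [evFree, ih]
  | d_congr _ _ ih => simp only [evFree, ih]
  | bracket_congr _ _ _ ih ih' => simp only [evFree, ih, ih']
  | add_assoc => exact _root_.add_assoc _ _ _
  | add_comm => exact _root_.add_comm _ _
  | zero_add => exact _root_.zero_add _
  | neg_add x => simp only [evFree, neg_smul, _root_.one_smul, neg_add_cancel]
  | smul_add => exact _root_.smul_add _ _ _
  | add_smul => exact _root_.add_smul _ _ _
  | mul_smul => exact (smul_smul _ _ _).symm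
  | one_smul => exact _root_.one_smul _ _
  | act_add => exact map_add _ _ _
  | act_smul => exact map_smul _ _ _
  | add_act => simp only [evFree, map_add, LinearMap.add_apply]
  | smul_act => simp only [evFree, map_smul, LinearMap.smul_apply]
  | one_act h x => simp only [evFree, gA_one, gOne_gMul]
  | mul_act hij hjl h₁ h₂ a b x => simp only [evFree, gA_mul, gMul_assoc hij hjl h₁ h₂]
  | d_add => exact map_add _ _ _
  | d_smul => exact map_smul _ _ _
  | d_d h h' x => exact gD_gBr_gBr _ _ _
  | d_act h hi hj hn h₁ h₂ a x =>
    simp only [evFree]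
    rw [gBr_gMul h _ (by omega) h₁ (by omega) h₂, gA_d hi (by omega), one_mul]
  | bracket_add => exact map_add _ _ _
  | bracket_smul => exact map_smul _ _ _
  | add_bracket => exact LinearMap.map_add₂ _ _ _ _
  | smul_bracket => exact LinearMap.map_smul₂ _ _ _ _
  | skew h h' x y =>
    simp only [evFree, neg_smul, _root_.one_smul]
    exact gBr_skew h h' _ _
  | jacobi hqr h₁ hpq h₂ hpr h₃ x y z => exact gBr_jacobi hqr h₁ hpq h₂ hpr h₃ _ _ _
  | d_bracket h hi hj hn h₁ h₂ x y =>
    simp only [evFree]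
    rw [gBr_jacobi h _ (by omega) h₁ (by omega) h₂, one_mul]
  | bracket_act hqr h₁ hpr h₂ hpq h₃ x a y =>
    simp only [evFree]
    rw [gBr_gMul hqr h₁ hpq h₃ hpr h₂, W.hasSymbol_evFree x _ _ hpq a, _root_.add_comm, mul_comm]
  | of_add v w => exact map_add _ _ _
  | of_smul c v => exact map_smul _ _ _
  | of_act h a v => exact W.gV_act h a v
  | of_d h v => exact W.gV_d h _ v

/-- The operator on `T` given by an element of the free algebroid. -/
def gFree (n : ℤ) : FreeX ρ n →ₗ[k] GEnd T n where
  toFun := Quotient.lift (s := freeSetoid ρ n) W.evFree fun _ _ h => W.evFree_eq h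
  map_add' x y := by induction x using FreeX.ind; induction y using FreeX.ind; rfl
  map_smul' c x := by induction x using FreeX.ind; rfl

/-- The operator on `T` given by a formal expression in elements of `A` and `free(V, ρ)`. -/
def evEnv : ∀ {n : ℤ}, EnvPre (free ρ) n → GEnd T n
  | n, .ofA a => gA T n a
  | n, .ofL x => W.gFree n x
  | _, .zero => 0
  | _, .add x y => evEnv x + evEnv y
  | _, .smul c x => c • evEnv x
  | _, .mul h x y => gMul h (evEnv x) (evEnv y)
  | _, .d (i := i) (j := j) h x => gBr (by omega : 1 + i = j) (gD T) (evEnv x)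

lemma evEnv_eq {n : ℤ} {x y : EnvPre (free ρ) n} (h : EnvRel (free ρ) x y) :
    W.evEnv x = W.evEnv y := by
  induction h with
  | refl => rfl
  | symm _ ih => exact ih.symm
  | trans _ _ ih ih' => exact ih.trans ih'
  | add_congr _ _ ih ih' => simp only [evEnv, ih, ih']
  | smul_congr _ _ ih => simp only [evEnv, ih]
  | mul_congr _ _ _ ih ih' => simp only [evEnv, ih, ih']
  | d_congr _ _ ih => simp only [evEnv, ih]
  | add_assoc => exact _root_.add_assoc _ _ _
  | add_comm => exact _root_.add_comm _ _
  | zero_add => exact _root_.zero_add _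
  | neg_add x => simp only [evEnv, neg_smul, _root_.one_smul, neg_add_cancel]
  | smul_add => exact _root_.smul_add _ _ _
  | add_smul => exact _root_.add_smul _ _ _
  | mul_smul => exact (smul_smul _ _ _).symm
  | one_smul => exact _root_.one_smul _ _
  | add_mul => exact LinearMap.map_add₂ _ _ _ _
  | smul_mul => exact LinearMap.map_smul₂ _ _ _ _
  | mul_add => exact map_add _ _ _
  | mul_smul' => exact map_smul _ _ _
  | mul_assoc hij hjl h₁ h₂ x y z => exact gMul_assoc hij hjl h₁ h₂ _ _ _
  | one_mul h x => simp only [evEnv, gA_one, gOne_gMul]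
  | mul_one h x => simp only [evEnv, gA_one, gMul_gOne]
  | d_add => exact map_add _ _ _
  | d_smul => exact map_smul _ _ _
  | d_d h h' x => exact gD_gBr_gBr _ _ _
  | d_mul h hi hj hn h₁ h₂ x y =>
    simp only [evEnv]
    rw [gBr_gMul h _ (by omega) h₁ (by omega) h₂, _root_.one_mul]
  | ofA_add a b => exact map_add _ _ _
  | ofA_smul c a => exact map_smul _ _ _
  | ofA_mul h a b => exact gA_mul h a b
  | ofA_d h a => exact gA_d h _ a
  | ofL_add x y => exact map_add _ _ _
  | ofL_smul c x => exact map_smul _ _ _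
  | ofL_act h a x => induction x using FreeX.ind; rfl
  | ofL_d h x => induction x using FreeX.ind; rfl
  | ofL_ofL h h' x y =>
    induction x using FreeX.ind
    induction y using FreeX.ind
    exact (add_sub_cancel _ _).symm
  | ofL_ofA h h' x a =>
    induction x using FreeX.ind with | _ x =>
    have := W.hasSymbol_evFree x _ _ h a
    rw [gBr_apply h h', sub_eq_iff_eq_add, _root_.add_comm] at this
    exact this

/-- The operator on `T` given by an element of the enveloping algebra. -/
def gEnv (n : ℤ) : EnvX (free ρ) n →ₗ[k] GEnd T n where
  toFun := Quotient.lift (s := envSetoid (free ρ) n) W.evEnv fun _ _ h => W.evEnv_eq h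
  map_add' x y := by induction x using EnvX.ind; induction y using EnvX.ind; rfl
  map_smul' c x := by induction x using EnvX.ind; rfl

lemma gEnv_envMul {i j n : ℤ} (h : i + j = n) (x : EnvX (free ρ) i) (y : EnvX (free ρ) j) :
    W.gEnv n (envMul (free ρ) h x y) = gMul h (W.gEnv i x) (W.gEnv j y) := by
  induction x using EnvX.ind; induction y using EnvX.ind; rfl

lemma gEnv_envA {n : ℤ} (a : A.X n) : W.gEnv n (envA (free ρ) n a) = gA T n a := rfl

lemma gEnv_envV {n : ℤ} (v : V.X n) : W.gEnv n (envV ρ n v) = W.gV n v := rfl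

lemma envTensorEval_balanced {M : DGModule A} (j : M ⟶ T) {n p l q pl lq : ℤ} (hpl : p + l = pl)
    (hlq : l + q = lq) (h₁ : pl + q = n) (h₂ : p + lq = n) (u : EnvX (free ρ) p) (a : A.X l)
    (m : M.X q) :
    ((gApp h₁).comp (W.gEnv pl)).compl₂ (j.f q) ((envelope (free ρ)).ract hpl u a) m =
      ((gApp h₂).comp (W.gEnv p)).compl₂ (j.f lq) u (M.act hlq a m) := by
  change gApp h₁ (W.gEnv pl (envMul (free ρ) hpl u (envA (free ρ) l a))) (j.f q m) =
    gApp h₂ (W.gEnv p u) (j.f lq (M.act hlq a m))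
  rw [gEnv_envMul, gEnv_envA, gApp_gMul hpl h₁ hlq h₂, gApp_gA, j.map_act]

/-- The map `U ⊗_A M ⟶ T`, `u ⊗ m ↦ u (j m)`, defined by an action of `V` on `T` and a morphism
`j : M ⟶ T`. -/
noncomputable def envTensorEval {M : DGModule A} (j : M ⟶ T) (n : ℤ) :
    (envelope (free ρ)).TensorX M n →ₗ[k] T.X n :=
  DGBimodule.tensorLift (K := envelope (free ρ))
    (fun p q h => ((gApp h).comp (W.gEnv p)).compl₂ (j.f q)) (W.envTensorEval_balanced j)

lemma envTensorEval_tmul {M : DGModule A} (j : M ⟶ T) {n p q : ℤ} (h : p + q = n)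
    (u : EnvX (free ρ) p) (m : M.X q) :
    W.envTensorEval j n ((envelope (free ρ)).tmul M h u m) = gApp h (W.gEnv p u) (j.f q m) :=
  DGBimodule.tensorLift_tmul (K := envelope (free ρ)) _ (W.envTensorEval_balanced j) h u m

end AnchoredAction

end Representation

/-! ### The Poincaré-Birkhoff-Witt theorem for the free algebroid -/

namespace DGModule

variable {V : DGModule A} (ρ : V ⟶ tangent A)

lemma tmul_fst (N : DGModule A) {i j n : ℤ} (h : i + j = n) (a : A.X i) (x : N.X j) :
    (V.atiyah ρ).tmul N h (a, 0) x = (V.hkrIncl ρ N).f n (N.act h a x) := by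
  rw [Hom.map_act]
  refine Eq.trans ?_ (DGBimodule.tensorAct_tmul (K := V.atiyah ρ) h (zero_add j) (add_zero i) h
    a (A.one, 0) x).symm
  congr 2
  refine Prod.ext ?_ ?_
  · exact (A.mul_one _ a).symm
  · exact (map_zero (V.act (add_zero i) a)).symm

/-- `(a, v) ⊗ x = 1 ⊗ a x + (0, v) ⊗ x`. -/
lemma tmul_eq (N : DGModule A) {i j n : ℤ} (h : i + j = n) (s : (V.atiyah ρ).X i) (x : N.X j) :
    (V.atiyah ρ).tmul N h s x =
      (V.hkrIncl ρ N).f n (N.act h s.1 x) + (V.atiyah ρ).tmul N h (0, s.2) x := by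
  rw [← tmul_fst, ← LinearMap.add_apply, ← map_add, Prod.mk_add_mk, add_zero, zero_add]

/-- `(0, v) ⊗ x`. -/
noncomputable def vTmul (N : DGModule A) {i j n : ℤ} (h : i + j = n) :
    V.X i →ₗ[k] N.X j →ₗ[k] (V.atiyah ρ).TensorX N n :=
  ((V.atiyah ρ).tmul N h).comp (LinearMap.inr k (A.X i) (V.X i))

lemma vTmul_act_left (N : DGModule A) {p q pq i qi n : ℤ} (hpq : p + q = pq) (h₁ : pq + i = n)
    (hqi : q + i = qi) (h₂ : p + qi = n) (a : A.X p) (v : V.X q) (x : N.X i) :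
    vTmul ρ N h₁ (V.act hpq a v) x = ((V.atiyah ρ).tensor N).act h₂ a (vTmul ρ N hqi v x) := by
  refine Eq.trans ?_ (DGBimodule.tensorAct_tmul (K := V.atiyah ρ) h₂ hqi hpq h₁ a (0, v) x).symm
  refine congrArg (fun s => (V.atiyah ρ).tmul N h₁ s x) (Prod.ext ?_ rfl)
  exact (map_zero (A.mul hpq a)).symm

lemma vTmul_act_right (N : DGModule A) {p q i pq qi pi n : ℤ} (hqi : q + i = qi) (h₁ : p + qi = n)
    (hpq : p + q = pq) (h₂ : pq + i = n) (hpi : p + i = pi) (h₃ : q + pi = n) (v : V.X p)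
    (a : A.X q) (x : N.X i) : vTmul ρ N h₁ v (N.act hqi a x) =
      (V.hkrIncl ρ N).f n (N.act h₂ (V.anchorApply ρ hpq v a) x) +
        sgn k (p * q) • ((V.atiyah ρ).tensor N).act h₃ a (vTmul ρ N hpi v x) := by
  rw [← vTmul_act_left ρ N (by omega : q + p = pq) h₂ hpi h₃]
  refine (DGBimodule.tmul_balanced (K := V.atiyah ρ) hpq hqi h₂ h₁ (0, v) a x).symm.trans ?_
  rw [tmul_eq]
  congr 2
  · refine congrArg (fun b => N.act h₂ b x) ?_
    change A.mul hpq 0 a + V.anchorApply ρ hpq v a = _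
    rw [map_zero, LinearMap.zero_apply, zero_add]
  · change vTmul ρ N h₂ (V.symAct hpq v a) x = _
    rw [symAct_apply, map_smul, LinearMap.smul_apply]

lemma d_vTmul (N : DGModule A) {i j n i' j' n' : ℤ} (h : i + j = n) (hi : i + 1 = i')
    (hj : j + 1 = j') (hn : n + 1 = n') (h₁ : i' + j = n') (h₂ : i + j' = n') (v : V.X i)
    (x : N.X j) : ((V.atiyah ρ).tensor N).d hn (vTmul ρ N h v x) =
      vTmul ρ N h₁ (V.d hi v) x + sgn k i • vTmul ρ N h₂ v (N.d hj x) := by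
  refine (DGBimodule.tensorD_tmul (K := V.atiyah ρ) hn h hi hj h₁ h₂ (0, v) x).trans ?_
  congr 1
  refine congrArg (fun s => (V.atiyah ρ).tmul N h₁ s x) (Prod.ext ?_ rfl)
  exact map_zero (A.d hi)

end DGModule

/-! ### Connections -/

/-- A connection of `V` on `N` along `j : N ⟶ N'`: operators `∇_v : N ⟶ N'` that depend
`A`-linearly on `v`, commute with the differentials, and satisfy
`∇_v (a x) = ρ(v)(a) j(x) + (-1)^{|v||a|} a ∇_v x`. -/
structure Connection {V : DGModule A} (ρ : V ⟶ tangent A) {N N' : DGModule A} (j : N ⟶ N') where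
  op : ∀ {i j n : ℤ}, i + j = n → V.X i →ₗ[k] N.X j →ₗ[k] N'.X n
  act_op : ∀ {p q pq i qi n : ℤ} (hpq : p + q = pq) (h₁ : pq + i = n) (hqi : q + i = qi)
    (h₂ : p + qi = n) (a : A.X p) (v : V.X q) (x : N.X i),
    op h₁ (V.act hpq a v) x = N'.act h₂ a (op hqi v x)
  op_act : ∀ {p q i pq qi pi n : ℤ} (hqi : q + i = qi) (h₁ : p + qi = n) (hpq : p + q = pq)
    (h₂ : pq + i = n) (hpi : p + i = pi) (h₃ : q + pi = n) (v : V.X p) (a : A.X q) (x : N.X i),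
    op h₁ v (N.act hqi a x) =
      N'.act h₂ (V.anchorApply ρ hpq v a) (j.f i x) + sgn k (p * q) • N'.act h₃ a (op hpi v x)
  d_op : ∀ {i j n i' j' n' : ℤ} (h : i + j = n) (hi : i + 1 = i') (hj : j + 1 = j')
    (hn : n + 1 = n') (h₁ : i' + j = n') (h₂ : i + j' = n') (v : V.X i) (x : N.X j),
    N'.d hn (op h v x) = op h₁ (V.d hi v) x + sgn k i • op h₂ v (N.d hj x)

namespace Connection

variable {V : DGModule A} {ρ : V ⟶ tangent A} {N N' : DGModule A} {j : N ⟶ N'}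

lemma hom_balanced (W : Connection ρ j) {i l r il lr n : ℤ} (hil : i + l = il)
    (hlr : l + r = lr) (h₁ : il + r = n) (h₂ : i + lr = n) (s : (V.atiyah ρ).X i) (a : A.X l)
    (x : N.X r) :
    N'.act h₁ ((V.atiyah ρ).ract hil s a).1 (j.f r x) + W.op h₁ ((V.atiyah ρ).ract hil s a).2 x =
      N'.act h₂ s.1 (j.f lr (N.act hlr a x)) + W.op h₂ s.2 (N.act hlr a x) := by
  rw [W.op_act hlr h₂ hil h₁ rfl (by omega), j.map_act, ← N'.mul_act hil hlr h₁ h₂,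
    ← W.act_op (by omega : l + i = il) h₁ rfl]
  change N'.act h₁ (A.mul hil s.1 a + V.anchorApply ρ hil s.2 a) _ +
    W.op h₁ (V.symAct hil s.2 a) x = _
  rw [map_add, LinearMap.add_apply, DGModule.symAct_apply, map_smul, LinearMap.smul_apply, add_assoc]

/-- The morphism `Σ_V ⊗_A N ⟶ N'`, `(a, v) ⊗ x ↦ a j(x) + ∇_v x`. -/
noncomputable def hom (W : Connection ρ j) : (V.atiyah ρ).tensor N ⟶ N' :=
  DGBimodule.tensorHom (K := V.atiyah ρ)
    { f := fun {i r n} h => ((N'.act h).compl₂ (j.f r)).comp (LinearMap.fst k (A.X i) (V.X i)) +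
        (W.op h).comp (LinearMap.snd k (A.X i) (V.X i))
      balanced := fun hil hlj h₁ h₂ s a x => W.hom_balanced hil hlj h₁ h₂ s a x
      act := fun {l i r li ij n} hli hij h₁ h₂ a s x => by
        change N'.act h₁ (A.mul hli a s.1) (j.f r x) + W.op h₁ (V.act hli a s.2) x =
          N'.act h₂ a (N'.act hij s.1 (j.f r x) + W.op hij s.2 x)
        rw [map_add, N'.mul_act hli hij h₁ h₂, W.act_op hli h₁ hij h₂]
      d := fun {i r n i' r' n'} h hi hj hn h₁ h₂ s x => by
        change N'.d hn (N'.act h s.1 (j.f r x) + W.op h s.2 x) =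
          N'.act h₁ (A.d hi s.1) (j.f r x) + W.op h₁ (V.d hi s.2) x +
            sgn k i • (N'.act h₂ s.1 (j.f r' (N.d hj x)) + W.op h₂ s.2 (N.d hj x))
        rw [map_add, N'.d_act h hi hj hn h₁ h₂, W.d_op h hi hj hn h₁ h₂, smul_add, j.map_d]
        abel }

lemma hom_tmul (W : Connection ρ j) {i r n : ℤ} (h : i + r = n)
    (s : (V.atiyah ρ).X i) (x : N.X r) :
    W.hom.f n ((V.atiyah ρ).tmul N h s x) = N'.act h s.1 (j.f r x) + W.op h s.2 x :=
  DGBimodule.tensorHom_tmul (K := V.atiyah ρ) _ h s x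

lemma hkrIncl_hom (W : Connection ρ j) : V.hkrIncl ρ N ≫ W.hom = j :=
  DGModule.hom_ext fun n x => by
    refine (W.hom_tmul (zero_add n) _ x).trans ?_
    rw [map_zero, LinearMap.zero_apply, add_zero, N'.one_act]

/-- The connection defined by a morphism `Σ_V ⊗_A N ⟶ N'`. -/
noncomputable def ofHom (f : (V.atiyah ρ).tensor N ⟶ N') : Connection ρ (V.hkrIncl ρ N ≫ f) where
  op {_ _ n} h := (DGModule.vTmul ρ N h).compr₂ (f.f n)
  act_op hpq h₁ hqi h₂ a v x := by
    simp only [LinearMap.compr₂_apply]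
    rw [DGModule.vTmul_act_left ρ N hpq h₁ hqi h₂]
    exact f.map_act h₂ a _
  op_act hqi h₁ hpq h₂ hpi h₃ v a x := by
    simp only [LinearMap.compr₂_apply]
    rw [DGModule.vTmul_act_right ρ N hqi h₁ hpq h₂ hpi h₃, map_add, map_smul,
      ← f.map_act h₃ a, DGModule.Hom.map_act (V.hkrIncl ρ N)]
    exact congrArg (· + _) (f.map_act h₂ _ _)
  d_op h hi hj hn h₁ h₂ v x := by
    simp only [LinearMap.compr₂_apply]
    rw [← map_smul, ← map_add, ← DGModule.d_vTmul ρ N h hi hj hn h₁ h₂]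
    exact (f.map_d hn _).symm

/-- The composite of a connection along `j : N ⟶ N'` with a morphism `N' ⟶ N''`. -/
noncomputable def map {N'' : DGModule A} (W : Connection ρ j) (g : N' ⟶ N'') :
    Connection ρ (j ≫ g) where
  op {_ _ n} h := (W.op h).compr₂ (g.f n)
  act_op hpq h₁ hqi h₂ a v x := by
    simp only [LinearMap.compr₂_apply, W.act_op hpq h₁ hqi h₂, g.map_act]
  op_act hqi h₁ hpq h₂ hpi h₃ v a x := by
    simp only [LinearMap.compr₂_apply, W.op_act hqi h₁ hpq h₂ hpi h₃, map_add, map_smul, g.map_act]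
    rfl
  d_op h hi hj hn h₁ h₂ v x := by
    simp only [LinearMap.compr₂_apply]
    rw [← g.map_d, W.d_op h hi hj hn h₁ h₂, map_add, map_smul]

end Connection

namespace AnchoredAction

variable {V : DGModule A} {ρ : V ⟶ tangent A} {T : DGModule A} (W : AnchoredAction ρ T)

/-- An action of `V` on `T` is a connection along the identity of `T`. -/
def connection : Connection ρ (𝟙 T) where
  op := W.op
  act_op := W.act_op
  op_act := W.op_act
  d_op := W.d_op

/-- The morphism `Σ_V ⊗_A T ⟶ T`, `(a, v) ⊗ x ↦ a x + v x`, defined by an action of `V`. -/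
noncomputable def mul : (V.atiyah ρ).tensor T ⟶ T := W.connection.hom

lemma mul_tmul {i j n : ℤ} (h : i + j = n)
    (s : (V.atiyah ρ).X i) (x : T.X j) :
    W.mul.f n ((V.atiyah ρ).tmul T h s x) = T.act h s.1 x + W.op h s.2 x :=
  W.connection.hom_tmul h s x

lemma mul_hkrIncl {n : ℤ} (x : T.X n) :
    W.mul.f n ((V.hkrIncl ρ T).f n x) = x :=
  congrArg (fun F : T ⟶ T => F.f n x) W.connection.hkrIncl_hom

end AnchoredAction

/-! ### The action on the colimit of the tower -/

namespace DGModule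

variable {V : DGModule A} (ρ : V ⟶ tangent A) (hV : V.IsPerfect) (M : DGModule A)

/-- The modules `T_0 = M ⊆ T_1 = Σ_V ⊗_A M ⊆ T_2 ⊆ ⋯` of the tower. -/
noncomputable abbrev towerX (p : ℕ) : DGModule A := (tower ρ hV M p).X

/-- The inclusion `T_p ⟶ T_{p+1}`. -/
noncomputable def towerι (p : ℕ) : towerX ρ hV M p ⟶ towerX ρ hV M (p + 1) := (tower ρ hV M p).ι

/-- The multiplication `Σ_V ⊗_A T_p ⟶ T_{p+1}`. -/
noncomputable def towerμ (p : ℕ) :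
    (V.atiyah ρ).tensor (towerX ρ hV M p) ⟶ towerX ρ hV M (p + 1) := (tower ρ hV M p).μ

/-- The graded piece `T_{p+1} / T_p`. -/
noncomputable abbrev towerG (p : ℕ) : DGModule A := (tower ρ hV M p).G

/-- The projection `T_{p+1} ⟶ T_{p+1} / T_p`. -/
noncomputable def towerπ (p : ℕ) : towerX ρ hV M (p + 1) ⟶ towerG ρ hV M p := (tower ρ hV M p).π

lemma tower_shortExact (p : ℕ) : ShortExact (towerι ρ hV M p) (towerπ ρ hV M p) :=
  (tower ρ hV M p).shortExact

lemma towerμ_surjective (p : ℕ) (n : ℤ) : Function.Surjective ((towerμ ρ hV M p).f n) :=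
  (tower ρ hV M p).μ_surjective n

lemma hkrIncl_towerμ (p : ℕ) : V.hkrIncl ρ (towerX ρ hV M p) ≫ towerμ ρ hV M p =
    towerι ρ hV M p := rfl

lemma towerμ_tensorMap_towerι (p : ℕ) {n : ℤ} (z : (V.atiyah ρ).TensorX (towerX ρ hV M p) n) :
    (towerμ ρ hV M (p + 1)).f n (((V.atiyah ρ).tensorMap (towerι ρ hV M p)).f n z) =
      (towerι ρ hV M (p + 1)).f n ((towerμ ρ hV M p).f n z) :=
  (tower ρ hV M p).nextμ_tensorMap z

lemma towerμ_towerπ (p : ℕ) : towerμ ρ hV M (p + 1) ≫ towerπ ρ hV M (p + 1) =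
    V.hkrProj ρ (towerX ρ hV M (p + 1)) ≫ V.sym.tensorMap (towerπ ρ hV M p) :=
  (tower ρ hV M p).nextμ_nextπ

/-- The colimit of the tower. -/
noncomputable abbrev towerColim : DGModule A := seqColim (towerX ρ hV M) (towerι ρ hV M)

/-- The map `V × T_p ⟶ T_{p+1}`, `(v, x) ↦ μ ((0, v) ⊗ x)`. -/
noncomputable def towerOp (p : ℕ) {i j n : ℤ} (h : i + j = n) :
    V.X i →ₗ[k] (towerX ρ hV M p).X j →ₗ[k] (towerX ρ hV M (p + 1)).X n :=
  (vTmul ρ (towerX ρ hV M p) h).compr₂ ((towerμ ρ hV M p).f n)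

lemma towerOp_towerι (p : ℕ) {i j n : ℤ} (h : i + j = n) (v : V.X i)
    (x : (towerX ρ hV M p).X j) :
    towerOp ρ hV M (p + 1) h v ((towerι ρ hV M p).f j x) =
      (towerι ρ hV M (p + 1)).f n (towerOp ρ hV M p h v x) := by
  refine Eq.trans ?_ (towerμ_tensorMap_towerι ρ hV M p (vTmul ρ (towerX ρ hV M p) h v x))
  exact congrArg _ (DGBimodule.tensorMap_tmul (K := V.atiyah ρ) (towerι ρ hV M p) h (0, v) x).symm

/-- The operators on the colimit of the tower given by elements of `V`. -/
noncomputable def colimOp {i j n : ℤ} (h : i + j = n) :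
    V.X i →ₗ[k] (towerColim ρ hV M).X j →ₗ[k] (towerColim ρ hV M).X n :=
  seqLift₂ (fun p => (towerOp ρ hV M p h).compr₂
    (seqOf (towerX ρ hV M) (towerι ρ hV M) (p + 1) n)) fun v p x => by
      rw [LinearMap.compr₂_apply, LinearMap.compr₂_apply, towerOp_towerι, seqOf_succ]

lemma colimOp_seqOf {i j n : ℤ} (h : i + j = n) (v : V.X i) (p : ℕ)
    (x : (towerX ρ hV M p).X j) :
    colimOp ρ hV M h v (seqOf (towerX ρ hV M) (towerι ρ hV M) p j x) =
      seqOf (towerX ρ hV M) (towerι ρ hV M) (p + 1) n (towerOp ρ hV M p h v x) :=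
  seqLift₂_of _ _ v p x

/-- The action of `V` on the colimit of the tower. -/
noncomputable def colimAction : AnchoredAction ρ (towerColim ρ hV M) where
  op := colimOp ρ hV M
  act_op hpq h₁ hqi h₂ a v z := by
    induction z using seq_induction with
    | zero => simp only [map_zero]
    | add x y hx hy => simp only [map_add, hx, hy]
    | of p x =>
      rw [colimOp_seqOf, colimOp_seqOf, seqAct_of]
      refine congrArg _ ?_
      refine (congrArg _ (vTmul_act_left ρ _ hpq h₁ hqi h₂ a v x)).trans ?_
      exact (towerμ ρ hV M p).map_act h₂ a _
  op_act {_ _ _ _ _ _ n} hqi h₁ hpq h₂ hpi h₃ v a z := by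
    induction z using seq_induction with
    | zero => simp only [map_zero, smul_zero, add_zero]
    | add x y hx hy => simp only [map_add, hx, hy, smul_add]; abel
    | of p x =>
      rw [colimOp_seqOf, seqAct_of, colimOp_seqOf, seqAct_of, seqAct_of, ← seqOf_succ (p := p),
        ← map_smul, ← map_add]
      refine congrArg _ ?_
      refine (congrArg ((towerμ ρ hV M p).f n) (vTmul_act_right ρ _ hqi h₁ hpq h₂ hpi h₃ v a x)).trans ?_
      rw [map_add, map_smul, Hom.map_act (towerμ ρ hV M p)]
      rfl
  d_op h hi hj hn h₁ h₂ v z := by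
    induction z using seq_induction with
    | zero => simp only [map_zero, smul_zero, add_zero]
    | add x y hx hy => simp only [map_add, hx, hy, smul_add]; abel
    | of p x =>
      rw [colimOp_seqOf, seqD_of, colimOp_seqOf, seqD_of, colimOp_seqOf, ← map_smul, ← map_add]
      refine congrArg _ ?_
      refine ((towerμ ρ hV M p).map_d hn _).symm.trans ?_
      rw [d_vTmul ρ _ h hi hj hn h₁ h₂, map_add, map_smul]
      rfl

end DGModule

/-! ### Left multiplication on `U ⊗_A M` -/

section EnvLeft

variable (L : DGLieAlgebroid A) (M : DGModule A)

lemma envLeft_balanced {i j n : ℤ} (h : i + j = n) (u : EnvX L i) {p l q pl lq : ℤ}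
    (hpl : p + l = pl) (hlq : l + q = lq) (h₁ : pl + q = j) (_ : p + lq = j) (x : EnvX L p)
    (b : A.X l) (m : M.X q) :
    ((envelope L).tmul M (by omega : i + pl + q = n)).comp (envMul L rfl u)
        ((envelope L).ract hpl x b) m =
      ((envelope L).tmul M (by omega : i + p + lq = n)).comp (envMul L rfl u) x
        (M.act hlq b m) := by
  refine Eq.trans ?_ (DGBimodule.tmul_balanced (K := envelope L) (by omega : i + p + l = i + pl) hlq
    (by omega) (by omega) (envMul L rfl u x) b m)
  refine congrArg (fun y => (envelope L).tmul M _ y m) ?_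
  exact (envMul_assoc L rfl hpl (by omega) rfl u x (envA L l b)).symm

/-- The left multiplication `u (x ⊗ m) = u x ⊗ m` of the enveloping algebra on `U ⊗_A M`. -/
noncomputable def envLeft {i j n : ℤ} (h : i + j = n) :
    EnvX L i →ₗ[k] (envelope L).TensorX M j →ₗ[k] (envelope L).TensorX M n where
  toFun u := DGBimodule.tensorLift (K := envelope L)
    (fun p q hpq => ((envelope L).tmul M (by omega : i + p + q = n)).comp (envMul L rfl u))
    (envLeft_balanced L M h u)
  map_add' a b := DGBimodule.tensor_hom_ext fun hpq x m => by
    rw [LinearMap.add_apply, DGBimodule.tensorLift_tmul, DGBimodule.tensorLift_tmul,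
      DGBimodule.tensorLift_tmul]
    simp
  map_smul' c a := DGBimodule.tensor_hom_ext fun hpq x m => by
    rw [LinearMap.smul_apply, DGBimodule.tensorLift_tmul, DGBimodule.tensorLift_tmul]
    simp

variable {L M}

lemma envLeft_tmul {i j n p q ip : ℤ} (h : i + j = n) (hpq : p + q = j) (hip : i + p = ip)
    (h' : ip + q = n) (u : EnvX L i) (x : EnvX L p) (m : M.X q) :
    envLeft L M h u ((envelope L).tmul M hpq x m) =
      (envelope L).tmul M h' (envMul L hip u x) m := by
  subst hip
  change DGBimodule.tensorLift (K := envelope L) (fun p q hpq =>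
    ((envelope L).tmul M (by omega : i + p + q = n)).comp (envMul L rfl u))
    (envLeft_balanced L M h u) _ = _
  rw [DGBimodule.tensorLift_tmul]
  rfl

lemma envLeft_envA {i j n : ℤ} (h : i + j = n) (a : A.X i) (z : (envelope L).TensorX M j) :
    envLeft L M h (envA L i a) z = ((envelope L).tensor M).act h a z := by
  induction z using DGBimodule.tensor_induction with
  | zero => simp only [map_zero]
  | add x y hx hy => simp only [map_add, hx, hy]
  | tmul hpq x m =>
    rw [envLeft_tmul h hpq rfl (by omega)]
    exact (DGBimodule.tensorAct_tmul (K := envelope L) h hpq rfl (by omega) a x m).symm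

lemma envLeft_envMul {i j l ij jl n : ℤ} (hij : i + j = ij) (hjl : j + l = jl) (h₁ : ij + l = n)
    (h₂ : i + jl = n) (u : EnvX L i) (u' : EnvX L j) (z : (envelope L).TensorX M l) :
    envLeft L M h₁ (envMul L hij u u') z = envLeft L M h₂ u (envLeft L M hjl u' z) := by
  induction z using DGBimodule.tensor_induction with
  | zero => simp only [map_zero]
  | add x y hx hy => simp only [map_add, hx, hy]
  | tmul hpq x m =>
    rename_i p q
    rw [envLeft_tmul h₁ hpq rfl (by omega), envLeft_tmul hjl hpq rfl (by omega),
      envLeft_tmul h₂ _ (by omega : i + (j + p) = ij + p) (by omega),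
      envMul_assoc L hij rfl rfl (by omega)]

lemma d_envLeft {i j n i' j' n' : ℤ} (h : i + j = n) (hi : i + 1 = i') (hj : j + 1 = j')
    (hn : n + 1 = n') (h₁ : i' + j = n') (h₂ : i + j' = n') (u : EnvX L i)
    (z : (envelope L).TensorX M j) :
    DGBimodule.tensorD (envelope L) M hn (envLeft L M h u z) = envLeft L M h₁ (envD L hi u) z +
      sgn k i • envLeft L M h₂ u (DGBimodule.tensorD (envelope L) M hj z) := by
  induction z using DGBimodule.tensor_induction with
  | zero => simp only [map_zero, smul_zero, add_zero]
  | add x y hx hy => simp only [map_add, hx, hy, smul_add]; abel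
  | tmul hpq x m =>
    rename_i p q
    subst hi
    rw [envLeft_tmul h hpq rfl (by omega),
      DGBimodule.tensorD_tmul (K := envelope L) hn _ rfl rfl (by omega) (by omega),
      envLeft_tmul h₁ hpq (by omega : i + 1 + p = i + p + 1) (by omega),
      DGBimodule.tensorD_tmul (K := envelope L) hj hpq rfl rfl (by omega) (by omega), map_add,
      map_smul, envLeft_tmul h₂ _ (by omega : i + (p + 1) = i + p + 1) (by omega),
      envLeft_tmul h₂ _ rfl (by omega)]
    refine (congrArg (fun y => (envelope L).tmul M _ y _ + _) (envD_mul L rfl rfl rfl rfl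
      (by omega : i + 1 + p = i + p + 1) (by omega) u x)).trans ?_
    simp only [map_add, map_smul, LinearMap.add_apply, LinearMap.smul_apply, smul_add, smul_smul,
      sgn_add, add_assoc]

end EnvLeft

namespace DGModule

variable {V : DGModule A} (ρ : V ⟶ tangent A) (M : DGModule A)

lemma envV_envA {i j n : ℤ} (h : i + j = n) (h' : j + i = n) (v : V.X i) (a : A.X j) :
    envMul (free ρ) h (envV ρ i v) (envA (free ρ) j a) =
      envA (free ρ) n (V.anchorApply ρ h v a) +
        sgn k (i * j) • envMul (free ρ) h' (envA (free ρ) j a) (envV ρ i v) := by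
  rw [add_comm]
  have := EnvX.sound (.ofL_ofA (L := free ρ) h h' ((freeOf ρ).f i v) a)
  exact this

/-- The action of `V` on `U ⊗_A M` by left multiplication. -/
noncomputable def envAction : AnchoredAction ρ (envTensor ρ M) where
  op {i _ _} h := (envLeft (free ρ) M h).comp (envV ρ i)
  act_op hpq h₁ hqi h₂ a v z := by
    rw [LinearMap.comp_apply, LinearMap.comp_apply, envV_act, envLeft_envMul hpq hqi h₁ h₂,
      envLeft_envA]
  op_act hqi h₁ hpq h₂ hpi h₃ v a z := by
    rw [LinearMap.comp_apply, LinearMap.comp_apply, ← envLeft_envA, ← envLeft_envA,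
      ← envLeft_envA, ← envLeft_envMul hpq hqi h₂ h₁, envV_envA ρ hpq (by omega), map_add,
      LinearMap.add_apply, map_smul, LinearMap.smul_apply, envLeft_envMul _ hpi h₂ h₃]
  d_op h hi hj hn h₁ h₂ v z := by
    rw [LinearMap.comp_apply, LinearMap.comp_apply, LinearMap.comp_apply, envV_d]
    exact d_envLeft h hi hj hn h₁ h₂ _ z

lemma envAction_mul_tmul {i j n : ℤ} (h : i + j = n) (s : (V.atiyah ρ).X i)
    (z : (envTensor ρ M).X j) : (envAction ρ M).mul.f n ((V.atiyah ρ).tmul (envTensor ρ M) h s z) =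
      envLeft (free ρ) M h (envA (free ρ) i s.1 + envV ρ i s.2) z := by
  rw [map_add, LinearMap.add_apply, envLeft_envA]
  exact (envAction ρ M).mul_tmul h s z

/-- The inclusion `M ⟶ U ⊗_A M`, `m ↦ 1 ⊗ m`. -/
noncomputable def envUnit : M ⟶ envTensor ρ M where
  f n := (envelope (free ρ)).tmul M (zero_add n) (envA (free ρ) 0 A.one)
  map_act {i j n} h a x := by
    refine Eq.trans ?_ (DGBimodule.tensorAct_tmul (K := envelope (free ρ)) h (zero_add j)
      (add_zero i) h a (envA (free ρ) 0 A.one) x).symm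
    refine (DGBimodule.tmul_balanced (K := envelope (free ρ)) (zero_add i) h h (zero_add n) _ a
      x).symm.trans ?_
    refine congrArg (fun y => (envelope (free ρ)).tmul M h y x) ?_
    exact (one_envMul (free ρ) (zero_add i) (envA (free ρ) i a)).trans
      (envMul_one (free ρ) (add_zero i) _).symm
  map_d {i j} h x := by
    refine Eq.trans ?_ (DGBimodule.tensorD_tmul (K := envelope (free ρ)) h (zero_add i) rfl h
      (by omega) (zero_add j) (envA (free ρ) 0 A.one) x).symm
    have e : (envelope (free ρ)).d (rfl : (0 : ℤ) + 1 = 0 + 1) (envA (free ρ) 0 A.one) = 0 := by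
      refine (envA_d (free ρ) rfl A.one).symm.trans ?_
      rw [A.d_one, map_zero]
    rw [e, map_zero, LinearMap.zero_apply, zero_add, sgn_zero, one_smul]

lemma tmul_envA {i j n : ℤ} (h : i + j = n) (a : A.X i) (m : M.X j) :
    (envelope (free ρ)).tmul M h (envA (free ρ) i a) m = (envUnit ρ M).f n (M.act h a m) := by
  refine Eq.trans ?_ (DGBimodule.tmul_balanced (K := envelope (free ρ)) (zero_add i) h h
    (zero_add n) _ a m)
  exact congrArg (fun y => (envelope (free ρ)).tmul M h y m) (one_envMul (free ρ) _ _).symm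

/-! ### Comparison of the tower with the filtration of `U ⊗_A M` -/

variable {ρ M}

namespace Stage

/-- A pair of maps from a stage to a module `T` on which `V` acts, compatible with the
multiplications by `Σ_V`. -/
structure MapTo {T : DGModule A} (S : Stage ρ) (W : AnchoredAction ρ T) where
  fX : S.X ⟶ T
  fY : S.Y ⟶ T
  comm : S.μ ≫ fY = (V.atiyah ρ).tensorMap fX ≫ W.mul

namespace MapTo

variable {T : DGModule A} {S : Stage ρ} {W : AnchoredAction ρ T} (F : S.MapTo W)

lemma ι_fY : S.ι ≫ F.fY = F.fX := by
  rw [Category.assoc, F.comm, ← Category.assoc, hkrIncl_naturality, Category.assoc]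
  exact hom_ext fun n x => W.mul_hkrIncl (F.fX.f n x)

/-- Extension of a map of stages to the next stage. -/
noncomputable def next (hV : V.IsPerfect) : (S.next hV).MapTo W where
  fX := F.fY
  fY := (range S.rel).lift ((V.atiyah ρ).tensorMap F.fY ≫ W.mul) (by
    rintro n _ ⟨z, rfl⟩
    rw [Stage.rel_apply, map_sub, sub_eq_zero, ← comp_f, ← Category.assoc, ← DGBimodule.tensorMap_comp,
      F.ι_fY, ← F.comm, ← comp_f, ← Category.assoc, hkrIncl_naturality]
    exact (W.mul_hkrIncl _).symm)
  comm := rfl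

end MapTo

end Stage

variable (ρ M) in
/-- The maps from the stages of the tower to `U ⊗_A M`. -/
noncomputable def towerMapTo (hV : V.IsPerfect) : ∀ p, (tower ρ hV M p).MapTo (envAction ρ M)
  | 0 =>
    { fX := envUnit ρ M
      fY := (V.atiyah ρ).tensorMap (envUnit ρ M) ≫ (envAction ρ M).mul
      comm := Category.id_comp _ }
  | p + 1 => (towerMapTo hV p).next hV

variable (ρ M) (hV : V.IsPerfect)

/-- The map `T_p ⟶ U ⊗_A M`. -/
noncomputable def towerMap (p : ℕ) : towerX ρ hV M p ⟶ envTensor ρ M := (towerMapTo ρ M hV p).fX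

lemma towerμ_towerMap (p : ℕ) : towerμ ρ hV M p ≫ towerMap ρ M hV (p + 1) =
    (V.atiyah ρ).tensorMap (towerMap ρ M hV p) ≫ (envAction ρ M).mul :=
  (towerMapTo ρ M hV p).comm

lemma towerι_towerMap (p : ℕ) : towerι ρ hV M p ≫ towerMap ρ M hV (p + 1) = towerMap ρ M hV p :=
  (towerMapTo ρ M hV p).ι_fY

lemma towerMap_towerμ_tmul (p : ℕ) {i j n : ℤ} (h : i + j = n) (s : (V.atiyah ρ).X i)
    (x : (towerX ρ hV M p).X j) : (towerMap ρ M hV (p + 1)).f n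
      ((towerμ ρ hV M p).f n ((V.atiyah ρ).tmul (towerX ρ hV M p) h s x)) =
    envLeft (free ρ) M h (envA (free ρ) i s.1 + envV ρ i s.2) ((towerMap ρ M hV p).f j x) := by
  rw [← comp_f, towerμ_towerMap, comp_f,
    DGBimodule.tensorMap_tmul (K := V.atiyah ρ) (towerMap ρ M hV p) h s x]
  exact envAction_mul_tmul ρ M h s _

/-- The inclusion of `M = T_0` into the colimit of the tower. -/
noncomputable def colimUnit : M ⟶ towerColim ρ hV M :=
  seqIncl (towerX ρ hV M) (towerι ρ hV M) 0

/-- The map `U ⊗_A M ⟶ colim T_p` given by the action of `U` on the colimit. -/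
noncomputable def envToColim (n : ℤ) : (envTensor ρ M).X n →ₗ[k] (towerColim ρ hV M).X n :=
  (colimAction ρ hV M).envTensorEval (colimUnit ρ M hV) n

lemma envToColim_tmul {n i j : ℤ} (h : i + j = n) (u : EnvX (free ρ) i) (m : M.X j) :
    envToColim ρ M hV n ((envelope (free ρ)).tmul M h u m) =
      gApp h ((colimAction ρ hV M).gEnv i u)
        (seqOf (towerX ρ hV M) (towerι ρ hV M) 0 j m) :=
  (colimAction ρ hV M).envTensorEval_tmul (colimUnit ρ M hV) h u m

lemma envToColim_envLeft {n i j : ℤ} (h : i + j = n) (u : EnvX (free ρ) i)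
    (z : (envTensor ρ M).X j) : envToColim ρ M hV n (envLeft (free ρ) M h u z) =
      gApp h ((colimAction ρ hV M).gEnv i u) (envToColim ρ M hV j z) := by
  induction z using DGBimodule.tensor_induction with
  | zero => simp only [map_zero]
  | add x y hx hy => simp only [map_add, hx, hy]
  | tmul hpq x m =>
    rw [envLeft_tmul h hpq rfl (by omega), envToColim_tmul, envToColim_tmul,
      AnchoredAction.gEnv_envMul, gApp_gMul rfl _ hpq h]

/-- `T_p ⟶ U ⊗_A M ⟶ colim T_p` is the canonical map, which is injective: this is the
Poincaré-Birkhoff-Witt theorem. -/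
lemma envToColim_towerMap (p : ℕ) : ∀ {n : ℤ} (x : (towerX ρ hV M p).X n),
    envToColim ρ M hV n ((towerMap ρ M hV p).f n x) =
      seqOf (towerX ρ hV M) (towerι ρ hV M) p n x := by
  induction p with
  | zero =>
    intro n x
    refine (envToColim_tmul ρ M hV (zero_add n) (envA (free ρ) 0 A.one) x).trans ?_
    rw [AnchoredAction.gEnv_envA, gA_one, gApp_gOne]
  | succ p ih =>
    intro n x
    obtain ⟨z, rfl⟩ := towerμ_surjective ρ hV M p n x
    induction z using DGBimodule.tensor_induction with
    | zero => simp only [map_zero]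
    | add x y hx hy => simp only [map_add, hx, hy]
    | tmul h s x =>
      rw [towerMap_towerμ_tmul, envToColim_envLeft, ih, map_add, map_add, LinearMap.add_apply,
        AnchoredAction.gEnv_envA, AnchoredAction.gEnv_envV, gApp_gA, AnchoredAction.gApp_gV,
        tmul_eq, map_add, map_add]
      refine congrArg₂ (· + ·) ?_ (colimOp_seqOf ρ hV M h s.2 p x)
      rw [seqAct_of, ← seqOf_succ (p := p)]
      rfl

lemma towerMap_injective (p : ℕ) (n : ℤ) : Function.Injective ((towerMap ρ M hV p).f n) := by
  refine Function.Injective.of_comp (f := envToColim ρ M hV n) fun x y h => ?_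
  refine seqOf_injective (T := towerX ρ hV M) (ι := towerι ρ hV M)
    (fun p => (tower_shortExact ρ hV M p).inj) p n ?_
  rw [← envToColim_towerMap, ← envToColim_towerMap]
  exact h

lemma mem_envTensorFil_succ {p : ℕ} {i j n : ℤ} (h : i + j = n) (a : A.X i) (v : V.X i)
    {z : (envTensor ρ M).X j} (hz : z ∈ (envTensorFil ρ M p).carrier j) :
    envLeft (free ρ) M h (envA (free ρ) i a + envV ρ i v) z ∈
      (envTensorFil ρ M (p + 1)).carrier n := by
  induction hz using Submodule.span_induction with
  | zero => rw [map_zero]; exact zero_mem _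
  | add x y _ _ hx hy => rw [map_add]; exact add_mem hx hy
  | smul c x _ hx => rw [map_smul]; exact Submodule.smul_mem _ _ hx
  | mem x hx =>
    obtain ⟨q, r, hqr, y, m, hy, rfl⟩ := hx
    rw [envLeft_tmul h hqr rfl (by omega)]
    exact Submodule.subset_span ⟨i + q, r, by omega, _, m,
      Submodule.subset_span ⟨i, q, rfl, a, v, y, hy, rfl⟩, rfl⟩

/-- The image of `T_p` is the `p`-th step of the filtration of `U ⊗_A M`. -/
lemma range_towerMap (p : ℕ) : ∀ n : ℤ,
    LinearMap.range ((towerMap ρ M hV p).f n) = (envTensorFil ρ M p).carrier n := by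
  induction p with
  | zero =>
    intro n
    refine le_antisymm ?_ (Submodule.span_le.2 ?_)
    · rintro _ ⟨x, rfl⟩
      exact Submodule.subset_span ⟨0, n, zero_add n, _, x, ⟨A.one, rfl⟩, rfl⟩
    · rintro _ ⟨i, j, h, _, m, ⟨a, rfl⟩, rfl⟩
      exact ⟨M.act h a m, (tmul_envA ρ M h a m).symm⟩
  | succ p ih =>
    intro n
    refine le_antisymm ?_ (Submodule.span_le.2 ?_)
    · rintro _ ⟨x, rfl⟩
      obtain ⟨z, rfl⟩ := towerμ_surjective ρ hV M p n x
      induction z using DGBimodule.tensor_induction with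
      | zero => simp only [map_zero]; exact zero_mem _
      | add x y hx hy => simp only [map_add]; exact add_mem hx hy
      | tmul h s x =>
        rw [towerMap_towerμ_tmul]
        exact mem_envTensorFil_succ ρ M h _ _ (ih _ ▸ ⟨x, rfl⟩)
    · rintro _ ⟨i, j, h, y, m, hy, rfl⟩
      rw [SetLike.mem_coe]
      induction hy using Submodule.span_induction with
      | zero => rw [map_zero, LinearMap.zero_apply]; exact zero_mem _
      | add x y _ _ hx hy => rw [map_add, LinearMap.add_apply]; exact add_mem hx hy
      | smul c x _ hx => rw [map_smul, LinearMap.smul_apply]; exact Submodule.smul_mem _ _ hx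
      | mem y hy =>
        obtain ⟨q, r, hqr, a, v, y, hy, rfl⟩ := hy
        have hz : (envelope (free ρ)).tmul M rfl y m ∈ (envTensorFil ρ M p).carrier (r + j) :=
          Submodule.subset_span ⟨r, j, rfl, y, m, hy, rfl⟩
        rw [← ih] at hz
        obtain ⟨x, hx⟩ := hz
        refine ⟨(towerμ ρ hV M p).f n ((V.atiyah ρ).tmul (towerX ρ hV M p)
          (by omega : q + (r + j) = n) (a, v) x), ?_⟩
        rw [towerMap_towerμ_tmul, hx]
        exact envLeft_tmul _ rfl hqr h _ y m

/-- The isomorphism of `T_p` with the `p`-th step of the filtration of `U ⊗_A M`. -/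
noncomputable def towerEquiv (p : ℕ) : towerX ρ hV M p ⟶ (envTensorFil ρ M p).toDGModule where
  f n := ((towerMap ρ M hV p).f n).codRestrict _ fun x => by
    rw [← range_towerMap ρ M hV]; exact ⟨x, rfl⟩
  map_act h a x := Subtype.ext ((towerMap ρ M hV p).map_act h a x)
  map_d h x := Subtype.ext ((towerMap ρ M hV p).map_d h x)

lemma towerEquiv_bijective (p : ℕ) (n : ℤ) :
    Function.Bijective ((towerEquiv ρ M hV p).f n) := by
  refine ⟨fun x y h => towerMap_injective ρ M hV p n (congrArg Subtype.val h), fun y => ?_⟩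
  obtain ⟨x, hx⟩ := (range_towerMap ρ M hV p n).ge y.2
  exact ⟨x, Subtype.ext hx⟩

lemma mem_envTensorFil_iff (p : ℕ) {n : ℤ} (x : (towerX ρ hV M (p + 1)).X n) :
    (towerπ ρ hV M p).f n x = 0 ↔
      (towerMap ρ M hV (p + 1)).f n x ∈ (envTensorFil ρ M p).carrier n := by
  rw [(tower_shortExact ρ hV M p).exact, ← range_towerMap ρ M hV, LinearMap.mem_range]
  refine exists_congr fun y => ?_
  rw [← towerι_towerMap, comp_f]
  exact (towerMap_injective ρ M hV (p + 1) n).eq_iff.symm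

/-- The step `F^p ⊆ F^{p+1}` of the filtration of `U ⊗_A M` splits if and only if the extension
`T_p ⟶ T_{p+1} ⟶ T_{p+1} / T_p` does. -/
lemma hasDerivedSection_grProj_iff (p : ℕ) :
    HasDerivedSection (towerπ ρ hV M p) ↔
      HasDerivedSection ((envelopeFiltration ρ M).grProj (p + 1)) := by
  refine hasDerivedSection_congr (towerEquiv ρ M hV (p + 1)) (towerEquiv_bijective ρ M hV (p + 1))
    (tower_shortExact ρ hV M p).surj (DGSubmodule.proj_surjective _) fun n x => ?_
  rw [mem_envTensorFil_iff]
  exact (DGSubmodule.proj_eq_zero (((envelopeFiltration ρ M).prev (p + 1)).restrict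
    ((envelopeFiltration ρ M).F (p + 1))) ((towerEquiv ρ M hV (p + 1)).f n x)).symm

end DGModule

namespace DGModule

/-! ### Pushouts along injective quasi-isomorphisms -/

section Pushout

variable {X Y Z : DGModule A} (F : X ⟶ Y) (G : X ⟶ Z)

/-- The relations defining the pushout of `F` and `G`. -/
def pushoutRel : DGSubmodule (prod Y Z) := range (prodLift F (subHom (zeroHom X Z) G))

/-- The pushout of `F : X ⟶ Y` and `G : X ⟶ Z`. -/
abbrev pushout : DGModule A := (pushoutRel F G).quotient

/-- The map `Y ⟶ Y ⊔_X Z`. -/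
def pushoutInl : Y ⟶ pushout F G := prodLift (𝟙 Y) (zeroHom Y Z) ≫ (pushoutRel F G).proj

/-- The map `Z ⟶ Y ⊔_X Z`. -/
def pushoutInr : Z ⟶ pushout F G := prodLift (zeroHom Z Y) (𝟙 Z) ≫ (pushoutRel F G).proj

lemma pushout_condition {n : ℤ} (x : X.X n) :
    (pushoutInl F G).f n (F.f n x) = (pushoutInr F G).f n (G.f n x) := by
  rw [← sub_eq_zero]
  change (pushoutRel F G).proj.f n _ - (pushoutRel F G).proj.f n _ = 0
  rw [← map_sub, DGSubmodule.proj_eq_zero]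
  refine ⟨x, Prod.ext ?_ ?_⟩
  · exact (sub_zero (F.f n x)).symm
  · rfl

lemma comp_pushoutInl : F ≫ pushoutInl F G = G ≫ pushoutInr F G :=
  hom_ext fun _ x => pushout_condition F G x

/-- The map `Y ⊔_X Z ⟶ Z / X`. -/
def pushoutToCoker : pushout F G ⟶ (range G).quotient :=
  (pushoutRel F G).lift (prodDesc (zeroHom Y _) (range G).proj) (by
    rintro n _ ⟨x, rfl⟩
    change (0 : ((range G).quotient).X n) + (range G).proj.f n (0 - G.f n x) = 0
    rw [zero_add, DGSubmodule.proj_eq_zero]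
    exact sub_mem (zero_mem _) ⟨x, rfl⟩)

lemma shortExact_pushout (hG : ∀ n, Function.Injective (G.f n)) :
    ShortExact (pushoutInl F G) (pushoutToCoker F G) := by
  refine ⟨fun n => (injective_iff_map_eq_zero _).2 fun y hy => ?_,
    fun n y => ⟨fun hy => ?_, ?_⟩, fun n z => ?_⟩
  · obtain ⟨x, hx⟩ := (DGSubmodule.proj_eq_zero _ _).1 hy
    have h1 : F.f n x = y := congrArg Prod.fst hx
    have h2 : (0 : Z.X n) - G.f n x = 0 := congrArg Prod.snd hx
    rw [zero_sub, neg_eq_zero] at h2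
    rw [← h1, hG n (h2.trans (map_zero _).symm), map_zero]
  · obtain ⟨⟨y, z⟩, rfl⟩ := DGSubmodule.proj_surjective _ n y
    change (0 : ((range G).quotient).X n) + (range G).proj.f n z = 0 at hy
    rw [zero_add, DGSubmodule.proj_eq_zero] at hy
    obtain ⟨x, rfl⟩ := hy
    refine ⟨y + F.f n x, ?_⟩
    rw [map_add, pushout_condition]
    change (pushoutRel F G).proj.f n _ + (pushoutRel F G).proj.f n _ = _
    rw [← map_add]
    refine congrArg _ (Prod.ext ?_ ?_)
    · exact add_zero y
    · exact zero_add (G.f n x)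
  · rintro ⟨x, rfl⟩
    change (0 : ((range G).quotient).X n) + (range G).proj.f n 0 = 0
    rw [map_zero, add_zero]
  · obtain ⟨z, rfl⟩ := DGSubmodule.proj_surjective _ n z
    exact ⟨(pushoutInr F G).f n z, zero_add ((range G).proj.f n z)⟩

lemma isQuasiIso_pushoutInl (hG : ∀ n, Function.Injective (G.f n)) (hG' : IsQuasiIso G) :
    IsQuasiIso (pushoutInl F G) := fun {_ _ _} hb hc =>
  (shortExact_pushout F G hG).isQuasiIso_left ((shortExact_range G hG).isAcyclic_right hG') hb hc

end Pushout

/-! ### The dg module of graded linear maps -/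

/-- `A`-linear maps of degree `t` between dg modules, not necessarily compatible with the
differentials. -/
def linearMaps (N R : DGModule A) (t : ℤ) :
    Submodule k (∀ p : {p : ℤ × ℤ // t + p.1 = p.2}, N.X p.1.1 →ₗ[k] R.X p.1.2) where
  carrier := {L | ∀ (l i j m n : ℤ) (h : l + i = n) (hi : t + i = j) (hn : t + n = m)
    (h' : l + j = m) (a : A.X l) (x : N.X i),
    L ⟨(n, m), hn⟩ (N.act h a x) = sgn k (t * l) • R.act h' a (L ⟨(i, j), hi⟩ x)}
  add_mem' {L L'} hL hL' l i j m n h hi hn h' a x := by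
    simp only [Pi.add_apply, LinearMap.add_apply, map_add, smul_add]
    rw [hL l i j m n h hi hn h' a x, hL' l i j m n h hi hn h' a x]
  zero_mem' l i j m n h hi hn h' a x := by simp
  smul_mem' c L hL l i j m n h hi hn h' a x := by
    simp only [Pi.smul_apply, LinearMap.smul_apply, map_smul]
    rw [hL l i j m n h hi hn h' a x, smul_comm c]

variable {N R : DGModule A}

/-- The value of a graded linear map. -/
def linApp {t i j : ℤ} (h : t + i = j) : linearMaps N R t →ₗ[k] N.X i →ₗ[k] R.X j :=
  (LinearMap.proj (⟨(i, j), h⟩ : {p : ℤ × ℤ // t + p.1 = p.2})).comp (linearMaps N R t).subtype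

lemma linApp_act {t l i j m n : ℤ} (L : linearMaps N R t) (h : l + i = n) (hi : t + i = j)
    (hn : t + n = m) (h' : l + j = m) (a : A.X l) (x : N.X i) :
    linApp hn L (N.act h a x) = sgn k (t * l) • R.act h' a (linApp hi L x) :=
  L.2 l i j m n h hi hn h' a x

lemma lin_ext {t : ℤ} {L L' : linearMaps N R t}
    (h : ∀ {i j : ℤ} (hij : t + i = j) (x : N.X i), linApp hij L x = linApp hij L' x) : L = L' :=
  Subtype.ext (funext fun p => LinearMap.ext fun x => h p.2 x)

/-- The graded linear map with the given values. -/
def mkLin {t : ℤ} (f : ∀ {i j : ℤ}, t + i = j → N.X i →ₗ[k] R.X j)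
    (hf : ∀ {l i j m n : ℤ} (h : l + i = n) (hi : t + i = j) (hn : t + n = m) (h' : l + j = m)
      (a : A.X l) (x : N.X i), f hn (N.act h a x) = sgn k (t * l) • R.act h' a (f hi x)) :
    linearMaps N R t :=
  ⟨fun p => f p.2, fun _ _ _ _ _ h hi hn h' a x => hf h hi hn h' a x⟩

variable (N R)

/-- Multiplication of a graded linear map by an element of `A`. -/
def linAct {l t n : ℤ} (h : l + t = n) :
    A.X l →ₗ[k] linearMaps N R t →ₗ[k] linearMaps N R n :=
  LinearMap.mk₂ k
    (fun a L => mkLin (fun {i j} hij => (R.act (by omega : l + (t + i) = j) a).comp (linApp rfl L))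
      fun {p i j m n'} hp hi hn h' b x => by
        simp only [LinearMap.comp_apply]
        rw [linApp_act L hp rfl rfl (by omega : p + (t + i) = t + n'), map_smul,
          ← R.mul_act (rfl : l + p = l + p) _ (by omega : l + p + (t + i) = m),
          ← R.mul_act (by omega : p + l = l + p) _ (by omega : l + p + (t + i) = m),
          A.mul_comm _ (by omega : p + l = l + p) a b, map_smul, LinearMap.smul_apply, smul_smul]
        subst h
        rw [add_mul, sgn_add, mul_comm (sgn k (t * p))])
    (fun a b L => lin_ext fun _ x => LinearMap.map_add₂ _ _ _ _)
    (fun c a L => lin_ext fun _ x => LinearMap.map_smul₂ _ _ _ _)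
    (fun a L L' => lin_ext fun {i j} _ x =>
      (R.act (by omega : l + (t + i) = j) a).map_add (linApp rfl L x) (linApp rfl L' x))
    (fun c a L => lin_ext fun {i j} _ x =>
      (R.act (by omega : l + (t + i) = j) a).map_smul c (linApp rfl L x))

variable {N R} in
lemma linApp_linAct {l t n i j m : ℤ} (h : l + t = n) (hj : n + i = j) (hm : t + i = m)
    (h' : l + m = j) (a : A.X l) (L : linearMaps N R t) (x : N.X i) :
    linApp hj (linAct N R h a L) x = R.act h' a (linApp hm L x) := by
  subst hm; rfl

/-- The differential `L ↦ d ∘ L - (-1)^{|L|} L ∘ d`. -/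
def linD {t n : ℤ} (h : t + 1 = n) : linearMaps N R t →ₗ[k] linearMaps N R n where
  toFun L := mkLin (fun {i j} hij => (R.d (by omega : t + i + 1 = j)).comp (linApp rfl L) -
      sgn k t • (linApp (by omega : t + (i + 1) = j) L).comp (N.d rfl))
    fun {p i j m n'} hp hi hn h' a x => by
      simp only [LinearMap.comp_apply, LinearMap.sub_apply, LinearMap.smul_apply]
      rw [linApp_act L hp rfl rfl (by omega : p + (t + i) = t + n'), map_smul,
        R.d_act _ rfl (by omega : t + i + 1 = j) _ (by omega) h',
        N.d_act hp rfl rfl rfl (by omega : p + 1 + i = n' + 1) (by omega), map_add, map_smul,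
        linApp_act L _ rfl _ (by omega : p + 1 + (t + i) = m),
        linApp_act L _ (by omega : t + (i + 1) = j) _ h']
      subst h
      simp only [mul_add, add_mul, sgn_add, mul_one, one_mul, smul_add, map_sub, map_smul,
        smul_sub, smul_smul]
      rcases sgn_cases k t with h1 | h1 <;> rcases sgn_cases k p with h2 | h2 <;>
        simp [h1, h2]
  map_add' L L' := lin_ext fun _ x => by
    change R.d _ (linApp _ L x + linApp _ L' x) - sgn k t • (linApp _ L _ + linApp _ L' _) =
      (R.d _ (linApp _ L x) - sgn k t • linApp _ L _) +
        (R.d _ (linApp _ L' x) - sgn k t • linApp _ L' _)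
    rw [map_add, smul_add, add_sub_add_comm]
  map_smul' c L := lin_ext fun _ x => by
    change R.d _ (c • linApp _ L x) - sgn k t • (c • linApp _ L _) =
      c • (R.d _ (linApp _ L x) - sgn k t • linApp _ L _)
    rw [map_smul, smul_sub, smul_comm c (sgn k t)]

variable {N R} in
lemma linApp_linD {t n i j m i' : ℤ} (h : t + 1 = n) (hj : n + i = j) (hm : t + i = m)
    (hmj : m + 1 = j) (hi : i + 1 = i') (hj' : t + i' = j) (L : linearMaps N R t) (x : N.X i) :
    linApp hj (linD N R h L) x =
      R.d hmj (linApp hm L x) - sgn k t • linApp hj' L (N.d hi x) := by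
  subst hm hi; rfl

/-- The dg module `Hom_A(N, R)` of graded linear maps. -/
abbrev homModule : DGModule A where
  X t := linearMaps N R t
  act := linAct N R
  d := linD N R
  one_act h L := lin_ext fun hij x => by rw [linApp_linAct h hij hij (by omega), R.one_act]
  mul_act {i j l ij jl n} hij hjl h₁ h₂ a b L := lin_ext fun {p q} hpq x => by
    rw [linApp_linAct h₁ hpq rfl (by omega), linApp_linAct h₂ hpq rfl (by omega),
      linApp_linAct hjl _ rfl (by omega), R.mul_act]
  d_d {i j l} h h' L := lin_ext fun {p q} hpq x => by
    subst h
    rw [linApp_linD h' hpq rfl (by omega) rfl (by omega),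
      linApp_linD rfl _ (rfl : i + p = i + p) (by omega) rfl (by omega),
      linApp_linD rfl _ (by omega : i + (p + 1) = i + 1 + p) (by omega) rfl (by omega), map_sub,
      map_smul, R.d_d, N.d_d, sgn_add, sgn_one]
    simp
  d_act {i j n i' j' n'} h hi hj hn h₁ h₂ a L := lin_ext fun {p q} hpq x => by
    change _ = linApp hpq (linAct N R h₁ _ L) x + sgn k i • linApp hpq (linAct N R h₂ a _) x
    rw [linApp_linD hn hpq rfl (by omega) rfl (by omega),
      linApp_linAct h _ (rfl : j + p = j + p) (by omega),
      linApp_linAct h _ (by omega : j + (p + 1) = j' + p) (by omega),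
      linApp_linAct h₁ _ (rfl : j + p = j + p) (by omega),
      linApp_linAct h₂ _ (rfl : j' + p = j' + p) (by omega),
      linApp_linD hj _ rfl (by omega) rfl (by omega),
      R.d_act _ hi (by omega : j + p + 1 = j' + p) _ (by omega) (by omega), map_sub, map_smul]
    subst h
    rw [sgn_add, smul_sub, smul_smul, add_sub_assoc]

variable {N R}
variable (V : DGModule A)

lemma idTensor_balanced {t s n : ℤ} (h : t + s = n) (L : linearMaps N R t) {i l j il lj : ℤ}
    (hil : i + l = il) (hlj : l + j = lj) (h₁ : il + j = s) (_ : i + lj = s) (w : V.X i)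
    (a : A.X l) (x : N.X j) :
    (sgn k (t * il) • (V.sym.tmul R (by omega : il + (t + j) = n)).compl₂ (linApp rfl L))
        (V.symAct hil w a) x =
      (sgn k (t * i) • (V.sym.tmul R (by omega : i + (t + lj) = n)).compl₂ (linApp rfl L)) w
        (N.act hlj a x) := by
  simp only [LinearMap.smul_apply, LinearMap.compl₂_apply]
  rw [linApp_act L hlj rfl rfl (by omega : l + (t + j) = t + lj), map_smul, smul_smul,
    DGBimodule.tmul_balanced (K := V.sym) hil (by omega : l + (t + j) = t + lj) (by omega)
      (by omega)]
  subst hil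
  rw [mul_add, sgn_add]

/-- The map `w ⊗ x ↦ (-1)^{|L||w|} w ⊗ L(x)` for a graded linear map `L`. -/
noncomputable def idTensor {t s n : ℤ} (h : t + s = n) :
    linearMaps N R t →ₗ[k] V.sym.TensorX N s →ₗ[k] V.sym.TensorX R n where
  toFun L := DGBimodule.tensorLift (K := V.sym)
    (fun i j hij => sgn k (t * i) •
      (V.sym.tmul R (by omega : i + (t + j) = n)).compl₂ (linApp rfl L))
    (idTensor_balanced V h L)
  map_add' L L' := DGBimodule.tensor_hom_ext fun hij w x => by
    rw [LinearMap.add_apply, DGBimodule.tensorLift_tmul, DGBimodule.tensorLift_tmul,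
      DGBimodule.tensorLift_tmul]
    simp
  map_smul' c L := DGBimodule.tensor_hom_ext fun hij w x => by
    rw [LinearMap.smul_apply, DGBimodule.tensorLift_tmul, DGBimodule.tensorLift_tmul]
    simp [smul_comm c]

variable {V}

lemma idTensor_tmul {t s n i j m : ℤ} (h : t + s = n) (L : linearMaps N R t) (hij : i + j = s)
    (hm : t + j = m) (h' : i + m = n) (w : V.X i) (x : N.X j) :
    idTensor V h L (V.sym.tmul N hij w x) =
      sgn k (t * i) • V.sym.tmul R h' w (linApp hm L x) := by
  subst hm
  change DGBimodule.tensorLift (K := V.sym) (fun i j hij => sgn k (t * i) •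
      (V.sym.tmul R (by omega : i + (t + j) = n)).compl₂ (linApp rfl L))
    (idTensor_balanced V h L) _ = _
  rw [DGBimodule.tensorLift_tmul]
  rfl

lemma idTensor_act {t l i j m n : ℤ} (L : linearMaps N R t) (h : l + i = n) (hi : t + i = j)
    (hn : t + n = m) (h' : l + j = m) (a : A.X l) (z : V.sym.TensorX N i) :
    idTensor V hn L (DGBimodule.tensorAct V.sym N h a z) =
      sgn k (t * l) • DGBimodule.tensorAct V.sym R h' a (idTensor V hi L z) := by
  induction z using DGBimodule.tensor_induction with
  | zero => simp only [map_zero, smul_zero]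
  | add x y hx hy => simp only [map_add, hx, hy, smul_add]
  | tmul hpq w x =>
    rename_i p q
    rw [DGBimodule.tensorAct_tmul (K := V.sym) h hpq rfl (by omega),
      idTensor_tmul hn L _ rfl (by omega), idTensor_tmul hi L hpq rfl (by omega), map_smul,
      DGBimodule.tensorAct_tmul (K := V.sym) h' _ rfl (by omega), smul_smul, mul_add, sgn_add]

lemma tmul_act_left {p q pq i qi n : ℤ} (hpq : p + q = pq) (h₁ : pq + i = n) (hqi : q + i = qi)
    (h₂ : p + qi = n) (a : A.X p) (w : V.X q) (x : N.X i) :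
    V.sym.tmul N h₁ (V.act hpq a w) x =
      DGBimodule.tensorAct V.sym N h₂ a (V.sym.tmul N hqi w x) :=
  (DGBimodule.tensorAct_tmul (K := V.sym) h₂ hqi hpq h₁ a w x).symm

lemma tmul_act_right {p q i qi pi n : ℤ} (hqi : q + i = qi) (h₁ : p + qi = n) (hpi : p + i = pi)
    (h₂ : q + pi = n) (w : V.X p) (a : A.X q) (x : N.X i) : V.sym.tmul N h₁ w (N.act hqi a x) =
      sgn k (p * q) • DGBimodule.tensorAct V.sym N h₂ a (V.sym.tmul N hpi w x) := by
  rw [← tmul_act_left (rfl : q + p = q + p) (by omega) hpi h₂,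
    ← DGBimodule.tmul_balanced (K := V.sym) (by omega : p + q = q + p) hqi (by omega) h₁]
  change V.sym.tmul N _ (V.symAct (by omega) w a) x = _
  rw [symAct_apply, map_smul, LinearMap.smul_apply]

variable (N V) in
/-- The graded linear map `x ↦ w ⊗ x`. -/
noncomputable def tmulLeft (t : ℤ) : V.X t →ₗ[k] linearMaps N (V.sym.tensor N) t where
  toFun w := ⟨fun p => V.sym.tmul N p.2 w, fun _ _ _ _ _ h hi hn h' a x =>
    tmul_act_right h hn hi h' w a x⟩
  map_add' w w' := by apply Subtype.ext; funext p; exact map_add _ _ _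
  map_smul' c w := by apply Subtype.ext; funext p; exact map_smul _ _ _

lemma linApp_tmulLeft {t i j : ℤ} (h : t + i = j) (w : V.X t) (x : N.X i) :
    linApp h (tmulLeft N V t w) x = V.sym.tmul N h w x := rfl

variable (N V) in
/-- The morphism `V ⟶ Hom_A(N, V ⊗_A N)`, `w ↦ w ⊗ -`. -/
noncomputable def tmulLeftHom : V ⟶ homModule N (V.sym.tensor N) where
  f := tmulLeft N V
  map_act {l t n} h a w := lin_ext fun {i j} hij x => by
    rw [linApp_linAct h hij rfl (by omega), linApp_tmulLeft, linApp_tmulLeft,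
      tmul_act_left h hij rfl (by omega)]
  map_d {t n} h w := lin_ext fun {i j} hij x => by
    rw [linApp_linD h hij rfl (by omega) rfl (by omega), linApp_tmulLeft, linApp_tmulLeft,
      linApp_tmulLeft, DGBimodule.tensorD_tmul (K := V.sym) _ rfl h rfl hij (by omega),
      add_sub_cancel_right]

lemma idTensor_linAct {l t s n m : ℤ} (h : l + t = n) (hn : n + s = m) {r : ℤ} (hr : t + s = r)
    (h' : l + r = m) (a : A.X l) (L : linearMaps N R t) (z : V.sym.TensorX N s) :
    idTensor V hn (linAct N R h a L) z =
      DGBimodule.tensorAct V.sym R h' a (idTensor V hr L z) := by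
  induction z using DGBimodule.tensor_induction with
  | zero => simp only [map_zero]
  | add x y hx hy => simp only [map_add, hx, hy]
  | tmul hpq w x =>
    rename_i p q
    rw [idTensor_tmul hn _ hpq rfl (by omega), idTensor_tmul hr L hpq rfl (by omega),
      linApp_linAct h _ (rfl : t + q = t + q) (by omega), map_smul,
      tmul_act_right _ _ (by omega : p + (t + q) = r) h', smul_smul]
    subst h
    rw [add_mul, sgn_add, mul_comm p l, mul_comm (sgn k (l * p)), mul_assoc, sgn_mul_self, mul_one]

lemma idTensor_linD {t n s r m s' : ℤ} (h : t + 1 = n) (hn : n + s = m) (hr : t + s = r)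
    (hrm : r + 1 = m) (hs : s + 1 = s') (hm : t + s' = m) (L : linearMaps N R t)
    (z : V.sym.TensorX N s) :
    idTensor V hn (linD N R h L) z = DGBimodule.tensorD V.sym R hrm (idTensor V hr L z) -
      sgn k t • idTensor V hm L (DGBimodule.tensorD V.sym N hs z) := by
  induction z using DGBimodule.tensor_induction with
  | zero => simp only [map_zero, smul_zero, sub_zero]
  | add x y hx hy => simp only [map_add, hx, hy, smul_add]; abel
  | tmul hpq w x =>
    rename_i p q
    rw [idTensor_tmul hn _ hpq rfl (by omega), idTensor_tmul hr L hpq rfl (by omega),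
      linApp_linD h _ (rfl : t + q = t + q) (by omega) rfl (by omega), map_smul,
      DGBimodule.tensorD_tmul (K := V.sym) hrm _ rfl (by omega : t + q + 1 = n + q) (by omega)
        (by omega),
      DGBimodule.tensorD_tmul (K := V.sym) hs hpq rfl rfl (by omega) (by omega), map_add, map_smul,
      idTensor_tmul hm L _ (rfl : t + q = t + q) (by omega),
      idTensor_tmul hm L _ (by omega : t + (q + 1) = n + q) (by omega), map_sub, map_smul]
    subst h
    simp only [mul_add, add_mul, sgn_add, mul_one, one_mul, smul_add, smul_sub, smul_smul]
    rcases sgn_cases k t with h1 | h1 <;> rcases sgn_cases k p with h2 | h2 <;>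
      simp [h1, h2]

variable (N R V) in
/-- The morphism `Hom_A(N, R) ⟶ Hom_A(V ⊗_A N, V ⊗_A R)`, `L ↦ id ⊗ L`. -/
noncomputable def idTensorHom :
    homModule N R ⟶ homModule (V.sym.tensor N) (V.sym.tensor R) where
  f t :=
    { toFun := fun L => mkLin (fun h => idTensor V h L)
        fun h hi hn h' a z => idTensor_act L h hi hn h' a z
      map_add' := fun L L' => lin_ext fun h z => LinearMap.map_add₂ (idTensor V h) _ _ _
      map_smul' := fun c L => lin_ext fun h z => LinearMap.map_smul₂ (idTensor V h) _ _ _ }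
  map_act {l t n} h a L := lin_ext fun {i j} hij z => by
    rw [linApp_linAct h hij (rfl : t + i = t + i) (by omega)]
    exact idTensor_linAct h hij rfl (by omega) a L z
  map_d {t n} h L := lin_ext fun {i j} hij z => by
    rw [linApp_linD h hij (rfl : t + i = t + i) (by omega) rfl (by omega)]
    exact idTensor_linD h hij rfl (by omega) rfl (by omega) L z

/-- The composite of a graded linear map with a morphism. -/
def linPost {R' : DGModule A} (g : R ⟶ R') (t : ℤ) :
    linearMaps N R t →ₗ[k] linearMaps N R' t where
  toFun L := mkLin (fun {_ j} h => (g.f j).comp (linApp h L)) fun h hi hn h' a x => by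
    simp only [LinearMap.comp_apply]
    rw [linApp_act L h hi hn h', map_smul, g.map_act]
  map_add' L L' := lin_ext fun {_ j} h x => (g.f j).map_add (linApp h L x) (linApp h L' x)
  map_smul' c L := lin_ext fun {_ j} h x => (g.f j).map_smul c (linApp h L x)

lemma linApp_linPost {R' : DGModule A} (g : R ⟶ R') {t i j : ℤ} (h : t + i = j)
    (L : linearMaps N R t) (x : N.X i) :
    linApp h (linPost g t L) x = g.f j (linApp h L x) := rfl

/-- Composition with a morphism, `Hom_A(N, R) ⟶ Hom_A(N, R')`. -/
def homPost (N : DGModule A) {R' : DGModule A} (g : R ⟶ R') :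
    homModule N R ⟶ homModule N R' where
  f := linPost g
  map_act {l t n} h a L := lin_ext fun {i j} hij x => by
    rw [linApp_linAct h hij (rfl : t + i = t + i) (by omega), linApp_linPost, linApp_linPost,
      linApp_linAct h hij (rfl : t + i = t + i) (by omega), g.map_act]
  map_d {t n} h L := lin_ext fun {i j} hij x => by
    rw [linApp_linD h hij (rfl : t + i = t + i) (by omega) rfl (by omega), linApp_linPost,
      linApp_linPost, linApp_linPost,
      linApp_linD h hij (rfl : t + i = t + i) (by omega) rfl (by omega), map_sub, map_smul,
      g.map_d]

/-- The morphism `V ⊗_A N ⟶ R` corresponding to a morphism `V ⟶ Hom_A(N, R)`. -/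
noncomputable def uncurry (δ : V ⟶ homModule N R) : V.sym.tensor N ⟶ R :=
  DGBimodule.tensorHom (K := V.sym)
    { f := fun {i j n} h => (linApp h).comp (δ.f i : V.X i →ₗ[k] linearMaps N R i)
      balanced := fun {i l j il lj n} hil hlj h₁ h₂ w a x => by
        simp only [LinearMap.comp_apply]
        rw [linApp_act (δ.f i w) hlj (rfl : i + j = i + j) h₂ (by omega)]
        change linApp h₁ (δ.f il (V.symAct hil w a)) x = _
        rw [symAct_apply, map_smul, map_smul, LinearMap.smul_apply, δ.map_act,
          linApp_linAct _ h₁ (rfl : i + j = i + j) (by omega)]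
      act := fun {l i j li ij n} hli hij h₁ h₂ a w x => by
        simp only [LinearMap.comp_apply]
        rw [← linApp_linAct hli h₁ hij h₂]
        exact congrArg (fun L => linApp h₁ L x) (δ.map_act hli a w)
      d := fun {i j n i' j' n'} h hi hj hn h₁ h₂ w x => by
        simp only [LinearMap.comp_apply]
        refine Eq.trans ?_ (congrArg (fun L : linearMaps N R i' => linApp h₁ L x + _)
          (δ.map_d hi w)).symm
        rw [linApp_linD hi h₁ h hn hj h₂, sub_add_cancel] }

lemma uncurry_tmul (δ : V ⟶ homModule N R) {i j n : ℤ} (h : i + j = n) (w : V.X i) (x : N.X j) :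
    (uncurry δ).f n (V.sym.tmul N h w x) = linApp h (δ.f i w : linearMaps N R i) x :=
  DGBimodule.tensorHom_tmul (K := V.sym) _ h w x

/-! ### The symmetry of `V ⊗ V ⊗ N` -/

variable (N V) in
/-- The symmetry `w ⊗ w' ⊗ x ↦ (-1)^{|w||w'|} w' ⊗ w ⊗ x` of `V ⊗_A V ⊗_A N`. -/
noncomputable def tensorSwap :
    V.sym.tensor (V.sym.tensor N) ⟶ V.sym.tensor (V.sym.tensor N) :=
  uncurry (tmulLeftHom N V ≫ idTensorHom N (V.sym.tensor N) V)

lemma tensorSwap_tmul {p q i qi pi n : ℤ} (hqi : q + i = qi) (h : p + qi = n) (hpi : p + i = pi)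
    (h' : q + pi = n) (w : V.X p) (w' : V.X q) (x : N.X i) :
    (tensorSwap N V).f n (V.sym.tmul (V.sym.tensor N) h w (V.sym.tmul N hqi w' x)) =
      sgn k (p * q) • V.sym.tmul (V.sym.tensor N) h' w' (V.sym.tmul N hpi w x) := by
  refine (uncurry_tmul _ h w _).trans ?_
  exact idTensor_tmul h (tmulLeft N V p w) hqi hpi h' w' x

lemma tensor_tensor_hom_ext {F G : V.sym.tensor (V.sym.tensor N) ⟶ R}
    (h : ∀ {p q i qi n : ℤ} (hqi : q + i = qi) (hn : p + qi = n) (w : V.X p) (w' : V.X q)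
      (x : N.X i), F.f n (V.sym.tmul (V.sym.tensor N) hn w (V.sym.tmul N hqi w' x)) =
        G.f n (V.sym.tmul (V.sym.tensor N) hn w (V.sym.tmul N hqi w' x))) : F = G :=
  DGBimodule.tensor_hom_ext' (K := V.sym) fun {p s n} hn w z => by
    induction z using DGBimodule.tensor_induction with
    | zero => simp only [map_zero]
    | add x y hx hy => simp only [map_add, hx, hy]
    | tmul hqi w' x => exact h hqi hn w w' x

lemma tensorSwap_tensorSwap : tensorSwap N V ≫ tensorSwap N V = 𝟙 _ :=
  tensor_tensor_hom_ext fun {p q i qi n} hqi hn w w' x => by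
    rw [comp_f, tensorSwap_tmul hqi hn rfl (by omega), map_smul,
      tensorSwap_tmul rfl _ hqi hn, smul_smul, mul_comm q p, sgn_mul_self, one_smul]
    rfl

lemma tensorSwap_bijective (n : ℤ) : Function.Bijective ((tensorSwap N V).f n) :=
  Function.bijective_iff_has_inverse.2 ⟨(tensorSwap N V).f n,
    fun x => congrArg (fun F : V.sym.tensor (V.sym.tensor N) ⟶ _ => F.f n x)
      tensorSwap_tensorSwap,
    fun x => congrArg (fun F : V.sym.tensor (V.sym.tensor N) ⟶ _ => F.f n x)
      tensorSwap_tensorSwap⟩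

lemma uncurry_idTensorHom (g : V.sym.tensor N ⟶ R) :
    uncurry ((tmulLeftHom N V ≫ homPost N g) ≫ idTensorHom N R V) =
      tensorSwap N V ≫ V.sym.tensorMap g :=
  tensor_tensor_hom_ext fun {p q i qi n} hqi hn w w' x => by
    refine (uncurry_tmul _ hn w _).trans ?_
    refine Eq.trans ?_ (congrArg ((V.sym.tensorMap g).f n)
      (tensorSwap_tmul hqi hn rfl (by omega) w w' x)).symm
    rw [map_smul, DGBimodule.tensorMap_tmul (K := V.sym)]
    exact idTensor_tmul hn _ hqi rfl (by omega) w' x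

end DGModule

/-! ### Connections on tensor products -/

namespace Connection

open DGModule

variable {V : DGModule A} {ρ : V ⟶ tangent A}

section Hom

variable {N N' P' R : DGModule A} {j : N ⟶ N'} {j' : V.sym.tensor N ⟶ P'}
  (W : Connection ρ j) (W' : Connection ρ j') (α : P' ⟶ R) (β : V.sym.tensor N' ⟶ R)

/-- The value `α (∇_v (w ⊗ x)) - (-1)^{|v||w|} β (w ⊗ ∇_v x)` of the commutator of `∇_v` and
`w ⊗ -`. -/
noncomputable def commOp {p q t : ℤ} (h : p + q = t) {i r : ℤ} (hi : t + i = r) :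
    V.X p →ₗ[k] V.X q →ₗ[k] N.X i →ₗ[k] R.X r :=
  LinearMap.mk₂ k
    (fun v w => ((α.f r).comp (W'.op (by omega : p + (q + i) = r) v)).comp (V.sym.tmul N rfl w) -
      sgn k (p * q) •
        ((β.f r).comp (V.sym.tmul N' (by omega : q + (p + i) = r) w)).comp (W.op rfl v))
    (fun v v' w => by ext x; simp; abel)
    (fun c v w => by ext x; simp [smul_sub, smul_comm c])
    (fun v w w' => by ext x; simp; abel)
    (fun c v w => by ext x; simp [smul_sub, smul_comm c])

lemma commOp_apply {p q t : ℤ} (h : p + q = t) {i r pi qi : ℤ} (hi : t + i = r) (hqi : q + i = qi)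
    (h₁ : p + qi = r) (hpi : p + i = pi) (h₂ : q + pi = r) (v : V.X p) (w : V.X q) (x : N.X i) :
    commOp W W' α β h hi v w x = α.f r (W'.op h₁ v (V.sym.tmul N hqi w x)) -
      sgn k (p * q) • β.f r (V.sym.tmul N' h₂ w (W.op hpi v x)) := by
  subst hqi hpi; rfl

lemma commOp_act_left {l p lp q s t : ℤ} (hl : l + p = lp) (h : lp + q = t) (hs : p + q = s)
    {i r m : ℤ} (hi : t + i = r) (hm : s + i = m) (h' : l + m = r) (a : A.X l) (v : V.X p)
    (w : V.X q) (x : N.X i) :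
    commOp W W' α β h hi (V.act hl a v) w x = R.act h' a (commOp W W' α β hs hm v w x) := by
  rw [commOp_apply W W' α β h hi rfl (by omega) rfl (by omega),
    commOp_apply W W' α β hs hm rfl (by omega) rfl (by omega),
    W'.act_op hl _ (by omega : p + (q + i) = m) h', W.act_op hl _ rfl (by omega), α.map_act,
    tmul_act_right (N := N') _ _ (by omega : q + (p + i) = m) h', map_smul, β.map_act, map_sub,
    map_smul, smul_smul]
  subst hl
  rw [add_mul, sgn_add, mul_comm q l, mul_comm (sgn k (l * q)), mul_assoc, sgn_mul_self, mul_one]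

variable {α β}

lemma commOp_act (hc : j' ≫ α = V.sym.tensorMap j ≫ β) {p q t : ℤ} (h : p + q = t) (v : V.X p)
    (w : V.X q) {l i r m n : ℤ} (hl : l + i = n) (hi : t + i = r) (hn : t + n = m)
    (h' : l + r = m) (a : A.X l) (x : N.X i) :
    commOp W W' α β h hn v w (N.act hl a x) =
      sgn k (t * l) • R.act h' a (commOp W W' α β h hi v w x) := by
  have e : α.f (q + i) (j'.f (q + i) (V.sym.tmul N rfl w x)) =
      β.f (q + i) (V.sym.tmul N' rfl w (j.f i x)) := by
    rw [← DGBimodule.tensorMap_tmul (K := V.sym)]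
    exact congrArg (fun F : V.sym.tensor N ⟶ R => F.f (q + i) (V.sym.tmul N rfl w x)) hc
  rw [commOp_apply W W' α β h hn rfl (by omega) rfl (by omega),
    commOp_apply W W' α β h hi rfl (by omega) rfl (by omega),
    tmul_act_right hl _ (rfl : q + i = q + i) (by omega), map_smul,
    W'.op_act (by omega : l + (q + i) = q + n) _ rfl (by omega) (by omega : p + (q + i) = r) h',
    W.op_act hl rfl rfl (by omega : p + l + i = p + n) (rfl : p + i = p + i) (by omega)]
  simp only [map_add, map_smul, α.map_act]
  rw [e, tmul_act_right (N := N') _ _ (rfl : q + i = q + i) (by omega : p + l + (q + i) = m),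
    tmul_act_right (N := N') _ _ (by omega : q + (p + i) = r) h']
  simp only [map_smul, smul_add, map_sub, smul_sub, smul_smul, β.map_act]
  subst h
  have e1 : sgn k (q * p) = sgn k (p * q) := by rw [mul_comm]
  simp only [mul_add, add_mul, sgn_add, e1]
  rcases sgn_cases k (p * q) with h1 | h1 <;> rcases sgn_cases k (q * l) with h2 | h2 <;>
    rcases sgn_cases k (p * l) with h3 | h3 <;> simp [h1, h2, h3]

variable (α β) in
lemma commOp_act_mid {p l q lq pl s t : ℤ} (hl : l + q = lq) (h : p + lq = t) (hpl : p + l = pl)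
    (hs : p + q = s) {i r m qi : ℤ} (hi : t + i = r) (hqi : q + i = qi) (h₁ : pl + qi = r)
    (hm : s + i = m) (h₂ : l + m = r) (v : V.X p) (a : A.X l) (w : V.X q) (x : N.X i) :
    commOp W W' α β h hi v (V.act hl a w) x =
      R.act h₁ (V.anchorApply ρ hpl v a) (α.f qi (j'.f qi (V.sym.tmul N hqi w x))) +
        sgn k (p * l) • R.act h₂ a (commOp W W' α β hs hm v w x) := by
  rw [commOp_apply W W' α β h hi rfl (by omega) rfl (by omega),
    commOp_apply W W' α β hs hm hqi (by omega) rfl (by omega),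
    tmul_act_left hl _ hqi (by omega), tmul_act_left hl _ (by omega : q + (p + i) = m) h₂,
    W'.op_act (by omega : l + qi = lq + i) _ hpl h₁ (by omega : p + qi = m) h₂]
  simp only [map_add, map_smul, α.map_act, β.map_act, map_sub, smul_sub, smul_smul]
  subst hl
  rw [mul_add, sgn_add, add_sub_assoc]

variable (α β) in
lemma d_commOp {p q t p' q' t' i i' r r' : ℤ} (h : p + q = t) (hp : p + 1 = p') (hq : q + 1 = q')
    (ht : t + 1 = t') (hi : i + 1 = i') (hr : r + 1 = r') (hti : t + i = r) (h₁ : p' + q = t')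
    (h₂ : p + q' = t') (ht' : t' + i = r') (hti' : t + i' = r') (v : V.X p) (w : V.X q)
    (x : N.X i) :
    R.d hr (commOp W W' α β h hti v w x) = commOp W W' α β h₁ ht' (V.d hp v) w x +
      sgn k p • commOp W W' α β h₂ ht' v (V.d hq w) x +
      sgn k t • commOp W W' α β h hti' v w (N.d hi x) := by
  rw [commOp_apply W W' α β h hti rfl (by omega) rfl (by omega),
    commOp_apply W W' α β h₁ ht' rfl (by omega) (by omega : p' + i = p + i + 1) (by omega),
    commOp_apply W W' α β h₂ ht' (by omega : q' + i = q + i + 1) (by omega) rfl (by omega),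
    commOp_apply W W' α β h hti' (by omega : q + i' = q + i + 1) (by omega)
      (by omega : p + i' = p + i + 1) (by omega), map_sub, map_smul, ← α.map_d, ← β.map_d,
    W'.d_op _ hp rfl hr (by omega) (by omega),
    DGBimodule.tensorD_tmul (K := V.sym) _ rfl hq hi (by omega : q' + i = q + i + 1) (by omega),
    DGBimodule.tensorD_tmul (K := V.sym) hr _ hq rfl (by omega : q' + (p + i) = r') (by omega),
    W.d_op rfl hp hi rfl (by omega : p' + i = p + i + 1) (by omega)]
  subst h hp hq
  have e1 : sgn k (q * p) = sgn k (p * q) := by rw [mul_comm]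
  simp only [map_add, map_smul, smul_add, smul_sub, smul_smul, add_mul, mul_add, mul_one, one_mul,
    sgn_add]
  rcases sgn_cases k (p * q) with h1 | h1 <;> rcases sgn_cases k p with h2 | h2 <;>
    rcases sgn_cases k q with h3 | h3 <;> simp [h1, h2, h3] <;> abel

/-- The connection on `V` with values in graded linear maps given by the commutators of `∇_v` and
`w ⊗ -`. -/
noncomputable def comm (hc : j' ≫ α = V.sym.tensorMap j ≫ β) :
    Connection ρ (tmulLeftHom N V ≫ homPost N (j' ≫ α)) where
  op {p q t} h := LinearMap.mk₂ k
    (fun v w => mkLin (fun {i r} hi => commOp W W' α β h hi v w)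
      fun hl hi hn h' a x => commOp_act W W' hc h v w hl hi hn h' a x)
    (fun v v' w => lin_ext fun {i r} hi x =>
      congrArg (fun L : N.X i →ₗ[k] R.X r => L x) ((commOp W W' α β h hi).map_add₂ v v' w))
    (fun c v w => lin_ext fun {i r} hi x =>
      congrArg (fun L : N.X i →ₗ[k] R.X r => L x) ((commOp W W' α β h hi).map_smul₂ c v w))
    (fun v w w' => lin_ext fun {i r} hi x =>
      congrArg (fun L : N.X i →ₗ[k] R.X r => L x) ((commOp W W' α β h hi v).map_add w w'))
    (fun c v w => lin_ext fun {i r} hi x =>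
      congrArg (fun L : N.X i →ₗ[k] R.X r => L x) ((commOp W W' α β h hi v).map_smul c w))
  act_op {l p lp q s t} hl h hs ht a v w := lin_ext fun {i r} hi x => by
    rw [linApp_linAct ht hi (rfl : s + i = s + i) (by omega)]
    exact commOp_act_left W W' α β hl h hs hi rfl (by omega) a v w x
  op_act {p l q pl lq s t} hl h hpl ht hs h₃ v a w := lin_ext fun {i r} hi x => by
    refine (commOp_act_mid W W' α β hl h hpl hs hi rfl (by omega) rfl (by omega) v a w x).trans ?_
    rw [map_add, map_smul, LinearMap.add_apply, LinearMap.smul_apply,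
      linApp_linAct ht hi (rfl : q + i = q + i) (by omega),
      linApp_linAct h₃ hi (rfl : s + i = s + i) (by omega)]
    rfl
  d_op {p q t p' q' t'} h hp hq ht h₁ h₂ v w := lin_ext fun {i r'} hi x => by
    rw [map_add, map_smul, LinearMap.add_apply, LinearMap.smul_apply,
      linApp_linD ht hi (rfl : t + i = t + i) (by omega) rfl (by omega)]
    exact sub_eq_of_eq_add
      (d_commOp W W' α β h hp hq ht rfl (by omega) rfl h₁ h₂ hi (by omega) v w x)

end Hom

section Tensor

variable {Z S P' R : DGModule A} {δ : V ⟶ homModule Z S} {j' : Z ⟶ P'}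
  (D : Connection ρ δ) (W' : Connection ρ j') {α : V.sym.tensor P' ⟶ R} {β : S ⟶ R}

variable (α β) in
/-- The trilinear map `(v, w, z) ↦ (-1)^{|v||w|} α (w ⊗ ∇_v z) + β (D_v(w)(z))`. -/
noncomputable def tensorOpAux {p q i s n : ℤ} (hs : q + i = s) (h : p + s = n) :
    V.X p →ₗ[k] V.X q →ₗ[k] Z.X i →ₗ[k] R.X n :=
  LinearMap.mk₂ k
    (fun v w => sgn k (p * q) •
        ((α.f n).comp (V.sym.tmul P' (by omega : q + (p + i) = n) w)).comp (W'.op rfl v) +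
      (β.f n).comp (linApp (by omega : p + q + i = n) (D.op rfl v w : linearMaps Z S (p + q))))
    (fun v v' w => by ext x; simp; abel)
    (fun c v w => by ext x; simp [smul_comm c])
    (fun v w w' => by ext x; simp; abel)
    (fun c v w => by ext x; simp [smul_comm c])

variable (α β) in
lemma tensorOpAux_apply {p q i s n pi pq : ℤ} (hs : q + i = s) (h : p + s = n) (hpi : p + i = pi)
    (h₁ : q + pi = n) (hpq : p + q = pq) (h₂ : pq + i = n) (v : V.X p) (w : V.X q) (z : Z.X i) :
    tensorOpAux D W' α β hs h v w z =
      sgn k (p * q) • α.f n (V.sym.tmul P' h₁ w (W'.op hpi v z)) +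
        β.f n (linApp h₂ (D.op hpq v w : linearMaps Z S pq) z) := by
  subst hpi hpq; rfl

lemma tensorOpAux_act_mid (hc : V.sym.tensorMap j' ≫ α = uncurry δ ≫ β) {p l q i lq s pl n : ℤ}
    (hlq : l + q = lq) (hs : lq + i = s) (h : p + s = n) {t m : ℤ} (ht : q + i = t)
    (hpl : p + l = pl) (h₁ : pl + t = n) (hm : p + t = m) (h₂ : l + m = n) (v : V.X p)
    (a : A.X l) (w : V.X q) (z : Z.X i) :
    tensorOpAux D W' α β hs h v (V.act hlq a w) z =
      R.act h₁ (V.anchorApply ρ hpl v a) (α.f t (V.sym.tmul P' ht w (j'.f i z))) +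
        sgn k (p * l) • R.act h₂ a (tensorOpAux D W' α β ht hm v w z) := by
  have e : α.f t (V.sym.tmul P' ht w (j'.f i z)) =
      β.f t (linApp ht (δ.f q w : linearMaps Z S q) z) := by
    rw [← DGBimodule.tensorMap_tmul (K := V.sym), ← uncurry_tmul]
    exact congrArg (fun F : V.sym.tensor Z ⟶ R => F.f t (V.sym.tmul Z ht w z)) hc
  rw [e, tensorOpAux_apply D W' α β hs h rfl (by omega) rfl (by omega),
    tensorOpAux_apply D W' α β ht hm rfl (by omega) rfl (by omega),
    D.op_act hlq rfl hpl (by omega) rfl (by omega : l + (p + q) = p + lq), map_add, map_smul,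
    LinearMap.add_apply, LinearMap.smul_apply,
    linApp_linAct _ _ ht h₁, linApp_linAct _ _ (by omega : p + q + i = m) h₂,
    tmul_act_left hlq _ (by omega : q + (p + i) = m) h₂]
  simp only [map_add, map_smul, α.map_act, β.map_act, smul_add, smul_smul]
  subst hlq
  rw [mul_add, sgn_add]
  abel

lemma tensorOpAux_act_right (hc : V.sym.tensorMap j' ≫ α = uncurry δ ≫ β)
    {p q l i li s n lq : ℤ} (hli : l + i = li) (hs : q + li = s) (h : p + s = n)
    (hlq : l + q = lq) (hs' : lq + i = s) (v : V.X p) (w : V.X q) (a : A.X l) (z : Z.X i) :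
    tensorOpAux D W' α β hs h v w (Z.act hli a z) =
      sgn k (q * l) • tensorOpAux D W' α β hs' h v (V.act hlq a w) z := by
  rw [tensorOpAux_act_mid D W' hc hlq hs' h rfl rfl (by omega) (rfl : p + (q + i) = p + (q + i))
      (by omega),
    tensorOpAux_apply D W' α β hs h rfl (by omega) rfl (by omega),
    tensorOpAux_apply D W' α β rfl rfl rfl (by omega) rfl (by omega),
    W'.op_act hli rfl rfl (by omega) (rfl : p + i = p + i) (by omega), map_add, map_smul,
    tmul_act_right (N := P') _ _ (rfl : q + i = q + i) (by omega : p + l + (q + i) = n),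
    tmul_act_right (N := P') _ _ (by omega : q + (p + i) = p + (q + i)) (by omega),
    linApp_act _ hli (by omega : p + q + i = p + (q + i)) _ (by omega)]
  simp only [map_add, map_smul, α.map_act, β.map_act, smul_add, smul_smul]
  have e1 : sgn k (q * p) = sgn k (p * q) := by rw [mul_comm]
  simp only [mul_add, add_mul, sgn_add, e1]
  rcases sgn_cases k (p * q) with h1 | h1 <;> rcases sgn_cases k (q * l) with h2 | h2 <;>
    rcases sgn_cases k (p * l) with h3 | h3 <;> simp [h1, h2, h3] <;> abel

lemma tensorOp_balanced (hc : V.sym.tensorMap j' ≫ α = uncurry δ ≫ β) {p s n : ℤ} (h : p + s = n)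
    (v : V.X p) {q l i ql li : ℤ} (hql : q + l = ql) (hli : l + i = li) (h₁ : ql + i = s)
    (h₂ : q + li = s) (w : V.X q) (a : A.X l) (z : Z.X i) :
    tensorOpAux D W' α β h₁ h v (V.symAct hql w a) z =
      tensorOpAux D W' α β h₂ h v w (Z.act hli a z) := by
  rw [tensorOpAux_act_right D W' hc hli h₂ h (by omega : l + q = ql) h₁, symAct_apply, map_smul,
    LinearMap.smul_apply]

/-- The operators `∇_v` on `V ⊗_A Z` defined by `tensorOpAux`. -/
noncomputable def tensorOp (hc : V.sym.tensorMap j' ≫ α = uncurry δ ≫ β) {p s n : ℤ}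
    (h : p + s = n) : V.X p →ₗ[k] V.sym.TensorX Z s →ₗ[k] R.X n where
  toFun v := DGBimodule.tensorLift (K := V.sym) (fun _ _ hs => tensorOpAux D W' α β hs h v)
    (tensorOp_balanced D W' hc h v)
  map_add' v v' := DGBimodule.tensor_hom_ext fun hij w z => by
    rw [LinearMap.add_apply, DGBimodule.tensorLift_tmul, DGBimodule.tensorLift_tmul,
      DGBimodule.tensorLift_tmul]
    simp
  map_smul' c v := DGBimodule.tensor_hom_ext fun hij w z => by
    rw [LinearMap.smul_apply, DGBimodule.tensorLift_tmul, DGBimodule.tensorLift_tmul]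
    simp

lemma tensorOp_tmul (hc : V.sym.tensorMap j' ≫ α = uncurry δ ≫ β) {p s n q i : ℤ}
    (h : p + s = n) (hs : q + i = s) (v : V.X p) (w : V.X q) (z : Z.X i) :
    tensorOp D W' hc h v (V.sym.tmul Z hs w z) = tensorOpAux D W' α β hs h v w z :=
  DGBimodule.tensorLift_tmul (K := V.sym) _ (tensorOp_balanced D W' hc h v) hs w z

/-- A connection `D` on `V` with values in `Hom_A(Z, S)` and a connection on `Z` define the
connection `∇_v (w ⊗ z) = (-1)^{|v||w|} w ⊗ ∇_v z + D_v(w)(z)` on `V ⊗_A Z`. -/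
noncomputable def tensor (hc : V.sym.tensorMap j' ≫ α = uncurry δ ≫ β) :
    Connection ρ (V.sym.tensorMap j' ≫ α) where
  op := tensorOp D W' hc
  act_op {l p lp s t n} hl h ht h' a v z := by
    induction z using DGBimodule.tensor_induction with
    | zero => simp only [map_zero]
    | add x y hx hy => simp only [map_add, hx, hy]
    | tmul hs w z =>
    rename_i q i
    rw [tensorOp_tmul, tensorOp_tmul, tensorOpAux_apply D W' α β hs h rfl (by omega) rfl (by omega),
      tensorOpAux_apply D W' α β hs ht rfl (by omega) rfl (by omega),
      D.act_op hl _ rfl (by omega : l + (p + q) = lp + q), W'.act_op hl _ rfl (by omega),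
      linApp_linAct _ _ (by omega : p + q + i = t) h',
      tmul_act_right (N := P') _ _ (by omega : q + (p + i) = t) h']
    simp only [map_add, map_smul, α.map_act, β.map_act, smul_smul]
    subst hl
    rw [add_mul, sgn_add, mul_comm q l, mul_comm (sgn k (l * q)), mul_assoc, sgn_mul_self, mul_one]
  op_act {p l s pl ls t n} hls h hpl h₁ ht h₂ v a z := by
    induction z using DGBimodule.tensor_induction with
    | zero => simp only [map_zero, smul_zero, add_zero]
    | add x y hx hy => simp only [map_add, hx, hy, smul_add]; abel
    | tmul hs w z =>
    rename_i q i
    rw [DGBimodule.tensorAct_tmul (K := V.sym) hls hs rfl (by omega), tensorOp_tmul,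
      tensorOpAux_act_mid D W' hc rfl _ _ hs hpl h₁ ht h₂, tensorOp_tmul, comp_f,
      DGBimodule.tensorMap_tmul (K := V.sym)]
  d_op {p s n p' s' n'} h hp hs' hn h₁ h₂ v z := by
    induction z using DGBimodule.tensor_induction with
    | zero => simp only [map_zero, smul_zero, add_zero]
    | add x y hx hy => simp only [map_add, hx, hy, smul_add]; abel
    | tmul hs w z =>
    rename_i q i
    rw [DGBimodule.tensorD_tmul (K := V.sym) hs' hs rfl rfl (by omega) (by omega), map_add,
      map_smul, tensorOp_tmul, tensorOp_tmul, tensorOp_tmul, tensorOp_tmul,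
      tensorOpAux_apply D W' α β hs h rfl (by omega) rfl (by omega),
      tensorOpAux_apply D W' α β hs h₁ (by omega : p' + i = p + i + 1) (by omega)
        (by omega : p' + q = p + q + 1) (by omega),
      tensorOpAux_apply D W' α β _ h₂ rfl (by omega) (by omega : p + (q + 1) = p + q + 1) (by omega),
      tensorOpAux_apply D W' α β _ h₂ (by omega : p + (i + 1) = p + i + 1) (by omega) rfl
        (by omega), map_add, map_smul, ← α.map_d, ← β.map_d,
      DGBimodule.tensorD_tmul (K := V.sym) hn _ rfl rfl (by omega : q + 1 + (p + i) = n')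
        (by omega : q + (p + i + 1) = n'),
      W'.d_op rfl hp rfl rfl (by omega : p' + i = p + i + 1) (by omega : p + (i + 1) = p + i + 1)]
    have e := congrArg (fun L => linApp (by omega : p + q + 1 + i = n') L z)
      (D.d_op (rfl : p + q = p + q) hp rfl rfl (by omega : p' + q = p + q + 1)
        (by omega : p + (q + 1) = p + q + 1) v w)
    simp only [map_add, map_smul, LinearMap.add_apply, LinearMap.smul_apply] at e
    rw [linApp_linD rfl _ (by omega : p + q + i = n) hn rfl (by omega), sub_eq_iff_eq_add] at e
    rw [e]
    subst hp
    have e1 : sgn k (q * p) = sgn k (p * q) := by rw [mul_comm]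
    simp only [map_add, map_smul, smul_add, smul_smul, add_mul, mul_add, mul_one, one_mul, sgn_add]
    rcases sgn_cases k (p * q) with h1 | h1 <;> rcases sgn_cases k p with h2 | h2 <;>
      rcases sgn_cases k q with h3 | h3 <;> simp [h1, h2, h3] <;> abel

end Tensor

end Connection

/-! ### Connections and the vanishing of the HKR class -/

namespace DGModule

variable {V : DGModule A} {ρ : V ⟶ tangent A}

/-- A connection along `j` is a map out of `Σ_V ⊗_A N` extending `j`; for `j` a quasi-isomorphism it
is a retraction of `N ⟶ Σ_V ⊗_A N` up to quasi-isomorphism. -/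
lemma hkrClass_eq_zero_of_connection (hV : V.IsPerfect) {N N' : DGModule A} {j : N ⟶ N'}
    (hj : IsQuasiIso j) (W : Connection ρ j) : hkrClass ρ N hV = derivedZero _ _ := by
  rw [← W.hkrIncl_hom] at hj
  exact extClass_eq_zero_of_retraction _ W.hom hj

/-- If the HKR class of `N` vanishes, then there is a connection along an injective
quasi-isomorphism out of `N`. -/
lemma exists_connection_of_hkrClass_eq_zero (hV : V.IsPerfect) {N : DGModule A}
    (h : hkrClass ρ N hV = derivedZero _ _) :
    ∃ (N' : DGModule A) (j : N ⟶ N'), (∀ n, Function.Injective (j.f n)) ∧ IsQuasiIso j ∧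
      Nonempty (Connection ρ j) := by
  obtain ⟨N', F, hF⟩ := exists_retraction_of_extClass_eq_zero (hkr_shortExact ρ N hV) h
  -- adding a contractible summand makes the retraction injective
  let G := prodLift F (coneInl (𝟙 ((V.atiyah ρ).tensor N)))
  refine ⟨_, V.hkrIncl ρ N ≫ G, fun n x y hxy => ?_, ?_, ⟨Connection.ofHom G⟩⟩
  · refine (hkr_shortExact ρ N hV).inj n ?_
    exact congrArg (fun z => z.2.1) hxy
  · exact isQuasiIso_prodLift (V.hkrIncl ρ N ≫ F) (V.hkrIncl ρ N ≫ coneInl _) hF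
      (isAcyclic_cone_id _)

/-- A connection on `V` with values in `Hom_A(Z, S)`, along a map whose adjoint `V ⊗_A Z ⟶ S` is an
injective quasi-isomorphism, and a connection on `Z` define a connection on `V ⊗_A Z` with values in
the pushout of `V ⊗_A P` and `S`. -/
lemma hkrClass_tensor_eq_zero_of_connection (hV : V.IsPerfect) {Z S P : DGModule A}
    {δ : V ⟶ homModule Z S} {j : Z ⟶ P} (D : Connection ρ δ) (W : Connection ρ j)
    (hj : ∀ n, Function.Injective (j.f n)) (hjq : IsQuasiIso j)
    (hδ : ∀ n, Function.Injective ((uncurry δ).f n)) (hδq : IsQuasiIso (uncurry δ)) :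
    hkrClass ρ (V.sym.tensor Z) hV = derivedZero _ _ := by
  refine hkrClass_eq_zero_of_connection hV ?_
    (Connection.tensor D W (comp_pushoutInl (V.sym.tensorMap j) (uncurry δ)))
  exact fun {_ _ _} hb hc => IsQuasiIso.comp (hV.isQuasiIso_tensorMap_of_injective j hj hjq)
    (isQuasiIso_pushoutInl _ _ hδ hδq) hb hc

/-- The case `Z = V ⊗_A N`, `S = V ⊗_A R` of `hkrClass_tensor_eq_zero_of_connection`, for a connection
on `V` with values in `Hom_A(N, R)`: composing with `L ↦ id ⊗ L` gives values in
`Hom_A(V ⊗_A N, V ⊗_A R)`, and the adjoint map is the symmetry of `V ⊗_A V ⊗_A N` followed by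
`id ⊗ γ`. -/
lemma hkrClass_tensor_tensor_eq_zero_of_connection (hV : V.IsPerfect) {N R P : DGModule A}
    {γ : V.sym.tensor N ⟶ R} {j : V.sym.tensor N ⟶ P}
    (D : Connection ρ (tmulLeftHom N V ≫ homPost N γ)) (W : Connection ρ j)
    (hj : ∀ n, Function.Injective (j.f n)) (hjq : IsQuasiIso j)
    (hγ : ∀ n, Function.Injective (γ.f n)) (hγq : IsQuasiIso γ) :
    hkrClass ρ (V.sym.tensor (V.sym.tensor N)) hV = derivedZero _ _ := by
  obtain ⟨B⟩ := hV.nonempty_dualBasis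
  refine hkrClass_tensor_eq_zero_of_connection hV (D.map (idTensorHom N R V)) W hj hjq
    (fun n => ?_) ?_
  · rw [uncurry_idTensorHom γ]
    exact (B.tensorMap_injective γ hγ n).comp (tensorSwap_bijective n).1
  · rw [uncurry_idTensorHom γ]
    exact fun {_ _ _} hb hc => IsQuasiIso.comp (isQuasiIso_of_bijective _ tensorSwap_bijective)
      (hV.isQuasiIso_tensorMap_of_injective γ hγ hγq) hb hc

/-- If the HKR classes of `N` and of `V ⊗_A N` vanish, then so does that of `V ⊗_A V ⊗_A N`: the
commutators of `∇_v` and `w ⊗ -` are a connection on `V` with values in graded linear maps. -/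
lemma hkrClass_tensor_tensor_eq_zero (hV : V.IsPerfect) {N : DGModule A}
    (h : hkrClass ρ N hV = derivedZero _ _)
    (h' : hkrClass ρ (V.sym.tensor N) hV = derivedZero _ _) :
    hkrClass ρ (V.sym.tensor (V.sym.tensor N)) hV = derivedZero _ _ := by
  obtain ⟨B⟩ := hV.nonempty_dualBasis
  obtain ⟨N', j, hj, hjq, ⟨W⟩⟩ := exists_connection_of_hkrClass_eq_zero hV h
  obtain ⟨P', j', hj', hjq', ⟨W'⟩⟩ := exists_connection_of_hkrClass_eq_zero hV h'
  have hVj := B.tensorMap_injective j hj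
  exact hkrClass_tensor_tensor_eq_zero_of_connection hV
    (Connection.comm W W' (comp_pushoutInl j' (V.sym.tensorMap j))) W' hj' hjq'
    (fun n => ((shortExact_pushout j' (V.sym.tensorMap j) hVj).inj n).comp (hj' n))
    (fun {_ _ _} hb hc => IsQuasiIso.comp hjq'
      (isQuasiIso_pushoutInl _ _ hVj (hV.isQuasiIso_tensorMap_of_injective j hj hjq)) hb hc)

lemma hkrClass_naturality (hV : V.IsPerfect) {M N : DGModule A} (F : M ⟶ N) :
    hkrClass ρ M hV ≫ (toDerived A).map F =
      (toDerived A).map (shiftMap (V.sym.tensorMap F) (-1)) ≫ hkrClass ρ N hV :=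
  extClass_naturality (hkr_shortExact ρ M hV) (hkr_shortExact ρ N hV) F
    ((V.atiyah ρ).tensorMap F) (V.sym.tensorMap F) (hkrIncl_naturality F) (hkrProj_naturality F)

variable (ρ) in
/-- The class of the extension `T_p ⟶ T_{p+1} ⟶ T_{p+1} / T_p`. -/
noncomputable def towerClass (hV : V.IsPerfect) (M : DGModule A) (p : ℕ) :
    (toDerived A).obj ((towerG ρ hV M p).shift (-1)) ⟶ (toDerived A).obj (towerX ρ hV M p) :=
  extClass _ _ (tower_shortExact ρ hV M p)

variable (ρ) in
/-- The class `towerClass ρ hV M (p + 1)`, with its source in the form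
`(V ⊗_A (T_{p+1} / T_p))[-1]`. -/
noncomputable def towerClassSucc (hV : V.IsPerfect) (M : DGModule A) (p : ℕ) :
    (toDerived A).obj ((V.sym.tensor (towerG ρ hV M p)).shift (-1)) ⟶
      (toDerived A).obj (towerX ρ hV M (p + 1)) :=
  towerClass ρ hV M (p + 1)

/-- The HKR class of `T_{p+1}` is the pullback of the class of the next extension. -/
lemma hkrClass_towerX (hV : V.IsPerfect) (M : DGModule A) (p : ℕ) :
    hkrClass ρ (towerX ρ hV M (p + 1)) hV =
      (toDerived A).map (shiftMap (V.sym.tensorMap (towerπ ρ hV M p)) (-1)) ≫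
        towerClassSucc ρ hV M p := by
  have h := extClass_naturality (hkr_shortExact ρ (towerX ρ hV M (p + 1)) hV)
    (tower_shortExact ρ hV M (p + 1)) (𝟙 _) (towerμ ρ hV M (p + 1))
    (V.sym.tensorMap (towerπ ρ hV M p))
    ((hkrIncl_towerμ ρ hV M (p + 1)).trans (Category.id_comp _).symm)
    (towerμ_towerπ ρ hV M p).symm
  rw [CategoryTheory.Functor.map_id, Category.comp_id] at h
  exact h

/-- A surjective quasi-isomorphism onto the graded piece that factors through `T_{p+1}`, for a
split extension. -/
lemma exists_lift_of_towerClass_eq_zero (hV : V.IsPerfect) (M : DGModule A) (p : ℕ)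
    (h : towerClass ρ hV M p = derivedZero _ _) :
    ∃ (W : DGModule A) (u : W ⟶ towerX ρ hV M (p + 1)),
      IsQuasiIso (u ≫ towerπ ρ hV M p) ∧
        IsQuasiIso (shiftMap (V.sym.tensorMap (u ≫ towerπ ρ hV M p)) (-1)) := by
  obtain ⟨N, F, hF⟩ := exists_retraction_of_extClass_eq_zero (tower_shortExact ρ hV M p) h
  obtain ⟨W, u, hs, hu⟩ := exists_section_of_retraction (tower_shortExact ρ hV M p) F hF
  exact ⟨W, u, hu, fun {_ _ _} hb hc =>
    IsQuasiIso.shift (hV.isQuasiIso_tensorMap_of_surjective _ hs hu) (-1) hb hc⟩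

lemma shiftMap_comp {X Y Z : DGModule A} (F : X ⟶ Y) (G : Y ⟶ Z) (s : ℤ) :
    shiftMap (F ≫ G) s = shiftMap F s ≫ shiftMap G s := rfl

/-- A splitting of the `p`-th extension lifts the graded piece to `T_{p+1}` in the derived category.
By naturality of the HKR class, the class of the next extension is the composite of the HKR class of
the graded piece and the lift. -/
lemma towerClass_succ_eq_zero (hV : V.IsPerfect) (M : DGModule A) (p : ℕ)
    (h : towerClass ρ hV M p = derivedZero _ _)
    (hG : hkrClass ρ (towerG ρ hV M p) hV = derivedZero _ _) :
    towerClass ρ hV M (p + 1) = derivedZero _ _ := by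
  obtain ⟨W, u, hu, hu'⟩ := exists_lift_of_towerClass_eq_zero hV M p h
  have hW : hkrClass ρ W hV = derivedZero _ _ := by
    refine eq_derivedZero_of_comp_map hu ?_
    rw [hkrClass_naturality, hG, map_comp_derivedZero]
  refine eq_derivedZero_of_map_comp (t := towerClassSucc ρ hV M p) hu' ?_
  rw [DGBimodule.tensorMap_comp, shiftMap_comp, CategoryTheory.Functor.map_comp, Category.assoc,
    ← hkrClass_towerX, ← hkrClass_naturality, hW, derivedZero_comp_map]

/-- If the first two extensions of the tower split, then the HKR class of `V ⊗_A M` vanishes: it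
becomes a composite through the class of the second extension when pulled back along a lift of
`V ⊗_A M` to `T_1`. -/
lemma hkrClass_tensor_eq_zero (hV : V.IsPerfect) (M : DGModule A)
    (h₀ : towerClass ρ hV M 0 = derivedZero _ _) (h₁ : towerClassSucc ρ hV M 0 = derivedZero _ _) :
    hkrClass ρ (V.sym.tensor M) hV = derivedZero _ _ := by
  obtain ⟨W, u, hu, hu'⟩ := exists_lift_of_towerClass_eq_zero hV M 0 h₀
  refine eq_derivedZero_of_map_comp hu' ?_
  refine (hkrClass_naturality (ρ := ρ) hV (u ≫ towerπ ρ hV M 0)).symm.trans ?_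
  rw [CategoryTheory.Functor.map_comp, ← Category.assoc, hkrClass_naturality hV u,
    hkrClass_towerX (ρ := ρ) hV M 0, h₁, map_comp_derivedZero, map_comp_derivedZero,
    derivedZero_comp_map]
  rfl

/-- If the HKR classes of `M` and `V ⊗_A M` vanish, then so do those of all `V ⊗_A ⋯ ⊗_A V ⊗_A M`. -/
lemma hkrClass_towerG_eq_zero (hV : V.IsPerfect) (M : DGModule A)
    (h : hkrClass ρ M hV = derivedZero _ _)
    (h' : hkrClass ρ (V.sym.tensor M) hV = derivedZero _ _) :
    ∀ p, hkrClass ρ (towerG ρ hV M p) hV = derivedZero _ _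
  | 0 => h'
  | 1 => hkrClass_tensor_tensor_eq_zero hV h h'
  | p + 2 => hkrClass_tensor_tensor_eq_zero hV (hkrClass_towerG_eq_zero hV M h h' p)
      (hkrClass_towerG_eq_zero hV M h h' (p + 1))

lemma towerClass_eq_zero (hV : V.IsPerfect) (M : DGModule A)
    (h : hkrClass ρ M hV = derivedZero _ _)
    (h' : hkrClass ρ (V.sym.tensor M) hV = derivedZero _ _) :
    ∀ p, towerClass ρ hV M p = derivedZero _ _
  | 0 => h
  | p + 1 => towerClass_succ_eq_zero hV M p (towerClass_eq_zero hV M h h' p)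
      (hkrClass_towerG_eq_zero hV M h h' p)

lemma towerClass_eq_zero_iff (hV : V.IsPerfect) (M : DGModule A) (p : ℕ) :
    towerClass ρ hV M p = derivedZero _ _ ↔
      HasDerivedSection ((envelopeFiltration ρ M).grProj (p + 1)) :=
  (extClass_eq_zero_iff_hasDerivedSection _).trans (hasDerivedSection_grProj_iff ρ M hV p)

end DGModule

/-! ### Splittings of restricted filtrations -/

namespace Filtration

open DGModule

variable {N : DGModule A} (Φ : Filtration N)

lemma mono_of_le {p q : ℕ} (h : p ≤ q) (n : ℤ) : (Φ.F p).carrier n ≤ (Φ.F q).carrier n := by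
  induction h with
  | refl => exact le_rfl
  | step _ ih => exact ih.trans (Φ.mono _ n)

lemma grProj_surjective (p : ℕ) (n : ℤ) : Function.Surjective ((Φ.grProj p).f n) :=
  DGSubmodule.proj_surjective _ n

lemma grProj_eq_zero (p : ℕ) {n : ℤ} (x : (Φ.F p).toDGModule.X n) :
    (Φ.grProj p).f n x = 0 ↔ x.1 ∈ (Φ.prev p).carrier n :=
  DGSubmodule.proj_eq_zero _ x

lemma mem_prev_restrict (q p : ℕ) {n : ℤ} (x : (Φ.F q).toDGModule.X n) :
    x ∈ ((Φ.restrict q).prev p).carrier n ↔ x.1 ∈ (Φ.prev p).carrier n := by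
  cases p with
  | zero => exact Subtype.ext_iff
  | succ p => exact Iff.rfl

/-- The inclusion of `F^p ∩ F^q` in `F^p`. -/
def restrictIncl (q p : ℕ) : ((Φ.restrict q).F p).toDGModule ⟶ (Φ.F p).toDGModule where
  f _ := ((Submodule.subtype _).comp (Submodule.subtype _)).codRestrict _ fun x => x.2
  map_act _ _ _ := rfl
  map_d _ _ := rfl

lemma hasDerivedSection_grProj_restrict {p q : ℕ} (h : p ≤ q) :
    HasDerivedSection ((Φ.restrict q).grProj p) ↔ HasDerivedSection (Φ.grProj p) := by
  refine hasDerivedSection_congr (Φ.restrictIncl q p) (fun n => ⟨fun x y hxy => ?_, fun y => ?_⟩)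
    (grProj_surjective _ p) (grProj_surjective _ p) fun n x => ?_
  · exact Subtype.ext (Subtype.ext (congrArg (fun z : ((Φ.F p).toDGModule).X n => z.1) hxy))
  · exact ⟨⟨⟨y.1, Φ.mono_of_le h n y.2⟩, y.2⟩, rfl⟩
  · rw [grProj_eq_zero, grProj_eq_zero]
    exact Φ.mem_prev_restrict q p x.1

lemma hasDerivedSection_grProj_of_lt {p q : ℕ} (h : q < p) :
    HasDerivedSection ((Φ.restrict q).grProj p) := by
  obtain ⟨p, rfl⟩ : ∃ r, p = r + 1 := ⟨p - 1, by omega⟩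
  -- the graded piece vanishes
  refine ⟨(toDerived A).map (zeroHom _ _), ?_⟩
  rw [← CategoryTheory.Functor.map_comp, ← CategoryTheory.Functor.map_id]
  refine congrArg _ (hom_ext fun n z => ?_)
  obtain ⟨x, rfl⟩ := grProj_surjective _ (p + 1) n z
  have hx : ((Φ.restrict q).grProj (p + 1)).f n x = 0 :=
    (grProj_eq_zero _ _ x).2 (Φ.mono_of_le (Nat.lt_succ_iff.1 h) n x.1.2)
  rw [hx, map_zero, map_zero]

lemma hasDerivedSection_grProj_zero : HasDerivedSection (Φ.grProj 0) := by
  refine hasDerivedSection_of_isQuasiIso (𝟙 _) _ (isQuasiIso_of_bijective _ fun n =>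
    ⟨(injective_iff_map_eq_zero _).2 fun x hx => ?_, Φ.grProj_surjective 0 n⟩)
  exact Subtype.ext ((Φ.grProj_eq_zero 0 x).1 hx)

end Filtration

end DGForm

theorem mainTheorem4 {k : Type u} [Field k] [CharZero k] (A : DGForm.CDGA k)
    (hA : A.IsNonpositive) (V : DGForm.DGModule A) (ρ : V ⟶ DGForm.tangent A)
    (hV : V.IsPerfect) (M : DGForm.DGModule A) :
    List.TFAE [
      (DGForm.envelopeFiltration ρ M).Splits,
      ((DGForm.envelopeFiltration ρ M).restrict 2).Splits,
      DGForm.DGModule.hkrClass ρ M hV = DGForm.derivedZero _ _ ∧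
        DGForm.DGModule.hkrClass ρ (V.sym.tensor M) hV = DGForm.derivedZero _ _] := by
  open DGForm DGModule in
  tfae_have 1 → 2 := fun h p => by
    rcases le_or_gt p 2 with hp | hp
    · exact ((envelopeFiltration ρ M).hasDerivedSection_grProj_restrict hp).2 (h p)
    · exact (envelopeFiltration ρ M).hasDerivedSection_grProj_of_lt hp
  open DGForm DGModule in
  tfae_have 2 → 3 := fun h => by
    have h' : ∀ p, p + 1 ≤ 2 → towerClass ρ hV M p = derivedZero _ _ := fun p hp =>
      (towerClass_eq_zero_iff hV M p).2
        (((envelopeFiltration ρ M).hasDerivedSection_grProj_restrict hp).1 (h (p + 1)))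
    exact ⟨h' 0 (by omega), hkrClass_tensor_eq_zero hV M (h' 0 (by omega)) (h' 1 le_rfl)⟩
  open DGForm DGModule in
  tfae_have 3 → 1 := fun ⟨h, h'⟩ p => by
    cases p with
    | zero => exact (envelopeFiltration ρ M).hasDerivedSection_grProj_zero
    | succ p => exact (towerClass_eq_zero_iff hV M p).1 (towerClass_eq_zero hV M h h' p)
  tfae_finish
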